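/- Let $p$ be a prime, let $A_p=\mathbb Z[\tfrac1p,e^{2\pi i/p}]\subset\mathbb C$, let $Q$ be a commutative regular (Noetherian) ring that is an $A_p$-algebra, and let $f\in Q$ be a non-zero-divisor. **Grothendieck groups.** Let $\mathrm{mf}(Q,f)$ be the category of matrix factorizations of $f$: finitely generated projective $\mathbb Z/2$-graded $Q$-modules $P=P_0\oplus P_1$ with an odd $Q$-linear endomorphism $d$ such that $d^2=f$; equivalently, pairs $(\alpha:P_1\to P_0,\ \beta:P_0\to P_1)$ with $\alpha\beta=f$ and $\beta\alpha=f$. Let $\mathcal P^{V(f)}(Q)$ be the category of bounded complexes of finitely generated projective $Q$-modules whose homology is supported on $V(f)$. Let $P(K_f/Q)$ be the category of dg-modules over the Koszul dga $K_f=Q[\varepsilon]/(\varepsilon^2)$, $|\varepsilon|=1$, $d\varepsilon=f$, that are finitely generated and projective over $Q$: bounded complexes $(P,d)$ of finitely generated projective $Q$-modules with a degree one map $s$ (multiplication by $\varepsilon$) such that $ds+sd=f$ and $s^2=0$. Morphisms have degree zero and commute with $d$ (and with $s$); a homotopy joining $g_1,g_2$ is a map $h$ of degree one with $dh+hd=g_1-g_2$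 (and, in $P(K_f/Q)$, $hs=-sh$). Each of the groups $K_0(\mathrm{mf}(Q,f))$, $K_0^{V(f)}(Q)=K_0(\mathcal P^{V(f)}(Q))$, $K_0(P(K_f/Q))$ is the abelian group generated by the classes $[P]$ of objects, modulo $[P]=[P']+[P'']$ for short exact sequences $0\to P'\to P\to P''\to0$ and $[P]=[P']$ for homotopy equivalent $P,P'$. **The map $\rho_f$.** Let $F_*:K_0(P(K_f/Q))\to K_0^{V(f)}(Q)$ be induced by $(P,d,s)\mapsto(P,d)$, and let $\mathrm{Fold}_*:K_0(P(K_f/Q))\to K_0(\mathrm{mf}(Q,f))$ be induced by sending $(P,d,s)$ to the matrix factorization $\bigoplus_iP_{2i}\oplus\bigoplus_iP_{2i+1}$ with differential $d+s$. **Cyclic Adams operations.** For an object $P$ of $\mathcal P^{V(f)}(Q)$ or of $\mathrm{mf}(Q,f)$, let $T^p(P)$ be its $p$-th tensor power over $Q$, with the usual (Koszul sign) differential and the signed action of the symmetric group $\Sigma_p$ permuting the factors. For $\zeta\in\mathbb C$ with $\zeta^p=1$ let $T^p(P)^{(\zeta)}$ be the eigenspace, for the $p$-cycle $(1\,2\,\cdots\,p)$,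 of eigenvalue the image of $\zeta$ in $Q$. Put $t^p_\zeta(P)=T^p(P)^{(\zeta)}\in\mathcal P^{V(f)}(Q)$ for a complex $P$. For a matrix factorization $P$ of $f$, $T^p(P)^{(\zeta)}$ is a matrix factorization $(\alpha,\beta)$ of $pf$, and we put $t^p_\zeta(P)=(\alpha,\tfrac1p\beta)\in\mathrm{mf}(Q,f)$. On $K=K_0^{V(f)}(Q)$ and on $K=K_0(\mathrm{mf}(Q,f))$, the cyclic Adams operation is the additive map $\psi^p:K\to K$ determined by $$1\otimes\psi^p([P])=\sum_{\zeta^p=1}\zeta\otimes[t^p_\zeta(P)]\quad\text{in } \mathbb Z[e^{2\pi i/p}]\otimes_{\mathbb Z}K,\quad\text{for all objects }P.$$ **Claim.** The map $F_*$ is an isomorphism, so that $\rho_f:=\mathrm{Fold}_*\circ F_*^{-1}:K_0^{V(f)}(Q)\to K_0(\mathrm{mf}(Q,f))$ is defined; $\rho_f$ is surjective; on each of $K_0^{V(f)}(Q)$ and $K_0(\mathrm{mf}(Q,f))$ there is exactly one additive map $\psi^p$ with the above property; and $$\rho_f\circ\psi^p=\psi^p\circ\rho_f .$$ -/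

import Mathlib

open scoped TensorProduct

namespace CyclicAdams

universe u v

/-! ## Signs -/

/-- `(-1) ^ b` for `b` modulo two. -/
noncomputable def sgn (Q : Type u) [CommRing Q] (b : ZMod 2) : Q := if b = 0 then 1 else -1

theorem zmod_two_eq (b : ZMod 2) : b = 0 ∨ b = 1 := by
  revert b; decide

theorem sgn_zero (Q : Type u) [CommRing Q] : sgn Q 0 = 1 := if_pos rfl

theorem sgn_one (Q : Type u) [CommRing Q] : sgn Q 1 = -1 := if_neg (by decide)

theorem sgn_add (Q : Type u) [CommRing Q] (a b : ZMod 2) :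
    sgn Q (a + b) = sgn Q a * sgn Q b := by
  rcases zmod_two_eq a with rfl | rfl <;> rcases zmod_two_eq b with rfl | rfl
  · simp [sgn_zero]
  · simp [sgn_zero]
  · simp [sgn_zero]
  · rw [show (1 + 1 : ZMod 2) = 0 from by decide, sgn_zero, sgn_one]; ring

/-- The exponent of the Koszul sign of a permutation `σ` acting on a tensor product of homogeneous
elements of parities `a 0, …, a (n - 1)`: a summand `a i * a j` for every pair `i < j` whose
order is inverted by `σ`. -/
def koszulExp {n : ℕ} (σ : Equiv.Perm (Fin n)) (a : Fin n → ZMod 2) : ZMod 2 :=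
  ∑ i, ∑ j, if i < j ∧ σ j < σ i then a i * a j else 0

theorem sum_pairs_eq_zero {n : ℕ} (g : Fin n → Fin n → ZMod 2)
    (h : ∀ i j, g i j + g j i = 0) (h' : ∀ i, g i i = 0) : ∑ i, ∑ j, g i j = 0 := by
  rw [← Finset.sum_product']
  refine Finset.sum_involution (fun x _ => x.swap) ?_ ?_ ?_ ?_
  · intro x _; exact h _ _
  · rintro ⟨i, j⟩ _ hx he
    simp only [Prod.swap_prod_mk, Prod.mk.injEq] at he
    apply hx; rw [← he.1]; exact h' _
  · intro x _; simp
  · intro x _; simp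

theorem koszulExp_one {n : ℕ} (a : Fin n → ZMod 2) : koszulExp 1 a = 0 := by
  unfold koszulExp
  refine Finset.sum_eq_zero fun i _ => Finset.sum_eq_zero fun j _ => if_neg ?_
  rintro ⟨h1, h2⟩
  exact lt_asymm h1 h2

theorem koszulExp_mul {n : ℕ} (σ τ : Equiv.Perm (Fin n)) (a : Fin n → ZMod 2) :
    koszulExp (σ * τ) a = koszulExp τ a + koszulExp σ (fun i => a (τ.symm i)) := by
  have e3 : koszulExp σ (fun i => a (τ.symm i)) =
      ∑ i, ∑ j, if τ i < τ j ∧ σ (τ j) < σ (τ i) then a i * a j else 0 := by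
    unfold koszulExp
    rw [← Equiv.sum_comp τ]
    refine Finset.sum_congr rfl fun i _ => ?_
    rw [← Equiv.sum_comp τ]
    simp
  rw [e3, ← sub_eq_zero]
  unfold koszulExp
  rw [← Finset.sum_add_distrib, ← Finset.sum_sub_distrib]
  simp_rw [← Finset.sum_add_distrib, ← Finset.sum_sub_distrib]
  apply sum_pairs_eq_zero
  · intro i j
    rw [mul_comm (a j) (a i)]
    generalize a i * a j = c
    rcases eq_or_ne i j with rfl | hij
    · simp
    have h1 : τ i ≠ τ j := fun h => hij (τ.injective h)
    have h2 : σ (τ i) ≠ σ (τ j) := fun h => h1 (σ.injective h)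
    simp only [Equiv.Perm.mul_apply]
    have h00 : c + c = 0 := CharTwo.add_self_eq_zero c
    have h00' : -c = c := CharTwo.neg_eq c
    rcases lt_or_gt_of_ne hij with h | h <;> rcases lt_or_gt_of_ne h1 with h' | h' <;>
      rcases lt_or_gt_of_ne h2 with h'' | h'' <;>
      simp [h, h', h'', h.not_gt, h'.not_gt, h''.not_gt, h00, h00']
  · intro i; simp

theorem koszulExp_update {n : ℕ} (σ : Equiv.Perm (Fin n)) (a : Fin n → ZMod 2) (j : Fin n) :
    koszulExp σ (Function.update a j (a j + 1)) + ∑ i, (if i < j then a i else 0) =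
      koszulExp σ a + ∑ i, (if i < σ j then a (σ.symm i) else 0) := by
  have hu : Function.update a j (a j + 1) = fun i => a i + if i = j then 1 else 0 := by
    funext i; by_cases h : i = j
    · subst h; simp
    · simp [h]
  have e1 : koszulExp σ (Function.update a j (a j + 1)) = koszulExp σ a +
      ∑ i, ((if i < j ∧ σ j < σ i then a i else 0) + (if j < i ∧ σ i < σ j then a i else 0)) := by
    rw [hu, Finset.sum_add_distrib]
    unfold koszulExp
    have : ∀ i k, (if i < k ∧ σ k < σ i then
          (a i + if i = j then 1 else 0) * (a k + if k = j then 1 else 0) else 0) =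
        (if i < k ∧ σ k < σ i then a i * a k else 0) +
        ((if k = j then (if i < j ∧ σ j < σ i then a i else 0) else 0) +
         (if i = j then (if j < k ∧ σ k < σ j then a k else 0) else 0)) := by
      intro i k
      by_cases h1 : i = j
      · subst h1
        by_cases h2 : k = i
        · subst h2; simp
        · by_cases h3 : i < k ∧ σ k < σ i <;> simp [h2, h3]; ring
      · by_cases h2 : k = j
        · subst h2
          by_cases h3 : i < k ∧ σ k < σ i <;> simp [h1, h3]; ring
        · simp [h1, h2]
    simp_rw [this, Finset.sum_add_distrib]
    congr 2
    · simp
    · rw [Finset.sum_comm]; simp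
  have e2 : ∑ i, (if i < σ j then a (σ.symm i) else 0) = ∑ i, if σ i < σ j then a i else 0 := by
    rw [← Equiv.sum_comp σ]; simp
  rw [e1, e2, add_assoc, ← Finset.sum_add_distrib]
  congr 1
  refine Finset.sum_congr rfl fun i _ => ?_
  generalize a i = c
  have h00 : c + c = 0 := CharTwo.add_self_eq_zero c
  rcases eq_or_ne i j with rfl | hij
  · simp
  have h1 : σ i ≠ σ j := fun h => hij (σ.injective h)
  rcases lt_or_gt_of_ne hij with h | h <;> rcases lt_or_gt_of_ne h1 with h' | h' <;>
      simp [h, h', h.not_gt, h'.not_gt, h00]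

theorem finRotate_pow_self (n : ℕ) : (finRotate n) ^ n = 1 := by
  rcases n with _ | _ | n
  · simp
  · simp; rfl
  · have h := (isCycle_finRotate (n := n)).orderOf
    rw [support_finRotate, Finset.card_univ, Fintype.card_fin] at h
    rw [← orderOf_dvd_iff_pow_eq_one, h]

/-! ## Graded modules with a differential of curvature `w` -/

/-- The groups of degrees that occur: `ℤ` and `ℤ/2`, with the reduction of a degree modulo two. -/
class SignedGrading (Γ : Type) [CommRing Γ] where
  parity : Γ →+* ZMod 2

instance : SignedGrading ℤ := ⟨Int.castRingHom (ZMod 2)⟩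

instance : SignedGrading (ZMod 2) := ⟨RingHom.id (ZMod 2)⟩

/-- A finitely generated projective `Q`-module `P = ⨁ i : Γ, P i`, with a `Q`-linear endomorphism
`d` of degree `-1` such that `d ^ 2` is multiplication by `w`. The grading is given by the
projections `proj i` of `P` onto its homogeneous components: they are orthogonal idempotents,
almost all zero, with sum the identity, and `P i` is the range of `proj i`.

For `Γ = ZMod 2` this is a matrix factorization of `w`. For `Γ = ℤ` and `w = 0` it is a bounded
complex of finitely generated projective modules, in homological notation. -/
structure CurvedModule (Γ : Type) [CommRing Γ] (Q : Type u) [CommRing Q] (w : Q) where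
  carrier : Type u
  [addCommGroup : AddCommGroup carrier]
  [module : Module Q carrier]
  [finite : Module.Finite Q carrier]
  [projective : Module.Projective Q carrier]
  proj : Γ → Module.End Q carrier
  proj_mul_self : ∀ i, proj i * proj i = proj i
  proj_mul_of_ne : ∀ i j, i ≠ j → proj i * proj j = 0
  exists_sum_proj : ∃ S : Finset Γ, (∀ i, i ∉ S → proj i = 0) ∧ ∑ i ∈ S, proj i = 1
  d : Module.End Q carrier
  d_mul_proj : ∀ i, d * proj i = proj (i - 1) * d
  d_mul_d : d * d = w • (1 : Module.End Q carrier)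

attribute [instance] CurvedModule.addCommGroup CurvedModule.module CurvedModule.finite
  CurvedModule.projective

/-- Matrix factorizations of `f`: the components `P 0` and `P 1`, with the restrictions
`α : P 1 → P 0` and `β : P 0 → P 1` of `d`. -/
abbrev MatFac (Q : Type u) [CommRing Q] (f : Q) := CurvedModule (ZMod 2) Q f

/-- Bounded complexes of finitely generated projective `Q`-modules. -/
abbrev BddComplex (Q : Type u) [CommRing Q] := CurvedModule ℤ Q 0

namespace CurvedModule

variable {Γ : Type} [CommRing Γ] {Q : Type u} [CommRing Q] {w : Q}

/-- `g` is a morphism: it has degree zero and commutes with the differentials. -/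
structure IsHom (P P' : CurvedModule Γ Q w) (g : P.carrier →ₗ[Q] P'.carrier) : Prop where
  proj : ∀ i, g ∘ₗ P.proj i = P'.proj i ∘ₗ g
  d : g ∘ₗ P.d = P'.d ∘ₗ g

/-- `h` is a homotopy joining `g₁` and `g₂`: it has degree one and `d h + h d = g₁ - g₂`. -/
structure IsHomotopy (P P' : CurvedModule Γ Q w) (h g₁ g₂ : P.carrier →ₗ[Q] P'.carrier) :
    Prop where
  proj : ∀ i, h ∘ₗ P.proj i = P'.proj (i + 1) ∘ₗ h
  d : P'.d ∘ₗ h + h ∘ₗ P.d = g₁ - g₂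

/-- `P` and `P'` are homotopy equivalent. -/
def HtpyEquiv (P P' : CurvedModule Γ Q w) : Prop :=
  ∃ (g : P.carrier →ₗ[Q] P'.carrier) (g' : P'.carrier →ₗ[Q] P.carrier)
    (h : P.carrier →ₗ[Q] P.carrier) (h' : P'.carrier →ₗ[Q] P'.carrier),
    IsHom P P' g ∧ IsHom P' P g' ∧
    IsHomotopy P P h (g' ∘ₗ g) LinearMap.id ∧ IsHomotopy P' P' h' (g ∘ₗ g') LinearMap.id

/-- There is a short exact sequence `0 → P' → P → P'' → 0`. -/
def ShortExact (P' P P'' : CurvedModule Γ Q w) : Prop :=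
  ∃ (i : P'.carrier →ₗ[Q] P.carrier) (q : P.carrier →ₗ[Q] P''.carrier),
    IsHom P' P i ∧ IsHom P P'' q ∧
    Function.Injective i ∧ Function.Exact i q ∧ Function.Surjective q

theorem proj_apply_self (P : CurvedModule Γ Q w) (i : Γ) (x : P.carrier) :
    P.proj i (P.proj i x) = P.proj i x :=
  LinearMap.congr_fun (P.proj_mul_self i) x

theorem proj_apply_of_mem (P : CurvedModule Γ Q w) [DecidableEq Γ] {i j : Γ} {x : P.carrier}
    (hx : P.proj i x = x) : P.proj j x = if i = j then x else 0 := by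
  split_ifs with h
  · subst h; exact hx
  · rw [← hx]; exact LinearMap.congr_fun (P.proj_mul_of_ne j i (Ne.symm h)) x

theorem proj_d_of_mem (P : CurvedModule Γ Q w) {i : Γ} {x : P.carrier}
    (hx : P.proj i x = x) : P.proj (i - 1) (P.d x) = P.d x := by
  have := LinearMap.congr_fun (P.d_mul_proj i) x
  simp only [Module.End.mul_apply, hx] at this
  exact this.symm


/-- Two linear maps on `P` agree if they agree on homogeneous elements. -/
theorem ext_of_mem {N : Type*} [AddCommGroup N] [Module Q N] (P : CurvedModule Γ Q w)
    {φ ψ : P.carrier →ₗ[Q] N} (h : ∀ i x, P.proj i x = x → φ x = ψ x) : φ = ψ := by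
  obtain ⟨S, -, hS⟩ := P.exists_sum_proj
  ext x
  have hx : x = ∑ i ∈ S, P.proj i x := by
    conv_lhs => rw [← Module.End.one_apply (R := Q) x, ← hS, LinearMap.sum_apply]
  rw [hx, map_sum, map_sum]
  exact Finset.sum_congr rfl fun i _ => h i _ (P.proj_apply_self i x)

/-! ## Tensor powers -/

section TensorGrading

variable (P : CurvedModule Γ Q w) (n : ℕ)

/-- The underlying module of the `n`-th tensor power of `P` over `Q`. -/
abbrev TPow : Type u := ⨂[Q] _ : Fin n, P.carrier

/-- The projection of the tensor power onto the component of degree `k`, which is spanned by the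
`x 0 ⊗ ⋯ ⊗ x (n - 1)` with homogeneous `x j` of degrees `a j` of sum `k`. -/
noncomputable def tProj (k : Γ) : Module.End Q (TPow P n) :=
  ∑ᶠ (a : Fin n → Γ) (_ : ∑ j, a j = k), PiTensorProduct.map fun j => P.proj (a j)

variable {n}

/-- Linear maps on the tensor power agree if they agree on tensors of homogeneous elements. -/
theorem tPow_ext {N : Type*} [AddCommGroup N] [Module Q N] {φ ψ : TPow P n →ₗ[Q] N}
    (h : ∀ (a : Fin n → Γ) (x : Fin n → P.carrier), (∀ j, P.proj (a j) (x j) = x j) →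
      φ (PiTensorProduct.tprod Q x) = ψ (PiTensorProduct.tprod Q x)) : φ = ψ := by
  classical
  obtain ⟨S, -, hS⟩ := P.exists_sum_proj
  apply PiTensorProduct.ext
  ext x
  have hx : x = fun j => ∑ i ∈ S, P.proj i (x j) := by
    funext j
    conv_lhs => rw [← Module.End.one_apply (R := Q) (x j), ← hS, LinearMap.sum_apply]
  rw [LinearMap.compMultilinearMap_apply, LinearMap.compMultilinearMap_apply, hx,
    MultilinearMap.map_sum_finset, map_sum, map_sum]
  exact Finset.sum_congr rfl fun a _ => h a _ fun j => P.proj_apply_self (a j) (x j)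

theorem tProj_apply [DecidableEq Γ] {a : Fin n → Γ} {x : Fin n → P.carrier}
    (hx : ∀ j, P.proj (a j) (x j) = x j) (k : Γ) :
    P.tProj n k (PiTensorProduct.tprod Q x) =
      if ∑ j, a j = k then PiTensorProduct.tprod Q x else 0 := by
  classical
  obtain ⟨S, hS, -⟩ := P.exists_sum_proj
  have h1 : P.tProj n k = ∑ b ∈ Fintype.piFinset fun _ : Fin n => S,
      if ∑ j, b j = k then PiTensorProduct.map (fun j => P.proj (b j)) else 0 := by
    unfold tProj
    have : ∀ b : Fin n → Γ, (∑ᶠ (_ : ∑ j, b j = k),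
        PiTensorProduct.map fun j => P.proj (b j)) =
      if ∑ j, b j = k then PiTensorProduct.map (fun j => P.proj (b j)) else 0 :=
      fun b => finsum_eq_if
    simp_rw [this]
    apply finsum_eq_sum_of_support_subset
    intro b hb
    by_contra hn
    apply hb
    simp only [Finset.mem_coe, Fintype.mem_piFinset, not_forall] at hn
    obtain ⟨j, hj⟩ := hn
    have : PiTensorProduct.map (fun j => P.proj (b j)) = 0 := by
      apply PiTensorProduct.ext
      ext y
      simp only [LinearMap.compMultilinearMap_apply, PiTensorProduct.map_tprod]
      exact (PiTensorProduct.tprod Q).map_coord_zero j (by rw [hS _ hj]; rfl)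
    simp [this]
  have h2 : ∀ b : Fin n → Γ, PiTensorProduct.map (fun j => P.proj (b j))
      (PiTensorProduct.tprod Q x) = if b = a then PiTensorProduct.tprod Q x else 0 := by
    intro b
    rw [PiTensorProduct.map_tprod]
    split_ifs with h
    · subst h; congr 1; funext j; exact hx j
    · obtain ⟨j, hj⟩ := Function.ne_iff.mp h
      exact (PiTensorProduct.tprod Q).map_coord_zero j
        (by rw [P.proj_apply_of_mem (hx j), if_neg (Ne.symm hj)])
  rw [h1, LinearMap.sum_apply]
  have h3 : ∀ b : Fin n → Γ, (if ∑ j, b j = k then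
      PiTensorProduct.map (fun j => P.proj (b j)) else 0) (PiTensorProduct.tprod Q x) =
      if b = a then (if ∑ j, a j = k then PiTensorProduct.tprod Q x else 0) else 0 := by
    intro b
    by_cases hb : b = a
    · subst hb
      by_cases hk : ∑ j, b j = k
      · simp only [hk, if_true]; rw [h2, if_pos rfl]
      · simp [hk]
    · by_cases hk : ∑ j, b j = k
      · simp only [hk, if_true, hb, if_false]; rw [h2, if_neg hb]
      · simp [hk, hb]
  simp_rw [h3]
  rw [Finset.sum_ite_eq']
  by_cases ha : a ∈ Fintype.piFinset fun _ : Fin n => S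
  · rw [if_pos ha]
  · rw [if_neg ha]
    simp only [Fintype.mem_piFinset, not_forall] at ha
    obtain ⟨j, hj⟩ := ha
    have : PiTensorProduct.tprod Q x = 0 :=
      (PiTensorProduct.tprod Q).map_coord_zero j (by rw [← hx j, hS _ hj]; rfl)
    simp [this]

theorem update_mem (j : Fin n) {a : Fin n → Γ} {x : Fin n → P.carrier}
    (hx : ∀ j, P.proj (a j) (x j) = x j) (k : Fin n) :
    P.proj (Function.update a j (a j - 1) k) (Function.update x j (P.d (x j)) k) =
      Function.update x j (P.d (x j)) k := by
  by_cases h : k = j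
  · subst h; simpa using P.proj_d_of_mem (hx k)
  · simpa [h] using hx k

theorem tProj_mul_self (k : Γ) : P.tProj n k * P.tProj n k = P.tProj n k := by
  classical
  apply P.tPow_ext
  intro a x hx
  rw [Module.End.mul_apply, P.tProj_apply hx]
  split_ifs with h
  · rw [P.tProj_apply hx, if_pos h]
  · simp

theorem tProj_mul_of_ne (k l : Γ) (hkl : k ≠ l) : P.tProj n k * P.tProj n l = 0 := by
  classical
  apply P.tPow_ext
  intro a x hx
  rw [Module.End.mul_apply, P.tProj_apply hx]
  split_ifs with h
  · rw [P.tProj_apply hx, if_neg (fun h' => hkl (h'.symm.trans h))]; rfl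
  · simp

theorem exists_sum_tProj : ∃ T : Finset Γ, (∀ k, k ∉ T → P.tProj n k = 0) ∧
    ∑ k ∈ T, P.tProj n k = 1 := by
  classical
  obtain ⟨S, hS, -⟩ := P.exists_sum_proj
  have key : ∀ (a : Fin n → Γ) (x : Fin n → P.carrier), (∀ j, P.proj (a j) (x j) = x j) →
      PiTensorProduct.tprod Q x ≠ 0 →
      ∑ j, a j ∈ (Fintype.piFinset fun _ : Fin n => S).image fun a => ∑ j, a j := by
    intro a x hx hne
    refine Finset.mem_image.mpr ⟨a, ?_, rfl⟩
    rw [Fintype.mem_piFinset]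
    intro j
    by_contra hj
    exact hne ((PiTensorProduct.tprod Q).map_coord_zero j (by rw [← hx j, hS _ hj]; rfl))
  refine ⟨(Fintype.piFinset fun _ : Fin n => S).image fun a => ∑ j, a j, ?_, ?_⟩
  · intro k hk
    apply P.tPow_ext
    intro a x hx
    rw [P.tProj_apply hx]
    split_ifs with h
    · by_contra hne
      exact hk (h ▸ key a x hx hne)
    · rfl
  · apply P.tPow_ext
    intro a x hx
    rw [LinearMap.sum_apply, Finset.sum_congr rfl fun k _ => P.tProj_apply hx k,
      Finset.sum_ite_eq]
    split_ifs with h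
    · rfl
    · by_contra hne
      exact h (key a x hx fun h0 => hne (by rw [h0]; simp))

end TensorGrading

/-! ## Parity -/

variable [SignedGrading Γ]

/-- The projection onto the part of `P` of parity `b`. -/
noncomputable def parityProj (P : CurvedModule Γ Q w) (b : ZMod 2) : Module.End Q P.carrier :=
  ∑ᶠ (i : Γ) (_ : SignedGrading.parity i = b), P.proj i

/-- The endomorphism `x ↦ (-1) ^ |x| x`. -/
noncomputable def signMap (P : CurvedModule Γ Q w) : Module.End Q P.carrier :=
  P.parityProj 0 - P.parityProj 1

theorem parityProj_eq_sum (P : CurvedModule Γ Q w) (b : ZMod 2) (S : Finset Γ)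
    (hS : ∀ i, i ∉ S → P.proj i = 0) :
    P.parityProj b = ∑ i ∈ S, if SignedGrading.parity i = b then P.proj i else 0 := by
  unfold parityProj
  have : ∀ i : Γ, (∑ᶠ (_ : SignedGrading.parity i = b), P.proj i) =
      if SignedGrading.parity i = b then P.proj i else 0 := fun i => finsum_eq_if
  simp_rw [this]
  apply finsum_eq_sum_of_support_subset
  intro i hi
  by_contra h
  apply hi
  simp [hS i h]

theorem parityProj_apply_of_mem (P : CurvedModule Γ Q w) {i : Γ} {x : P.carrier}
    (hx : P.proj i x = x) (b : ZMod 2) :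
    P.parityProj b x = if SignedGrading.parity i = b then x else 0 := by
  classical
  obtain ⟨S, hS, -⟩ := P.exists_sum_proj
  rw [P.parityProj_eq_sum b S hS, LinearMap.sum_apply]
  have : ∀ j ∈ S, (if SignedGrading.parity j = b then P.proj j else 0) x =
      if j = i then (if SignedGrading.parity i = b then x else 0) else 0 := by
    intro j _
    by_cases h : j = i
    · subst h
      by_cases h1 : SignedGrading.parity j = b
      · simp [h1, hx]
      · simp [h1]
    · by_cases h1 : SignedGrading.parity j = b
      · simp only [h1, h, if_true, if_false]
        rw [proj_apply_of_mem P hx, if_neg (Ne.symm h)]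
      · simp [h1, h]
  rw [Finset.sum_congr rfl this, Finset.sum_ite_eq']
  by_cases hi : i ∈ S
  · simp [hi]
  · have : x = 0 := by rw [← hx, hS i hi]; rfl
    simp [this]

theorem signMap_apply_of_mem (P : CurvedModule Γ Q w) {i : Γ} {x : P.carrier}
    (hx : P.proj i x = x) : P.signMap x = sgn Q (SignedGrading.parity i) • x := by
  unfold signMap
  rw [LinearMap.sub_apply, P.parityProj_apply_of_mem hx, P.parityProj_apply_of_mem hx]
  generalize (SignedGrading.parity i : ZMod 2) = c
  rcases zmod_two_eq c with rfl | rfl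
  · simp [sgn_zero]
  · simp [sgn_one]

theorem signMap_mul_signMap (P : CurvedModule Γ Q w) : P.signMap * P.signMap = 1 := by
  apply P.ext_of_mem
  intro i x hx
  rw [Module.End.mul_apply, P.signMap_apply_of_mem hx, map_smul, P.signMap_apply_of_mem hx,
    smul_smul, Module.End.one_apply]
  generalize (SignedGrading.parity i : ZMod 2) = c
  rcases zmod_two_eq c with rfl | rfl
  · simp [sgn_zero]
  · simp [sgn_one]

theorem signMap_mul_d (P : CurvedModule Γ Q w) : P.signMap * P.d = -(P.d * P.signMap) := by
  apply P.ext_of_mem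
  intro i x hx
  rw [Module.End.mul_apply, LinearMap.neg_apply, Module.End.mul_apply, P.signMap_apply_of_mem hx,
    map_smul, P.signMap_apply_of_mem (P.proj_d_of_mem hx), map_sub, map_one]
  generalize (SignedGrading.parity i : ZMod 2) = c
  rcases zmod_two_eq c with rfl | rfl
  · simp [sgn_zero, show (0 - 1 : ZMod 2) = 1 from by decide, sgn_one]
  · simp [sgn_zero, sgn_one]

/-! ## The differential and the action of permutations on tensor powers -/

section TensorPower

variable (P : CurvedModule Γ Q w) (n : ℕ)

/-- The `j`-th summand of the differential of the tensor power,
`x 0 ⊗ ⋯ ⊗ x (n - 1) ↦ (-1) ^ (|x 0| + ⋯ + |x (j - 1)|) x 0 ⊗ ⋯ ⊗ d (x j) ⊗ ⋯ ⊗ x (n - 1)`. -/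
noncomputable def tDiffAt (j : Fin n) : Module.End Q (TPow P n) :=
  PiTensorProduct.map fun k => if k < j then P.signMap else if k = j then P.d else 1

/-- The differential of the tensor power. -/
noncomputable def tDiff : Module.End Q (TPow P n) := ∑ j, P.tDiffAt n j

/-- The action of a permutation `σ` on the tensor power: on homogeneous elements
`x 0 ⊗ ⋯ ⊗ x (n - 1)` goes to the element with `x (σ⁻¹ j)` in position `j`, with the Koszul sign.
(The sum decomposes the tensor power according to the parities `a` of the factors.) -/
noncomputable def tPerm (σ : Equiv.Perm (Fin n)) : Module.End Q (TPow P n) :=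
  ∑ a : Fin n → ZMod 2, sgn Q (koszulExp σ a) •
    ((PiTensorProduct.reindex Q (fun _ => P.carrier) σ).toLinearMap ∘ₗ
      PiTensorProduct.map fun j => P.parityProj (a j))

variable {n}

theorem tPerm_apply (σ : Equiv.Perm (Fin n)) {a : Fin n → Γ} {x : Fin n → P.carrier}
    (hx : ∀ j, P.proj (a j) (x j) = x j) :
    P.tPerm n σ (PiTensorProduct.tprod Q x) =
      sgn Q (koszulExp σ fun j => SignedGrading.parity (a j)) •
        PiTensorProduct.tprod Q fun j => x (σ.symm j) := by
  classical
  unfold tPerm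
  rw [LinearMap.sum_apply, Finset.sum_eq_single fun j => SignedGrading.parity (a j)]
  · rw [LinearMap.smul_apply, LinearMap.comp_apply, PiTensorProduct.map_tprod]
    have : (fun j => P.parityProj (SignedGrading.parity (a j)) (x j)) = x := by
      funext j; rw [P.parityProj_apply_of_mem (hx j), if_pos rfl]
    rw [this]
    congr 1
    exact PiTensorProduct.reindex_tprod σ x
  · intro b _ hb
    obtain ⟨j, hj⟩ := Function.ne_iff.mp hb
    rw [LinearMap.smul_apply, LinearMap.comp_apply, PiTensorProduct.map_tprod,
      (PiTensorProduct.tprod Q).map_coord_zero j, map_zero, smul_zero]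
    rw [P.parityProj_apply_of_mem (hx j), if_neg (Ne.symm hj)]
  · intro h; exact absurd (Finset.mem_univ _) h

theorem tDiffAt_apply (j : Fin n) {a : Fin n → Γ} {x : Fin n → P.carrier}
    (hx : ∀ j, P.proj (a j) (x j) = x j) :
    P.tDiffAt n j (PiTensorProduct.tprod Q x) =
      sgn Q (∑ k, if k < j then SignedGrading.parity (a k) else 0) •
        PiTensorProduct.tprod Q (Function.update x j (P.d (x j))) := by
  classical
  unfold tDiffAt
  rw [PiTensorProduct.map_tprod]
  have h1 : ∀ s : Finset (Fin n), sgn Q (∑ k ∈ s, if k < j then SignedGrading.parity (a k) else 0) =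
      ∏ k ∈ s, sgn Q (if k < j then SignedGrading.parity (a k) else 0) := by
    intro s
    induction s using Finset.induction_on with
    | empty => simp [sgn_zero]
    | insert k s hk ih => rw [Finset.sum_insert hk, Finset.prod_insert hk, sgn_add, ih]
  have h2 : (fun k => (if k < j then P.signMap else if k = j then P.d else 1) (x k)) =
      fun k => sgn Q (if k < j then SignedGrading.parity (a k) else 0) •
        Function.update x j (P.d (x j)) k := by
    funext k
    rcases lt_trichotomy k j with h | h | h
    · simp [h, h.ne, P.signMap_apply_of_mem (hx k)]
    · subst h; simp [sgn_zero]
    · simp [h.not_gt, h.ne', sgn_zero]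
  rw [h2, MultilinearMap.map_smul_univ, h1]

theorem tPerm_one : P.tPerm n 1 = 1 := by
  apply P.tPow_ext
  intro a x hx
  rw [P.tPerm_apply 1 hx, koszulExp_one, sgn_zero, one_smul]
  rfl

theorem tPerm_mul (σ τ : Equiv.Perm (Fin n)) : P.tPerm n (σ * τ) = P.tPerm n σ * P.tPerm n τ := by
  apply P.tPow_ext
  intro a x hx
  rw [P.tPerm_apply _ hx, Module.End.mul_apply, P.tPerm_apply τ hx, map_smul,
    P.tPerm_apply σ (a := fun j => a (τ.symm j)) (fun j => hx _), smul_smul, koszulExp_mul,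
    sgn_add, mul_comm]
  rfl

theorem tPerm_pow (σ : Equiv.Perm (Fin n)) (k : ℕ) : P.tPerm n (σ ^ k) = P.tPerm n σ ^ k := by
  induction k with
  | zero => exact P.tPerm_one
  | succ k ih => rw [pow_succ, pow_succ, tPerm_mul, ih]

theorem tPerm_mul_tProj (σ : Equiv.Perm (Fin n)) (k : Γ) :
    P.tPerm n σ * P.tProj n k = P.tProj n k * P.tPerm n σ := by
  classical
  apply P.tPow_ext
  intro a x hx
  rw [Module.End.mul_apply, Module.End.mul_apply, P.tProj_apply hx, P.tPerm_apply σ hx, map_smul,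
    P.tProj_apply (a := fun j => a (σ.symm j)) (fun j => hx _), Equiv.sum_comp σ.symm a]
  split_ifs
  · exact P.tPerm_apply σ hx
  · simp

theorem tPerm_mul_tDiff (σ : Equiv.Perm (Fin n)) :
    P.tPerm n σ * P.tDiff n = P.tDiff n * P.tPerm n σ := by
  classical
  apply P.tPow_ext
  intro a x hx
  rw [Module.End.mul_apply, Module.End.mul_apply]
  unfold tDiff
  rw [LinearMap.sum_apply, LinearMap.sum_apply, map_sum,
    ← Equiv.sum_comp σ fun j => P.tDiffAt n j (P.tPerm n σ (PiTensorProduct.tprod Q x))]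
  refine Finset.sum_congr rfl fun j _ => ?_
  rw [P.tDiffAt_apply j hx, map_smul, P.tPerm_apply σ (P.update_mem j hx), P.tPerm_apply σ hx,
    map_smul, P.tDiffAt_apply (σ j) (a := fun j => a (σ.symm j)) (fun j => hx _), smul_smul,
    smul_smul, ← sgn_add, ← sgn_add]
  have e1 : (fun k => Function.update x j (P.d (x j)) (σ.symm k)) =
      Function.update (fun k => x (σ.symm k)) (σ j) (P.d (x (σ.symm (σ j)))) := by
    funext k
    by_cases h : k = σ j
    · subst h; simp
    · have : σ.symm k ≠ j := fun h' => h (by rw [← h', Equiv.apply_symm_apply])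
      simp [h, this]
  have e2 : (fun k => SignedGrading.parity (Function.update a j (a j - 1) k)) =
      Function.update (fun k => SignedGrading.parity (a k)) j
        ((SignedGrading.parity (a j) : ZMod 2) + 1) := by
    funext k
    by_cases h : k = j
    · subst h; simp [sub_eq_add_neg]
    · simp [h]
  rw [e1, e2, add_comm, koszulExp_update σ (fun k => SignedGrading.parity (a k)) j]

theorem tDiff_mul_tProj (k : Γ) : P.tDiff n * P.tProj n k = P.tProj n (k - 1) * P.tDiff n := by
  classical
  apply P.tPow_ext
  intro a x hx
  rw [Module.End.mul_apply, Module.End.mul_apply, P.tProj_apply hx]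
  unfold tDiff
  have : ∀ j, P.tProj n (k - 1) (P.tDiffAt n j (PiTensorProduct.tprod Q x)) =
      if ∑ j, a j = k then P.tDiffAt n j (PiTensorProduct.tprod Q x) else 0 := by
    intro j
    rw [P.tDiffAt_apply j hx, map_smul, P.tProj_apply (P.update_mem j hx)]
    have hs : ∑ l, Function.update a j (a j - 1) l = ∑ l, a l - 1 := by
      rw [Finset.sum_update_of_mem (Finset.mem_univ j), ← Finset.add_sum_erase _ a
        (Finset.mem_univ j), Finset.sdiff_singleton_eq_erase]
      ring
    rw [hs]
    by_cases h : ∑ l, a l = k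
    · simp [h]
    · simp [h]
  rw [LinearMap.sum_apply, LinearMap.sum_apply, map_sum, Finset.sum_congr rfl fun j _ => this j]
  split_ifs
  · rfl
  · simp

theorem tDiffAt_mul_self (j : Fin n) : P.tDiffAt n j * P.tDiffAt n j = w • 1 := by
  classical
  unfold tDiffAt
  rw [← PiTensorProduct.map_mul]
  have : (fun i => (if i < j then P.signMap else if i = j then P.d else 1) *
      (if i < j then P.signMap else if i = j then P.d else 1)) =
      Function.update (fun _ => (1 : Module.End Q P.carrier)) j (w • 1) := by
    funext i
    rcases lt_trichotomy i j with h | h | h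
    · simp [h, h.ne, P.signMap_mul_signMap]
    · subst h; simp [P.d_mul_d]
    · simp [h.not_gt, h.ne']
  rw [this, PiTensorProduct.map_update_smul]
  congr 1
  rw [Function.update_eq_self j (fun _ => (1 : Module.End Q P.carrier))]
  exact PiTensorProduct.map_one

theorem tDiffAt_anticomm {i j : Fin n} (hij : i < j) :
    P.tDiffAt n i * P.tDiffAt n j + P.tDiffAt n j * P.tDiffAt n i = 0 := by
  classical
  unfold tDiffAt
  rw [← PiTensorProduct.map_mul, ← PiTensorProduct.map_mul]
  set g : Fin n → Module.End Q P.carrier := fun k =>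
    (if k < i then P.signMap else if k = i then P.d else 1) *
      (if k < j then P.signMap else if k = j then P.d else 1) with hg
  have h1 : (fun k => (if k < j then P.signMap else if k = j then P.d else 1) *
      (if k < i then P.signMap else if k = i then P.d else 1)) =
      Function.update g i ((-1 : Q) • g i) := by
    funext k
    by_cases h : k = i
    · subst h
      simp [hg, hij, P.signMap_mul_d]
    · rcases lt_or_gt_of_ne h with h' | h'
      · simp [hg, h, h', h'.trans hij]
      · simp [hg, h, h'.not_gt]
  rw [h1, PiTensorProduct.map_update_smul, Function.update_eq_self]
  calc PiTensorProduct.map g + (-1 : Q) • PiTensorProduct.map g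
      = ((1 : Q) + (-1)) • PiTensorProduct.map g := by rw [add_smul, one_smul]
    _ = 0 := by rw [add_neg_cancel, zero_smul]

theorem tDiff_mul_tDiff : P.tDiff n * P.tDiff n = ((n : Q) * w) • 1 := by
  classical
  unfold tDiff
  rw [Finset.sum_mul_sum, ← Finset.sum_product']
  rw [← Finset.sum_filter_add_sum_filter_not _ (fun x : Fin n × Fin n => x.1 = x.2)]
  have h1 : ∑ x ∈ (Finset.univ ×ˢ Finset.univ).filter (fun x : Fin n × Fin n => x.1 = x.2),
      P.tDiffAt n x.1 * P.tDiffAt n x.2 = ((n : Q) * w) • 1 := by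
    rw [Finset.sum_filter, Finset.sum_product]
    simp [P.tDiffAt_mul_self, mul_smul, Nat.cast_smul_eq_nsmul]
  have h2 : ∑ x ∈ (Finset.univ ×ˢ Finset.univ).filter (fun x : Fin n × Fin n => ¬ x.1 = x.2),
      P.tDiffAt n x.1 * P.tDiffAt n x.2 = 0 := by
    refine Finset.sum_involution (fun x _ => x.swap) ?_ ?_ ?_ ?_
    · rintro ⟨i, j⟩ hx
      have hx' : i ≠ j := by simpa using hx
      rcases lt_or_gt_of_ne hx' with h | h
      · exact P.tDiffAt_anticomm h
      · rw [add_comm]; exact P.tDiffAt_anticomm h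
    · rintro ⟨i, j⟩ hx _ he
      have hx' : i ≠ j := by simpa using hx
      simp only [Prod.swap_prod_mk, Prod.mk.injEq] at he
      exact hx' he.2
    · rintro ⟨i, j⟩ hx
      have hx' : i ≠ j := by simpa using hx
      simpa using hx'.symm
    · intro x _; simp
  rw [h1, h2, add_zero]

end TensorPower

end CurvedModule


/-! ## Eigenspaces of the cyclic permutation -/

theorem projective_tPow (Q : Type u) [CommRing Q] (M : Type u) [AddCommGroup M] [Module Q M]
    [Module.Finite Q M] [Module.Projective Q M] (n : ℕ) :
    Module.Projective Q (⨂[Q] _ : Fin n, M) := by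
  obtain ⟨m, f, g, -, -, hfg⟩ := Module.Finite.exists_comp_eq_id_of_projective Q M
  have : Module.Free Q (⨂[Q] _ : Fin n, (Fin m → Q)) :=
    Module.Free.of_basis (Basis.piTensorProduct fun _ : Fin n => Pi.basisFun Q (Fin m))
  refine Module.Projective.of_split (PiTensorProduct.map fun _ : Fin n => g)
    (PiTensorProduct.map fun _ : Fin n => f) ?_
  rw [← PiTensorProduct.map_comp, hfg]
  exact PiTensorProduct.map_id

section Eigen

variable {Q : Type u} [CommRing Q] {M : Type u} [AddCommGroup M] [Module Q M]

/-- The eigenspace of eigenvalue `z` of `σ`. -/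
abbrev eig (σ : Module.End Q M) (z : Q) : Submodule Q M := LinearMap.ker (σ - z • 1)

theorem mem_eig {σ : Module.End Q M} {z : Q} {x : M} : x ∈ eig σ z ↔ σ x = z • x := by
  rw [LinearMap.mem_ker, LinearMap.sub_apply, sub_eq_zero]; rfl

theorem map_eig {σ φ : Module.End Q M} {z : Q} (h : σ * φ = φ * σ) :
    ∀ x ∈ eig σ z, φ x ∈ eig σ z := by
  intro x hx
  rw [mem_eig] at hx ⊢
  have := LinearMap.congr_fun h x
  simp only [Module.End.mul_apply] at this
  rw [this, hx, map_smul]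

/-- If `σ ^ p = 1`, `z ^ p = 1` and `p` is invertible, then the eigenspace is a direct summand,
by a projection that commutes with everything that commutes with `σ`. -/
theorem exists_eig_proj {p : ℕ} (hp : IsUnit (p : Q)) {z : Q} (hz : z ^ p = 1)
    {σ : Module.End Q M} (hσ : σ ^ p = 1) :
    ∃ π : Module.End Q M, (∀ x, π x ∈ eig σ z) ∧ (∀ x ∈ eig σ z, π x = x) ∧
      ∀ φ : Module.End Q M, σ * φ = φ * σ → π * φ = φ * π := by
  obtain ⟨u, hu⟩ := hp
  have hc : Commute σ (z • (1 : Module.End Q M)) := (Commute.one_right σ).smul_right z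
  set A : Module.End Q M := ∑ k ∈ Finset.range p, σ ^ k * (z • (1 : Module.End Q M)) ^ (p - 1 - k)
    with hA
  have hgeom : (σ - z • 1) * A = 0 := by
    rw [hA, hc.mul_geom_sum₂ p, hσ, smul_pow, hz, one_pow, one_smul, sub_self]
  refine ⟨((u⁻¹ : Qˣ) : Q) • z • A, ?_, ?_, ?_⟩
  · intro x
    have : A x ∈ eig σ z := LinearMap.congr_fun hgeom x
    exact Submodule.smul_mem _ _ (Submodule.smul_mem _ _ this)
  · intro x hx
    rw [mem_eig] at hx
    have h1 : ∀ k, (σ ^ k) x = z ^ k • x := by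
      intro k
      induction k with
      | zero => simp
      | succ k ih => rw [pow_succ', Module.End.mul_apply, ih, map_smul, hx, smul_smul, pow_succ]
    have h2 : z • A x = (p : Q) • x := by
      rw [hA, LinearMap.sum_apply, Finset.smul_sum]
      have : ∀ k ∈ Finset.range p,
          z • (σ ^ k * (z • (1 : Module.End Q M)) ^ (p - 1 - k)) x = x := by
        intro k hk
        have hk' := Finset.mem_range.mp hk
        have hzk : z * z ^ (p - 1 - k) * z ^ k = 1 := by
          rw [← pow_succ', ← pow_add, show p - 1 - k + 1 + k = p by omega, hz]
        rw [smul_pow, one_pow, Module.End.mul_apply, LinearMap.smul_apply, Module.End.one_apply,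
          map_smul, h1, smul_smul, smul_smul, hzk, one_smul]
      rw [Finset.sum_congr rfl this, Finset.sum_const, Finset.card_range, Nat.cast_smul_eq_nsmul]
    rw [LinearMap.smul_apply, LinearMap.smul_apply, h2, smul_smul, ← hu, Units.inv_mul, one_smul]
  · intro φ hφ
    have hAφ : A * φ = φ * A := by
      have h3 : Commute A φ := by
        rw [hA]
        refine Commute.sum_left _ _ _ fun k _ => Commute.mul_left (Commute.pow_left hφ k) ?_
        exact Commute.pow_left ((Commute.one_left φ).smul_left z) _
      exact h3
    rw [smul_mul_assoc, smul_mul_assoc, hAφ, mul_smul_comm, mul_smul_comm]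

end Eigen

namespace CurvedModule

variable {Γ : Type} [CommRing Γ] {Q : Type u} [CommRing Q]

/-- `P`, regarded as having curvature `w' = w`. -/
def copy {w w' : Q} (h : w = w') (P : CurvedModule Γ Q w) : CurvedModule Γ Q w' where
  carrier := P.carrier
  proj := P.proj
  proj_mul_self := P.proj_mul_self
  proj_mul_of_ne := P.proj_mul_of_ne
  exists_sum_proj := P.exists_sum_proj
  d := P.d
  d_mul_proj := P.d_mul_proj
  d_mul_d := h ▸ P.d_mul_d

/-- The eigenspace of eigenvalue `z` of an automorphism `σ` of `P` with `σ ^ p = 1`, with the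
restricted projections and differential. -/
noncomputable def eigenspace {w : Q} (P : CurvedModule Γ Q w) (σ : Module.End Q P.carrier)
    (hproj : ∀ i, σ * P.proj i = P.proj i * σ) (hd : σ * P.d = P.d * σ)
    {p : ℕ} (hp : IsUnit (p : Q)) (hσ : σ ^ p = 1) (z : Q) (hz : z ^ p = 1) :
    CurvedModule Γ Q w where
  carrier := eig σ z
  finite := by
    obtain ⟨π, h1, h2, -⟩ := exists_eig_proj hp hz hσ
    exact Module.Finite.of_surjective (π.codRestrict (eig σ z) h1)
      fun y => ⟨y, Subtype.ext (h2 y y.2)⟩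
  projective := by
    obtain ⟨π, h1, h2, -⟩ := exists_eig_proj hp hz hσ
    exact Module.Projective.of_split (eig σ z).subtype (π.codRestrict (eig σ z) h1)
      (LinearMap.ext fun y => Subtype.ext (h2 y y.2))
  proj i := (P.proj i).restrict (map_eig (hproj i))
  proj_mul_self i := LinearMap.ext fun x => Subtype.ext (P.proj_apply_self i x)
  proj_mul_of_ne i j h :=
    LinearMap.ext fun x => Subtype.ext (LinearMap.congr_fun (P.proj_mul_of_ne i j h) x)
  exists_sum_proj := by
    obtain ⟨S, h1, h2⟩ := P.exists_sum_proj
    refine ⟨S, fun i hi => LinearMap.ext fun x => Subtype.ext ?_,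
      LinearMap.ext fun x => Subtype.ext ?_⟩
    · simp [h1 i hi]
    · have := LinearMap.congr_fun h2 (x : P.carrier)
      rw [LinearMap.sum_apply] at this
      simpa using this
  d := P.d.restrict (map_eig hd)
  d_mul_proj i :=
    LinearMap.ext fun x => Subtype.ext (LinearMap.congr_fun (P.d_mul_proj i) (x : P.carrier))
  d_mul_d :=
    LinearMap.ext fun x => Subtype.ext (LinearMap.congr_fun P.d_mul_d (x : P.carrier))

variable [SignedGrading Γ]

theorem tPerm_finRotate_pow {w : Q} (P : CurvedModule Γ Q w) (n : ℕ) :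
    P.tPerm n (finRotate n) ^ n = 1 := by
  rw [← P.tPerm_pow, finRotate_pow_self]
  exact P.tPerm_one

/-- The tensor power `T^n P`, of curvature `n * w`. -/
noncomputable def tensorPower {w : Q} (P : CurvedModule Γ Q w) (n : ℕ) :
    CurvedModule Γ Q ((n : Q) * w) where
  carrier := TPow P n
  projective := projective_tPow Q P.carrier n
  proj := P.tProj n
  proj_mul_self := P.tProj_mul_self
  proj_mul_of_ne := P.tProj_mul_of_ne
  exists_sum_proj := P.exists_sum_tProj
  d := P.tDiff n
  d_mul_proj := P.tDiff_mul_tProj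
  d_mul_d := P.tDiff_mul_tDiff

/-- `(T^p P)^(z)`: the eigenspace of eigenvalue `z`, where `z ^ p = 1`, of the `p`-cycle
`0 ↦ 1 ↦ ⋯ ↦ p - 1 ↦ 0` on the `p`-th tensor power of `P`. -/
noncomputable def cyclicPower {w : Q} (P : CurvedModule Γ Q w) {p : ℕ} (hp : IsUnit (p : Q))
    (z : Q) (hz : z ^ p = 1) : CurvedModule Γ Q ((p : Q) * w) :=
  (P.tensorPower p).eigenspace (P.tPerm p (finRotate p)) (P.tPerm_mul_tProj _)
    (P.tPerm_mul_tDiff _) hp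
    (P.tPerm_finRotate_pow p) z hz

end CurvedModule

theorem zmod_two_sub_one_ne {i j : ZMod 2} (h : i ≠ j) : i - 1 = j := by
  revert i j; decide

/-- For a unit `u`, the matrix factorization `(α, u β)` of `u f` attached to a matrix
factorization `(α : P 1 → P 0, β : P 0 → P 1)` of `f`. -/
noncomputable def MatFac.mult {Q : Type u} [CommRing Q] {f : Q} (u : Qˣ) (P : MatFac Q f) :
    MatFac Q ((u : Q) * f) where
  carrier := P.carrier
  proj := P.proj
  proj_mul_self := P.proj_mul_self
  proj_mul_of_ne := P.proj_mul_of_ne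
  exists_sum_proj := P.exists_sum_proj
  d := P.d * (P.proj 1 + (u : Q) • P.proj 0)
  d_mul_proj i := by
    have e : (P.proj 1 + (u : Q) • P.proj 0) * P.proj i =
        P.proj i * (P.proj 1 + (u : Q) • P.proj 0) := by
      rw [add_mul, mul_add, smul_mul_assoc, mul_smul_comm]
      rcases zmod_two_eq i with rfl | rfl
      · rw [P.proj_mul_of_ne 0 1 (by decide), P.proj_mul_of_ne 1 0 (by decide)]
      · rw [P.proj_mul_of_ne 0 1 (by decide), P.proj_mul_of_ne 1 0 (by decide)]
    rw [← mul_assoc, ← P.d_mul_proj, mul_assoc, mul_assoc, e]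
  d_mul_d := by
    apply P.ext_of_mem
    intro i x hx
    have hdx := P.proj_d_of_mem hx
    have hdd : P.d (P.d x) = f • x := LinearMap.congr_fun P.d_mul_d x
    simp only [Module.End.mul_apply, LinearMap.add_apply, LinearMap.smul_apply,
      Module.End.one_apply]
    rcases zmod_two_eq i with rfl | rfl
    · rw [P.proj_apply_of_mem hx, P.proj_apply_of_mem hx, if_neg (by decide), if_pos rfl, zero_add,
        map_smul, map_smul, map_smul, P.proj_apply_of_mem hdx, P.proj_apply_of_mem hdx,
        if_pos (by decide), if_neg (by decide), smul_zero, smul_zero, add_zero, map_smul, hdd,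
        smul_smul]
    · rw [P.proj_apply_of_mem hx, P.proj_apply_of_mem hx, if_pos (by decide), if_neg (by decide),
        smul_zero, add_zero, P.proj_apply_of_mem hdx, P.proj_apply_of_mem hdx,
        if_neg (by decide), if_pos (by decide), zero_add, map_smul, hdd, smul_smul]

/-! ## Complexes with homology supported on `V(f)` -/

namespace BddComplex

variable {Q : Type u} [CommRing Q]

/-- The homology (the direct sum of the homology modules in all degrees) of a complex. -/
abbrev Homology (P : BddComplex Q) : Type u :=
  LinearMap.ker P.d ⧸ (LinearMap.range P.d).submoduleOf (LinearMap.ker P.d)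

/-- The homology of `P` is supported on `V(f)`. -/
def SupportedOn (P : BddComplex Q) (f : Q) : Prop :=
  Module.support Q P.Homology ⊆ PrimeSpectrum.zeroLocus {f}

theorem supportedOn_of_pow (P : BddComplex Q) (f : Q) (N : ℕ)
    (h : ∀ x, P.d x = 0 → ∃ y, P.d y = f ^ N • x) : P.SupportedOn f := by
  intro q hq
  rw [Module.mem_support_iff'] at hq
  obtain ⟨m, hm⟩ := hq
  rw [PrimeSpectrum.mem_zeroLocus, Set.singleton_subset_iff, SetLike.mem_coe]
  by_contra hf
  refine hm (f ^ N) (fun h' => hf (q.2.mem_of_pow_mem N h')) ?_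
  obtain ⟨⟨x, hx⟩, rfl⟩ := Submodule.Quotient.mk_surjective _ m
  rw [← Submodule.Quotient.mk_smul, Submodule.Quotient.mk_eq_zero]
  exact h x hx

theorem pow_of_supportedOn [IsNoetherianRing Q] (P : BddComplex Q) (f : Q)
    (h : P.SupportedOn f) : ∃ N : ℕ, ∀ x, P.d x = 0 → ∃ y, P.d y = f ^ N • x := by
  unfold SupportedOn at h
  rw [Module.support_eq_zeroLocus, ← PrimeSpectrum.zeroLocus_span {f},
    PrimeSpectrum.zeroLocus_subset_zeroLocus_iff] at h
  obtain ⟨N, hN⟩ := h (Ideal.mem_span_singleton_self f)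
  refine ⟨N, fun x hx => ?_⟩
  have := Module.mem_annihilator.mp hN (Submodule.Quotient.mk ⟨x, hx⟩)
  rw [← Submodule.Quotient.mk_smul, Submodule.Quotient.mk_eq_zero] at this
  exact this

/-- If multiplication by `g` annihilates the homology of a bounded complex of projective modules,
then a power of `g` is null-homotopic. -/
theorem exists_nullHomotopy (P : BddComplex Q) (g : Q)
    (hg : ∀ x, P.d x = 0 → ∃ y, P.d y = g • x) :
    ∃ (N : ℕ) (h : Module.End Q P.carrier), (∀ i, h * P.proj i = P.proj (i + 1) * h) ∧
      P.d * h + h * P.d = g ^ N • 1 := by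
  obtain ⟨S, hS0, hS1⟩ := P.exists_sum_proj
  obtain ⟨m, hm⟩ : ∃ m : ℤ, ∀ i ∈ S, m ≤ i := S.bddBelow
  obtain ⟨M, hM⟩ : ∃ m : ℤ, ∀ i ∈ S, i ≤ m := S.bddAbove
  have key : ∀ k : ℕ, ∃ (N : ℕ) (h : Module.End Q P.carrier),
      (∀ i, h * P.proj i = P.proj (i + 1) * h) ∧
      ∀ i < m + k, (g ^ N • 1 - P.d * h - h * P.d) * P.proj i = 0 := by
    intro k
    induction k with
    | zero =>
      refine ⟨0, 0, by simp, fun i hi => ?_⟩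
      have : P.proj i = 0 := hS0 i fun h => by have := hm i h; simp at hi; omega
      simp [this]
    | succ k ih =>
      obtain ⟨N, h, hh, hz⟩ := ih
      set φ := g ^ N • 1 - P.d * h - h * P.d with hφ
      set n := m + (k : ℤ) with hn
      have hdφ : P.d * φ = φ * P.d := by
        rw [hφ]
        have : P.d * P.d = 0 := by rw [P.d_mul_d, zero_smul]
        have e1 : P.d * (P.d * h) = 0 := by rw [← mul_assoc, this, zero_mul]
        have e2 : h * P.d * P.d = 0 := by rw [mul_assoc, this, mul_zero]
        rw [mul_sub, mul_sub, sub_mul, sub_mul, e1, e2, mul_smul_comm, smul_mul_assoc, mul_one,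
          one_mul, mul_assoc]
        abel
      have hφp : ∀ i, φ * P.proj i = P.proj i * φ := by
        intro i
        rw [hφ, sub_mul, sub_mul, mul_sub, mul_sub, smul_mul_assoc, mul_smul_comm, one_mul, mul_one]
        congr 1
        · congr 1
          rw [mul_assoc, hh, ← mul_assoc, P.d_mul_proj, mul_assoc, add_sub_cancel_right]
        · rw [mul_assoc, P.d_mul_proj, ← mul_assoc, hh, mul_assoc, sub_add_cancel]
      have hlift : ∀ x, (g • (φ * P.proj n)) x ∈ LinearMap.range P.d := by
        intro x
        have : P.d ((φ * P.proj n) x) = 0 := by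
          have e : P.d * (φ * P.proj n) = 0 := by
            rw [← mul_assoc, hdφ, mul_assoc, P.d_mul_proj, ← mul_assoc, hz _ (by omega), zero_mul]
          exact LinearMap.congr_fun e x
        exact hg _ this
      obtain ⟨h₀, hh₀⟩ := Module.projective_lifting_property P.d.rangeRestrict
        ((g • (φ * P.proj n)).codRestrict _ hlift) P.d.surjective_rangeRestrict
      have hh₀' : P.d * h₀ = g • (φ * P.proj n) := by
        ext x
        exact congrArg Subtype.val (LinearMap.congr_fun hh₀ x)
      set h' := P.proj (n + 1) * h₀ * P.proj n with hh'
      have e0 : P.d * h' = g • (φ * P.proj n) := by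
        rw [hh', ← mul_assoc, ← mul_assoc, P.d_mul_proj, add_sub_cancel_right, mul_assoc (P.proj n),
          hh₀', mul_smul_comm, smul_mul_assoc, ← mul_assoc, ← hφp, mul_assoc, mul_assoc,
          P.proj_mul_self, P.proj_mul_self]
      have e1 : ∀ i, i ≠ n → h' * P.proj i = 0 := by
        intro i hi
        rw [hh', mul_assoc, P.proj_mul_of_ne n i (Ne.symm hi), mul_zero]
      have e2 : ∀ i, i ≠ n → P.proj (i + 1) * h' = 0 := by
        intro i hi
        rw [hh', ← mul_assoc, ← mul_assoc, P.proj_mul_of_ne (i + 1) (n + 1) (by omega), zero_mul,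
          zero_mul]
      refine ⟨N + 1, g • h + h', ?_, ?_⟩
      · intro i
        rw [add_mul, mul_add, smul_mul_assoc, mul_smul_comm, hh]
        congr 1
        by_cases hi : i = n
        · subst hi
          rw [hh', mul_assoc, P.proj_mul_self, ← mul_assoc, ← mul_assoc, P.proj_mul_self]
        · rw [e1 i hi, e2 i hi]
      · intro i hi
        have e3 : g ^ (N + 1) • 1 - P.d * (g • h + h') - (g • h + h') * P.d =
            g • φ - P.d * h' - h' * P.d := by
          rw [hφ, mul_add, add_mul, mul_smul_comm, smul_mul_assoc, smul_sub, smul_sub, smul_smul,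
            pow_succ']
          abel
        rw [e3, sub_mul, sub_mul, e0, mul_assoc h', P.d_mul_proj, ← mul_assoc h',
          e1 (i - 1) (by push_cast at hi; omega), zero_mul, sub_zero, smul_mul_assoc,
          smul_mul_assoc, mul_assoc, ← smul_sub]
        by_cases hi' : i = n
        · subst hi'; rw [P.proj_mul_self, sub_self, smul_zero]
        · rw [P.proj_mul_of_ne n i (Ne.symm hi'), mul_zero, sub_zero,
            hz i (by push_cast at hi; omega), smul_zero]
  obtain ⟨N, h, hh, hz⟩ := key (M - m + 1).toNat
  refine ⟨N, h, hh, ?_⟩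
  have : g ^ N • 1 - P.d * h - h * P.d = 0 := by
    refine (mul_one _).symm.trans ?_
    refine (congrArg ((g ^ N • 1 - P.d * h - h * P.d) * ·) hS1).symm.trans ?_
    refine (Finset.mul_sum _ _ _).trans ?_
    refine Finset.sum_eq_zero fun i hi => hz i ?_
    have := hM i hi
    have := Int.self_le_toNat (M - m + 1)
    omega
  rw [sub_sub, sub_eq_zero] at this
  exact this.symm

theorem signMap_mul_of_degree_one (P : BddComplex Q) (h : Module.End Q P.carrier)
    (hh : ∀ i, h * P.proj i = P.proj (i + 1) * h) : P.signMap * h = -(h * P.signMap) := by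
  apply P.ext_of_mem
  intro i x hx
  have hhx : P.proj (i + 1) (h x) = h x := by
    have := LinearMap.congr_fun (hh i) x
    simp only [Module.End.mul_apply, hx] at this
    exact this.symm
  rw [Module.End.mul_apply, LinearMap.neg_apply, Module.End.mul_apply, P.signMap_apply_of_mem hx,
    map_smul, P.signMap_apply_of_mem hhx, map_add, map_one, sgn_add, sgn_one]
  simp

/-- A null-homotopy of multiplication by `c` on `P` yields one on the tensor powers. -/
theorem exists_tensorPower_nullHomotopy (P : BddComplex Q) (h : Module.End Q P.carrier)
    (hh : ∀ i, h * P.proj i = P.proj (i + 1) * h) (c : Q) (hc : P.d * h + h * P.d = c • 1)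
    (n : ℕ) : ∃ H : Module.End Q (P.TPow (n + 1)),
      P.tDiff (n + 1) * H + H * P.tDiff (n + 1) = c • 1 := by
  classical
  set one : Fin (n + 1) → Module.End Q P.carrier := fun _ => 1 with hone
  have h1 : PiTensorProduct.map one = 1 := PiTensorProduct.map_one
  refine ⟨PiTensorProduct.map (Function.update one 0 h), ?_⟩
  unfold CurvedModule.tDiff
  rw [Finset.sum_mul, Finset.mul_sum, ← Finset.sum_add_distrib, Finset.sum_eq_single 0]
  · unfold CurvedModule.tDiffAt
    rw [← PiTensorProduct.map_mul, ← PiTensorProduct.map_mul]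
    have e1 : (fun i : Fin (n + 1) => (if i < 0 then P.signMap else if i = 0 then P.d else 1) *
        Function.update one 0 h i) = Function.update one 0 (P.d * h) := by
      funext i
      by_cases hi : i = 0
      · subst hi; simp
      · simp [hi, hone]
    have e2 : (fun i : Fin (n + 1) => Function.update one 0 h i *
        (if i < 0 then P.signMap else if i = 0 then P.d else 1)) =
        Function.update one 0 (h * P.d) := by
      funext i
      by_cases hi : i = 0
      · subst hi; simp
      · simp [hi, hone]
    rw [e1, e2, ← PiTensorProduct.map_update_add, hc, PiTensorProduct.map_update_smul]
    congr 1
    rw [show (1 : Module.End Q P.carrier) = one 0 from rfl, Function.update_eq_self, h1]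
  · intro j _ hj
    have hj' : 0 < j := Fin.pos_iff_ne_zero.mpr hj
    unfold CurvedModule.tDiffAt
    rw [← PiTensorProduct.map_mul, ← PiTensorProduct.map_mul]
    set g : Fin (n + 1) → Module.End Q P.carrier := fun i => Function.update one 0 h i *
        (if i < j then P.signMap else if i = j then P.d else 1) with hgdef
    have e1 : (fun i : Fin (n + 1) => (if i < j then P.signMap else if i = j then P.d else 1) *
        Function.update one 0 h i) = Function.update g 0 ((-1 : Q) • g 0) := by
      funext i
      by_cases hi : i = 0
      · subst hi
        simp [hgdef, hj', signMap_mul_of_degree_one P h hh]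
      · simp [hgdef, hi, hone]
    rw [e1, PiTensorProduct.map_update_smul, Function.update_eq_self]
    calc (-1 : Q) • PiTensorProduct.map g + PiTensorProduct.map g
        = ((-1 : Q) + 1) • PiTensorProduct.map g := by rw [add_smul, one_smul]
      _ = 0 := by rw [neg_add_cancel, zero_smul]
  · intro hn; exact absurd (Finset.mem_univ _) hn

/-- `(T^p P)^(z)` for a complex `P`. -/
noncomputable def cyclicPower (P : BddComplex Q) {p : ℕ} (hp : IsUnit (p : Q))
    (z : Q) (hz : z ^ p = 1) : BddComplex Q :=
  (CurvedModule.cyclicPower P hp z hz).copy (mul_zero _)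

theorem cyclicPower_supportedOn [IsNoetherianRing Q] (P : BddComplex Q) (f : Q)
    (hP : P.SupportedOn f) {p : ℕ} (hp0 : p ≠ 0) (hp : IsUnit (p : Q)) (z : Q) (hz : z ^ p = 1) :
    (P.cyclicPower hp z hz).SupportedOn f := by
  obtain ⟨n, rfl⟩ := Nat.exists_eq_succ_of_ne_zero hp0
  obtain ⟨N, hN⟩ := P.pow_of_supportedOn f hP
  obtain ⟨N', h, hh, hc⟩ := P.exists_nullHomotopy _ hN
  obtain ⟨H, hH⟩ := P.exists_tensorPower_nullHomotopy h hh _ hc n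
  obtain ⟨π, h1, h2, h3⟩ := exists_eig_proj (σ := P.tPerm (n + 1) (finRotate (n + 1))) hp hz
    (P.tPerm_finRotate_pow (n + 1))
  refine supportedOn_of_pow _ f (N * N') ?_
  intro (x : eig (P.tPerm (n + 1) (finRotate (n + 1))) z) hx
  have hx' : P.tDiff (n + 1) (x : P.TPow (n + 1)) = 0 := congrArg Subtype.val hx
  refine ⟨⟨π (H x), h1 _⟩, Subtype.ext ?_⟩
  change P.tDiff (n + 1) (π (H x)) = f ^ (N * N') • (x : P.TPow (n + 1))
  have e1 := LinearMap.congr_fun (h3 _ (P.tPerm_mul_tDiff (finRotate (n + 1)))) (H x)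
  have e2 := LinearMap.congr_fun hH (x : P.TPow (n + 1))
  simp only [Module.End.mul_apply, LinearMap.add_apply, hx', map_zero, add_zero] at e1 e2
  rw [← e1, e2, LinearMap.smul_apply, map_smul, Module.End.one_apply, h2 _ x.2, pow_mul]

end BddComplex

/-- Bounded complexes of finitely generated projective `Q`-modules with homology supported
on `V(f)`. -/
abbrev SuppComplex (Q : Type u) [CommRing Q] (f : Q) := {P : BddComplex Q // P.SupportedOn f}

/-! ## Modules over the Koszul algebra of `f` -/

/-- A dg-module over the Koszul algebra `Q[ε]/(ε²)`, `d ε = f`, that is finitely generated and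
projective over `Q`; the map `s` of degree one is multiplication by `ε`. -/
structure KoszulModule (Q : Type u) [CommRing Q] (f : Q) extends CurvedModule ℤ Q 0 where
  s : Module.End Q carrier
  s_mul_proj : ∀ i, s * proj i = proj (i + 1) * s
  d_mul_s_add : d * s + s * d = f • (1 : Module.End Q carrier)
  s_mul_s : s * s = 0

namespace KoszulModule

variable {Q : Type u} [CommRing Q] {f : Q}

/-- The underlying complex. -/
abbrev cx (P : KoszulModule Q f) : BddComplex Q := P.toCurvedModule

/-- `g` is a morphism of dg-modules. -/
structure IsHom (P P' : KoszulModule Q f) (g : P.carrier →ₗ[Q] P'.carrier) : Prop where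
  cx : CurvedModule.IsHom P.cx P'.cx g
  s : g ∘ₗ P.s = P'.s ∘ₗ g

/-- `h` is a homotopy of morphisms of dg-modules: a homotopy of morphisms of complexes that is
linear over the Koszul algebra, which for a map of degree one means `h s = - s h`. -/
structure IsHomotopy (P P' : KoszulModule Q f) (h g₁ g₂ : P.carrier →ₗ[Q] P'.carrier) :
    Prop where
  cx : CurvedModule.IsHomotopy P.cx P'.cx h g₁ g₂
  s : h ∘ₗ P.s = -(P'.s ∘ₗ h)

/-- `P` and `P'` are homotopy equivalent. -/
def HtpyEquiv (P P' : KoszulModule Q f) : Prop :=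
  ∃ (g : P.carrier →ₗ[Q] P'.carrier) (g' : P'.carrier →ₗ[Q] P.carrier)
    (h : P.carrier →ₗ[Q] P.carrier) (h' : P'.carrier →ₗ[Q] P'.carrier),
    IsHom P P' g ∧ IsHom P' P g' ∧
    IsHomotopy P P h (g' ∘ₗ g) LinearMap.id ∧ IsHomotopy P' P' h' (g ∘ₗ g') LinearMap.id

/-- There is a short exact sequence `0 → P' → P → P'' → 0`. -/
def ShortExact (P' P P'' : KoszulModule Q f) : Prop :=
  ∃ (i : P'.carrier →ₗ[Q] P.carrier) (q : P.carrier →ₗ[Q] P''.carrier),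
    IsHom P' P i ∧ IsHom P P'' q ∧
    Function.Injective i ∧ Function.Exact i q ∧ Function.Surjective q

theorem cx_supportedOn (P : KoszulModule Q f) : P.cx.SupportedOn f := by
  refine P.cx.supportedOn_of_pow f 1 fun x hx => ⟨P.s x, ?_⟩
  have := LinearMap.congr_fun P.d_mul_s_add x
  simp only [LinearMap.add_apply, Module.End.mul_apply] at this
  rw [hx, map_zero, add_zero] at this
  rw [this, pow_one]; rfl

/-- The functor `F` that forgets `s`. -/
def forget (P : KoszulModule Q f) : SuppComplex Q f := ⟨P.cx, P.cx_supportedOn⟩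

theorem proj_s_of_mem (P : KoszulModule Q f) {i : ℤ} {x : P.carrier} (hx : P.proj i x = x) :
    P.proj (i + 1) (P.s x) = P.s x := by
  have := LinearMap.congr_fun (P.s_mul_proj i) x
  simp only [Module.End.mul_apply, hx] at this
  exact this.symm

/-- The folding of `P`: the matrix factorization of `f` with components the sums of the
components of `P` of even and of odd degree, and with the differential `d + s`. -/
noncomputable def fold (P : KoszulModule Q f) : MatFac Q f where
  carrier := P.carrier
  proj b := P.cx.parityProj b
  proj_mul_self b := by
    apply P.cx.ext_of_mem
    intro i x hx
    rw [Module.End.mul_apply, P.cx.parityProj_apply_of_mem hx]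
    split_ifs with h
    · rw [P.cx.parityProj_apply_of_mem hx, if_pos h]
    · exact map_zero _
  proj_mul_of_ne b c hbc := by
    apply P.cx.ext_of_mem
    intro i x hx
    rw [Module.End.mul_apply, P.cx.parityProj_apply_of_mem hx]
    split_ifs with h
    · rw [P.cx.parityProj_apply_of_mem hx, if_neg fun h' => hbc (h'.symm.trans h)]; rfl
    · exact map_zero _
  exists_sum_proj := by
    refine ⟨Finset.univ, fun i hi => absurd (Finset.mem_univ i) hi, ?_⟩
    apply P.cx.ext_of_mem
    intro i x hx
    rw [LinearMap.sum_apply,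
      Finset.sum_congr rfl fun b _ => P.cx.parityProj_apply_of_mem hx b, Finset.sum_ite_eq,
      if_pos (Finset.mem_univ _)]
    rfl
  d := P.d + P.s
  d_mul_proj b := by
    apply P.cx.ext_of_mem
    intro i x hx
    rw [Module.End.mul_apply, Module.End.mul_apply, P.cx.parityProj_apply_of_mem hx,
      LinearMap.add_apply, LinearMap.add_apply, map_add,
      P.cx.parityProj_apply_of_mem (P.cx.proj_d_of_mem hx),
      P.cx.parityProj_apply_of_mem (P.proj_s_of_mem hx), map_sub, map_add, map_one]
    generalize (SignedGrading.parity i : ZMod 2) = c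
    rcases eq_or_ne c b with rfl | h
    · rw [if_pos rfl, if_pos rfl, if_pos (by revert c; decide)]
    · rw [if_neg h, if_neg (by revert c b; decide), if_neg (by revert c b; decide), map_zero,
        map_zero]
  d_mul_d := by
    have h0 : P.d * P.d = 0 := by rw [P.d_mul_d, zero_smul]
    rw [add_mul, mul_add, mul_add, h0, P.s_mul_s, zero_add, add_zero, P.d_mul_s_add]

theorem parityProj_comp {P P' : BddComplex Q} {g : P.carrier →ₗ[Q] P'.carrier} (k : ℤ)
    (hg : ∀ i, g ∘ₗ P.proj i = P'.proj (i + k) ∘ₗ g) (b : ZMod 2) :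
    g ∘ₗ P.parityProj b = P'.parityProj (b + k) ∘ₗ g := by
  apply P.ext_of_mem
  intro i x hx
  have hgx : P'.proj (i + k) (g x) = g x := by
    have := LinearMap.congr_fun (hg i) x
    simp only [LinearMap.comp_apply, hx] at this
    exact this.symm
  rw [LinearMap.comp_apply, LinearMap.comp_apply, P.parityProj_apply_of_mem hx,
    P'.parityProj_apply_of_mem hgx, map_add]
  have : (SignedGrading.parity k : ZMod 2) = (k : ZMod 2) := rfl
  rw [this]
  by_cases h : SignedGrading.parity i = b
  · rw [if_pos h, if_pos (by rw [h])]
  · rw [if_neg h, if_neg fun h' => h (add_right_cancel h'), map_zero]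

theorem IsHom.fold {P P' : KoszulModule Q f} {g : P.carrier →ₗ[Q] P'.carrier}
    (hg : IsHom P P' g) : CurvedModule.IsHom P.fold P'.fold g where
  proj b := by
    have := parityProj_comp 0 (fun i => by rw [add_zero]; exact hg.cx.proj i) b
    rw [Int.cast_zero, add_zero] at this
    exact this
  d := by
    change g ∘ₗ (P.d + P.s) = (P'.d + P'.s) ∘ₗ g
    rw [LinearMap.comp_add, LinearMap.add_comp, hg.cx.d, hg.s]

theorem IsHomotopy.fold {P P' : KoszulModule Q f} {h g₁ g₂ : P.carrier →ₗ[Q] P'.carrier}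
    (hh : IsHomotopy P P' h g₁ g₂) : CurvedModule.IsHomotopy P.fold P'.fold h g₁ g₂ where
  proj b := by
    have := parityProj_comp 1 hh.cx.proj b
    rw [Int.cast_one] at this
    exact this
  d := by
    change (P'.d + P'.s) ∘ₗ h + h ∘ₗ (P.d + P.s) = g₁ - g₂
    rw [LinearMap.comp_add, LinearMap.add_comp, hh.s, ← hh.cx.d]
    abel

end KoszulModule

/-! ## Grothendieck groups -/

/-- The Grothendieck group of objects of type `O`: the abelian group with a generator for every
object and the relations `[P] = [P'] + [P'']` for short exact sequences `0 → P' → P → P'' → 0`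
and `[P] = [P']` for homotopy equivalent `P`, `P'`. -/
abbrev K0 (O : Type v) (ses : O → O → O → Prop) (htpy : O → O → Prop) : Type v :=
  FreeAbelianGroup O ⧸ AddSubgroup.closure
    ({x : FreeAbelianGroup O | ∃ P' P P'', ses P' P P'' ∧
        x = FreeAbelianGroup.of P - (FreeAbelianGroup.of P' + FreeAbelianGroup.of P'')} ∪
      {x | ∃ P P', htpy P P' ∧ x = FreeAbelianGroup.of P - FreeAbelianGroup.of P'})

/-- The class of an object. -/
def K0.cls {O : Type v} {ses : O → O → O → Prop} {htpy : O → O → Prop} (P : O) : K0 O ses htpy :=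
  QuotientAddGroup.mk (FreeAbelianGroup.of P)

/-- The homomorphism `[P] ↦ [F P]` induced by a functor that preserves short exact sequences and
homotopy equivalences. -/
def K0.map {O O' : Type v} {ses : O → O → O → Prop} {htpy : O → O → Prop}
    {ses' : O' → O' → O' → Prop} {htpy' : O' → O' → Prop} (F : O → O')
    (h₁ : ∀ P' P P'', ses P' P P'' → ses' (F P') (F P) (F P''))
    (h₂ : ∀ P P', htpy P P' → htpy' (F P) (F P')) : K0 O ses htpy →+ K0 O' ses' htpy' :=
  QuotientAddGroup.map _ _ (FreeAbelianGroup.map F) (by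
    rw [AddSubgroup.closure_le]
    rintro x (⟨P', P, P'', h, rfl⟩ | ⟨P, P', h, rfl⟩)
    · apply AddSubgroup.subset_closure
      exact Or.inl ⟨F P', F P, F P'', h₁ _ _ _ h, by simp [FreeAbelianGroup.map_of_apply]⟩
    · apply AddSubgroup.subset_closure
      exact Or.inr ⟨F P, F P', h₂ _ _ h, by simp [FreeAbelianGroup.map_of_apply]⟩)

section Groups

variable (Q : Type u) [CommRing Q] (f : Q)

/-- `K_0(mf(Q, f))`. -/
abbrev K0MatFac : Type (u + 1) :=
  K0 (MatFac Q f) CurvedModule.ShortExact CurvedModule.HtpyEquiv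

/-- `K_0^{V(f)}(Q)`. -/
abbrev K0Supp : Type (u + 1) :=
  K0 (SuppComplex Q f) (fun P' P P'' => CurvedModule.ShortExact P'.1 P.1 P''.1)
    (fun P P' => CurvedModule.HtpyEquiv P.1 P'.1)

/-- `K_0(P(K_f/Q))`. -/
abbrev K0Koszul : Type (u + 1) :=
  K0 (KoszulModule Q f) KoszulModule.ShortExact KoszulModule.HtpyEquiv

/-- The map `K_0(P(K_f/Q)) → K_0^{V(f)}(Q)` induced by the forgetful functor. -/
def forgetMap : K0Koszul Q f →+ K0Supp Q f :=
  K0.map KoszulModule.forget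
    (fun _ _ _ ⟨i, q, hi, hq, h⟩ => ⟨i, q, hi.cx, hq.cx, h⟩)
    (fun _ _ ⟨g, g', h, h', hg, hg', hh, hh'⟩ => ⟨g, g', h, h', hg.cx, hg'.cx, hh.cx, hh'.cx⟩)

/-- The map `K_0(P(K_f/Q)) → K_0(mf(Q, f))` induced by folding. -/
noncomputable def foldMap : K0Koszul Q f →+ K0MatFac Q f :=
  K0.map KoszulModule.fold
    (fun _ _ _ ⟨i, q, hi, hq, h⟩ => ⟨i, q, hi.fold, hq.fold, h⟩)
    (fun _ _ ⟨g, g', h, h', hg, hg', hh, hh'⟩ =>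
      ⟨g, g', h, h', hg.fold, hg'.fold, hh.fold, hh'.fold⟩)

variable {Q f}

/-- `ρ_f`: the composite of the inverse of the isomorphism induced by the forgetful functor with
the map induced by folding. -/
noncomputable def rho (hF : Function.Bijective (forgetMap Q f)) : K0Supp Q f →+ K0MatFac Q f :=
  (foldMap Q f).comp (AddEquiv.ofBijective (forgetMap Q f) hF).symm.toAddMonoidHom

end Groups

/-! ## The cyclic Adams operations -/

/-- `e^{2 π i / p}`. -/
noncomputable def zetaC (p : ℕ) : ℂ := Complex.exp (2 * Real.pi * Complex.I / p)

/-- The subring `A_p = ℤ[1/p, e^{2 π i / p}]` of `ℂ`. -/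
abbrev Ap (p : ℕ) : Subalgebra ℤ ℂ := Algebra.adjoin ℤ {(p : ℂ)⁻¹, zetaC p}

/-- The subring `ℤ[e^{2 π i / p}]` of `ℂ`. -/
abbrev CycInt (p : ℕ) : Subalgebra ℤ ℂ := Algebra.adjoin ℤ {zetaC p}

/-- `e^{2 π i / p}` as an element of `ℤ[e^{2 π i / p}]`. -/
noncomputable def zetaInt (p : ℕ) : CycInt p :=
  ⟨zetaC p, Algebra.subset_adjoin rfl⟩

/-- The image of `e^{2 π i / p}` in an `A_p`-algebra `Q`. -/
noncomputable def zetaQ (p : ℕ) (Q : Type u) [CommRing Q] [Algebra (Ap p) Q] : Q :=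
  algebraMap (Ap p) Q ⟨zetaC p, Algebra.subset_adjoin (Or.inr rfl)⟩

section Adams

variable {p : ℕ} {Q : Type u} [CommRing Q] [Algebra (Ap p) Q]

theorem zetaQ_pow_pow (hp : p.Prime) (k : ℕ) : (zetaQ p Q ^ k) ^ p = 1 := by
  have h : (⟨zetaC p, Algebra.subset_adjoin (Or.inr rfl)⟩ : Ap p) ^ p = 1 := by
    apply Subtype.ext
    have := (Complex.isPrimitiveRoot_exp p hp.ne_zero).pow_eq_one
    simpa [zetaC] using this
  rw [← pow_mul, mul_comm, pow_mul, zetaQ, ← map_pow, h, map_one, one_pow]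

theorem isUnit_natCast (hp : p.Prime) : IsUnit (p : Q) := by
  have h : (p : Ap p) * ⟨(p : ℂ)⁻¹, Algebra.subset_adjoin (Or.inl rfl)⟩ = 1 := by
    apply Subtype.ext
    have : (p : ℂ) ≠ 0 := Nat.cast_ne_zero.mpr hp.ne_zero
    simp [this]
  have := (IsUnit.of_mul_eq_one _ h).map (algebraMap (Ap p) Q)
  simpa using this

/-- The matrix factorization `(1/p) (T^p P)^(ζ)` of `f`, where `ζ = e^{2 π i k / p}`, whose class
is the value of `t^p_ζ` on the class of `P`. -/
noncomputable def tMatFac (hp : p.Prime) {f : Q} (k : ℕ) (P : MatFac Q f) : MatFac Q f :=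
  (MatFac.mult (isUnit_natCast hp).unit⁻¹
    (P.cyclicPower (isUnit_natCast hp) (zetaQ p Q ^ k) (zetaQ_pow_pow hp k))).copy (by
      rw [← mul_assoc, IsUnit.val_inv_mul, one_mul])

/-- The complex `(T^p P)^(ζ)`, where `ζ = e^{2 π i k / p}`, whose class is the value of `t^p_ζ` on
the class of `P`. -/
noncomputable def tSupp [IsNoetherianRing Q] (hp : p.Prime) {f : Q} (k : ℕ)
    (P : SuppComplex Q f) : SuppComplex Q f :=
  ⟨P.1.cyclicPower (isUnit_natCast hp) (zetaQ p Q ^ k) (zetaQ_pow_pow hp k),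
    P.1.cyclicPower_supportedOn f P.2 hp.ne_zero _ _ _⟩

/-- `ψ` is the operation `∑ ζ t^p_ζ`, the sum over all `p`-th roots of unity `ζ = e^{2 π i k / p}`:
`ψ [P] = ∑ ζ [t k P]` in `ℤ[e^{2 π i / p}] ⊗ K_0`, for every object `P`. -/
def IsCyclicAdams (p : ℕ) {O : Type v} {ses : O → O → O → Prop} {htpy : O → O → Prop}
    (t : ℕ → O → O) (ψ : K0 O ses htpy →+ K0 O ses htpy) : Prop :=
  ∀ P : O, (1 : CycInt p) ⊗ₜ[ℤ] ψ (K0.cls P) =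
    ∑ k ∈ Finset.range p, (zetaInt p ^ k) ⊗ₜ[ℤ] (K0.cls (t k P) : K0 O ses htpy)

end Adams

end CyclicAdams

/-! ### Regular local rings are domains. -/

section

open IsLocalRing
open scoped Pointwise

/-! Bijectivity of the forgetful map is dévissage. Projectivity is dropped: objects become finitely
generated graded modules over the free algebra on the operators `e i`, `d`, `s`, so that submodules,
quotients and exactness are those of ordinary modules, and both Koszul modules and supported
complexes (those with `s = 0`) are classes of such objects. Over a regular ring every finitely
generated module has finite projective dimension (`IsRegularRing.exists_hasProjectiveDimensionLE`),
so the universal additive functions extend from projective objects to all objects of either class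
and vanish on acyclic ones (`Resolving.exists_extension`). Such a function is determined by its
values on objects with `d = 0` and `s = 0` (`AdditiveOn.eq_of_homology`). For Koszul modules these
are the graded modules killed by `f`; for supported complexes, those killed by a power of `f`.
Filtering by the powers of `f` extends a function from the former to the latter
(`AdditiveOn.exists_dev`). If `φ` is the extension of the universal class of Koszul modules, then
the inverse of the forgetful map sends `[X]` to `φ (H X)`. This is additive by the long exact
homology sequence, because a shift of degree changes the sign of `φ`.

Surjectivity of `ρ_f` holds because a matrix factorization, placed in degrees 0 and 1, is itself a
Koszul module that folds back to it.

For the Adams operations, a permutation of the factors that conjugates the cycle to one of its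
powers makes the eigenspaces for `ζ ^ k`, `0 < k < p`, isomorphic (`cyclicPower_pow_htpyEquiv`). The
nontrivial roots of unity have sum `-1`, so the operation must be `[T^(1)] - [T^(ζ)]`. To see that
this difference is additive on an extension of `P''` by `P'`, filter the tensor power by the number
of factors taken from `P'`. The two extremal parts are the tensor powers of `P'` and `P''`. In a
part of intermediate weight, multiplying the `P'`-component of the factor in position `s` by the
`s`-th power of a root of unity interchanges the eigenspaces, so these parts cancel
(`IsWeight.weight_htpyEquiv`, `ShortExact.class_cyclicPower`). Uniqueness holds because `ℤ` is a
direct summand of `ℤ[ζ]`.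

For the compatibility, `s` extends to the tensor power as a derivation, which makes the cyclic power
of a Koszul module for `f` one for `p f`; dividing `s` by `p` returns to `f`. The result forgets to
the cyclic power of the complex and folds, up to isomorphism, to the normalized cyclic power of the
matrix factorization. As the forgetful map is surjective on `K_0`, checking classes of Koszul
modules suffices (`rho_adams`). -/

theorem spanFinrank_maximalIdeal_quotient_span_singleton {R : Type*} [CommRing R] [IsLocalRing R]
    [IsNoetherianRing R] {x : R} (hx : x ∈ maximalIdeal R) (hx2 : x ∉ maximalIdeal R ^ 2)
    [IsLocalRing (R ⧸ Ideal.span {x})] :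
    (maximalIdeal (R ⧸ Ideal.span {x})).spanFinrank + 1 ≤ (maximalIdeal R).spanFinrank := by
  set k := ResidueField R
  set v : CotangentSpace R := (maximalIdeal R).toCotangent ⟨x, hx⟩ with hv
  have hv0 : v ≠ 0 := by
    rw [hv, Ne, Ideal.toCotangent_eq_zero]; exact hx2
  have hrank : Module.finrank k (CotangentSpace R ⧸ Submodule.span k {v}) + 1 =
      (maximalIdeal R).spanFinrank := by
    rw [spanFinrank_maximalIdeal_eq_finrank_cotangentSpace, ← finrank_span_singleton (K := k) hv0]
    exact Submodule.finrank_quotient_add_finrank _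
  set b := Module.finBasis k (CotangentSpace R ⧸ Submodule.span k {v})
  have hl : ∀ i, ∃ y : maximalIdeal R,
      (Submodule.Quotient.mk ((maximalIdeal R).toCotangent y) :
        CotangentSpace R ⧸ Submodule.span k {v}) = b i := by
    intro i
    obtain ⟨z, hz⟩ := Submodule.Quotient.mk_surjective _ (b i)
    obtain ⟨y, hy⟩ := (maximalIdeal R).toCotangent_surjective z
    exact ⟨y, by rw [hy, hz]⟩
  choose y hy using hl
  -- Nakayama: `x` together with lifts of a basis of the cotangent space modulo the class of `x`
  -- generates the maximal ideal. Modulo `x` only the lifts remain, one fewer than the embedding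
  -- dimension.
  have htop : Submodule.span R (insert ⟨x, hx⟩ (Set.range y)) = (⊤ : Submodule R (maximalIdeal R)) := by
    rw [← CotangentSpace.span_image_eq_top_iff, Set.image_insert_eq, Submodule.span_insert, ← hv,
      ← Set.range_comp]
    have : Submodule.map (Submodule.span k {v}).mkQ
        (Submodule.span k (Set.range ((maximalIdeal R).toCotangent ∘ y))) = ⊤ := by
      rw [Submodule.map_span, ← Set.range_comp]
      have hb : (Submodule.span k {v}).mkQ ∘ ((maximalIdeal R).toCotangent ∘ y) = b := funext hy
      erw [hb]
      exact b.span_eq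
    have h2 := congrArg (Submodule.comap (Submodule.span k {v}).mkQ) this
    rw [Submodule.comap_map_eq, Submodule.ker_mkQ, Submodule.comap_top, sup_comm] at h2
    exact h2
  have hspan : maximalIdeal (R ⧸ Ideal.span {x}) =
      Submodule.span _ (Set.range fun i => Ideal.Quotient.mk (Ideal.span {x}) (y i)) := by
    have h1 : (maximalIdeal R) = Ideal.span (insert x (Set.range fun i => (y i : R))) := by
      have := congrArg (Submodule.map (maximalIdeal R).subtype) htop
      rw [Submodule.map_span, Submodule.map_top, Submodule.range_subtype, Set.image_insert_eq,
        ← Set.range_comp] at this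
      exact this.symm
    have h2 : maximalIdeal (R ⧸ Ideal.span {x}) =
        (maximalIdeal R).map (Ideal.Quotient.mk (Ideal.span {x})) := by
      apply le_antisymm
      · intro z hz
        obtain ⟨r, rfl⟩ := Ideal.Quotient.mk_surjective z
        apply Ideal.mem_map_of_mem
        rw [mem_maximalIdeal, mem_nonunits_iff] at hz ⊢
        exact fun h => hz (h.map _)
      · rw [Ideal.map_le_iff_le_comap]
        have : IsLocalHom (Ideal.Quotient.mk (Ideal.span {x})) :=
          .of_surjective _ Ideal.Quotient.mk_surjective
        exact ((local_hom_TFAE (Ideal.Quotient.mk (Ideal.span {x}))).out 0 3).mp this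
    rw [h2]
    refine (congrArg (Ideal.map _) h1).trans ?_
    rw [Ideal.map_span, Set.image_insert_eq, ← Set.range_comp]
    have : Ideal.Quotient.mk (Ideal.span {x}) x = 0 :=
      Ideal.Quotient.eq_zero_iff_mem.mpr (Ideal.mem_span_singleton_self x)
    rw [this]
    exact Ideal.span_insert_zero
  rw [← hrank, hspan]
  gcongr
  refine (Submodule.spanFinrank_span_le_ncard_of_finite (Set.finite_range _)).trans ?_
  rw [← Nat.card_coe_set_eq]
  refine (Finite.card_range_le _).trans ?_
  simp

/-- Passing to the quotient lowers the Krull dimension by at most one and the embedding dimension by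
at least one, so the two stay equal. The bound is stated for any `IsLocalRing` instance because the
quotient acquires one only through the first conclusion. -/
theorem isRegularLocalRing_quotient_span_singleton {R : Type*} [CommRing R] [IsRegularLocalRing R]
    {x : R} (hx : x ∈ maximalIdeal R) (hx2 : x ∉ maximalIdeal R ^ 2) :
    IsRegularLocalRing (R ⧸ Ideal.span {x}) ∧ ∀ [IsLocalRing (R ⧸ Ideal.span {x})],
      (maximalIdeal (R ⧸ Ideal.span {x})).spanFinrank + 1 ≤ (maximalIdeal R).spanFinrank := by
  have hne : Ideal.span {x} ≠ ⊤ := fun h =>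
    Ideal.IsPrime.ne_top' (I := maximalIdeal R)
      (top_le_iff.mp (h ▸ (Ideal.span_singleton_le_iff_mem _).mpr hx))
  have : Nontrivial (R ⧸ Ideal.span {x}) := Ideal.Quotient.nontrivial_iff.mpr hne
  have : IsLocalRing (R ⧸ Ideal.span {x}) :=
    .of_surjective' (Ideal.Quotient.mk _) Ideal.Quotient.mk_surjective
  have h1 := spanFinrank_maximalIdeal_quotient_span_singleton hx hx2
  refine ⟨.of_spanFinrank_maximalIdeal_le _ ?_, h1⟩
  have h2 := ringKrullDim_le_ringKrullDim_quotSMulTop_succ hx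
  have h3 : Ideal.span {x} = x • (⊤ : Ideal R) := by simp [← Submodule.ideal_span_singleton_smul]
  rw [← ringKrullDim_eq_of_ringEquiv (Ideal.quotientEquivAlgOfEq R h3).toRingEquiv,
    ← IsRegularLocalRing.spanFinrank_maximalIdeal] at h2
  have h4 : (((maximalIdeal (R ⧸ Ideal.span {x})).spanFinrank + 1 : ℕ) : WithBot ℕ∞) ≤
      ringKrullDim (R ⧸ Ideal.span {x}) + 1 := le_trans (by exact_mod_cast h1) h2
  push_cast at h4
  exact ENat.WithBot.add_le_add_one_right_iff.mp h4

/-- Induction on the embedding dimension. Choose `x` in the maximal ideal, outside its square and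
outside all minimal primes. The quotient by `x` is a domain by induction, so `(x)` is prime and
contains a minimal prime `p`. Since `x ∉ p`, every element of `p` is `x` times an element of `p`,
and Nakayama gives `p = 0`. -/
theorem IsRegularLocalRing.isDomain_aux (n : ℕ) : ∀ (R : Type*) [CommRing R] [IsRegularLocalRing R],
    (maximalIdeal R).spanFinrank ≤ n → IsDomain R := by
  induction n with
  | zero =>
    intro R _ _ h
    have : maximalIdeal R = ⊥ := (Submodule.spanFinrank_eq_zero_iff_eq_bot
      (maximalIdeal R).fg_of_isNoetherianRing).mp (Nat.le_zero.mp h)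
    exact (IsLocalRing.isField_iff_maximalIdeal_eq.mpr this).isDomain
  | succ n ih =>
    intro R _ _ h
    by_cases hm : maximalIdeal R = ⊥
    · exact (IsLocalRing.isField_iff_maximalIdeal_eq.mpr hm).isDomain
    have hjac : maximalIdeal R ≤ (⊥ : Ideal R).jacobson :=
      (IsLocalRing.jacobson_eq_maximalIdeal _ bot_ne_top).ge
    have hm2 : ¬ maximalIdeal R ≤ maximalIdeal R ^ 2 := by
      intro hle
      apply hm
      refine Submodule.eq_bot_of_le_smul_of_le_jacobson_bot (maximalIdeal R) _
        (IsNoetherian.noetherian _) ?_ hjac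
      rwa [smul_eq_mul, ← pow_two]
    -- Otherwise the dimension, hence the embedding dimension, would be zero and the maximal ideal
    -- would vanish.
    have hmin : maximalIdeal R ∉ minimalPrimes R := by
      intro hmem
      have h0 : (maximalIdeal R).height = 0 := Ideal.height_eq_zero_iff.mpr hmem
      have h1 : ringKrullDim R = 0 := by
        rw [← IsLocalRing.maximalIdeal_height_eq_ringKrullDim, h0]; rfl
      rw [← IsRegularLocalRing.spanFinrank_maximalIdeal] at h1
      have h2 : (maximalIdeal R).spanFinrank = 0 := by exact_mod_cast h1
      exact hm ((Submodule.spanFinrank_eq_zero_iff_eq_bot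
        (maximalIdeal R).fg_of_isNoetherianRing).mp h2)
    obtain ⟨x, hx, hxn⟩ : ∃ x ∈ maximalIdeal R,
        x ∉ ⋃ I ∈ insert (maximalIdeal R ^ 2) (minimalPrimes R), (I : Set R) := by
      by_contra! hsub
      replace hsub : (maximalIdeal R : Set R) ⊆
        ⋃ I ∈ insert (maximalIdeal R ^ 2) (minimalPrimes R), ((id I : Ideal R) : Set R) := hsub
      -- Prime avoidance tolerates two ideals that need not be prime; the square of the maximal
      -- ideal fills both places.
      rw [Ideal.subset_union_prime_finite (f := id)
        ((minimalPrimes.finite_of_isNoetherianRing R).insert _) (maximalIdeal R ^ 2)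
        (maximalIdeal R ^ 2)] at hsub
      · obtain ⟨I, hI, hle⟩ := hsub
        rcases hI with rfl | hI
        · exact hm2 hle
        · have : I.IsPrime := hI.1.1
          have : I = maximalIdeal R := le_antisymm (IsLocalRing.le_maximalIdeal this.ne_top) hle
          exact hmin (this ▸ hI)
      · rintro I (rfl | hI) h1 -
        · exact absurd rfl h1
        · exact hI.1.1
    simp only [Set.mem_insert_iff, Set.iUnion_iUnion_eq_or_left, Set.mem_union, not_or,
      Set.mem_iUnion, not_exists, SetLike.mem_coe] at hxn
    obtain ⟨hx2, hxp⟩ := hxn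
    obtain ⟨hreg, hle⟩ := isRegularLocalRing_quotient_span_singleton hx hx2
    have := ih (R ⧸ Ideal.span {x}) (by have := hle; omega)
    have hprime : (Ideal.span {x}).IsPrime := (Ideal.Quotient.isDomain_iff_prime _).mp this
    obtain ⟨p, hp, hpx⟩ := Ideal.exists_minimalPrimes_le (bot_le : ⊥ ≤ Ideal.span {x})
    have hpp : p.IsPrime := hp.1.1
    have hxp' : x ∉ p := fun h => hxp p hp h
    have : p = ⊥ := by
      refine Submodule.eq_bot_of_le_smul_of_le_jacobson_bot (maximalIdeal R) _
        (IsNoetherian.noetherian _) ?_ hjac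
      intro y hy
      obtain ⟨z, rfl⟩ := Ideal.mem_span_singleton'.mp (hpx hy)
      rw [mul_comm]
      exact Submodule.smul_mem_smul hx ((hpp.mem_or_mem hy).resolve_right hxp')
    subst this
    exact IsDomain.of_bot_isPrime R

theorem IsRegularLocalRing.isDomain (R : Type*) [CommRing R] [IsRegularLocalRing R] : IsDomain R :=
  isDomain_aux _ R le_rfl

end

/-! ### Finite projective dimension over regular rings. -/

section

universe u

open IsLocalRing CategoryTheory
open scoped Pointwise

/-- The change of rings `R → R / x` for projective dimensions, over a local ring. -/
theorem hasProjectiveDimensionLE_of_quotSMulTop (n : ℕ) {R : Type u} [CommRing R] [IsLocalRing R]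
    [IsNoetherianRing R] {x : R} (hx : x ∈ maximalIdeal R) (hxR : x ∈ nonZeroDivisors R) :
    ∀ (M : Type u) [AddCommGroup M] [Module R M] [Module.Finite R M], IsSMulRegular M x →
      HasProjectiveDimensionLE (ModuleCat.of (R ⧸ Ideal.span {x}) (QuotSMulTop x M)) n →
      HasProjectiveDimensionLE (ModuleCat.of R M) n := by
  induction n with
  | zero =>
    intro M _ _ _ hreg h
    have hjac : x ∈ (⊥ : Ideal R).jacobson :=
      (IsLocalRing.jacobson_eq_maximalIdeal _ bot_ne_top).ge hx
    have hne : Ideal.span {x} ≠ ⊤ := fun h =>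
      Ideal.IsPrime.ne_top' (I := maximalIdeal R)
        (top_le_iff.mp (h ▸ (Ideal.span_singleton_le_iff_mem _).mpr hx))
    have : Nontrivial (R ⧸ Ideal.span {x}) := Ideal.Quotient.nontrivial_iff.mpr hne
    have : IsLocalRing (R ⧸ Ideal.span {x}) :=
      .of_surjective' (Ideal.Quotient.mk _) Ideal.Quotient.mk_surjective
    have : Module.FinitePresentation R M := Module.finitePresentation_of_finite R M
    rw [← projective_iff_hasProjectiveDimensionLE_zero, ← IsProjective.iff_projective] at h ⊢
    have : Module.Finite (R ⧸ Ideal.span {x}) (QuotSMulTop x M) :=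
      Module.Finite.of_restrictScalars_finite R _ _
    -- Over a local ring projective means free here, and freeness of `M / x M` lifts to `M` because
    -- `x` is regular on `M` and lies in the Jacobson radical.
    have : Module.Free (R ⧸ Ideal.span {x}) (QuotSMulTop x M) :=
      Module.free_of_flat_of_isLocalRing
    have := (Module.free_quotSMulTop_iff_free R M hjac hreg).mp this
    infer_instance
  | succ n ih =>
    intro M _ _ _ hreg h
    obtain ⟨F, _, _, _, _, g, hg⟩ := Module.exists_finite_presentation R M
    have hS := LinearMap.shortExact_shortComplexKer hg
    have hF : IsSMulRegular F x := Module.Flat.isSMulRegular_of_nonZeroDivisors hxR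
    have hKreg : IsSMulRegular (LinearMap.ker g) x := hF.submodule _ _
    have hP : Projective (ModuleCat.of R F) :=
      ModuleCat.projective_of_categoryTheory_projective _
    refine (hS.hasProjectiveDimensionLT_X₃_iff n hP).mpr (ih _ hKreg ?_)
    -- Since `x` is regular on `M`, the relevant `Tor` vanishes and the syzygy sequence stays exact
    -- modulo `x`; projective dimensions over both rings are then shifted along the same sequence.
    have hinj : Function.Injective (QuotSMulTop.map x (LinearMap.ker g).subtype) := by
      have h1 : Function.Exact (0 : PUnit →ₗ[R] LinearMap.ker g) (LinearMap.ker g).subtype := by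
        rw [LinearMap.exact_iff]; simp
      have h2 := QuotSMulTop.map_first_exact_on_four_term_exact_of_isSMulRegular_last h1
        g.exact_subtype_ker_map hreg
      rw [map_zero] at h2
      rw [injective_iff_map_eq_zero]
      intro a ha
      obtain ⟨b, rfl⟩ := (h2 a).mp ha
      rfl
    have hsurj := QuotSMulTop.map_surjective x hg
    have hex := QuotSMulTop.map_exact x g.exact_subtype_ker_map hg
    obtain ⟨φ, hφ⟩ : ∃ φ : QuotSMulTop x (LinearMap.ker g) →ₗ[R ⧸ Ideal.span {x}] QuotSMulTop x F,
        ⇑φ = QuotSMulTop.map x (LinearMap.ker g).subtype :=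
      ⟨(QuotSMulTop.map x (LinearMap.ker g).subtype).extendScalarsOfSurjective
        Ideal.Quotient.mk_surjective, rfl⟩
    obtain ⟨ψ, hψ⟩ : ∃ ψ : QuotSMulTop x F →ₗ[R ⧸ Ideal.span {x}] QuotSMulTop x M,
        ⇑ψ = QuotSMulTop.map x g :=
      ⟨(QuotSMulTop.map x g).extendScalarsOfSurjective Ideal.Quotient.mk_surjective, rfl⟩
    rw [← hφ] at hinj hex
    rw [← hψ] at hsurj hex
    have hS' := ModuleCat.shortComplex_shortExact (ModuleCat.shortComplexOfCompEqZero φ ψ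
      (LinearMap.ext hex.apply_apply_eq_zero)) hex hinj hsurj
    have hP' : Projective (ModuleCat.of (R ⧸ Ideal.span {x}) (QuotSMulTop x F)) :=
      ModuleCat.projective_of_categoryTheory_projective _
    exact (hS'.hasProjectiveDimensionLT_X₃_iff n hP').mp h

/-- The global dimension of a regular local ring is finite. -/
theorem IsRegularLocalRing.hasProjectiveDimensionLE (n : ℕ) : ∀ (R : Type u) [CommRing R]
    [IsRegularLocalRing R], (maximalIdeal R).spanFinrank ≤ n →
    ∀ (M : Type u) [AddCommGroup M] [Module R M] [Module.Finite R M],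
      HasProjectiveDimensionLE (ModuleCat.of R M) n := by
  induction n with
  | zero =>
    intro R _ _ h M _ _ _
    have : maximalIdeal R = ⊥ := (Submodule.spanFinrank_eq_zero_iff_eq_bot
      (maximalIdeal R).fg_of_isNoetherianRing).mp (Nat.le_zero.mp h)
    have hfield := IsLocalRing.isField_iff_maximalIdeal_eq.mpr this
    rw [← projective_iff_hasProjectiveDimensionLE_zero, ← IsProjective.iff_projective]
    let := hfield.toField
    exact Module.Projective.of_free (R := R)
  | succ n ih =>
    intro R _ _ h M _ _ _
    by_cases hm : maximalIdeal R = ⊥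
    · have hfield := IsLocalRing.isField_iff_maximalIdeal_eq.mpr hm
      have : HasProjectiveDimensionLE (ModuleCat.of R M) 0 := by
        rw [← projective_iff_hasProjectiveDimensionLE_zero, ← IsProjective.iff_projective]
        let := hfield.toField
        exact Module.Projective.of_free (R := R)
      exact hasProjectiveDimensionLT_of_ge _ 1 _ (by omega)
    have := IsRegularLocalRing.isDomain R
    have hjac : maximalIdeal R ≤ (⊥ : Ideal R).jacobson :=
      (IsLocalRing.jacobson_eq_maximalIdeal _ bot_ne_top).ge
    have hm2 : ¬ maximalIdeal R ≤ maximalIdeal R ^ 2 := by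
      intro hle
      apply hm
      refine Submodule.eq_bot_of_le_smul_of_le_jacobson_bot (maximalIdeal R) _
        (IsNoetherian.noetherian _) ?_ hjac
      rwa [smul_eq_mul, ← pow_two]
    obtain ⟨x, hx, hx2⟩ := SetLike.not_le_iff_exists.mp hm2
    obtain ⟨hreg, hle⟩ := isRegularLocalRing_quotient_span_singleton hx hx2
    have hx0 : x ≠ 0 := by rintro rfl; exact hx2 (zero_mem _)
    have hxR : x ∈ nonZeroDivisors R := mem_nonZeroDivisors_of_ne_zero hx0
    obtain ⟨F, _, _, _, _, g, hg⟩ := Module.exists_finite_presentation R M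
    have hP : Projective (ModuleCat.of R F) :=
      ModuleCat.projective_of_categoryTheory_projective _
    have hF : IsSMulRegular F x := Module.Flat.isSMulRegular_of_nonZeroDivisors hxR
    refine ((LinearMap.shortExact_shortComplexKer hg).hasProjectiveDimensionLT_X₃_iff n hP).mpr ?_
    -- `x` may be a zero divisor on `M`, but it is regular on the syzygy, a submodule of a
    -- projective module. So the change of rings is applied to the syzygy, and the step from the
    -- syzygy to `M` accounts for the extra one in `n + 1`.
    refine hasProjectiveDimensionLE_of_quotSMulTop n hx hxR (LinearMap.ker g) (hF.submodule _ _) ?_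
    have : Module.Finite (R ⧸ Ideal.span {x}) (QuotSMulTop x (LinearMap.ker g)) :=
      Module.Finite.of_restrictScalars_finite R _ _
    exact ih (R ⧸ Ideal.span {x}) (by have := hle; omega) _

theorem finite_localizedModule {R : Type u} [CommRing R] (M : ModuleCat.{u} R) [Module.Finite R M]
    (p : PrimeSpectrum R) :
    Module.Finite (Localization.AtPrime p.asIdeal) (M.localizedModule p.1.primeCompl) :=
  have : IsLocalizedModule p.1.primeCompl (M.localizedModuleMkLinearMap p.1.primeCompl) :=
    inferInstance
  Module.Finite.of_isLocalizedModule p.1.primeCompl (M.localizedModuleMkLinearMap p.1.primeCompl)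

/-- For `n = 0` this is the openness of the free locus. Localization is exact and preserves
projectives, so the locus of `M` for `n + 1` is the locus of its first syzygy for `n`. -/
theorem isOpen_setOf_hasProjectiveDimensionLE {R : Type u} [CommRing R] [IsNoetherianRing R]
    (n : ℕ) : ∀ (M : ModuleCat.{u} R) [Module.Finite R M],
    IsOpen {p : PrimeSpectrum R | HasProjectiveDimensionLE (M.localizedModule p.1.primeCompl) n} := by
  induction n with
  | zero =>
    intro M _
    have : Module.FinitePresentation R M := Module.finitePresentation_of_finite R M
    convert Module.isOpen_freeLocus (R := R) (M := M) using 1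
    ext p
    have : IsLocalizedModule p.1.primeCompl (M.localizedModuleMkLinearMap p.1.primeCompl) :=
      inferInstance
    have hmem := Module.mem_freeLocus_of_isLocalization p (Localization.AtPrime p.asIdeal)
      (M.localizedModule p.1.primeCompl) (M.localizedModuleMkLinearMap p.1.primeCompl)
    rw [hmem, Set.mem_ofPred_eq,
      ← projective_iff_hasProjectiveDimensionLE_zero, ← IsProjective.iff_projective]
    have := finite_localizedModule M p
    exact ⟨fun _ => Module.free_of_flat_of_isLocalRing,
      fun h : Module.Free _ _ => @Module.Projective.of_free _ _ _ _ _ h⟩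
  | succ n ih =>
    intro M _
    obtain ⟨P, _, _, _, _, f, surjf⟩ := Module.exists_finite_presentation R M
    let S := f.shortComplexKer
    have S_exact := LinearMap.shortExact_shortComplexKer surjf
    have proj := ModuleCat.projective_of_categoryTheory_projective S.X₂
    convert ih (ModuleCat.of R (LinearMap.ker f)) using 1
    ext p
    let Sp := S.map (ModuleCat.localizedModuleFunctor p.1.primeCompl)
    have Sp_exact : Sp.ShortExact :=
      S_exact.map_of_exact (ModuleCat.localizedModuleFunctor p.asIdeal.primeCompl)
    have projp : Projective Sp.X₂ :=
      (ModuleCat.localizedModuleFunctor.{u} p.1.primeCompl).projective_obj_of_projective proj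
    exact Sp_exact.hasProjectiveDimensionLT_X₃_iff n projp

/-- A finitely generated module over a regular ring has finite projective dimension. -/
theorem IsRegularRing.exists_hasProjectiveDimensionLE {R : Type u} [CommRing R] [IsRegularRing R]
    (M : Type u) [AddCommGroup M] [Module R M] [Module.Finite R M] :
    ∃ n, HasProjectiveDimensionLE (ModuleCat.of R M) n := by
  let U : ℕ → Set (PrimeSpectrum R) := fun n =>
    {p | HasProjectiveDimensionLE ((ModuleCat.of R M).localizedModule p.1.primeCompl) n}
  -- The sets `U n` are open and increasing, and they cover because each localization is a regular
  -- local ring; quasi-compactness of the spectrum gives one bound for all primes.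
  obtain ⟨n, hn⟩ := isCompact_univ.elim_directed_cover U
    (fun n => isOpen_setOf_hasProjectiveDimensionLE n _) (by
      intro p _
      have := finite_localizedModule (ModuleCat.of R M) p
      exact Set.mem_iUnion.mpr ⟨_, IsRegularLocalRing.hasProjectiveDimensionLE _
        (Localization.AtPrime p.asIdeal) le_rfl _⟩)
    (directed_of_isDirected_le fun m n hmn p (hp : HasProjectiveDimensionLE _ m) =>
      hasProjectiveDimensionLT_of_ge _ (m + 1) _ (by omega))
  exact ⟨n, (ModuleCat.hasProjectiveDimensionLE_iff_forall_primeSpectrum n _).mpr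
    fun p => hn (Set.mem_univ p)⟩

end

namespace CyclicAdams

universe u v w

/-! ## Modules over the ring of operators -/

/-- The operators on a graded module with a differential: the projections onto the homogeneous
components, the differential, and the multiplication by the Koszul generator. -/
inductive Gen
  | e (i : ℤ)
  | d
  | s

/-- The free `Q`-algebra on the operators. -/
abbrev Op (Q : Type u) [CommRing Q] := FreeAlgebra Q Gen

section Op

variable (Q : Type u) [CommRing Q]

/-- The projection onto the component of degree `i`. -/
def opE (i : ℤ) : Op Q := FreeAlgebra.ι Q (.e i)

/-- The differential. -/
def opD : Op Q := FreeAlgebra.ι Q .d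

/-- The multiplication by the Koszul generator. -/
def opS : Op Q := FreeAlgebra.ι Q .s

variable {Q} {M N : Type*} [AddCommGroup M] [Module Q M] [Module (Op Q) M]
  [IsScalarTower Q (Op Q) M] [AddCommGroup N] [Module Q N] [Module (Op Q) N]
  [IsScalarTower Q (Op Q) N]

theorem op_induction {C : Op Q → Prop} (hr : ∀ r : Q, C (algebraMap Q (Op Q) r))
    (he : ∀ i, C (opE Q i)) (hd : C (opD Q)) (hs : C (opS Q)) (hm : ∀ a b, C a → C b → C (a * b))
    (ha : ∀ a b, C a → C b → C (a + b)) (a : Op Q) : C a :=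
  FreeAlgebra.induction Q Gen hr (fun t => by cases t; exacts [he _, hd, hs]) hm ha a

/-- A `Q`-linear map that commutes with the operators. -/
def homOfCommute (g : M →ₗ[Q] N) (he : ∀ i x, g (opE Q i • x) = opE Q i • g x)
    (hd : ∀ x, g (opD Q • x) = opD Q • g x) (hs : ∀ x, g (opS Q • x) = opS Q • g x) :
    M →ₗ[Op Q] N where
  toFun := g
  map_add' := map_add g
  map_smul' a := by
    induction a using op_induction with
    | hr r => intro x; simp [algebraMap_smul]
    | he i => exact he i
    | hd => exact hd
    | hs => exact hs
    | hm a b h1 h2 => intro x; simp only [RingHom.id_apply] at *; rw [mul_smul, h1, h2, mul_smul]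
    | ha a b h1 h2 => intro x; simp only [RingHom.id_apply] at *; rw [add_smul, map_add, h1, h2, add_smul]

/-- A `Q`-submodule that is stable under the operators. -/
def subOfStable (L : Submodule Q M) (he : ∀ i, ∀ x ∈ L, opE Q i • x ∈ L)
    (hd : ∀ x ∈ L, opD Q • x ∈ L) (hs : ∀ x ∈ L, opS Q • x ∈ L) : Submodule (Op Q) M where
  carrier := L
  add_mem' := L.add_mem
  zero_mem' := L.zero_mem
  smul_mem' a := by
    induction a using op_induction with
    | hr r => intro x hx; rw [algebraMap_smul]; exact L.smul_mem r hx
    | he i => intro x hx; exact he i x hx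
    | hd => intro x hx; exact hd x hx
    | hs => intro x hx; exact hs x hx
    | hm a b h1 h2 => intro x hx; rw [mul_smul]; exact h1 (h2 hx)
    | ha a b h1 h2 => intro x hx; rw [add_smul]; exact L.add_mem (h1 hx) (h2 hx)

@[simp] theorem mem_subOfStable {L : Submodule Q M} {he hd hs} {x : M} :
    x ∈ subOfStable L he hd hs ↔ x ∈ L := Iff.rfl

/-- The laws of a bounded graded module with a differential of degree `-1` and an operator of
degree `1`. -/
structure IsGraded (Q : Type u) [CommRing Q] (M : Type*) [AddCommGroup M] [Module (Op Q) M] :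
    Prop where
  e_e : ∀ i (x : M), opE Q i • opE Q i • x = opE Q i • x
  e_ne : ∀ i j, i ≠ j → ∀ x : M, opE Q i • opE Q j • x = 0
  bdd : ∃ S : Finset ℤ, (∀ i, i ∉ S → ∀ x : M, opE Q i • x = 0) ∧
    ∀ x : M, ∑ i ∈ S, opE Q i • x = x
  d_e : ∀ i (x : M), opD Q • opE Q i • x = opE Q (i - 1) • opD Q • x
  s_e : ∀ i (x : M), opS Q • opE Q i • x = opE Q (i + 1) • opS Q • x
  d_d : ∀ x : M, opD Q • opD Q • x = 0

section IsGraded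

variable {M N : Type*} [AddCommGroup M] [Module (Op Q) M] [AddCommGroup N] [Module (Op Q) N]

theorem IsGraded.of_injective (h : IsGraded Q N) (g : M →ₗ[Op Q] N) (hg : Function.Injective g) :
    IsGraded Q M where
  e_e i x := hg (by simp only [map_smul, h.e_e])
  e_ne i j hij x := hg (by simp only [map_smul, h.e_ne i j hij, map_zero])
  bdd := by
    obtain ⟨S, h1, h2⟩ := h.bdd
    exact ⟨S, fun i hi x => hg (by rw [map_smul, h1 i hi, map_zero]),
      fun x => hg (by rw [map_sum]; simp only [map_smul, h2])⟩
  d_e i x := hg (by simp only [map_smul, h.d_e])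
  s_e i x := hg (by simp only [map_smul, h.s_e])
  d_d x := hg (by simp only [map_smul, h.d_d, map_zero])

theorem IsGraded.of_surjective (h : IsGraded Q M) (g : M →ₗ[Op Q] N) (hg : Function.Surjective g) :
    IsGraded Q N where
  e_e i := hg.forall.mpr fun x => by simp only [← map_smul, h.e_e]
  e_ne i j hij := hg.forall.mpr fun x => by simp only [← map_smul, h.e_ne i j hij, map_zero]
  bdd := by
    obtain ⟨S, h1, h2⟩ := h.bdd
    exact ⟨S, fun i hi => hg.forall.mpr fun x => by rw [← map_smul, h1 i hi, map_zero],
      hg.forall.mpr fun x => by simp only [← map_smul, ← map_sum, h2]⟩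
  d_e i := hg.forall.mpr fun x => by simp only [← map_smul, h.d_e]
  s_e i := hg.forall.mpr fun x => by simp only [← map_smul, h.s_e]
  d_d := hg.forall.mpr fun x => by simp only [← map_smul, h.d_d, map_zero]

theorem IsGraded.prod (h : IsGraded Q M) (h' : IsGraded Q N) : IsGraded Q (M × N) where
  e_e i x := Prod.ext (h.e_e i _) (h'.e_e i _)
  e_ne i j hij x := Prod.ext (h.e_ne i j hij _) (h'.e_ne i j hij _)
  bdd := by
    classical
    obtain ⟨S, h1, h2⟩ := h.bdd
    obtain ⟨S', h1', h2'⟩ := h'.bdd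
    refine ⟨S ∪ S', fun i hi x => ?_, fun x => ?_⟩
    · simp only [Finset.mem_union, not_or] at hi
      exact Prod.ext (h1 i hi.1 _) (h1' i hi.2 _)
    · apply Prod.ext
      · rw [Prod.fst_sum]
        exact (Finset.sum_subset Finset.subset_union_left fun i _ hi => h1 i hi _).symm.trans
          (h2 x.1)
      · rw [Prod.snd_sum]
        exact (Finset.sum_subset Finset.subset_union_right fun i _ hi => h1' i hi _).symm.trans
          (h2' x.2)
  d_e i x := Prod.ext (h.d_e i _) (h'.d_e i _)
  s_e i x := Prod.ext (h.s_e i _) (h'.s_e i _)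
  d_d x := Prod.ext (h.d_d _) (h'.d_d _)

end IsGraded

end Op

/-- A finitely generated bounded graded `Q`-module with operators `d` and `s` of degrees `-1` and
`1`, where `d ^ 2 = 0`. -/
structure Obj (Q : Type u) [CommRing Q] where
  carrier : Type u
  [addCommGroup : AddCommGroup carrier]
  [module : Module Q carrier]
  [opModule : Module (Op Q) carrier]
  [tower : IsScalarTower Q (Op Q) carrier]
  [finite : Module.Finite Q carrier]
  isGraded : IsGraded Q carrier

attribute [instance] Obj.addCommGroup Obj.module Obj.opModule Obj.tower Obj.finite

namespace Obj

variable {Q : Type u} [CommRing Q]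

instance : CoeSort (Obj Q) (Type u) := ⟨Obj.carrier⟩

/-- The zero object. -/
abbrev zero (Q : Type u) [CommRing Q] : Obj Q where
  carrier := PUnit
  isGraded := ⟨fun _ _ => rfl, fun _ _ _ _ => rfl, ⟨∅, fun _ _ _ => rfl, fun _ => rfl⟩,
    fun _ _ => rfl, fun _ _ => rfl, fun _ => rfl⟩

/-- The direct sum. -/
abbrev prod (M N : Obj Q) : Obj Q where
  carrier := M × N
  isGraded := M.isGraded.prod N.isGraded

/-- The quotient by a submodule stable under the operators. -/
abbrev quot (M : Obj Q) (L : Submodule (Op Q) M) : Obj Q where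
  carrier := M ⧸ L
  finite := Module.Finite.of_surjective ((L.mkQ).restrictScalars Q) L.mkQ_surjective
  isGraded := M.isGraded.of_surjective L.mkQ L.mkQ_surjective

/-- A submodule stable under the operators. -/
abbrev sub [IsNoetherianRing Q] (M : Obj Q) (L : Submodule (Op Q) M) : Obj Q where
  carrier := L
  finite := Module.Finite.of_injective (L.subtype.restrictScalars Q) L.injective_subtype
  isGraded := M.isGraded.of_injective L.subtype L.injective_subtype

/-- The representation of the ring of operators attached to a family of operators. -/
noncomputable def opsHom {A : Type u} [AddCommGroup A] [Module Q A] (e : ℤ → Module.End Q A)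
    (d s : Module.End Q A) : Op Q →ₐ[Q] Module.End Q A :=
  FreeAlgebra.lift Q fun
    | .e i => e i
    | .d => d
    | .s => s

section opsHom

variable {A : Type u} [AddCommGroup A] [Module Q A] (e : ℤ → Module.End Q A)
  (d s : Module.End Q A)

theorem opsHom_e (i : ℤ) : opsHom e d s (opE Q i) = e i := FreeAlgebra.lift_ι_apply _ _

theorem opsHom_d : opsHom e d s (opD Q) = d := FreeAlgebra.lift_ι_apply _ _

theorem opsHom_s : opsHom e d s (opS Q) = s := FreeAlgebra.lift_ι_apply _ _

end opsHom

/-- The object attached to a family of operators. -/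
noncomputable def ofOps (A : Type u) [AddCommGroup A] [Module Q A] [Module.Finite Q A]
    (e : ℤ → Module.End Q A)
    (d s : Module.End Q A) (e_e : ∀ i, e i * e i = e i) (e_ne : ∀ i j, i ≠ j → e i * e j = 0)
    (bdd : ∃ S : Finset ℤ, (∀ i, i ∉ S → e i = 0) ∧ ∑ i ∈ S, e i = 1)
    (d_e : ∀ i, d * e i = e (i - 1) * d) (s_e : ∀ i, s * e i = e (i + 1) * s) (d_d : d * d = 0) :
    Obj Q :=
  letI : Module (Op Q) A := Module.compHom A (opsHom e d s).toRingHom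
  have hE (i) (x : A) : opE Q i • x = e i x := LinearMap.congr_fun (opsHom_e e d s i) x
  have hD (x : A) : opD Q • x = d x := LinearMap.congr_fun (opsHom_d e d s) x
  have hS (x : A) : opS Q • x = s x := LinearMap.congr_fun (opsHom_s e d s) x
  { carrier := A
    tower := ⟨fun r a x => by
      change opsHom e d s (r • a) x = r • opsHom e d s a x
      rw [map_smul]; rfl⟩
    isGraded :=
      { e_e := fun i x => by simp only [hE]; exact LinearMap.congr_fun (e_e i) x
        e_ne := fun i j hij x => by simp only [hE]; exact LinearMap.congr_fun (e_ne i j hij) x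
        bdd := by
          obtain ⟨S, h1, h2⟩ := bdd
          refine ⟨S, fun i hi x => by rw [hE, h1 i hi]; rfl, fun x => ?_⟩
          have := LinearMap.congr_fun h2 x
          rw [LinearMap.sum_apply] at this
          simp only [hE]
          exact this
        d_e := fun i x => by simp only [hE, hD]; exact LinearMap.congr_fun (d_e i) x
        s_e := fun i x => by simp only [hE, hS]; exact LinearMap.congr_fun (s_e i) x
        d_d := fun x => by simp only [hD]; exact LinearMap.congr_fun d_d x } }

section ofOps

variable {A : Type u} [AddCommGroup A] [Module Q A] [Module.Finite Q A] {e : ℤ → Module.End Q A}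
  {d s : Module.End Q A} {h1 : ∀ i, e i * e i = e i} {h2 : ∀ i j, i ≠ j → e i * e j = 0}
  {h3 : ∃ S : Finset ℤ, (∀ i, i ∉ S → e i = 0) ∧ ∑ i ∈ S, e i = 1}
  {h4 : ∀ i, d * e i = e (i - 1) * d} {h5 : ∀ i, s * e i = e (i + 1) * s} {h6 : d * d = 0}

theorem ofOps_e (i : ℤ) (x : ofOps A e d s h1 h2 h3 h4 h5 h6) : opE Q i • x = e i x :=
  DFunLike.congr_fun (opsHom_e e d s i) (x : A)

theorem ofOps_d (x : ofOps A e d s h1 h2 h3 h4 h5 h6) : opD Q • x = d x :=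
  DFunLike.congr_fun (opsHom_d e d s) (x : A)

theorem ofOps_s (x : ofOps A e d s h1 h2 h3 h4 h5 h6) : opS Q • x = s x :=
  DFunLike.congr_fun (opsHom_s e d s) (x : A)

end ofOps

/-- The action of an operator, as a `Q`-linear map. -/
def act (M : Obj Q) (a : Op Q) : Module.End Q M where
  toFun x := a • x
  map_add' := smul_add a
  map_smul' r x := smul_comm a r x

@[simp] theorem act_apply (M : Obj Q) (a : Op Q) (x : M) : M.act a x = a • x := rfl

/-- The object with the same projections and differential, and with `s = 0`. -/
noncomputable def forgetS (M : Obj Q) : Obj Q :=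
  ofOps M.carrier (fun i => M.act (opE Q i)) (M.act (opD Q)) 0
    (fun i => LinearMap.ext fun x => M.isGraded.e_e i x)
    (fun i j h => LinearMap.ext fun x => M.isGraded.e_ne i j h x)
    (by
      obtain ⟨S, h1, h2⟩ := M.isGraded.bdd
      exact ⟨S, fun i hi => LinearMap.ext fun x => h1 i hi x,
        LinearMap.ext fun x => by rw [LinearMap.sum_apply]; exact h2 x⟩)
    (fun i => LinearMap.ext fun x => M.isGraded.d_e i x) (fun i => by rw [zero_mul, mul_zero])
    (LinearMap.ext fun x => M.isGraded.d_d x)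

/-- The homology is zero. -/
def Acyclic (M : Obj Q) : Prop := ∀ x : M, opD Q • x = 0 → ∃ y : M, opD Q • y = x

/-- The laws of a module over the Koszul algebra. -/
def IsKoszul (f : Q) (M : Obj Q) : Prop :=
  (∀ x : M, opS Q • opS Q • x = 0) ∧ ∀ x : M, opD Q • opS Q • x + opS Q • opD Q • x = f • x

/-- A complex (without `s`), with homology annihilated by a power of `f`. -/
def IsSupp (f : Q) (M : Obj Q) : Prop :=
  (∀ x : M, opS Q • x = 0) ∧ ∃ N : ℕ, ∀ x : M, opD Q • x = 0 → ∃ y : M, opD Q • y = f ^ N • x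

variable {A : Type*} [AddCommGroup A]

/-- The sequence `0 → M' → M → M'' → 0` is exact. -/
structure SES {M' M M'' : Obj Q} (i : M' →ₗ[Op Q] M) (q : M →ₗ[Op Q] M'') : Prop where
  inj : Function.Injective i
  exact : Function.Exact i q
  surj : Function.Surjective q

/-- The function `b` is additive on short exact sequences of objects in `C`. -/
def AdditiveOn (C : Obj Q → Prop) (b : Obj Q → A) : Prop :=
  ∀ ⦃M' M M'' : Obj Q⦄, C M' → C M → C M'' → ∀ (i : M' →ₗ[Op Q] M) (q : M →ₗ[Op Q] M''),
    SES i q → b M = b M' + b M''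

theorem AdditiveOn.mono {C D : Obj Q → Prop} {b : Obj Q → A} (h : AdditiveOn C b)
    (hD : ∀ M, D M → C M) : AdditiveOn D b :=
  fun _ _ _ h1 h2 h3 => h (hD _ h1) (hD _ h2) (hD _ h3)

/-- When `M` is zero, `0 → M → M → M → 0` is exact, so `b M = b M + b M`. -/
theorem AdditiveOn.map_subsingleton {C : Obj Q → Prop} {b : Obj Q → A} (h : AdditiveOn C b)
    (M : Obj Q) [Subsingleton M] (hM : C M) : b M = 0 := by
  have := h hM hM hM LinearMap.id LinearMap.id ⟨Function.injective_id,
    fun x => ⟨fun _ => ⟨x, rfl⟩, fun _ => Subsingleton.elim _ _⟩, Function.surjective_id⟩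
  simpa using this

theorem AdditiveOn.map_equiv {C : Obj Q → Prop} {b : Obj Q → A} (h : AdditiveOn C b)
    (h0 : C (zero Q)) {M N : Obj Q} (hM : C M) (hN : C N) (φ : M ≃ₗ[Op Q] N) : b M = b N := by
  have h1 := h h0 hM hN 0 φ.toLinearMap ⟨Function.injective_of_subsingleton _, fun x => by
    simp only [LinearEquiv.coe_coe, LinearEquiv.map_eq_zero_iff]
    exact ⟨fun h => ⟨0, h.symm⟩, fun ⟨_, h⟩ => h.symm⟩, φ.surjective⟩
  rw [h1, h.map_subsingleton _ h0, zero_add]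

theorem ses_ker [IsNoetherianRing Q] {M N : Obj Q} {q : M →ₗ[Op Q] N}
    (hq : Function.Surjective q) :
    SES (M' := M.sub (LinearMap.ker q)) (LinearMap.ker q).subtype q :=
  ⟨Subtype.val_injective, LinearMap.exact_subtype_ker_map q, hq⟩

theorem ses_mkQ [IsNoetherianRing Q] (M : Obj Q) (L : Submodule (Op Q) M) :
    SES (M' := M.sub L) (M'' := M.quot L) L.subtype L.mkQ :=
  ⟨Subtype.val_injective, LinearMap.exact_subtype_mkQ L, L.mkQ_surjective⟩

end Obj

end CyclicAdams

namespace CyclicAdams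

universe u v w
namespace Obj
open CategoryTheory

variable {Q : Type u} [CommRing Q]

/-! ## Resolutions -/

/-- The projective dimension over `Q` is at most `n`. -/
def PdLE (n : ℕ) (M : Obj Q) : Prop := HasProjectiveDimensionLE (ModuleCat.of Q M) n

theorem pdLE_zero {M : Obj Q} : PdLE 0 M ↔ Module.Projective Q M := by
  unfold PdLE
  rw [← projective_iff_hasProjectiveDimensionLE_zero, ← IsProjective.iff_projective]

theorem PdLE.mono {m n : ℕ} (h : m ≤ n) {M : Obj Q} (hM : PdLE m M) : PdLE n M :=
  have : HasProjectiveDimensionLT (ModuleCat.of Q M) (m + 1) := hM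
  hasProjectiveDimensionLT_of_ge _ (m + 1) (n + 1) (by omega)

section

variable {M' M M'' : Obj Q} {i : M' →ₗ[Op Q] M} {q : M →ₗ[Op Q] M''}

theorem SES.shortExact (h : SES i q) : (ModuleCat.shortComplexOfCompEqZero (i.restrictScalars Q)
    (q.restrictScalars Q) (LinearMap.ext h.exact.apply_apply_eq_zero)).ShortExact :=
  ModuleCat.shortComplex_shortExact _ h.exact h.inj h.surj

theorem PdLE.left (h : SES i q) {n : ℕ} (hM : Module.Projective Q M) (h'' : PdLE (n + 1) M'') :
    PdLE n M' :=
  (h.shortExact.hasProjectiveDimensionLT_X₃_iff n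
    (ModuleCat.projective_of_categoryTheory_projective (ModuleCat.of Q M))).mp h''

theorem PdLE.middle (h : SES i q) {n : ℕ} (h' : PdLE n M') (h'' : PdLE n M'') : PdLE n M :=
  h.shortExact.hasProjectiveDimensionLT_X₂ (n + 1) h' h''

end

variable [IsNoetherianRing Q]

/-- The class `C` of objects is closed under direct sums and kernels of surjections, and every
object of `C` is a quotient of an acyclic object of `C` that is projective over `Q`. -/
structure Resolving (C : Obj Q → Prop) : Prop where
  zero : C (zero Q)
  prod : ∀ {M N : Obj Q}, C M → C N → C (M.prod N)
  ker : ∀ {M N : Obj Q} (q : M →ₗ[Op Q] N), Function.Surjective q → C M → C N →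
    C (M.sub (LinearMap.ker q))
  cover : ∀ {M : Obj Q}, C M → ∃ P : Obj Q, C P ∧ Module.Projective Q P ∧ Acyclic P ∧
    ∃ q : P →ₗ[Op Q] M, Function.Surjective q

variable {A : Type*} [AddCommGroup A] {C : Obj Q → Prop}

/-- A projective cover and its kernel, which has smaller projective dimension, determine the value
at `M`. The bound `N` in the additivity hypotheses is kept apart from the induction variable `k` so
that the same two functions are compared throughout. -/
theorem Resolving.eq_of_pdLE (hC : Resolving C) {N : ℕ} {b₁ b₂ : Obj Q → A}
    (h₁ : AdditiveOn (fun M => C M ∧ PdLE N M) b₁) (h₂ : AdditiveOn (fun M => C M ∧ PdLE N M) b₂)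
    (h : ∀ M, C M → Module.Projective Q M → b₁ M = b₂ M) (k : ℕ) (hk : k ≤ N) :
    ∀ M, C M → PdLE k M → b₁ M = b₂ M := by
  induction k with
  | zero => exact fun M hM hp => h M hM (pdLE_zero.mp hp)
  | succ k ih =>
    intro M hM hp
    obtain ⟨P, hP, hPp, -, q, hq⟩ := hC.cover hM
    have hs := ses_ker hq
    have hK := hC.ker q hq hP hM
    have hKp := PdLE.left hs hPp hp
    have e : (C P ∧ PdLE N P) ∧ (C M ∧ PdLE N M) ∧ C (P.sub _) ∧ PdLE N (P.sub _) :=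
      ⟨⟨hP, (pdLE_zero.mpr hPp).mono (Nat.zero_le _)⟩, ⟨hM, hp.mono hk⟩, hK, hKp.mono (by omega)⟩
    have e₁ := h₁ e.2.2 e.1 e.2.1 _ _ hs
    have e₂ := h₂ e.2.2 e.1 e.2.1 _ _ hs
    rw [h P hP hPp, ih (by omega) _ hK hKp] at e₁
    exact add_left_cancel (e₁.symm.trans e₂)

/-- Schanuel's argument: the fibre product of the two covers over `M`, realized as the kernel of
`r`, is an extension of `P` by `ker q'` and also of `P'` by `ker q`. -/
theorem Resolving.sub_eq_sub (hC : Resolving C) {n : ℕ} {b : Obj Q → A}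
    (hb : AdditiveOn (fun M => C M ∧ PdLE n M) b) {M P P' : Obj Q} (hM : C M)
    (hMp : PdLE (n + 1) M) (hP : C P) (hPp : Module.Projective Q P) (hP' : C P')
    (hPp' : Module.Projective Q P') (q : P →ₗ[Op Q] M) (hq : Function.Surjective q)
    (q' : P' →ₗ[Op Q] M) (hq' : Function.Surjective q') :
    b P - b (P.sub (LinearMap.ker q)) = b P' - b (P'.sub (LinearMap.ker q')) := by
  set r : P.prod P' →ₗ[Op Q] M := q ∘ₗ LinearMap.fst _ _ _ - q' ∘ₗ LinearMap.snd _ _ _ with hr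
  have hrs : Function.Surjective r := fun m => by
    obtain ⟨x, rfl⟩ := hq m
    exact ⟨(x, 0), by simp [hr]⟩
  have hW := hC.ker r hrs (hC.prod hP hP') hM
  have hs := ses_ker hq
  have hs' := ses_ker hq'
  have s₁ : SES (M' := P'.sub (LinearMap.ker q')) (M := (P.prod P').sub (LinearMap.ker r)) (M'' := P)
      ((LinearMap.inr (Op Q) P P' ∘ₗ (LinearMap.ker q').subtype).codRestrict _ (fun x => by
        simp [hr])) (LinearMap.fst (Op Q) P P' ∘ₗ (LinearMap.ker r).subtype) := by
    refine ⟨fun x y h => ?_, ?_, fun x => ?_⟩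
    · exact Subtype.ext (congrArg (fun z => z.1.2) h)
    · rintro ⟨⟨x, y⟩, hxy⟩
      constructor
      · intro h
        change x = 0 at h
        subst h
        have hy : q' y = 0 := by simpa [hr] using hxy
        exact ⟨⟨y, hy⟩, rfl⟩
      · rintro ⟨z, h⟩
        exact (congrArg (fun z => z.1.1) h).symm
    · obtain ⟨y, hy⟩ := hq' (q x)
      exact ⟨⟨(x, y), by simp [hr, hy]⟩, rfl⟩
  have s₂ : SES (M' := P.sub (LinearMap.ker q)) (M := (P.prod P').sub (LinearMap.ker r)) (M'' := P')
      ((LinearMap.inl (Op Q) P P' ∘ₗ (LinearMap.ker q).subtype).codRestrict _ (fun x => by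
        simp [hr])) (LinearMap.snd (Op Q) P P' ∘ₗ (LinearMap.ker r).subtype) := by
    refine ⟨fun x y h => ?_, ?_, fun y => ?_⟩
    · exact Subtype.ext (congrArg (fun z => z.1.1) h)
    · rintro ⟨⟨x, y⟩, hxy⟩
      constructor
      · intro h
        change y = 0 at h
        subst h
        have hx : q x = 0 := by simpa [hr] using hxy
        exact ⟨⟨x, hx⟩, rfl⟩
      · rintro ⟨z, h⟩
        exact (congrArg (fun z => z.1.2) h).symm
    · obtain ⟨x, hx⟩ := hq (q' y)
      exact ⟨⟨(x, y), by simp [hr, hx]⟩, rfl⟩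
  have p₁ := PdLE.left hs hPp hMp
  have p₂ := PdLE.left hs' hPp' hMp
  have pP : PdLE n P := (pdLE_zero.mpr hPp).mono (Nat.zero_le _)
  have pP' : PdLE n P' := (pdLE_zero.mpr hPp').mono (Nat.zero_le _)
  have pW := PdLE.middle s₁ p₂ pP
  have e₁ := hb ⟨hC.ker q' hq' hP' hM, p₂⟩ ⟨hW, pW⟩ ⟨hP, pP⟩ _ _ s₁
  have e₂ := hb ⟨hC.ker q hq hP hM, p₁⟩ ⟨hW, pW⟩ ⟨hP', pP'⟩ _ _ s₂
  rw [sub_eq_sub_iff_add_eq_add, add_comm (b P), ← e₁, e₂, add_comm]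

/-- The value at `M` is `b P - b (ker q)` for any projective cover, which is independent of the
cover by `sub_eq_sub`. For additivity, covers `P₁` of `M'` and `P₂` of `M` give the cover `P₁ × P₂`
of `M`, while `P₂` also covers `M''`; the three kernels form a short exact sequence. -/
theorem Resolving.exists_extension_succ (hC : Resolving C) {n : ℕ} {b : Obj Q → A}
    (hb : AdditiveOn (fun M => C M ∧ PdLE n M) b) :
    ∃ b' : Obj Q → A, AdditiveOn (fun M => C M ∧ PdLE (n + 1) M) b' ∧
      ∀ M, C M → Module.Projective Q M → b' M = b M := by
  classical
  have hcov : ∀ M, ∃ x : A, C M → PdLE (n + 1) M → ∀ (P : Obj Q) (_ : C P)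
      (_ : Module.Projective Q P) (q : P →ₗ[Op Q] M) (_ : Function.Surjective q),
      x = b P - b (P.sub (LinearMap.ker q)) := by
    intro M
    by_cases hM : C M
    · obtain ⟨P, hP, hPp, -, q, hq⟩ := hC.cover hM
      exact ⟨b P - b (P.sub (LinearMap.ker q)), fun _ hMp P' hP' hPp' q' hq' =>
        hC.sub_eq_sub hb hM hMp hP hPp hP' hPp' q hq q' hq'⟩
    · exact ⟨0, fun h => absurd h hM⟩
  choose b' hb' using hcov
  refine ⟨b', ?_, ?_⟩
  · rintro M' M M'' ⟨hM', p'⟩ ⟨hM, p⟩ ⟨hM'', p''⟩ i q h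
    obtain ⟨P₁, hP₁, hPp₁, -, q₁, hq₁⟩ := hC.cover hM'
    obtain ⟨P₂, hP₂, hPp₂, -, q₂, hq₂⟩ := hC.cover hM
    have hPp : Module.Projective Q (P₁.prod P₂) :=
      inferInstanceAs (Module.Projective Q (P₁ × P₂))
    set r : P₁.prod P₂ →ₗ[Op Q] M := (i ∘ₗ q₁).coprod q₂ with hr
    have hrs : Function.Surjective r := fun m => by
      obtain ⟨y, rfl⟩ := hq₂ m
      exact ⟨(0, y), by simp [hr]⟩
    have hq₃ : Function.Surjective (q ∘ₗ q₂) := h.surj.comp hq₂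
    have hP := hC.prod hP₁ hP₂
    rw [hb' M hM p _ hP hPp r hrs, hb' M' hM' p' _ hP₁ hPp₁ q₁ hq₁,
      hb' M'' hM'' p'' _ hP₂ hPp₂ (q ∘ₗ q₂) hq₃]
    have pz : ∀ {P : Obj Q}, Module.Projective Q P → PdLE n P :=
      fun h => (pdLE_zero.mpr h).mono (Nat.zero_le _)
    have e₁ := hb ⟨hP₁, pz hPp₁⟩ ⟨hP, pz hPp⟩ ⟨hP₂, pz hPp₂⟩ (LinearMap.inl (Op Q) P₁ P₂)
      (LinearMap.snd (Op Q) P₁ P₂) ⟨LinearMap.inl_injective, .inl_snd, LinearMap.snd_surjective⟩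
    have s₂ : SES (M' := P₁.sub (LinearMap.ker q₁)) (M := (P₁.prod P₂).sub (LinearMap.ker r))
        (M'' := P₂.sub (LinearMap.ker (q ∘ₗ q₂)))
        ((LinearMap.inl (Op Q) P₁ P₂ ∘ₗ (LinearMap.ker q₁).subtype).codRestrict _ (fun x => by
          simp [hr]))
        ((LinearMap.snd (Op Q) P₁ P₂ ∘ₗ (LinearMap.ker r).subtype).codRestrict _ (by
          rintro ⟨⟨x, y⟩, hxy⟩
          have h1 : i (q₁ x) + q₂ y = 0 := by simpa [hr] using hxy
          have h2 := congrArg q h1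
          rw [map_add, h.exact.apply_apply_eq_zero, zero_add, map_zero] at h2
          exact h2)) := by
      refine ⟨fun x y h => ?_, ?_, ?_⟩
      · exact Subtype.ext (congrArg (fun z => z.1.1) h)
      · rintro ⟨⟨x, y⟩, hxy⟩
        constructor
        · intro h0
          have hy : y = 0 := congrArg Subtype.val h0
          subst hy
          have hx : q₁ x = 0 := h.inj (by simpa [hr] using hxy)
          exact ⟨⟨x, hx⟩, rfl⟩
        · rintro ⟨z, hz⟩
          exact Subtype.ext (congrArg (fun z => z.1.2) hz).symm
      · rintro ⟨y, hy⟩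
        obtain ⟨m, hm⟩ := (h.exact (q₂ y)).mp hy
        obtain ⟨x, rfl⟩ := hq₁ m
        exact ⟨⟨(-x, y), by simp [hr, hm]⟩, rfl⟩
    have e₂ := hb ⟨hC.ker q₁ hq₁ hP₁ hM', PdLE.left (ses_ker hq₁) hPp₁ p'⟩
      ⟨hC.ker r hrs hP hM, PdLE.left (ses_ker hrs) hPp p⟩
      ⟨hC.ker _ hq₃ hP₂ hM'', PdLE.left (ses_ker hq₃) hPp₂ p''⟩ _ _ s₂
    rw [e₁, e₂]
    abel
  · intro M hM hMp
    have pz : ∀ {P : Obj Q}, Module.Projective Q P → ∀ n, PdLE n P :=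
      fun h _ => (pdLE_zero.mpr h).mono (Nat.zero_le _)
    rw [hb' M hM (pz hMp _) M hM hMp LinearMap.id Function.surjective_id]
    have : Subsingleton (M.sub (LinearMap.ker (LinearMap.id : M →ₗ[Op Q] M))) :=
      ⟨fun x y => Subtype.ext (x.2.trans y.2.symm)⟩
    rw [hb.map_subsingleton _ ⟨hC.ker _ Function.surjective_id hM hM,
      PdLE.left (ses_ker Function.surjective_id) hMp (pz hMp _)⟩, sub_zero]

theorem Resolving.exists_extension_pdLE (hC : Resolving C) {c : Obj Q → A}
    (hc : AdditiveOn (fun M => C M ∧ Module.Projective Q M) c) (n : ℕ) :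
    ∃ b : Obj Q → A, AdditiveOn (fun M => C M ∧ PdLE n M) b ∧
      ∀ M, C M → Module.Projective Q M → b M = c M := by
  induction n with
  | zero => exact ⟨c, hc.mono fun M h => ⟨h.1, pdLE_zero.mp h.2⟩, fun _ _ _ => rfl⟩
  | succ n ih =>
    obtain ⟨b, h1, h2⟩ := ih
    obtain ⟨b', h3, h4⟩ := hC.exists_extension_succ h1
    exact ⟨b', h3, fun M hM hp => (h4 M hM hp).trans (h2 M hM hp)⟩

theorem exists_pdLE {Q : Type u} [CommRing Q] [IsRegularRing Q] (M : Obj Q) : ∃ n, PdLE n M :=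
  IsRegularRing.exists_hasProjectiveDimensionLE M

theorem Resolving.eq_of_projective {Q : Type u} [CommRing Q] [IsRegularRing Q] {C : Obj Q → Prop}
    (hC : Resolving C) {b₁ b₂ : Obj Q → A} (h₁ : AdditiveOn C b₁) (h₂ : AdditiveOn C b₂)
    (h : ∀ M, C M → Module.Projective Q M → b₁ M = b₂ M) (M : Obj Q) (hM : C M) :
    b₁ M = b₂ M := by
  obtain ⟨n, hn⟩ := exists_pdLE M
  exact hC.eq_of_pdLE (h₁.mono fun _ h => h.1) (h₂.mono fun _ h => h.1) h n le_rfl M hM hn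

/-- The extensions for different bounds on the projective dimension agree where both apply, so they
glue. Vanishing on acyclic objects is an induction on the projective dimension, and this is why
covers are required to be acyclic: then the kernel is acyclic too. -/
theorem Resolving.exists_extension {Q : Type u} [CommRing Q] [IsRegularRing Q] {C : Obj Q → Prop}
    (hC : Resolving C) {c : Obj Q → A}
    (hc : AdditiveOn (fun M => C M ∧ Module.Projective Q M) c)
    (h0 : ∀ M, C M → Module.Projective Q M → Acyclic M → c M = 0) :
    ∃ b : Obj Q → A, AdditiveOn C b ∧ (∀ M, C M → Module.Projective Q M → b M = c M) ∧
      ∀ M, C M → Acyclic M → b M = 0 := by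
  choose n hn using fun M : Obj Q => exists_pdLE M
  choose b hb hbc using hC.exists_extension_pdLE hc
  have key : ∀ M, C M → ∀ k, n M ≤ k → b (n M) M = b k M := fun M hM k hk =>
    hC.eq_of_pdLE (hb _) ((hb k).mono fun N h => ⟨h.1, h.2.mono hk⟩)
      (fun N h1 h2 => (hbc _ N h1 h2).trans (hbc k N h1 h2).symm) _ le_rfl M hM (hn M)
  have hadd : AdditiveOn C fun M => b (n M) M := by
    intro M' M M'' h' h h'' i q hs
    -- The chosen bounds differ for the three objects; additivity is read off at a common one.
    set k := max (n M') (max (n M) (n M''))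
    have k1 : n M' ≤ k := le_max_left _ _
    have k2 : n M ≤ k := (le_max_left _ _).trans (le_max_right _ _)
    have k3 : n M'' ≤ k := (le_max_right _ _).trans (le_max_right _ _)
    change b _ _ = b _ _ + b _ _
    rw [key M' h' k k1, key M h k k2, key M'' h'' k k3]
    exact hb k ⟨h', (hn M').mono k1⟩ ⟨h, (hn M).mono k2⟩ ⟨h'', (hn M'').mono k3⟩ i q hs
  refine ⟨_, hadd, fun M hM hp => hbc _ M hM hp, ?_⟩
  suffices ∀ k M, C M → Acyclic M → PdLE k M → b (n M) M = 0 from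
    fun M hM ha => this _ M hM ha (hn M)
  intro k
  induction k with
  | zero => exact fun M hM ha hp =>
      (hbc _ M hM (pdLE_zero.mp hp)).trans (h0 M hM (pdLE_zero.mp hp) ha)
  | succ k ih =>
    intro M hM ha hp
    obtain ⟨P, hP, hPp, hPa, q, hq⟩ := hC.cover hM
    have hs := ses_ker hq
    have hK := hC.ker q hq hP hM
    have e := hadd hK hP hM _ _ hs
    -- A cycle `x` of the kernel is `d y` with `y` in `P`. The image of `y` is a cycle of the
    -- acyclic object `M`, hence `d (q w)`, and `y - d w` is a preimage of `x` inside the kernel.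
    have hKa : Acyclic (P.sub (LinearMap.ker q)) := by
      rintro ⟨x, hx⟩ hdx
      obtain ⟨y, hy⟩ := hPa x (congrArg Subtype.val hdx)
      obtain ⟨z, hz⟩ := ha (q y) (by rw [← map_smul, hy]; exact hx)
      obtain ⟨w, rfl⟩ := hq z
      refine ⟨⟨y - opD Q • w, ?_⟩, Subtype.ext ?_⟩
      · rw [LinearMap.mem_ker, map_sub, map_smul, hz, sub_self]
      · change opD Q • (y - opD Q • w) = x
        rw [smul_sub, P.isGraded.d_d, sub_zero, hy]
    have e1 := ih _ hK hKa (PdLE.left hs hPp hp)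
    have e2 := (hbc (n P) P hP hPp).trans (h0 P hP hPp hPa)
    change b _ _ = b _ _ + b _ _ at e
    rw [e1, e2, zero_add] at e
    exact e.symm

end Obj
end CyclicAdams

namespace CyclicAdams

universe u v w
namespace Obj

variable {Q : Type u} [CommRing Q]

/-! ## Covers by acyclic projective objects -/

/-- A bounded grading of a module, by projections. -/
structure IsGrading {F : Type u} [AddCommGroup F] [Module Q F] (e : ℤ → Module.End Q F) : Prop where
  e_e : ∀ i x, e i (e i x) = e i x
  e_ne : ∀ i j, i ≠ j → ∀ x, e i (e j x) = 0
  bdd : ∃ S : Finset ℤ, (∀ i, i ∉ S → ∀ x, e i x = 0) ∧ ∀ x, ∑ i ∈ S, e i x = x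

theorem IsGrading.shift {F : Type u} [AddCommGroup F] [Module Q F] {e : ℤ → Module.End Q F}
    (h : IsGrading e) (k : ℤ) : IsGrading fun i => e (i + k) where
  e_e i := h.e_e _
  e_ne i j hij := h.e_ne _ _ fun h' => hij (add_right_cancel h')
  bdd := by
    obtain ⟨S, h1, h2⟩ := h.bdd
    refine ⟨S.map (Equiv.subRight k).toEmbedding, fun i hi => h1 _ fun h' => hi ?_, fun x => ?_⟩
    · exact Finset.mem_map.mpr ⟨_, h', by simp⟩
    · rw [Finset.sum_map]
      simpa using h2 x

theorem IsGrading.prodMap {F G : Type u} [AddCommGroup F] [Module Q F] [AddCommGroup G]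
    [Module Q G] {e : ℤ → Module.End Q F} {e' : ℤ → Module.End Q G} (h : IsGrading e)
    (h' : IsGrading e') : IsGrading fun i => (e i).prodMap (e' i) where
  e_e i x := Prod.ext (h.e_e i _) (h'.e_e i _)
  e_ne i j hij x := Prod.ext (h.e_ne i j hij _) (h'.e_ne i j hij _)
  bdd := by
    classical
    obtain ⟨S, h1, h2⟩ := h.bdd
    obtain ⟨S', h1', h2'⟩ := h'.bdd
    refine ⟨S ∪ S', fun i hi x => ?_, fun x => ?_⟩
    · simp only [Finset.mem_union, not_or] at hi
      exact Prod.ext (h1 i hi.1 _) (h1' i hi.2 _)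
    · apply Prod.ext
      · rw [Prod.fst_sum]
        exact (Finset.sum_subset Finset.subset_union_left fun i _ hi => h1 i hi _).symm.trans
          (h2 x.1)
      · rw [Prod.snd_sum]
        exact (Finset.sum_subset Finset.subset_union_right fun i _ hi => h1' i hi _).symm.trans
          (h2' x.2)

theorem exists_of_isGrading {F : Type u} [AddCommGroup F] [Module Q F] [Module.Finite Q F]
    {e : ℤ → Module.End Q F} (h : IsGrading e) (d s : Module.End Q F)
    (d_e : ∀ i x, d (e i x) = e (i - 1) (d x)) (s_e : ∀ i x, s (e i x) = e (i + 1) (s x))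
    (d_d : ∀ x, d (d x) = 0) : ∃ (P : Obj Q) (φ : P ≃ₗ[Q] F),
      (∀ i x, φ (opE Q i • x) = e i (φ x)) ∧ (∀ x, φ (opD Q • x) = d (φ x)) ∧
      ∀ x, φ (opS Q • x) = s (φ x) :=
  ⟨ofOps F e d s (fun i => LinearMap.ext (h.e_e i))
    (fun i j hij => LinearMap.ext (h.e_ne i j hij))
    (by
      obtain ⟨S, h1, h2⟩ := h.bdd
      exact ⟨S, fun i hi => LinearMap.ext (h1 i hi), LinearMap.ext fun x => by
        rw [LinearMap.sum_apply]; exact h2 x⟩)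
    (fun i => LinearMap.ext (d_e i)) (fun i => LinearMap.ext (s_e i)) (LinearMap.ext d_d),
    LinearEquiv.refl Q F, fun _ _ => ofOps_e _ _, fun _ => ofOps_d _, fun _ => ofOps_s _⟩

theorem map_smul' {M N : Obj Q} (g : M →ₗ[Op Q] N) (r : Q) (x : M) : g (r • x) = r • g x :=
  g.map_smul_of_tower r x

theorem isGrading (M : Obj Q) : IsGrading fun i => M.act (opE Q i) :=
  ⟨M.isGraded.e_e, M.isGraded.e_ne, M.isGraded.bdd⟩

/-- One copy of `Q ^ n` is taken for each degree `j` in the support, mapping to `M` by the degree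
`j` components of `n` generators. -/
theorem exists_graded_cover (M : Obj Q) : ∃ (F : Type u) (_ : AddCommGroup F) (_ : Module Q F)
    (_ : Module.Finite Q F) (_ : Module.Projective Q F) (e : ℤ → Module.End Q F)
    (q : F →ₗ[Q] M), IsGrading e ∧ (∀ i x, q (e i x) = opE Q i • q x) ∧ Function.Surjective q := by
  classical
  obtain ⟨S, h1, h2⟩ := M.isGraded.bdd
  obtain ⟨n, g, hg⟩ := Module.Finite.exists_fin' Q M
  refine ⟨S → Fin n → Q, inferInstance, inferInstance, inferInstance, inferInstance,
    fun i => LinearMap.pi fun j => if (j : ℤ) = i then LinearMap.proj j else 0,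
    ∑ j : S, M.act (opE Q j) ∘ₗ g ∘ₗ LinearMap.proj j, ⟨?_, ?_, S, ?_, ?_⟩, ?_, ?_⟩
  · intro i x
    funext j
    by_cases h : (j : ℤ) = i <;> simp [LinearMap.pi_apply, h]
  · intro i k hik x
    funext j
    by_cases h : (j : ℤ) = i
    · have : (j : ℤ) ≠ k := by rw [h]; exact hik
      simp [LinearMap.pi_apply, h, hik]
    · simp [LinearMap.pi_apply, h]
  · intro i hi x
    funext j
    have : (j : ℤ) ≠ i := fun h => hi (h ▸ j.2)
    simp [LinearMap.pi_apply, this]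
  · intro x
    funext j
    rw [Finset.sum_apply, Finset.sum_eq_single (j : ℤ)]
    · simp
    · intro i _ hi
      simp [Ne.symm hi]
    · intro h; exact absurd j.2 h
  · intro i x
    simp only [LinearMap.sum_apply, LinearMap.comp_apply, act_apply, LinearMap.proj_apply,
      LinearMap.pi_apply, Finset.smul_sum]
    refine Finset.sum_congr rfl fun j _ => ?_
    by_cases h : (j : ℤ) = i
    · rw [if_pos h, LinearMap.proj_apply, ← h, M.isGraded.e_e]
    · rw [if_neg h, LinearMap.zero_apply, map_zero, smul_zero, M.isGraded.e_ne _ _ (Ne.symm h)]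
  · intro m
    obtain ⟨v, rfl⟩ := hg m
    -- The constant family is a preimage, since an element is the sum of its components.
    refine ⟨fun _ => v, ?_⟩
    simp only [LinearMap.sum_apply, LinearMap.comp_apply, act_apply, LinearMap.proj_apply]
    rw [Finset.sum_coe_sort S fun i => opE Q i • g v, h2]

/-- The cover is the cone of the identity of a graded cover `F`: a pair `(x, y)` stands for `x + d
y`. As `d y` has degree one less than `y`, the second copy of `F` has its grading shifted. -/
theorem exists_supp_cover (M : Obj Q) (hM : ∀ x : M, opS Q • x = 0) :
    ∃ P : Obj Q, (∀ x : P, opS Q • x = 0) ∧ Module.Projective Q P ∧ Acyclic P ∧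
      ∃ q : P →ₗ[Op Q] M, Function.Surjective q := by
  obtain ⟨F, _, _, _, _, e, q, he, hq, hqs⟩ := M.exists_graded_cover
  let d : Module.End Q (F × F) := LinearMap.inr Q F F ∘ₗ LinearMap.fst Q F F
  have hd : ∀ x, d x = (0, x.1) := fun _ => rfl
  obtain ⟨P, φ, hE, hD, hS⟩ := exists_of_isGrading (he.prodMap (he.shift 1)) d 0
    (fun i x => by simp only [hd, LinearMap.prodMap_apply, map_zero, sub_add_cancel])
    (fun i x => (map_zero ((e (i + 1)).prodMap (e (i + 1 + 1)))).symm) (fun x => rfl)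
  let r : F × F →ₗ[Q] M := q.coprod (M.act (opD Q) ∘ₗ q)
  have hr : ∀ x, r x = q x.1 + opD Q • q x.2 := fun _ => rfl
  refine ⟨P, fun x => φ.injective ((hS x).trans (map_zero φ).symm),
    Module.Projective.of_equiv φ.symm, fun x hx => ?_,
    homOfCommute (r ∘ₗ φ.toLinearMap) (fun i x => ?_) (fun x => ?_) (fun x => ?_), fun m => ?_⟩
  · have h0 := hD x
    rw [hx, map_zero, hd] at h0
    refine ⟨φ.symm ((φ x).2, 0), φ.injective ?_⟩
    rw [hD, φ.apply_symm_apply, hd]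
    exact Prod.ext (congrArg Prod.snd h0) rfl
  · have := M.isGraded.d_e (i + 1) (q (φ x).2)
    rw [add_sub_cancel_right] at this
    change r (φ _) = _ • r (φ x)
    rw [hE, hr, hr, smul_add, ← this]
    simp only [LinearMap.prodMap_apply, hq]
  · change r (φ _) = _ • r (φ x)
    rw [hD, hr, hr, hd, smul_add, M.isGraded.d_d, map_zero, zero_add, add_zero]
  · change r (φ _) = _ • r (φ x)
    rw [hS, LinearMap.zero_apply, hM, map_zero]
  · obtain ⟨v, rfl⟩ := hqs m
    refine ⟨φ.symm (v, 0), ?_⟩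
    change r (φ _) = _
    rw [φ.apply_symm_apply, hr, map_zero, smul_zero, add_zero]

/-- The quadruple `(a, b, c, g)` stands for `a + d b + s c + d s g`, an element freely generated
from `F` under `d² = s² = 0` and `d s + s d = f`. The formula for `s` comes from rewriting `s d` as
`f - d s`. A cycle has `a = c = 0` and is then the boundary of `(b, 0, g, 0)`. -/
theorem exists_koszul_cover {f : Q} (M : Obj Q) (hM : IsKoszul f M) :
    ∃ P : Obj Q, IsKoszul f P ∧ Module.Projective Q P ∧ Acyclic P ∧
      ∃ q : P →ₗ[Op Q] M, Function.Surjective q := by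
  obtain ⟨F, _, _, _, _, e, q, he, hq, hqs⟩ := M.exists_graded_cover
  let d : Module.End Q (F × F × F × F) :=
    { toFun := fun x => (0, x.1, 0, x.2.2.1)
      map_add' := fun x y => by simp
      map_smul' := fun r x => by simp }
  let s : Module.End Q (F × F × F × F) :=
    { toFun := fun x => (f • x.2.1, 0, x.1 + f • x.2.2.2, -x.2.1)
      map_add' := fun x y => by
        simp only [Prod.fst_add, Prod.snd_add, smul_add, Prod.mk_add_mk, neg_add, add_zero]
        rw [add_add_add_comm]
      map_smul' := fun r x => by
        simp only [Prod.smul_fst, Prod.smul_snd, Prod.smul_mk, smul_add, smul_neg, smul_zero,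
          smul_comm f r, RingHom.id_apply] }
  have hd : ∀ x, d x = (0, x.1, 0, x.2.2.1) := fun _ => rfl
  have hs : ∀ x, s x = (f • x.2.1, 0, x.1 + f • x.2.2.2, -x.2.1) := fun _ => rfl
  obtain ⟨P, φ, hE, hD, hS⟩ := exists_of_isGrading
    (he.prodMap ((he.shift 1).prodMap ((he.shift (-1)).prodMap he))) d s
    (fun i x => by simp [hd, sub_eq_add_neg]) (fun i x => by simp [hs])
    (fun x => by simp [hd])
  let r : F × F × F × F →ₗ[Q] M := q.coprod ((M.act (opD Q) ∘ₗ q).coprod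
    ((M.act (opS Q) ∘ₗ q).coprod (M.act (opD Q) ∘ₗ M.act (opS Q) ∘ₗ q)))
  have hr : ∀ x, r x = q x.1 + (opD Q • q x.2.1 + (opS Q • q x.2.2.1 +
    opD Q • opS Q • q x.2.2.2)) := fun _ => rfl
  have hsd : ∀ x : M, opS Q • opD Q • x = f • x - opD Q • opS Q • x := fun x =>
    eq_sub_of_add_eq' (hM.2 x)
  refine ⟨P, ⟨fun x => φ.injective ?_, fun x => φ.injective ?_⟩, Module.Projective.of_equiv φ.symm,
    fun x hx => ?_, homOfCommute (r ∘ₗ φ.toLinearMap) (fun i x => ?_) (fun x => ?_) (fun x => ?_),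
    fun m => ?_⟩
  · rw [hS, hS, hs, hs, map_zero]
    refine Prod.ext (smul_zero _) (Prod.ext rfl (Prod.ext ?_ neg_zero))
    simp
  · rw [map_add, hD, hS, hS, hD, map_smul, hd, hs, hs, hd]
    obtain ⟨a, b, c, g⟩ := φ x
    simp
  · have h0 := hD x
    rw [hx, map_zero, hd] at h0
    refine ⟨φ.symm ((φ x).2.1, 0, (φ x).2.2.2, 0), φ.injective ?_⟩
    rw [hD, φ.apply_symm_apply, hd]
    exact Prod.ext (congrArg (fun z => z.2.1) h0) (Prod.ext rfl
      (Prod.ext (congrArg (fun z => z.2.2.2) h0) rfl))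
  · change r (φ _) = _ • r (φ x)
    have h1 := M.isGraded.d_e (i + 1) (q (φ x).2.1)
    have h2 := M.isGraded.s_e (i + -1) (q (φ x).2.2.1)
    have h3 := M.isGraded.s_e i (q (φ x).2.2.2)
    have h4 := M.isGraded.d_e (i + 1) (opS Q • q (φ x).2.2.2)
    rw [add_sub_cancel_right] at h1 h4
    rw [neg_add_cancel_right] at h2
    rw [hE, hr, hr, smul_add, smul_add, smul_add, ← h1, ← h2, ← h4, ← h3]
    simp only [LinearMap.prodMap_apply, hq]
  · change r (φ _) = _ • r (φ x)
    rw [hD, hr, hr, hd, smul_add, smul_add, smul_add, M.isGraded.d_d, M.isGraded.d_d]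
    simp
  · change r (φ _) = _ • r (φ x)
    rw [hS, hr, hr, hs, smul_add, smul_add, smul_add, hM.1, hsd, hsd, hM.1]
    simp only [map_add, map_smul, map_neg, map_zero, smul_zero, smul_neg, smul_add, zero_add,
      sub_zero]
    rw [smul_comm (opS Q) f]
    abel
  · obtain ⟨v, rfl⟩ := hqs m
    refine ⟨φ.symm (v, 0, 0, 0), ?_⟩
    change r (φ _) = _
    rw [φ.apply_symm_apply, hr]
    simp

variable [IsNoetherianRing Q]

theorem resolving_isKoszul (f : Q) : Resolving (IsKoszul f) where
  zero := ⟨fun _ => rfl, fun _ => rfl⟩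
  prod hM hN := ⟨fun _ => Prod.ext (hM.1 _) (hN.1 _), fun _ => Prod.ext (hM.2 _) (hN.2 _)⟩
  ker _ _ hM _ := ⟨fun _ => Subtype.ext (hM.1 _), fun _ => Subtype.ext (hM.2 _)⟩
  cover hM := exists_koszul_cover _ hM

theorem resolving_isSupp (f : Q) : Resolving (IsSupp f) where
  zero := ⟨fun _ => rfl, 0, fun _ _ => ⟨0, rfl⟩⟩
  prod := by
    rintro M N ⟨hM, m, hm⟩ ⟨hN, n, hn⟩
    refine ⟨fun x => Prod.ext (hM _) (hN _), m + n, fun x hx => ?_⟩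
    obtain ⟨y, hy⟩ := hm x.1 (congrArg Prod.fst hx)
    obtain ⟨z, hz⟩ := hn x.2 (congrArg Prod.snd hx)
    refine ⟨(f ^ n • y, f ^ m • z), Prod.ext ?_ ?_⟩
    · change opD Q • f ^ n • y = f ^ (m + n) • x.1
      rw [smul_comm, hy, smul_smul, pow_add, mul_comm]
    · change opD Q • f ^ m • z = f ^ (m + n) • x.2
      rw [smul_comm, hz, smul_smul, pow_add]
  ker := by
    rintro M N q hq ⟨hM, m, hm⟩ ⟨hN, n, hn⟩
    refine ⟨fun x => Subtype.ext (hM _), m + n, fun x hx => ?_⟩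
    obtain ⟨y, hy⟩ := hm x.1 (congrArg Subtype.val hx)
    have hqy : opD Q • q y = 0 := by
      rw [← map_smul, hy, map_smul', x.2, smul_zero]
    obtain ⟨z, hz⟩ := hn _ hqy
    obtain ⟨w, rfl⟩ := hq z
    -- `y` need not lie in the kernel, but `f ^ n • q y` is the boundary of `q w`; subtracting `d w`
    -- corrects this without changing the boundary. As in a long exact sequence, the exponents add.
    refine ⟨⟨f ^ n • y - opD Q • w, ?_⟩, Subtype.ext ?_⟩
    · rw [LinearMap.mem_ker, map_sub, map_smul', map_smul, hz, sub_self]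
    · change opD Q • (f ^ n • y - opD Q • w) = f ^ (m + n) • x.1
      rw [smul_sub, M.isGraded.d_d, sub_zero, smul_comm, hy, smul_smul, pow_add, mul_comm]
  cover := by
    rintro M ⟨hM, -⟩
    obtain ⟨P, h1, h2, h3, h4⟩ := exists_supp_cover M hM
    exact ⟨P, ⟨h1, 0, fun x hx => by simpa using h3 x hx⟩, h2, h3, h4⟩

end Obj
end CyclicAdams

namespace CyclicAdams

universe u v w
namespace Obj

variable {Q : Type u} [CommRing Q]

/-! ## Truncation -/

/-- The components of degrees outside `[m, m + n)` are zero. -/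
def InDegrees (M : Obj Q) (m : ℤ) (n : ℕ) : Prop :=
  ∀ i, (i < m ∨ m + n ≤ i) → ∀ x : M, opE Q i • x = 0

theorem exists_inDegrees (M : Obj Q) : ∃ m n, M.InDegrees m n := by
  obtain ⟨S, h1, -⟩ := M.isGraded.bdd
  obtain ⟨m, hm⟩ := S.bddBelow
  obtain ⟨k, hk⟩ := S.bddAbove
  refine ⟨m, (k - m + 1).toNat, fun i hi x => h1 i (fun h => ?_) x⟩
  have h2 := hm h
  have h3 := hk h
  have := Int.self_le_toNat (k - m + 1)
  omega

theorem InDegrees.subsingleton {M : Obj Q} {m : ℤ} (h : M.InDegrees m 0) : Subsingleton M := by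
  refine ⟨fun x y => ?_⟩
  have : ∀ x : M, x = 0 := fun x => by
    obtain ⟨S, -, h2⟩ := M.isGraded.bdd
    rw [← h2 x]
    exact Finset.sum_eq_zero fun i _ => h i (by have := lt_or_ge i m; simpa using this) x
  rw [this x, this y]

theorem InDegrees.d_e {M : Obj Q} {m : ℤ} {n : ℕ} (h : M.InDegrees m n) (x : M) :
    opD Q • opE Q m • x = 0 := by
  rw [M.isGraded.d_e, h _ (Or.inl (by omega))]

theorem e_d (M : Obj Q) (i : ℤ) (x : M) : opE Q i • opD Q • x = opD Q • opE Q (i + 1) • x := by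
  rw [M.isGraded.d_e, add_sub_cancel_right]

theorem e_s (M : Obj Q) (i : ℤ) (x : M) : opE Q i • opS Q • x = opS Q • opE Q (i - 1) • x := by
  rw [M.isGraded.s_e, sub_add_cancel]

theorem e_mem (M : Obj Q) (i j : ℤ) (x : M) :
    opE Q i • opE Q j • x = if i = j then opE Q i • x else 0 := by
  split_ifs with h
  · rw [← h, M.isGraded.e_e]
  · exact M.isGraded.e_ne i j h x

theorem InDegrees.e_s {M : Obj Q} {m : ℤ} {n : ℕ} (h : M.InDegrees m n) (x : M) :
    opE Q m • opS Q • x = 0 := by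
  rw [M.e_s, h _ (Or.inl (by omega)), smul_zero]

/-- The truncation: the degrees above `m + 1`, and the cycles in degree `m + 1`. -/
def trunc {M : Obj Q} {m : ℤ} {n : ℕ} (h : M.InDegrees m n) : Submodule (Op Q) M :=
  subOfStable (LinearMap.ker (M.act (opE Q m)) ⊓ LinearMap.ker (M.act (opD Q * opE Q (m + 1))))
    (fun i x hx => by
      simp only [Submodule.mem_inf, LinearMap.mem_ker, act_apply, mul_smul] at hx ⊢
      rw [M.e_mem, M.e_mem]
      constructor
      · split_ifs
        exacts [hx.1, rfl]
      · split_ifs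
        exacts [hx.2, smul_zero _])
    (fun x hx => by
      simp only [Submodule.mem_inf, LinearMap.mem_ker, act_apply, mul_smul] at hx ⊢
      rw [e_d, e_d, M.isGraded.d_d]
      exact ⟨hx.2, rfl⟩)
    -- As `s` raises degrees, the component of `s x` in degree `m + 1` comes from that of `x` in
    -- degree `m`, which is zero.
    (fun x hx => by
      simp only [Submodule.mem_inf, LinearMap.mem_ker, act_apply, mul_smul] at hx ⊢
      rw [M.e_s (m + 1), add_sub_cancel_right, hx.1]
      exact ⟨h.e_s x, by rw [smul_zero, smul_zero]⟩)

theorem mem_trunc {M : Obj Q} {m : ℤ} {n : ℕ} (h : M.InDegrees m n) {x : M} :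
    x ∈ trunc h ↔ opE Q m • x = 0 ∧ opD Q • opE Q (m + 1) • x = 0 := by
  unfold trunc
  simp [mul_smul]

/-- Boundaries in `L` are boundaries of elements of `L`: the homology of `L` injects. -/
def HInj {M : Obj Q} (L : Submodule (Op Q) M) : Prop :=
  ∀ y : M, opD Q • y ∈ L → ∃ y' ∈ L, opD Q • y' = opD Q • y

/-- The differential kills the lowest degree `m`, so dropping the component of `y` there changes no
boundary, and what remains lies in the truncation. -/
theorem hInj_trunc {M : Obj Q} {m : ℤ} {n : ℕ} (h : M.InDegrees m n) : HInj (trunc h) := by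
  intro y hy
  rw [mem_trunc, e_d] at hy
  refine ⟨y - opE Q m • y, (mem_trunc h).mpr ⟨?_, ?_⟩, ?_⟩
  · rw [smul_sub, M.isGraded.e_e, sub_self]
  · rw [smul_sub, M.isGraded.e_ne _ _ (by omega), sub_zero, hy.1]
  · rw [smul_sub, h.d_e, sub_zero]

/-- The submodule of all elements whose component of degree `m` is a boundary. -/
def boundaryIn {M : Obj Q} {m : ℤ} {n : ℕ} (h : M.InDegrees m n) : Submodule (Op Q) M :=
  subOfStable ((LinearMap.range (M.act (opD Q * opE Q (m + 1)))).comap (M.act (opE Q m)))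
    (fun i x hx => by
      simp only [Submodule.mem_comap, act_apply, M.e_mem]
      split_ifs
      exacts [hx, zero_mem _])
    (fun x _ => by
      simp only [Submodule.mem_comap, act_apply, M.e_d]
      exact ⟨x, by simp [mul_smul]⟩)
    (fun x _ => by
      simp only [Submodule.mem_comap, act_apply, h.e_s]
      exact zero_mem _)

theorem mem_boundaryIn {M : Obj Q} {m : ℤ} {n : ℕ} (h : M.InDegrees m n) {x : M} :
    x ∈ boundaryIn h ↔ ∃ y : M, opD Q • opE Q (m + 1) • y = opE Q m • x := by
  unfold boundaryIn
  simp [mul_smul]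

theorem hInj_boundaryIn {M : Obj Q} {m : ℤ} {n : ℕ} (h : M.InDegrees m n) :
    HInj (boundaryIn h) := by
  intro y _
  refine ⟨y - opE Q m • y, (mem_boundaryIn h).mpr ⟨0, ?_⟩, ?_⟩
  · rw [smul_sub, M.isGraded.e_e, sub_self, smul_zero, smul_zero]
  · rw [smul_sub, h.d_e, sub_zero]

variable {A : Type*} [AddCommGroup A]

theorem AdditiveOn.sub {C : Obj Q → Prop} {b b' : Obj Q → A} (h : AdditiveOn C b)
    (h' : AdditiveOn C b') : AdditiveOn C fun M => b M - b' M := by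
  intro M' M M'' h1 h2 h3 i q hs
  simp only [h h1 h2 h3 i q hs, h' h1 h2 h3 i q hs]
  abel

/-- The quotient is the two-term complex from the degree `m + 1` part modulo its cycles to the
degree `m` part: injective by construction, surjective by `hM`. -/
theorem acyclic_quot_trunc {M : Obj Q} {m : ℤ} {n : ℕ} (h : M.InDegrees m n)
    (hM : ∀ x : M, ∃ y : M, opD Q • opE Q (m + 1) • y = opE Q m • x) :
    (M.quot (trunc h)).Acyclic := by
  intro x hx
  obtain ⟨x, rfl⟩ := (trunc h).mkQ_surjective x
  rw [← map_smul, Submodule.mkQ_apply, Submodule.Quotient.mk_eq_zero, mem_trunc, e_d] at hx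
  obtain ⟨y, hy⟩ := hM x
  refine ⟨(trunc h).mkQ (opE Q (m + 1) • y), ?_⟩
  rw [← map_smul, hy, ← sub_eq_zero, ← map_sub, Submodule.mkQ_apply,
    Submodule.Quotient.mk_eq_zero, mem_trunc, smul_sub, smul_sub, M.isGraded.e_e, sub_self,
    M.isGraded.e_ne _ _ (by omega), zero_sub, smul_neg, hx.1, neg_zero]
  exact ⟨rfl, rfl⟩

/-- The complex underlying an object that is projective over `Q`. -/
abbrev toCx (M : Obj Q) [Module.Projective Q M] : BddComplex Q where
  carrier := M
  proj i := M.act (opE Q i)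
  proj_mul_self i := LinearMap.ext (M.isGraded.e_e i)
  proj_mul_of_ne i j h := LinearMap.ext (M.isGraded.e_ne i j h)
  exists_sum_proj := by
    obtain ⟨S, h1, h2⟩ := M.isGraded.bdd
    exact ⟨S, fun i hi => LinearMap.ext (h1 i hi), LinearMap.ext fun x => by
      rw [LinearMap.sum_apply]; exact h2 x⟩
  d := M.act (opD Q)
  d_mul_proj i := LinearMap.ext (M.isGraded.d_e i)
  d_mul_d := LinearMap.ext fun x => by
    rw [zero_smul]; exact M.isGraded.d_d x

/-- This is `exists_nullHomotopy` for multiplication by 1. The homotopy need not anticommute with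
`s`, so it does not yet give `Contractible`. -/
theorem Acyclic.exists_homotopy {M : Obj Q} (hM : M.Acyclic) [Module.Projective Q M] :
    ∃ h : Module.End Q M, (∀ i x, h (opE Q i • x) = opE Q (i + 1) • h x) ∧
      ∀ x, opD Q • h x + h (opD Q • x) = x := by
  obtain ⟨N, h, h1, h2⟩ := M.toCx.exists_nullHomotopy 1 fun x hx => by
    rw [one_smul]; exact hM x hx
  refine ⟨h, fun i x => LinearMap.congr_fun (h1 i) x, fun x => ?_⟩
  rw [one_pow, one_smul] at h2
  exact LinearMap.congr_fun h2 x

/-- The class `C` is closed under submodules whose homology injects, and the quotients by them. -/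
structure Thick [IsNoetherianRing Q] (C : Obj Q → Prop) : Prop where
  sub : ∀ {M : Obj Q}, C M → ∀ L : Submodule (Op Q) M, HInj L → C (M.sub L)
  quot : ∀ {M : Obj Q}, C M → ∀ L : Submodule (Op Q) M, HInj L → C (M.quot L)

variable [IsNoetherianRing Q]

theorem thick_isKoszul (f : Q) : Thick (IsKoszul f) where
  sub hM _ _ := ⟨fun _ => Subtype.ext (hM.1 _), fun _ => Subtype.ext (hM.2 _)⟩
  quot {M} hM L _ := by
    refine ⟨fun x => ?_, fun x => ?_⟩
    · obtain ⟨x, rfl⟩ := L.mkQ_surjective x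
      rw [← map_smul, ← map_smul, hM.1, map_zero]
    · obtain ⟨x, rfl⟩ := L.mkQ_surjective x
      rw [← map_smul, ← map_smul, ← map_smul, ← map_smul, ← map_add, hM.2]
      exact map_smul' (N := M.quot L) L.mkQ f x

theorem thick_isSupp (f : Q) : Thick (IsSupp f) where
  sub := by
    rintro M ⟨h1, N, h2⟩ L hL
    refine ⟨fun x => Subtype.ext (h1 _), N, fun x hx => ?_⟩
    obtain ⟨y, hy⟩ := h2 x.1 (congrArg Subtype.val hx)
    obtain ⟨y', hy', e⟩ := hL y (by rw [hy]; exact (f ^ N • x).2)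
    exact ⟨⟨y', hy'⟩, Subtype.ext (e.trans hy)⟩
  quot := by
    rintro M ⟨h1, N, h2⟩ L hL
    refine ⟨fun x => ?_, N, fun x hx => ?_⟩
    · obtain ⟨x, rfl⟩ := L.mkQ_surjective x
      rw [← map_smul, h1, map_zero]
    · obtain ⟨x, rfl⟩ := L.mkQ_surjective x
      rw [← map_smul, Submodule.mkQ_apply, Submodule.Quotient.mk_eq_zero] at hx
      obtain ⟨l, hl, e⟩ := hL x hx
      obtain ⟨y, hy⟩ := h2 (x - l) (by rw [smul_sub, e, sub_self])
      refine ⟨L.mkQ y, ?_⟩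
      have hl0 : L.mkQ l = 0 := (Submodule.Quotient.mk_eq_zero L).mpr hl
      rw [← map_smul, hy]
      refine (map_smul' (N := M.quot L) L.mkQ _ _).trans ?_
      rw [map_sub, hl0, sub_zero]

theorem inDegrees_trunc {M : Obj Q} {m : ℤ} {n : ℕ} (h : M.InDegrees m (n + 1)) :
    (M.sub (trunc h)).InDegrees (m + 1) n := by
  rintro i hi ⟨x, hx⟩
  apply Subtype.ext
  change opE Q i • x = 0
  by_cases him : i = m
  · subst him; exact ((mem_trunc h).mp hx).1
  · exact h i (by push_cast; omega) x

/-- Induction on the number of degrees. The quotient by `boundaryIn` is the homology in the lowest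
degree, where `d` and `s` vanish and `h0` applies. Inside `boundaryIn` every element of lowest
degree is a boundary, so truncation has an acyclic quotient and leaves a submodule with one degree
fewer. -/
theorem AdditiveOn.eq_zero_of_inDegrees {C : Obj Q → Prop} (hC : Thick C) {b : Obj Q → A}
    (hb : AdditiveOn C b) (ha : ∀ M, C M → Acyclic M → b M = 0)
    (h0 : ∀ M : Obj Q, C M → (∀ x : M, opD Q • x = 0) → (∀ x : M, opS Q • x = 0) → b M = 0)
    (n : ℕ) : ∀ (M : Obj Q) (m : ℤ), C M → M.InDegrees m n → b M = 0 := by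
  induction n with
  | zero =>
    intro M m hM h
    have := h.subsingleton
    exact hb.map_subsingleton M hM
  | succ n ih =>
    have key : ∀ (M : Obj Q) (m : ℤ), C M → M.InDegrees m (n + 1) →
        (∀ x : M, ∃ y : M, opD Q • opE Q (m + 1) • y = opE Q m • x) → b M = 0 := by
      intro M m hM h hMb
      have h1 := hC.sub hM _ (hInj_trunc h)
      have h2 := hC.quot hM _ (hInj_trunc h)
      rw [hb h1 hM h2 _ _ (ses_mkQ M (trunc h)), ih _ (m + 1) h1 (inDegrees_trunc h),
        ha _ h2 (acyclic_quot_trunc h hMb), add_zero]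
    intro M m hM h
    have h1 := hC.sub hM _ (hInj_boundaryIn h)
    have h2 := hC.quot hM _ (hInj_boundaryIn h)
    rw [hb h1 hM h2 _ _ (ses_mkQ M (boundaryIn h)),
      key (M.sub (boundaryIn h)) m h1 (fun i hi x => Subtype.ext (h i hi x)) ?_,
      h0 _ h2 ?_ ?_, add_zero]
    · intro x
      obtain ⟨x, rfl⟩ := (boundaryIn h).mkQ_surjective x
      rw [← map_smul, Submodule.mkQ_apply, Submodule.Quotient.mk_eq_zero, mem_boundaryIn, e_d]
      exact ⟨x, rfl⟩
    · intro x
      obtain ⟨x, rfl⟩ := (boundaryIn h).mkQ_surjective x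
      rw [← map_smul, Submodule.mkQ_apply, Submodule.Quotient.mk_eq_zero, mem_boundaryIn, h.e_s]
      exact ⟨0, by rw [smul_zero, smul_zero]⟩
    · rintro ⟨x, hx⟩
      obtain ⟨y, hy⟩ := (mem_boundaryIn h).mp hx
      refine ⟨⟨opE Q (m + 1) • y, (mem_boundaryIn h).mpr ⟨0, ?_⟩⟩, Subtype.ext ?_⟩
      · rw [M.isGraded.e_ne _ _ (by omega), smul_zero, smul_zero]
      · change opD Q • opE Q (m + 1) • opE Q (m + 1) • y = opE Q m • x
        rw [M.isGraded.e_e, hy]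

/-- Additive functions that vanish on acyclic objects are determined by their values on the
objects with `d = 0` and `s = 0`. -/
theorem AdditiveOn.eq_of_homology {C : Obj Q → Prop} (hC : Thick C) {b b' : Obj Q → A}
    (hb : AdditiveOn C b) (hb' : AdditiveOn C b') (ha : ∀ M, C M → Acyclic M → b M = 0)
    (ha' : ∀ M, C M → Acyclic M → b' M = 0)
    (h0 : ∀ M : Obj Q, C M → (∀ x : M, opD Q • x = 0) → (∀ x : M, opS Q • x = 0) → b M = b' M)
    (M : Obj Q) (hM : C M) : b M = b' M := by
  obtain ⟨m, n, h⟩ := M.exists_inDegrees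
  exact sub_eq_zero.mp ((hb.sub hb').eq_zero_of_inDegrees hC
    (fun M h h' => by rw [ha M h h', ha' M h h', sub_zero])
    (fun M h h' h'' => by rw [h0 M h h' h'', sub_self]) n M m hM h)

/-- The identity is null-homotopic. -/
def Contractible (M : Obj Q) : Prop :=
  ∃ h : Module.End Q M, (∀ i x, h (opE Q i • x) = opE Q (i + 1) • h x) ∧
    (∀ x, opD Q • h x + h (opD Q • x) = x) ∧ ∀ x, h (opS Q • x) = -(opS Q • h x)

theorem acyclic_trunc {M : Obj Q} {m : ℤ} {n : ℕ} (h : M.InDegrees m n) (hM : M.Acyclic) :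
    (M.sub (trunc h)).Acyclic := by
  rintro ⟨x, hx⟩ hdx
  obtain ⟨y, rfl⟩ := hM x (congrArg Subtype.val hdx)
  obtain ⟨y', hy', e⟩ := hInj_trunc h y hx
  exact ⟨⟨y', hy'⟩, Subtype.ext e⟩

/-- The operator `p = e m + h ∘ e m ∘ d` is idempotent with kernel the truncation: in degree `m + 1`
it is `h d`, the projection along the cycles. So the truncation and its quotient are both summands
of `M`. The quotient lives in degrees `m` and `m + 1` only, where `h s` and `s h` both vanish; the
induced homotopy is therefore compatible with `s` even if `h` is not. -/
theorem Acyclic.trunc {M : Obj Q} {m : ℤ} {n : ℕ} (hM : M.Acyclic) [Module.Projective Q M]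
    (hm : M.InDegrees m n) : Module.Projective Q (M.sub (trunc hm)) ∧
      Module.Projective Q (M.quot (trunc hm)) ∧ (M.quot (trunc hm)).Contractible := by
  obtain ⟨h, h1, h2⟩ := hM.exists_homotopy
  have hem : ∀ x, opE Q m • h x = 0 := fun x => by
    have := h1 (m - 1) x
    rw [sub_add_cancel, hm (m - 1) (Or.inl (by omega)), map_zero] at this
    exact this.symm
  let p : Module.End Q M := M.act (opE Q m) + h ∘ₗ M.act (opE Q m * opD Q)
  have hp : ∀ x, p x = opE Q m • x + h (opE Q m • opD Q • x) := fun x => by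
    simp [p, mul_smul]
  have hker : ∀ x, p x = 0 ↔ x ∈ Obj.trunc hm := by
    intro x
    rw [mem_trunc, hp, ← e_d]
    constructor
    · intro hx
      have e1 := congrArg (opE Q m • ·) hx
      simp only [smul_add, hem, M.isGraded.e_e, smul_zero, add_zero] at e1
      rw [e1, zero_add] at hx
      have e2 := h2 (opE Q m • opD Q • x)
      rw [hx, smul_zero, zero_add, hm.d_e, map_zero] at e2
      exact ⟨e1, e2.symm⟩
    · rintro ⟨h3, h4⟩
      rw [h3, h4, map_zero, add_zero]
  have hpp : ∀ x, p (p x) = p x := by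
    intro x
    have e1 : p (opE Q m • x) = opE Q m • x := by
      rw [hp, hm.d_e, smul_zero, map_zero, add_zero, M.isGraded.e_e]
    have e2 : p (h (opE Q m • opD Q • x)) = h (opE Q m • opD Q • x) := by
      have e3 := h2 (opE Q m • opD Q • x)
      rw [hm.d_e, map_zero, add_zero] at e3
      rw [hp, hem, zero_add, e3, M.isGraded.e_e]
    rw [hp x, map_add, e1, e2]
  have hsub : ∀ x, x - p x ∈ Obj.trunc hm := fun x => by
    rw [← hker, map_sub, hpp, sub_self]
  refine ⟨?_, ?_, ?_⟩
  · let r : M →ₗ[Q] M.sub (Obj.trunc hm) :=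
      (LinearMap.id - p).codRestrict ((Obj.trunc hm).restrictScalars Q) hsub
    refine Module.Projective.of_split ((Obj.trunc hm).subtype.restrictScalars Q) r
      (LinearMap.ext fun x => Subtype.ext ?_)
    change x.1 - p x.1 = x.1
    rw [(hker _).mpr x.2, sub_zero]
  · let j : M.quot (Obj.trunc hm) →ₗ[Q] M :=
      ((Obj.trunc hm).restrictScalars Q).liftQ p fun x hx => (hker x).mpr hx
    refine Module.Projective.of_split j
      ((Obj.trunc hm).mkQ.restrictScalars Q : M →ₗ[Q] M.quot (Obj.trunc hm))
      (LinearMap.ext fun x => ?_)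
    obtain ⟨x, rfl⟩ := (Obj.trunc hm).mkQ_surjective x
    refine (sub_eq_zero.mp ?_).symm
    change (Obj.trunc hm).mkQ x - (Obj.trunc hm).mkQ (p x) = 0
    rw [← map_sub, Submodule.mkQ_apply, Submodule.Quotient.mk_eq_zero]
    exact hsub x
  · let k : Module.End Q (M.quot (Obj.trunc hm)) :=
      ((Obj.trunc hm).restrictScalars Q).mapQ ((Obj.trunc hm).restrictScalars Q)
        (h ∘ₗ M.act (opE Q m)) (fun x hx => by
          rw [Submodule.mem_comap, LinearMap.comp_apply, act_apply, ((mem_trunc hm).mp hx).1,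
            map_zero]
          exact zero_mem _)
    have hk : ∀ x, k ((Obj.trunc hm).mkQ x) = (Obj.trunc hm).mkQ (h (opE Q m • x)) :=
      fun _ => rfl
    refine ⟨k, fun i => ?_, ?_, ?_⟩
    · refine (Obj.trunc hm).mkQ_surjective.forall.mpr fun x => ?_
      rw [← map_smul, hk, hk, ← map_smul, ← h1, M.e_mem, M.e_mem]
      split_ifs with hi hi' hi'
      exacts [congrArg (fun j => (Obj.trunc hm).mkQ (h (opE Q j • x))) hi.symm ▸ rfl,
        absurd hi.symm hi', absurd hi'.symm hi, rfl]
    · refine (Obj.trunc hm).mkQ_surjective.forall.mpr fun x => ?_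
      have e := h2 (opE Q m • x)
      rw [hm.d_e, map_zero, add_zero] at e
      rw [← map_smul (Obj.trunc hm).mkQ (opD Q) x, hk, hk, ← map_smul (Obj.trunc hm).mkQ, ← map_add,
        e, ← hp, ← sub_eq_zero, ← map_sub,
        Submodule.mkQ_apply, Submodule.Quotient.mk_eq_zero, ← neg_sub]
      exact neg_mem (hsub x)
    · refine (Obj.trunc hm).mkQ_surjective.forall.mpr fun x => ?_
      rw [← map_smul, hk, hk, hm.e_s, map_zero, map_zero, ← map_smul, ← map_neg, eq_comm,
        Submodule.mkQ_apply, Submodule.Quotient.mk_eq_zero, mem_trunc, smul_neg, hm.e_s, smul_neg,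
        M.e_s (m + 1), add_sub_cancel_right, hem, smul_zero, neg_zero, smul_zero]
      exact ⟨rfl, rfl⟩

/-- Additive functions on projective objects that vanish on contractible objects vanish on
acyclic objects. -/
theorem AdditiveOn.eq_zero_of_acyclic {C : Obj Q → Prop} (hC : Thick C) {c : Obj Q → A}
    (hc : AdditiveOn (fun M => C M ∧ Module.Projective Q M) c)
    (h0 : ∀ M, C M → Module.Projective Q M → Contractible M → c M = 0) (M : Obj Q) (hM : C M)
    (hMp : Module.Projective Q M) (ha : Acyclic M) : c M = 0 := by
  suffices ∀ (n : ℕ) (M : Obj Q) (m : ℤ), C M → Module.Projective Q M → Acyclic M →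
      M.InDegrees m n → c M = 0 by
    obtain ⟨m, n, h⟩ := M.exists_inDegrees
    exact this n M m hM hMp ha h
  intro n
  induction n with
  | zero =>
    intro M m hM hMp _ h
    have := h.subsingleton
    exact hc.map_subsingleton M ⟨hM, hMp⟩
  | succ n ih =>
    intro M m hM hMp ha h
    obtain ⟨p1, p2, p3⟩ := ha.trunc h
    have h1 := hC.sub hM _ (hInj_trunc h)
    have h2 := hC.quot hM _ (hInj_trunc h)
    rw [hc ⟨h1, p1⟩ ⟨hM, hMp⟩ ⟨h2, p2⟩ _ _ (ses_mkQ M (trunc h)),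
      ih _ (m + 1) h1 p1 (acyclic_trunc h ha) (inDegrees_trunc h), h0 _ h2 p2 p3, add_zero]

end Obj
end CyclicAdams

namespace CyclicAdams

universe u v w
namespace Obj

variable {Q : Type u} [CommRing Q]

/-! ## Dévissage -/

/-- Graded modules (with zero operators) that are annihilated by `g`. -/
def IsTors (g : Q) (N : Obj Q) : Prop :=
  (∀ x : N, opD Q • x = 0) ∧ (∀ x : N, opS Q • x = 0) ∧ ∀ x : N, g • x = 0

/-- Graded modules (with zero operators) that are annihilated by a power of `f`. -/
def IsNilp (f : Q) (N : Obj Q) : Prop := ∃ n : ℕ, IsTors (f ^ n) N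

theorem IsTors.mul {g : Q} {N : Obj Q} (h : IsTors g N) (r : Q) : IsTors (r * g) N :=
  ⟨h.1, h.2.1, fun x => by rw [mul_smul, h.2.2, smul_zero]⟩

theorem isTors_zero (g : Q) : IsTors g (zero Q) := ⟨fun _ => rfl, fun _ => rfl, fun _ => rfl⟩

/-- With zero operators the relation `d s + s d = f` says exactly that `f` acts as zero. These
modules are the common ground of Koszul modules and supported complexes. -/
theorem IsTors.isKoszul {f : Q} {N : Obj Q} (h : IsTors f N) : IsKoszul f N :=
  ⟨fun x => h.2.1 _, fun x => by rw [h.1, h.2.1, add_zero, h.2.2]⟩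

theorem IsTors.of_surjective {g : Q} {M N : Obj Q} (h : IsTors g M) (q : M →ₗ[Op Q] N)
    (hq : Function.Surjective q) : IsTors g N :=
  ⟨hq.forall.mpr fun x => by rw [← map_smul, h.1, map_zero],
    hq.forall.mpr fun x => by rw [← map_smul, h.2.1, map_zero],
    hq.forall.mpr fun x => by rw [← map_smul', h.2.2, map_zero]⟩

theorem IsTors.of_injective {g : Q} {M N : Obj Q} (h : IsTors g N) (q : M →ₗ[Op Q] N)
    (hq : Function.Injective q) : IsTors g M :=
  ⟨fun x => hq (by rw [map_smul, h.1, map_zero]), fun x => hq (by rw [map_smul, h.2.1, map_zero]),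
    fun x => hq (by rw [map_smul', h.2.2, map_zero])⟩

theorem IsTors.quot {g : Q} {M : Obj Q} (h : IsTors g M) (L : Submodule (Op Q) M) :
    IsTors g (M.quot L) := h.of_surjective L.mkQ L.mkQ_surjective

theorem IsNilp.quot {f : Q} {M : Obj Q} (h : IsNilp f M) (L : Submodule (Op Q) M) :
    IsNilp f (M.quot L) := h.imp fun _ h => h.quot L

/-- The submodule `g M`. -/
def smulSub (g : Q) (M : Obj Q) : Submodule (Op Q) M :=
  subOfStable (LinearMap.range (LinearMap.lsmul Q M g))
    (by rintro i _ ⟨x, rfl⟩; exact ⟨opE Q i • x, smul_comm _ _ _⟩)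
    (by rintro _ ⟨x, rfl⟩; exact ⟨opD Q • x, smul_comm _ _ _⟩)
    (by rintro _ ⟨x, rfl⟩; exact ⟨opS Q • x, smul_comm _ _ _⟩)

theorem quot_smulSub {f : Q} {M : Obj Q} (h1 : ∀ x : M, opD Q • x = 0)
    (h2 : ∀ x : M, opS Q • x = 0) : IsTors f (M.quot (smulSub f M)) := by
  refine ⟨(smulSub f M).mkQ_surjective.forall.mpr fun x => ?_,
    (smulSub f M).mkQ_surjective.forall.mpr fun x => ?_,
    (smulSub f M).mkQ_surjective.forall.mpr fun x => ?_⟩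
  · rw [← map_smul, h1, map_zero]
  · rw [← map_smul, h2, map_zero]
  · refine (map_smul' (N := M.quot _) (smulSub f M).mkQ _ _).symm.trans ?_
    rw [Submodule.mkQ_apply, Submodule.Quotient.mk_eq_zero]
    exact ⟨x, rfl⟩

theorem IsTors.subsingleton {f : Q} {N : Obj Q} (h : IsTors (f ^ 0) N) : Subsingleton N :=
  ⟨fun x y => by
    have e : ∀ x : N, x = 0 := fun x => by simpa using h.2.2 x
    rw [e x, e y]⟩

theorem isTors_isNilp {f : Q} {N : Obj Q} (h : IsTors f N) : IsNilp f N :=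
  ⟨1, by rwa [pow_one]⟩

variable [IsNoetherianRing Q]

theorem IsTors.sub {g : Q} {M : Obj Q} (h : IsTors g M) (L : Submodule (Op Q) M) :
    IsTors g (M.sub L) := h.of_injective L.subtype L.injective_subtype

theorem IsNilp.sub {f : Q} {M : Obj Q} (h : IsNilp f M) (L : Submodule (Op Q) M) :
    IsNilp f (M.sub L) := h.imp fun _ h => h.sub L

theorem IsTors.sub_smulSub {f : Q} {n : ℕ} {M : Obj Q} (h : IsTors (f ^ (n + 1)) M) :
    IsTors (f ^ n) (M.sub (smulSub f M)) := by
  refine ⟨fun x => Subtype.ext (h.1 _), fun x => Subtype.ext (h.2.1 _), ?_⟩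
  rintro ⟨_, x, rfl⟩
  apply Subtype.ext
  change f ^ n • f • x = 0
  rw [smul_smul, ← pow_succ, h.2.2]

theorem ses_sub_sub (M : Obj Q) {L L' : Submodule (Op Q) M} (h : L ≤ L') :
    SES (M' := M.sub L) (M := M.sub L') (M'' := (M.sub L').quot (L.comap L'.subtype))
      (Submodule.inclusion h) (L.comap L'.subtype).mkQ := by
  refine ⟨Submodule.inclusion_injective h, fun x => ?_, Submodule.mkQ_surjective _⟩
  rw [Submodule.mkQ_apply, Submodule.Quotient.mk_eq_zero]
  exact ⟨fun hx => ⟨⟨x, hx⟩, rfl⟩, fun ⟨y, hy⟩ => hy ▸ y.2⟩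

theorem ses_quot_quot (M : Obj Q) {L L' : Submodule (Op Q) M} (h : L ≤ L') :
    SES (M' := (M.sub L').quot (L.comap L'.subtype)) (M := M.quot L) (M'' := M.quot L')
      ((L.comap L'.subtype).mapQ L L'.subtype le_rfl) (Submodule.factor h) := by
  refine ⟨?_, ?_, Submodule.factor_surjective h⟩
  · refine (injective_iff_map_eq_zero _).mpr (Submodule.mkQ_surjective _ |>.forall.mpr
      fun x hx => ?_)
    exact (Submodule.Quotient.mk_eq_zero _).mpr ((Submodule.Quotient.mk_eq_zero L).mp hx :)
  · refine L.mkQ_surjective.forall.mpr fun x => ?_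
    change Submodule.Quotient.mk (p := L') x = 0 ↔ _
    rw [Submodule.Quotient.mk_eq_zero]
    constructor
    · exact fun hx => ⟨Submodule.Quotient.mk ⟨x, hx⟩, rfl⟩
    · rintro ⟨y, hy⟩
      obtain ⟨y, rfl⟩ := Submodule.mkQ_surjective _ y
      have h1 : (y : M) - x ∈ L := (Submodule.Quotient.eq L).mp hy
      have := L'.sub_mem y.2 (h h1)
      rwa [sub_sub_cancel] at this

variable {A : Type*} [AddCommGroup A]

theorem AdditiveOn.sub_sub {C : Obj Q → Prop} {b : Obj Q → A} (hb : AdditiveOn C b) {M : Obj Q}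
    {L L' : Submodule (Op Q) M} (h : L ≤ L') (h1 : C (M.sub L)) (h2 : C (M.sub L'))
    (h3 : C ((M.sub L').quot (L.comap L'.subtype))) :
    b (M.sub L') = b (M.sub L) + b ((M.sub L').quot (L.comap L'.subtype)) :=
  hb h1 h2 h3 _ _ (ses_sub_sub M h)

theorem AdditiveOn.quot_quot {C : Obj Q → Prop} {b : Obj Q → A} (hb : AdditiveOn C b) {M : Obj Q}
    {L L' : Submodule (Op Q) M} (h : L ≤ L') (h1 : C (M.quot L)) (h2 : C (M.quot L'))
    (h3 : C ((M.sub L').quot (L.comap L'.subtype))) :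
    b (M.quot L) = b ((M.sub L').quot (L.comap L'.subtype)) + b (M.quot L') :=
  hb h3 h1 h2 _ _ (ses_quot_quot M h)

/-- The extension of `b` to modules annihilated by `f ^ n`, by the filtration by the `f ^ i M`. -/
noncomputable def dev (f : Q) (b : Obj Q → A) : ℕ → Obj Q → A
  | 0, _ => 0
  | n + 1, N => dev f b n (N.sub (smulSub f N)) + b (N.quot (smulSub f N))

variable {f : Q} {b : Obj Q → A}

theorem dev_subsingleton (hb : AdditiveOn (IsTors f) b) (n : ℕ) : ∀ (N : Obj Q) [Subsingleton N],
    dev f b n N = 0 := by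
  induction n with
  | zero => exact fun _ _ => rfl
  | succ n ih =>
    intro N hN
    have h : ∀ x : N, x = 0 := fun x => Subsingleton.elim _ _
    have h1 : Subsingleton (N.quot (smulSub f N)) :=
      (smulSub f N).mkQ_surjective.subsingleton
    rw [dev, ih, hb.map_subsingleton _ (quot_smulSub (fun _ => h _) fun _ => h _), add_zero]

/-- Once `f ^ n` kills the module, further steps of the filtration meet only zero modules; so the
value does not depend on the exponent. -/
theorem dev_succ (hb : AdditiveOn (IsTors f) b) (n : ℕ) : ∀ N : Obj Q, IsTors (f ^ n) N →
    dev f b (n + 1) N = dev f b n N := by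
  induction n with
  | zero =>
    intro N h
    have := h.subsingleton
    rw [dev_subsingleton hb, dev_subsingleton hb]
  | succ n ih =>
    intro N h
    rw [dev, ih _ h.sub_smulSub, dev]

theorem dev_of_isTors (hb : AdditiveOn (IsTors f) b) (n : ℕ) (N : Obj Q) (hn : IsTors (f ^ n) N)
    (h : IsTors f N) : dev f b n N = b N := by
  cases n with
  | zero =>
    have := hn.subsingleton
    rw [hb.map_subsingleton N h]; rfl
  | succ n =>
    have h1 : smulSub f N = ⊥ := by
      rw [eq_bot_iff]
      rintro _ ⟨x, rfl⟩
      exact h.2.2 x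
    have h2 : Subsingleton (N.sub (smulSub f N)) :=
      ⟨fun x y => Subtype.ext (by
        have : ∀ z : N.sub (smulSub f N), z.1 = 0 := fun z => by
          exact (Submodule.mem_bot _).mp (h1 ▸ z.2 : z.1 ∈ (⊥ : Submodule (Op Q) N))
        rw [this, this])⟩
    rw [dev, dev_subsingleton hb, zero_add]
    exact (hb.map_equiv (isTors_zero f) h (h.quot _)
      (Submodule.quotEquivOfEqBot _ h1).symm).symm

/-- Multiplication by `f` does not preserve exactness: `L`, the part of `M'` that falls in `f M`,
may exceed `f M'`. The sequences `L → f M → f M''` and `M' / L → M / f M → M'' / f M''` are exact,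
and the discrepancy `L / f M'`, killed by `f`, enters the two contributions with opposite signs. -/
theorem AdditiveOn.dev (hb : AdditiveOn (IsTors f) b) (n : ℕ) :
    AdditiveOn (IsTors (f ^ n)) (dev f b n) := by
  induction n with
  | zero => intro _ _ _ _ _ _ _ _ _; exact (add_zero (0 : A)).symm
  | succ n ih =>
    intro M' M M'' h' h h'' i q hs
    set L := (smulSub f M).comap i with hL
    have hle : smulSub f M' ≤ L := by
      rintro _ ⟨x, rfl⟩
      exact ⟨i x, (map_smul' i f x).symm⟩
    have t0 := quot_smulSub (f := f) h.1 h.2.1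
    have t0' := quot_smulSub (f := f) h'.1 h'.2.1
    have t0'' := quot_smulSub (f := f) h''.1 h''.2.1
    have s1 : SES (M' := M'.sub L) (M := M.sub (smulSub f M)) (M'' := M''.sub (smulSub f M''))
        (i.restrict fun x hx => hx) (q.restrict (by
          rintro _ ⟨x, rfl⟩
          exact ⟨q x, (map_smul' q f x).symm⟩)) := by
      refine ⟨fun x y hxy => Subtype.ext (hs.inj (congrArg Subtype.val hxy)), ?_, ?_⟩
      · rintro ⟨x, hx⟩
        constructor
        · intro hq
          obtain ⟨y, rfl⟩ := (hs.exact x).mp (congrArg Subtype.val hq)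
          exact ⟨⟨y, hx⟩, rfl⟩
        · rintro ⟨y, hy⟩
          refine Subtype.ext ?_
          have : i y.1 = x := congrArg Subtype.val hy
          exact this ▸ hs.exact.apply_apply_eq_zero y.1
      · rintro ⟨_, y, rfl⟩
        obtain ⟨x, rfl⟩ := hs.surj y
        exact ⟨⟨f • x, x, rfl⟩, Subtype.ext (map_smul' q f x)⟩
    have s2 : SES (M' := M'.quot L) (M := M.quot (smulSub f M)) (M'' := M''.quot (smulSub f M''))
        (L.mapQ _ i le_rfl) ((smulSub f M).mapQ _ q (by
          rintro _ ⟨x, rfl⟩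
          exact ⟨q x, (map_smul' q f x).symm⟩)) := by
      refine ⟨?_, ?_, ?_⟩
      · refine (injective_iff_map_eq_zero _).mpr (L.mkQ_surjective.forall.mpr fun x hx => ?_)
        exact (Submodule.Quotient.mk_eq_zero _).mpr ((Submodule.Quotient.mk_eq_zero _).mp hx :)
      · refine (smulSub f M).mkQ_surjective.forall.mpr fun x => ?_
        constructor
        · intro hx
          obtain ⟨y, hy⟩ := (Submodule.Quotient.mk_eq_zero _).mp hx
          obtain ⟨y, rfl⟩ := hs.surj y
          have h0 : q (x - f • y) = 0 := by
            rw [map_sub, map_smul', sub_eq_zero]; exact hy.symm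
          obtain ⟨z, hz⟩ := (hs.exact _).mp h0
          refine ⟨L.mkQ z, ?_⟩
          change Submodule.Quotient.mk (i z) = Submodule.Quotient.mk x
          rw [hz, Submodule.Quotient.eq]
          exact ⟨-y, by rw [LinearMap.lsmul_apply, smul_neg]; abel⟩
        · rintro ⟨y, hy⟩
          obtain ⟨y, rfl⟩ := L.mkQ_surjective y
          rw [← hy]
          change Submodule.Quotient.mk (q (i y)) = 0
          rw [hs.exact.apply_apply_eq_zero]; rfl
      · refine (smulSub f M'').mkQ_surjective.forall.mpr fun x => ?_
        obtain ⟨x, rfl⟩ := hs.surj x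
        exact ⟨Submodule.Quotient.mk x, rfl⟩
    have tL : IsTors (f ^ n) (M'.sub L) := h.sub_smulSub.of_injective _ s1.inj
    have tQ : IsTors f (M'.quot L) := t0.of_injective _ s2.inj
    have tm : IsTors f ((M'.sub L).quot ((smulSub f M').comap L.subtype)) :=
      t0'.of_injective _ (ses_quot_quot M' hle).inj
    have e1 := ih tL h.sub_smulSub h''.sub_smulSub _ _ s1
    have e2 := hb tQ t0 t0'' _ _ s2
    have e3 := ih.sub_sub hle h'.sub_smulSub tL (tL.quot _)
    have e4 := hb.quot_quot hle t0' tQ tm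
    have e5 := dev_of_isTors hb n _ (tL.quot _) tm
    rw [Obj.dev, Obj.dev, Obj.dev, e1, e2, e3, e4, e5]
    abel

/-- Dévissage: an additive function on modules annihilated by `f` extends to modules annihilated
by a power of `f`. -/
theorem AdditiveOn.exists_dev (hb : AdditiveOn (IsTors f) b) : ∃ φ : Obj Q → A,
    AdditiveOn (IsNilp f) φ ∧ ∀ N, IsTors f N → φ N = b N := by
  classical
  let φ : Obj Q → A := fun N => if h : IsNilp f N then Obj.dev f b (Nat.find h) N else 0
  have hφ : ∀ (N : Obj Q) n, IsTors (f ^ n) N → φ N = Obj.dev f b n N := by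
    intro N n hn
    have h : IsNilp f N := ⟨n, hn⟩
    have h0 : IsTors (f ^ Nat.find h) N := Nat.find_spec h
    have : ∀ k, Obj.dev f b (Nat.find h + k) N = Obj.dev f b (Nat.find h) N := by
      intro k
      induction k with
      | zero => rfl
      | succ k ih =>
        rw [← add_assoc, dev_succ hb _ N (by rw [pow_add, mul_comm]; exact h0.mul _), ih]
    obtain ⟨k, hk⟩ := Nat.exists_eq_add_of_le (Nat.find_min' h hn)
    have e := this k
    rw [← hk] at e
    change (if h : IsNilp f N then Obj.dev f b (Nat.find h) N else 0) = _
    rw [dif_pos h, e]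
  refine ⟨φ, ?_, fun N h => ?_⟩
  · rintro M' M M'' ⟨n', h'⟩ ⟨n, h⟩ ⟨n'', h''⟩ i q hs
    have t' : IsTors (f ^ (n' + n + n'')) M' := by
      rw [add_assoc, add_comm, pow_add]; exact h'.mul _
    have t : IsTors (f ^ (n' + n + n'')) M := by
      rw [add_right_comm, pow_add]; exact h.mul _
    have t'' : IsTors (f ^ (n' + n + n'')) M'' := by
      rw [pow_add]; exact h''.mul _
    rw [hφ _ _ t', hφ _ _ t, hφ _ _ t'']
    exact hb.dev _ t' t t'' i q hs
  · rw [hφ N 1 (by rw [pow_one]; exact h), dev_of_isTors hb 1 N (by rw [pow_one]; exact h) h]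

theorem AdditiveOn.dev_step {φ : Obj Q → A} (hφ : AdditiveOn (IsNilp f) φ) {N : Obj Q}
    (h : IsNilp f N) : φ N = φ (N.sub (smulSub f N)) + φ (N.quot (smulSub f N)) :=
  hφ (h.sub _) h (h.quot _) _ _ (ses_mkQ N _)

theorem AdditiveOn.eq_of_isTors {φ φ' : Obj Q → A} (hφ : AdditiveOn (IsNilp f) φ)
    (hφ' : AdditiveOn (IsNilp f) φ') (h : ∀ N, IsTors f N → φ N = φ' N) (N : Obj Q)
    (hN : IsNilp f N) : φ N = φ' N := by
  obtain ⟨n, hn⟩ := hN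
  induction n generalizing N with
  | zero =>
    have := hn.subsingleton
    rw [hφ.map_subsingleton N ⟨0, hn⟩, hφ'.map_subsingleton N ⟨0, hn⟩]
  | succ n ih =>
    rw [hφ.dev_step ⟨_, hn⟩, hφ'.dev_step ⟨_, hn⟩, ih _ hn.sub_smulSub,
      h _ (quot_smulSub hn.1 hn.2.1)]

/-- `N'` is the shift of `N` by one. -/
def IsShift (N N' : Obj Q) : Prop :=
  ∃ σ : N ≃ₗ[Q] N', ∀ i x, σ (opE Q i • x) = opE Q (i + 1) • σ x

/-- If `f` kills `N`, the cone of the identity with `s = 0` is an acyclic Koszul module that is an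
extension of the shift by `N`, so the two values cancel. Powers of `f` are handled by induction
through `f N` and `N / f N`. -/
theorem AdditiveOn.add_eq_zero_of_isShift {φ : Obj Q → A} (hφ : AdditiveOn (IsNilp f) φ)
    (hb : AdditiveOn (IsKoszul f) b) (ha : ∀ M, IsKoszul f M → Acyclic M → b M = 0)
    (h : ∀ N, IsTors f N → φ N = b N) (n : ℕ) : ∀ N N' : Obj Q, IsShift N N' →
    IsTors (f ^ n) N → IsTors (f ^ n) N' → φ N + φ N' = 0 := by
  have h1 : ∀ N N' : Obj Q, IsShift N N' → IsTors f N → IsTors f N' → b N + b N' = 0 := by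
    rintro N N' ⟨σ, hσ⟩ t t'
    have hσ' : ∀ i x, σ.symm (opE Q (i + 1) • x) = opE Q i • σ.symm x := fun i x => by
      rw [σ.symm_apply_eq, hσ, σ.apply_symm_apply]
    let d : Module.End Q (N × N') := LinearMap.inl Q N N' ∘ₗ σ.symm.toLinearMap ∘ₗ
      LinearMap.snd Q N N'
    have hd : ∀ x, d x = (σ.symm x.2, 0) := fun _ => rfl
    obtain ⟨P, ψ, hE, hD, hS⟩ := exists_of_isGrading (N.isGrading.prodMap N'.isGrading) d 0
      (fun i x => by
        have := hσ' (i - 1) x.2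
        rw [sub_add_cancel] at this
        simp only [hd, LinearMap.prodMap_apply, act_apply, this, smul_zero])
      (fun i x => (map_zero ((N.act (opE Q (i + 1))).prodMap (N'.act (opE Q (i + 1))))).symm)
      (fun x => by simp [hd])
    have kP : IsKoszul f P := by
      refine ⟨fun x => ψ.injective ?_, fun x => ψ.injective ?_⟩
      · rw [hS, map_zero]; rfl
      · rw [map_add, hD, hS, hS, map_smul ψ f, LinearMap.zero_apply, LinearMap.zero_apply,
          map_zero, add_zero]
        exact (Prod.ext (t.2.2 _) (t'.2.2 _)).symm
    have aP : Acyclic P := by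
      intro x hx
      have h0 := hD x
      rw [hx, map_zero, hd] at h0
      have h2 : (ψ x).2 = 0 := σ.symm.injective
        ((congrArg Prod.fst h0).symm.trans (map_zero σ.symm).symm)
      refine ⟨ψ.symm (0, σ (ψ x).1), ψ.injective ?_⟩
      rw [hD, ψ.apply_symm_apply, hd]
      exact Prod.ext (σ.symm_apply_apply _) h2.symm
    let i : N →ₗ[Op Q] P := homOfCommute (ψ.symm.toLinearMap ∘ₗ LinearMap.inl Q N N')
      (fun i x => ψ.injective (by rw [hE]; simp))
      (fun x => ψ.injective (by rw [hD]; simp [hd, t.1])) (fun x => ψ.injective (by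
        rw [hS]; simp [t.2.1]))
    let q : P →ₗ[Op Q] N' := homOfCommute (LinearMap.snd Q N N' ∘ₗ ψ.toLinearMap)
      (fun i x => by
        change (ψ _).2 = _ • (ψ x).2
        rw [hE]; rfl)
      (fun x => by
        change (ψ _).2 = _ • (ψ x).2
        rw [hD, t'.1, hd]) (fun x => by
        change (ψ _).2 = _ • (ψ x).2
        rw [hS, t'.2.1]; rfl)
    have hi : ∀ x, ψ (i x) = (x, 0) := fun x => ψ.apply_symm_apply _
    have hq : ∀ x, q x = (ψ x).2 := fun _ => rfl
    rw [← hb t.isKoszul kP t'.isKoszul i q ⟨fun x y hxy => ?_, fun x => ?_, fun y => ?_⟩, ha P kP aP]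
    · have := congrArg ψ hxy
      rw [hi, hi] at this
      exact congrArg Prod.fst this
    · rw [hq]
      refine ⟨fun hx => ⟨(ψ x).1, ψ.injective ?_⟩, ?_⟩
      · rw [hi, ← hx]
      · rintro ⟨y, rfl⟩
        rw [hi]
    · exact ⟨ψ.symm (0, y), by rw [hq, ψ.apply_symm_apply]⟩
  induction n with
  | zero =>
    intro N N' _ t t'
    have := t.subsingleton
    have := t'.subsingleton
    rw [hφ.map_subsingleton N ⟨0, t⟩, hφ.map_subsingleton N' ⟨0, t'⟩, add_zero]
  | succ n ih =>
    rintro N N' ⟨σ, hσ⟩ t t'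
    have m1 : ((smulSub f N).restrictScalars Q).map σ.toLinearMap =
        (smulSub f N').restrictScalars Q := by
      ext x
      constructor
      · rintro ⟨_, ⟨y, rfl⟩, rfl⟩
        exact ⟨σ y, (map_smul σ f y).symm⟩
      · rintro ⟨y, rfl⟩
        exact ⟨f • σ.symm y, ⟨σ.symm y, rfl⟩, by simp⟩
    have e1 := ih (N.sub (smulSub f N)) (N'.sub (smulSub f N'))
      ⟨σ.ofSubmodules _ _ m1, fun i x => Subtype.ext (hσ i x.1)⟩ t.sub_smulSub t'.sub_smulSub
    let τ : N.quot (smulSub f N) ≃ₗ[Q] N'.quot (smulSub f N') :=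
      Submodule.Quotient.equiv ((smulSub f N).restrictScalars Q)
        ((smulSub f N').restrictScalars Q) σ m1
    have hτ : ∀ x, τ ((smulSub f N).mkQ x) = (smulSub f N').mkQ (σ x) := fun _ => rfl
    have e2 := h1 (N.quot (smulSub f N)) (N'.quot (smulSub f N'))
      ⟨τ, fun i => (smulSub f N).mkQ_surjective.forall.mpr fun x => by
        rw [← map_smul, hτ, hτ, hσ, map_smul]⟩ (quot_smulSub t.1 t.2.1)
        (quot_smulSub t'.1 t'.2.1)
    rw [hφ.dev_step ⟨_, t⟩, hφ.dev_step ⟨_, t'⟩, h _ (quot_smulSub t.1 t.2.1),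
      h _ (quot_smulSub t'.1 t'.2.1), add_add_add_comm, e1, e2, add_zero]

end Obj
end CyclicAdams

namespace CyclicAdams

universe u v w
namespace Obj

variable {Q : Type u} [CommRing Q]

/-! ## Homology -/

/-- The cycles. -/
abbrev cycles (X : Obj Q) : Submodule Q X := LinearMap.ker (X.act (opD Q))

theorem mem_cycles {X : Obj Q} {x : X} : x ∈ X.cycles ↔ opD Q • x = 0 := Iff.rfl

theorem e_mem_cycles {X : Obj Q} (i : ℤ) {x : X} (hx : x ∈ X.cycles) :
    opE Q i • x ∈ X.cycles := by
  rw [mem_cycles] at hx ⊢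
  rw [X.isGraded.d_e, hx, smul_zero]

theorem d_mem_cycles {X : Obj Q} (x : X) : opD Q • x ∈ X.cycles := X.isGraded.d_d x

/-- The graded module `N`, with zero operators, is the homology of `X`, by the map `π` that sends
a cycle to its class. -/
structure IsHomology (X N : Obj Q) (π : X.cycles →ₗ[Q] N) : Prop where
  d : ∀ x : N, opD Q • x = 0
  s : ∀ x : N, opS Q • x = 0
  surj : Function.Surjective π
  ker : ∀ z : X.cycles, π z = 0 ↔ ∃ y : X, opD Q • y = z
  e : ∀ i (z : X.cycles), π ⟨opE Q i • z.1, e_mem_cycles i z.2⟩ = opE Q i • π z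

/-- The linear map induced on a quotient. -/
theorem exists_factor {Z M N : Type*} [AddCommGroup Z] [Module Q Z] [AddCommGroup M] [Module Q M]
    [AddCommGroup N] [Module Q N] (π : Z →ₗ[Q] M) (hπ : Function.Surjective π) (g : Z →ₗ[Q] N)
    (h : ∀ z, π z = 0 → g z = 0) : ∃ g' : M →ₗ[Q] N, ∀ z, g' (π z) = g z := by
  refine ⟨(LinearMap.ker π).liftQ g h ∘ₗ (π.quotKerEquivOfSurjective hπ).symm.toLinearMap,
    fun z => ?_⟩
  have : (π.quotKerEquivOfSurjective hπ).symm (π z) = (LinearMap.ker π).mkQ z := by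
    rw [LinearEquiv.symm_apply_eq]; rfl
  change (LinearMap.ker π).liftQ g h ((π.quotKerEquivOfSurjective hπ).symm (π z)) = _
  rw [this]; rfl

theorem exists_equiv_of_ker_eq {Z M N : Type*} [AddCommGroup Z] [Module Q Z] [AddCommGroup M]
    [Module Q M] [AddCommGroup N] [Module Q N] (π : Z →ₗ[Q] M) (hπ : Function.Surjective π)
    (g : Z →ₗ[Q] N) (hg : Function.Surjective g) (h : ∀ z, π z = 0 ↔ g z = 0) :
    ∃ σ : M ≃ₗ[Q] N, ∀ z, σ (π z) = g z := by
  obtain ⟨a, ha⟩ := exists_factor π hπ g fun z => (h z).mp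
  obtain ⟨b, hb⟩ := exists_factor g hg π fun z => (h z).mpr
  exact ⟨LinearEquiv.ofLinearMap a b (LinearMap.ext (hg.forall.mpr fun z => by simp [ha, hb]))
    (LinearMap.ext (hπ.forall.mpr fun z => by simp [ha, hb])), ha⟩

theorem exists_isHomology [IsNoetherianRing Q] (X : Obj Q) : ∃ N π, IsHomology X N π := by
  let B : Submodule Q X.cycles := (LinearMap.range (X.act (opD Q))).submoduleOf X.cycles
  let e : ℤ → Module.End Q (X.cycles ⧸ B) := fun i => B.mapQ B
    ((X.act (opE Q i)).restrict fun x hx => e_mem_cycles i hx) (by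
      rintro ⟨_, hz⟩ ⟨y, rfl⟩
      exact ⟨opE Q (i + 1) • y, (X.e_d i y).symm⟩)
  have he : ∀ i z, e i (B.mkQ z) = B.mkQ ⟨opE Q i • z.1, e_mem_cycles i z.2⟩ := fun _ _ => rfl
  have hg : IsGrading e := by
    refine ⟨fun i => B.mkQ_surjective.forall.mpr fun z => ?_,
      fun i j hij => B.mkQ_surjective.forall.mpr fun z => ?_, ?_⟩
    · rw [he, he]
      exact congrArg B.mkQ (Subtype.ext (X.isGraded.e_e _ _))
    · rw [he, he]
      exact (congrArg B.mkQ (Subtype.ext (X.isGraded.e_ne _ _ hij _))).trans (map_zero B.mkQ)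
    · obtain ⟨S, h1, h2⟩ := X.isGraded.bdd
      refine ⟨S, fun i hi => B.mkQ_surjective.forall.mpr fun z => ?_,
        B.mkQ_surjective.forall.mpr fun z => ?_⟩
      · rw [he]
        exact (congrArg B.mkQ (Subtype.ext (h1 i hi _))).trans (map_zero B.mkQ)
      · simp only [he]
        rw [← map_sum]
        refine congrArg B.mkQ (Subtype.ext ?_)
        rw [AddSubmonoidClass.coe_finsetSum]
        exact h2 _
  obtain ⟨N, φ, hE, hD, hS⟩ := exists_of_isGrading hg 0 0
    (fun i x => (map_zero (e (i - 1))).symm) (fun i x => (map_zero (e (i + 1))).symm)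
    (fun x => rfl)
  refine ⟨N, φ.symm.toLinearMap ∘ₗ B.mkQ, fun x => φ.injective ?_, fun x => φ.injective ?_,
    φ.symm.surjective.comp B.mkQ_surjective, fun z => ?_, fun i z => φ.injective ?_⟩
  · rw [hD, map_zero]; rfl
  · rw [hS, map_zero]; rfl
  · rw [LinearMap.comp_apply, LinearEquiv.coe_coe, map_eq_zero_iff φ.symm φ.symm.injective,
      Submodule.mkQ_apply, Submodule.Quotient.mk_eq_zero]
    rfl
  · rw [hE]
    simp only [LinearMap.comp_apply, LinearEquiv.coe_coe, LinearEquiv.apply_symm_apply]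
    rfl

section

variable {X N Y N' : Obj Q} {π : X.cycles →ₗ[Q] N} {π' : Y.cycles →ₗ[Q] N'}

/-- A chain map induces a map on homology. -/
theorem IsHomology.exists_map (h : IsHomology X N π) (h' : IsHomology Y N' π') (g : X →ₗ[Q] Y)
    (ge : ∀ i x, g (opE Q i • x) = opE Q i • g x) (gd : ∀ x, g (opD Q • x) = opD Q • g x) :
    ∃ g' : N →ₗ[Op Q] N', ∀ (z : X.cycles) (hz : g z ∈ Y.cycles), g' (π z) = π' ⟨g z, hz⟩ := by
  have hz : ∀ z ∈ X.cycles, g z ∈ Y.cycles := fun z hz => by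
    rw [mem_cycles] at hz ⊢
    rw [← gd, hz, map_zero]
  obtain ⟨g', hg'⟩ := exists_factor π h.surj (π' ∘ₗ g.restrict hz) fun z hz0 => by
    obtain ⟨y, hy⟩ := (h.ker z).mp hz0
    refine (h'.ker _).mpr ⟨g y, ?_⟩
    rw [← gd, hy]; rfl
  refine ⟨homOfCommute g' (fun i => h.surj.forall.mpr fun z => ?_)
    (fun x => by rw [h.d, h'.d, map_zero]) (fun x => by rw [h.s, h'.s, map_zero]),
    fun z _ => hg' z⟩
  rw [← h.e, hg', hg', LinearMap.comp_apply, LinearMap.comp_apply, ← h'.e]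
  exact congrArg π' (Subtype.ext (ge i z))

/-- Chain maps that are inverse to each other up to homotopy induce isomorphisms on homology. -/
theorem IsHomology.nonempty_equiv (h : IsHomology X N π) (h' : IsHomology Y N' π')
    (g : X →ₗ[Q] Y) (ge : ∀ i x, g (opE Q i • x) = opE Q i • g x)
    (gd : ∀ x, g (opD Q • x) = opD Q • g x) (g' : Y →ₗ[Q] X)
    (ge' : ∀ i x, g' (opE Q i • x) = opE Q i • g' x) (gd' : ∀ x, g' (opD Q • x) = opD Q • g' x)
    (k : X → X) (hk : ∀ x, opD Q • x = 0 → g' (g x) - x = opD Q • k x)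
    (k' : Y → Y) (hk' : ∀ x, opD Q • x = 0 → g (g' x) - x = opD Q • k' x) :
    Nonempty (N ≃ₗ[Op Q] N') := by
  obtain ⟨a, ha⟩ := h.exists_map h' g ge gd
  obtain ⟨b, hb⟩ := h'.exists_map h g' ge' gd'
  have hz : ∀ z ∈ X.cycles, g z ∈ Y.cycles := fun z hz => by
    rw [mem_cycles] at hz ⊢
    rw [← gd, hz, map_zero]
  have hz' : ∀ z ∈ Y.cycles, g' z ∈ X.cycles := fun z hz => by
    rw [mem_cycles] at hz ⊢
    rw [← gd', hz, map_zero]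
  refine ⟨LinearEquiv.ofLinearMap a b (LinearMap.ext (h'.surj.forall.mpr fun z => ?_))
    (LinearMap.ext (h.surj.forall.mpr fun z => ?_))⟩
  · rw [LinearMap.comp_apply, hb z (hz' _ z.2), ha _ (hz _ (hz' _ z.2)), LinearMap.id_apply,
      ← sub_eq_zero, ← map_sub]
    exact (h'.ker _).mpr ⟨k' z, (hk' z z.2).symm⟩
  · rw [LinearMap.comp_apply, ha z (hz _ z.2), hb _ (hz' _ (hz _ z.2)), LinearMap.id_apply,
      ← sub_eq_zero, ← map_sub]
    exact (h.ker _).mpr ⟨k z, (hk z z.2).symm⟩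

end

theorem IsHomology.isNilp {X N : Obj Q} {π : X.cycles →ₗ[Q] N} (h : IsHomology X N π) {f : Q}
    {n : ℕ} (hn : ∀ x : X, opD Q • x = 0 → ∃ y : X, opD Q • y = f ^ n • x) : IsNilp f N :=
  ⟨n, h.d, h.s, h.surj.forall.mpr fun z => by
    rw [← map_smul, h.ker]; exact hn z z.2⟩

/-- The homology of `X` is annihilated by a power of `f`. -/
def HasNilpHomology (f : Q) (X : Obj Q) : Prop :=
  ∃ n : ℕ, ∀ x : X, opD Q • x = 0 → ∃ y : X, opD Q • y = f ^ n • x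

theorem IsSupp.hasNilpHomology {f : Q} {X : Obj Q} (h : IsSupp f X) : HasNilpHomology f X := h.2

theorem IsKoszul.hasNilpHomology {f : Q} {X : Obj Q} (h : IsKoszul f X) : HasNilpHomology f X :=
  ⟨1, fun x hx => ⟨opS Q • x, by
    have := h.2 x
    rw [hx, smul_zero, add_zero] at this
    rw [this, pow_one]⟩⟩

variable [IsNoetherianRing Q] {A : Type*} [AddCommGroup A] {f : Q}

/-- The long exact homology sequence, for additive functions. -/
theorem AdditiveOn.map_homology {φ : Obj Q → A} (hφ : AdditiveOn (IsNilp f) φ)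
    (hs : ∀ N N' : Obj Q, IsShift N N' → IsNilp f N → IsNilp f N' → φ N + φ N' = 0)
    {X' X X'' N' N N'' : Obj Q} {π' : X'.cycles →ₗ[Q] N'} {π : X.cycles →ₗ[Q] N}
    {π'' : X''.cycles →ₗ[Q] N''} (h' : IsHomology X' N' π') (h : IsHomology X N π)
    (h'' : IsHomology X'' N'' π'') (t' : IsNilp f N') (t : IsNilp f N) (t'' : IsNilp f N'')
    (i : X' →ₗ[Op Q] X) (q : X →ₗ[Op Q] X'') (hiq : SES i q) : φ N = φ N' + φ N'' := by
  obtain ⟨a, ha⟩ := h'.exists_map h (i.restrictScalars Q) (fun _ => map_smul i _) (map_smul i _)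
  obtain ⟨b, hb⟩ := h.exists_map h'' (q.restrictScalars Q) (fun _ => map_smul q _) (map_smul q _)
  have hi : ∀ z ∈ X'.cycles, i z ∈ X.cycles := fun z hz => by
    rw [mem_cycles] at hz ⊢
    rw [← map_smul, hz, map_zero]
  have hi' : ∀ z, i z ∈ X.cycles → z ∈ X'.cycles := fun z hz => hiq.inj (by
    rw [act_apply, map_smul, map_zero]; exact hz)
  have hq : ∀ z ∈ X.cycles, q z ∈ X''.cycles := fun z hz => by
    rw [mem_cycles] at hz ⊢
    rw [← map_smul, hz, map_zero]
  have hab : Function.Exact a b := by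
    refine h.surj.forall.mpr fun z => ?_
    rw [hb z (hq _ z.2), h''.ker]
    constructor
    · rintro ⟨y, hy⟩
      obtain ⟨y, rfl⟩ := hiq.surj y
      have h0 : q (z.1 - opD Q • y) = 0 := by
        rw [map_sub, map_smul, hy]; exact sub_self _
      obtain ⟨x, hx⟩ := (hiq.exact _).mp h0
      have hxc : x ∈ X'.cycles := hi' x (by
        rw [hx]; exact X.cycles.sub_mem z.2 (d_mem_cycles y))
      refine ⟨π' ⟨x, hxc⟩, ?_⟩
      rw [ha _ (hi _ hxc), ← sub_eq_zero, ← map_sub, h.ker]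
      refine ⟨-y, ?_⟩
      change _ = i x - z.1
      rw [hx, smul_neg]; abel
    · rintro ⟨n, hn⟩
      obtain ⟨x, rfl⟩ := h'.surj n
      rw [ha _ (hi _ x.2), eq_comm, ← sub_eq_zero, ← map_sub, h.ker] at hn
      obtain ⟨y, hy⟩ := hn
      refine ⟨q y, ?_⟩
      rw [← map_smul, hy]
      change q (z.1 - i x) = q z.1
      rw [map_sub, hiq.exact.apply_apply_eq_zero, sub_zero]
  -- `T` is the relation behind the connecting homomorphism: pairs with `d x = i x'`. Sending such a
  -- pair to the class of `x'` in `ker a`, or to the class of `q x` in the cokernel of `b`, gives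
  -- two surjections with the same kernel. They identify these modules up to a shift by one.
  let T : Submodule Q (X × X') :=
    LinearMap.ker ((X.act (opD Q)).coprod (-(i.restrictScalars Q)))
  have hT : ∀ x : X × X', x ∈ T ↔ opD Q • x.1 = i x.2 := fun x => by
    rw [← sub_eq_zero, sub_eq_add_neg]; rfl
  have hT1 : ∀ x : T, q x.1.1 ∈ X''.cycles := fun x => by
    rw [mem_cycles, ← map_smul, (hT _).mp x.2, hiq.exact.apply_apply_eq_zero]
  have hT2 : ∀ x : T, x.1.2 ∈ X'.cycles := fun x => hi' _ (by
    rw [← (hT _).mp x.2]; exact d_mem_cycles _)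
  let α₀ : T →ₗ[Q] N' := π' ∘ₗ (LinearMap.snd Q X X' ∘ₗ T.subtype).codRestrict X'.cycles hT2
  have hα₀ : ∀ x : T, α₀ x = π' ⟨x.1.2, hT2 x⟩ := fun _ => rfl
  let α : T →ₗ[Q] N'.sub (LinearMap.ker a) :=
    α₀.codRestrict ((LinearMap.ker a).restrictScalars Q) fun x => by
      change a (α₀ x) = 0
      rw [hα₀, ha _ (hi _ (hT2 x)), h.ker]
      exact ⟨x.1.1, (hT _).mp x.2⟩
  have hα : ∀ x : T, (α x).1 = π' ⟨x.1.2, hT2 x⟩ := fun _ => rfl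
  let γ : T →ₗ[Q] N''.quot (LinearMap.range b) := (LinearMap.range b).mkQ.restrictScalars Q ∘ₗ
    π'' ∘ₗ (q.restrictScalars Q ∘ₗ LinearMap.fst Q X X' ∘ₗ T.subtype).codRestrict X''.cycles hT1
  have hγ : ∀ x : T, γ x = (LinearMap.range b).mkQ (π'' ⟨q x.1.1, hT1 x⟩) := fun _ => rfl
  have hαs : Function.Surjective α := by
    rintro ⟨n, hn⟩
    obtain ⟨x', rfl⟩ := h'.surj n
    rw [LinearMap.mem_ker, ha _ (hi _ x'.2), h.ker] at hn
    obtain ⟨x, hx⟩ := hn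
    exact ⟨⟨(x, x'.1), (hT _).mpr hx⟩, Subtype.ext rfl⟩
  have hγs : Function.Surjective γ := by
    intro n
    obtain ⟨n, rfl⟩ := Submodule.mkQ_surjective _ n
    obtain ⟨⟨x, hx⟩, rfl⟩ := h''.surj n
    obtain ⟨x, rfl⟩ := hiq.surj x
    rw [mem_cycles, ← map_smul] at hx
    obtain ⟨x', hx'⟩ := (hiq.exact _).mp hx
    exact ⟨⟨(x, x'), (hT _).mpr hx'.symm⟩, rfl⟩
  have hker : ∀ x, α x = 0 ↔ γ x = 0 := by
    intro x
    rw [hγ, Submodule.mkQ_apply, Submodule.Quotient.mk_eq_zero]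
    have e1 : α x = 0 ↔ ∃ y : X', opD Q • y = x.1.2 := by
      rw [← h'.ker ⟨_, hT2 x⟩, ← hα]
      exact Subtype.ext_iff
    rw [e1]
    constructor
    · rintro ⟨y, hy⟩
      have hz : x.1.1 - i y ∈ X.cycles := by
        rw [mem_cycles, smul_sub, ← map_smul, hy, (hT _).mp x.2, sub_self]
      refine ⟨π ⟨_, hz⟩, ?_⟩
      rw [hb _ (hq _ hz)]
      refine congrArg π'' (Subtype.ext ?_)
      change q (x.1.1 - i y) = q x.1.1
      rw [map_sub, hiq.exact.apply_apply_eq_zero, sub_zero]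
    · rintro ⟨n, hn⟩
      obtain ⟨z, rfl⟩ := h.surj n
      rw [hb _ (hq _ z.2), eq_comm, ← sub_eq_zero, ← map_sub, h''.ker] at hn
      obtain ⟨y, hy⟩ := hn
      obtain ⟨y, rfl⟩ := hiq.surj y
      have h0 : q (x.1.1 - z.1 - opD Q • y) = 0 := by
        rw [map_sub, map_smul, hy, map_sub]; exact sub_self _
      obtain ⟨y', hy'⟩ := (hiq.exact _).mp h0
      refine ⟨y', hiq.inj ?_⟩
      rw [map_smul, hy', smul_sub, smul_sub, X.isGraded.d_d, mem_cycles.mp z.2, sub_zero, sub_zero,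
        (hT _).mp x.2]
  obtain ⟨σ, hσ⟩ := exists_equiv_of_ker_eq α hαs γ hγs hker
  have hshift : IsShift (N'.sub (LinearMap.ker a)) (N''.quot (LinearMap.range b)) := by
    refine ⟨σ, fun j => hαs.forall.mpr fun x => ?_⟩
    have hx : (opE Q (j + 1) • x.1.1, opE Q j • x.1.2) ∈ T := by
      rw [hT]
      change opD Q • opE Q (j + 1) • x.1.1 = i (opE Q j • x.1.2)
      rw [← X.e_d, (hT _).mp x.2, map_smul]
    have e1 : opE Q j • α x = α ⟨_, hx⟩ := Subtype.ext (by
      change opE Q j • (α x).1 = _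
      rw [hα, hα, ← h'.e])
    rw [e1, hσ, hσ, hγ, hγ, ← map_smul, ← h''.e]
    exact congrArg (fun z => (LinearMap.range b).mkQ (π'' z)) (Subtype.ext (map_smul q _ _))
  have e0 := hs _ _ hshift (t'.sub _) (t''.quot _)
  have e1 := hφ (t'.sub (LinearMap.ker a)) t' (t.sub (LinearMap.ker b)) (LinearMap.ker a).subtype
    (a.codRestrict (LinearMap.ker b) fun x => hab.apply_apply_eq_zero x) ⟨Subtype.val_injective,
      fun x => ⟨fun hx => ⟨⟨x, congrArg Subtype.val hx⟩, rfl⟩, fun ⟨y, hy⟩ =>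
        Subtype.ext (hy ▸ y.2)⟩, fun ⟨y, hy⟩ => by
        obtain ⟨x, rfl⟩ := (hab y).mp hy
        exact ⟨x, rfl⟩⟩
  have e2 := hφ (t.sub (LinearMap.ker b)) t (t''.sub (LinearMap.range b)) (LinearMap.ker b).subtype
    b.rangeRestrict ⟨Subtype.val_injective, fun x => ⟨fun hx => ⟨⟨x, congrArg Subtype.val hx⟩, rfl⟩,
      fun ⟨y, hy⟩ => Subtype.ext (hy ▸ y.2)⟩, b.surjective_rangeRestrict⟩
  have e3 := hφ (t''.sub (LinearMap.range b)) t'' (t''.quot _) _ _ (ses_mkQ N'' (LinearMap.range b))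
  -- Everything cancels except the values at `ker a` and at the cokernel of `b`, whose sum is zero
  -- by the shift.
  rw [e1, e2, e3, ← sub_eq_zero, ← neg_eq_zero, ← e0]
  abel

/-- A choice of homology. -/
noncomputable def homology (X : Obj Q) : Obj Q := X.exists_isHomology.choose

/-- The class of a cycle. -/
noncomputable def homologyπ (X : Obj Q) : X.cycles →ₗ[Q] X.homology :=
  X.exists_isHomology.choose_spec.choose

theorem isHomology (X : Obj Q) : IsHomology X X.homology X.homologyπ :=
  X.exists_isHomology.choose_spec.choose_spec

/-- The function `φ` on modules annihilated by a power of `f` is additive, agrees on those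
annihilated by `f` with a function on Koszul modules, and vanishes on acyclic ones. -/
structure IsDev (f : Q) (b φ : Obj Q → A) : Prop where
  koszul : AdditiveOn (IsKoszul f) b
  acyclic : ∀ M, IsKoszul f M → Acyclic M → b M = 0
  nilp : AdditiveOn (IsNilp f) φ
  eq : ∀ N, IsTors f N → φ N = b N

theorem IsDev.add_eq_zero {b φ : Obj Q → A} (h : IsDev f b φ) {N N' : Obj Q} (hs : IsShift N N') :
    IsNilp f N → IsNilp f N' → φ N + φ N' = 0 := by
  rintro ⟨n, hn⟩ ⟨n', hn'⟩
  refine h.nilp.add_eq_zero_of_isShift h.koszul h.acyclic h.eq (n + n') N N' hs ?_ ?_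
  · rw [pow_add, mul_comm]; exact hn.mul _
  · rw [pow_add]; exact hn'.mul _

theorem IsDev.additiveOn_homology {b φ : Obj Q → A} (h : IsDev f b φ) :
    AdditiveOn (HasNilpHomology f) fun X => φ X.homology := by
  rintro X' X X'' ⟨n', h'⟩ ⟨n, hn⟩ ⟨n'', h''⟩ i q hs
  exact h.nilp.map_homology (fun _ _ => h.add_eq_zero) X'.isHomology X.isHomology X''.isHomology
    (X'.isHomology.isNilp h') (X.isHomology.isNilp hn) (X''.isHomology.isNilp h'') i q hs

theorem IsDev.map_homology_of_acyclic {b φ : Obj Q → A} (h : IsDev f b φ) {X : Obj Q}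
    (hX : X.Acyclic) : φ X.homology = 0 := by
  have hz : ∀ x : X.homology, x = 0 := X.isHomology.surj.forall.mpr fun z =>
    (X.isHomology.ker z).mpr (hX z z.2)
  have : Subsingleton X.homology := ⟨fun x y => by rw [hz x, hz y]⟩
  exact h.nilp.map_subsingleton _ ⟨0, X.isHomology.d, X.isHomology.s, fun x => by
    rw [hz x, smul_zero]⟩

theorem IsDev.map_homology_of_isNilp {b φ : Obj Q → A} (h : IsDev f b φ) {X : Obj Q}
    (hX : IsNilp f X) : φ X.homology = φ X := by
  have hd : ∀ x : X, x ∈ X.cycles := hX.choose_spec.1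
  let g : X →ₗ[Q] X.homology := X.homologyπ ∘ₗ LinearMap.id.codRestrict X.cycles hd
  have hg : ∀ x, g x = X.homologyπ ⟨x, hd x⟩ := fun _ => rfl
  have hH := X.isHomology
  have hs := hX.choose_spec.2.1
  have hbij : Function.Bijective g := by
    refine ⟨(injective_iff_map_eq_zero g).mpr fun x hx => ?_, fun n => ?_⟩
    · rw [hg, hH.ker] at hx
      obtain ⟨y, hy⟩ := hx
      exact hy.symm.trans (hd y)
    · obtain ⟨z, rfl⟩ := hH.surj n
      exact ⟨z, rfl⟩
  refine (h.nilp.map_equiv ⟨0, isTors_zero _⟩ hX ?_ (LinearEquiv.ofBijective (homOfCommute g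
    (fun i x => (hH.e i ⟨x, hd x⟩)) (fun x => ?_) (fun x => ?_)) hbij)).symm
  · exact hH.isNilp (n := hX.choose) fun x _ => ⟨0, by
      rw [smul_zero, hX.choose_spec.2.2]⟩
  · rw [hH.d, show opD Q • x = 0 from hd x, map_zero]
  · rw [hH.s, hs, map_zero]

end Obj
/-! ## Grothendieck groups -/

namespace K0

variable {O : Type v} {ses : O → O → O → Prop} {htpy : O → O → Prop}

theorem cls_of_ses {P' P P'' : O} (h : ses P' P P'') :
    (cls P : K0 O ses htpy) = cls P' + cls P'' := by
  rw [← sub_eq_zero]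
  exact (QuotientAddGroup.eq_zero_iff _).mpr
    (AddSubgroup.subset_closure (Or.inl ⟨P', P, P'', h, rfl⟩))

theorem cls_of_htpy {P P' : O} (h : htpy P P') : (cls P : K0 O ses htpy) = cls P' := by
  rw [← sub_eq_zero]
  exact (QuotientAddGroup.eq_zero_iff _).mpr (AddSubgroup.subset_closure (Or.inr ⟨P, P', h, rfl⟩))

variable {A : Type w} [AddCommGroup A]

/-- The universal property. -/
def lift (F : O → A) (h₁ : ∀ P' P P'', ses P' P P'' → F P = F P' + F P'')
    (h₂ : ∀ P P', htpy P P' → F P = F P') : K0 O ses htpy →+ A :=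
  QuotientAddGroup.lift _ (FreeAbelianGroup.lift F) (by
    rw [AddSubgroup.closure_le]
    rintro x (⟨P', P, P'', h, rfl⟩ | ⟨P, P', h, rfl⟩)
    · simp [h₁ _ _ _ h]
    · simp [h₂ _ _ h])

@[simp] theorem lift_cls (F : O → A) (h₁ : ∀ P' P P'', ses P' P P'' → F P = F P' + F P'')
    (h₂ : ∀ P P', htpy P P' → F P = F P') (P : O) :
    lift F h₁ h₂ (cls P : K0 O ses htpy) = F P := FreeAbelianGroup.lift_apply_of F P

theorem induction {C : K0 O ses htpy → Prop} (h : ∀ P, C (cls P)) (h0 : C 0)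
    (ha : ∀ x y, C x → C y → C (x + y)) (hn : ∀ x, C x → C (-x)) (x : K0 O ses htpy) : C x := by
  obtain ⟨x, rfl⟩ := QuotientAddGroup.mk_surjective x
  induction x using FreeAbelianGroup.induction_on with
  | zero => exact h0
  | of P => exact h P
  | neg P _ => exact hn _ (h P)
  | add x y hx hy => exact ha _ _ hx hy

theorem hom_ext {φ ψ : K0 O ses htpy →+ A} (h : ∀ P, φ (cls P) = ψ (cls P)) : φ = ψ := by
  refine DFunLike.ext _ _ fun x => ?_
  induction x using induction with
  | h P => exact h P
  | h0 => rw [map_zero, map_zero]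
  | ha x y hx hy => rw [map_add, map_add, hx, hy]
  | hn x hx => rw [map_neg, map_neg, hx]

end K0

namespace CurvedModule

variable {Γ : Type} [CommRing Γ] {Q : Type u} [CommRing Q] {f : Q}

theorem isHomotopy_zero {P P' : CurvedModule Γ Q f} {g₁ g₂ : P.carrier →ₗ[Q] P'.carrier}
    (h : g₁ = g₂) : IsHomotopy P P' 0 g₁ g₂ :=
  ⟨fun _ => by rw [LinearMap.zero_comp, LinearMap.comp_zero],
    by rw [LinearMap.comp_zero, LinearMap.zero_comp, h, sub_self, add_zero]⟩

theorem IsHom.symm {P P' : CurvedModule Γ Q f} {φ : P.carrier ≃ₗ[Q] P'.carrier}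
    (h : IsHom P P' φ.toLinearMap) : IsHom P' P φ.symm.toLinearMap := by
  refine ⟨fun i => LinearMap.ext fun x => φ.injective ?_, LinearMap.ext fun x => φ.injective ?_⟩
  · have := LinearMap.congr_fun (h.proj i) (φ.symm x)
    simp only [LinearMap.comp_apply, LinearEquiv.coe_coe, LinearEquiv.apply_symm_apply] at this ⊢
    exact this.symm
  · have := LinearMap.congr_fun h.d (φ.symm x)
    simp only [LinearMap.comp_apply, LinearEquiv.coe_coe, LinearEquiv.apply_symm_apply] at this ⊢
    exact this.symm

/-- Isomorphic objects are homotopy equivalent. -/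
theorem HtpyEquiv.of_equiv {P P' : CurvedModule Γ Q f} (φ : P.carrier ≃ₗ[Q] P'.carrier)
    (h : IsHom P P' φ.toLinearMap) : HtpyEquiv P P' :=
  ⟨φ.toLinearMap, φ.symm.toLinearMap, 0, 0, h, h.symm,
    isHomotopy_zero (LinearMap.ext φ.symm_apply_apply),
    isHomotopy_zero (LinearMap.ext φ.apply_symm_apply)⟩

end CurvedModule

theorem KoszulModule.HtpyEquiv.of_equiv {Q : Type u} [CommRing Q] {f : Q} {P P' : KoszulModule Q f}
    (φ : P.carrier ≃ₗ[Q] P'.carrier) (h : IsHom P P' φ.toLinearMap) : HtpyEquiv P P' := by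
  refine ⟨φ.toLinearMap, φ.symm.toLinearMap, 0, 0, h, ⟨h.cx.symm, LinearMap.ext fun x =>
    φ.injective ?_⟩, ⟨CurvedModule.isHomotopy_zero (LinearMap.ext φ.symm_apply_apply), ?_⟩,
    ⟨CurvedModule.isHomotopy_zero (LinearMap.ext φ.apply_symm_apply), ?_⟩⟩
  · have := LinearMap.congr_fun h.s (φ.symm x)
    simp only [LinearMap.comp_apply, LinearEquiv.coe_coe, LinearEquiv.apply_symm_apply] at this ⊢
    exact this.symm
  all_goals rw [LinearMap.zero_comp, LinearMap.comp_zero, neg_zero]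

section

variable {Q : Type u} [CommRing Q] {f : Q}

theorem K0Supp.cls_of_ses {X' X X'' : SuppComplex Q f}
    (h : CurvedModule.ShortExact X'.1 X.1 X''.1) :
    (K0.cls X : K0Supp Q f) = K0.cls X' + K0.cls X'' := K0.cls_of_ses h

theorem K0Supp.cls_of_htpy {X X' : SuppComplex Q f} (h : CurvedModule.HtpyEquiv X.1 X'.1) :
    (K0.cls X : K0Supp Q f) = K0.cls X' := K0.cls_of_htpy h

end

/-! ### Classes in the Grothendieck groups as additive functions on objects. -/

namespace Obj

variable {Q : Type u} [CommRing Q] {f : Q}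

/-- The map `M → forgetS M` that is the identity of the underlying modules. -/
noncomputable def forgetSEquiv (M : Obj Q) : M.forgetS ≃ₗ[Q] M := LinearEquiv.refl Q M

theorem forgetSEquiv_e (M : Obj Q) (i : ℤ) (x : M.forgetS) :
    M.forgetSEquiv (opE Q i • x) = opE Q i • M.forgetSEquiv x := ofOps_e _ _

theorem forgetSEquiv_d (M : Obj Q) (x : M.forgetS) :
    M.forgetSEquiv (opD Q • x) = opD Q • M.forgetSEquiv x := ofOps_d _

theorem forgetSEquiv_s (M : Obj Q) (x : M.forgetS) : M.forgetSEquiv (opS Q • x) = 0 := ofOps_s _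

theorem isSupp_forgetS {M : Obj Q} (h : HasNilpHomology f M) : IsSupp f M.forgetS := by
  obtain ⟨n, hn⟩ := h
  refine ⟨fun x => M.forgetSEquiv.injective ?_, n, fun x hx => ?_⟩
  · rw [forgetSEquiv_s, map_zero]
  · obtain ⟨y, hy⟩ := hn (M.forgetSEquiv x) (by rw [← forgetSEquiv_d, hx, map_zero])
    refine ⟨M.forgetSEquiv.symm y, M.forgetSEquiv.injective ?_⟩
    rw [forgetSEquiv_d, LinearEquiv.apply_symm_apply, hy, map_smul M.forgetSEquiv]

/-- A morphism, regarded as a morphism of the underlying complexes. -/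
noncomputable def forgetSHom {M N : Obj Q} (g : M →ₗ[Op Q] N) : M.forgetS →ₗ[Op Q] N.forgetS :=
  homOfCommute (N.forgetSEquiv.symm.toLinearMap ∘ₗ g.restrictScalars Q ∘ₗ
      M.forgetSEquiv.toLinearMap)
    (fun i x => N.forgetSEquiv.injective (by
      simp [forgetSEquiv_e]))
    (fun x => N.forgetSEquiv.injective (by simp [forgetSEquiv_d]))
    (fun x => N.forgetSEquiv.injective (by simp [forgetSEquiv_s]))

theorem forgetSEquiv_hom {M N : Obj Q} (g : M →ₗ[Op Q] N) (x : M.forgetS) :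
    N.forgetSEquiv (forgetSHom g x) = g (M.forgetSEquiv x) :=
  N.forgetSEquiv.apply_symm_apply _

theorem SES.forgetS {M' M M'' : Obj Q} {i : M' →ₗ[Op Q] M} {q : M →ₗ[Op Q] M''} (h : SES i q) :
    SES (forgetSHom i) (forgetSHom q) := by
  refine ⟨fun x y hxy => ?_, fun x => ?_, fun y => ?_⟩
  · have := congrArg M.forgetSEquiv hxy
    rw [forgetSEquiv_hom, forgetSEquiv_hom] at this
    exact M'.forgetSEquiv.injective (h.inj this)
  · rw [← map_eq_zero_iff M''.forgetSEquiv M''.forgetSEquiv.injective, forgetSEquiv_hom]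
    refine (h.exact _).trans ⟨?_, ?_⟩
    · rintro ⟨y, hy⟩
      refine ⟨M'.forgetSEquiv.symm y, M.forgetSEquiv.injective ?_⟩
      rw [forgetSEquiv_hom, LinearEquiv.apply_symm_apply, hy]
    · rintro ⟨y, rfl⟩
      exact ⟨M'.forgetSEquiv y, (forgetSEquiv_hom i y).symm⟩
  · obtain ⟨x, hx⟩ := h.surj (M''.forgetSEquiv y)
    refine ⟨M.forgetSEquiv.symm x, M''.forgetSEquiv.injective ?_⟩
    rw [forgetSEquiv_hom, LinearEquiv.apply_symm_apply, hx]

/-- The object attached to a complex with an operator `s`. -/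
theorem exists_ofCx (P : BddComplex Q) (s : Module.End Q P.carrier)
    (hs : ∀ i, s * P.proj i = P.proj (i + 1) * s) : ∃ (M : Obj Q) (φ : M ≃ₗ[Q] P.carrier),
      (∀ i x, φ (opE Q i • x) = P.proj i (φ x)) ∧ (∀ x, φ (opD Q • x) = P.d (φ x)) ∧
      ∀ x, φ (opS Q • x) = s (φ x) := by
  obtain ⟨S, h1, h2⟩ := P.exists_sum_proj
  refine exists_of_isGrading ⟨P.proj_apply_self,
    fun i j h => LinearMap.congr_fun (P.proj_mul_of_ne i j h), S, fun i hi => by simp [h1 i hi],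
    fun x => ?_⟩ P.d s (fun i => LinearMap.congr_fun (P.d_mul_proj i))
    (fun i => LinearMap.congr_fun (hs i)) fun x => ?_
  · rw [← LinearMap.sum_apply, h2]; rfl
  · have := LinearMap.congr_fun P.d_mul_d x
    rwa [zero_smul] at this

/-- The object attached to a complex, with `s = 0`. -/
noncomputable def ofCx (P : BddComplex Q) : Obj Q :=
  (exists_ofCx P 0 fun i => by rw [zero_mul, mul_zero]).choose

/-- The underlying module of `ofCx P`. -/
noncomputable def ofCxEquiv (P : BddComplex Q) : ofCx P ≃ₗ[Q] P.carrier :=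
  (exists_ofCx P 0 fun i => by rw [zero_mul, mul_zero]).choose_spec.choose

theorem ofCxEquiv_spec (P : BddComplex Q) :
    (∀ i x, ofCxEquiv P (opE Q i • x) = P.proj i (ofCxEquiv P x)) ∧
      (∀ x, ofCxEquiv P (opD Q • x) = P.d (ofCxEquiv P x)) ∧
      ∀ x, ofCxEquiv P (opS Q • x) = 0 :=
  (exists_ofCx P 0 fun i => by rw [zero_mul, mul_zero]).choose_spec.choose_spec

theorem hasNilpHomology_of_equiv {M : Obj Q} {P : BddComplex Q} (φ : M ≃ₗ[Q] P.carrier)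
    (hd : ∀ x, φ (opD Q • x) = P.d (φ x)) [IsNoetherianRing Q] (hP : P.SupportedOn f) :
    HasNilpHomology f M := by
  obtain ⟨n, hn⟩ := P.pow_of_supportedOn f hP
  refine ⟨n, fun x hx => ?_⟩
  obtain ⟨y, hy⟩ := hn (φ x) (by rw [← hd, hx, map_zero])
  refine ⟨φ.symm y, φ.injective ?_⟩
  rw [hd, φ.apply_symm_apply, hy, map_smul φ]

theorem supportedOn_toCx {M : Obj Q} [Module.Projective Q M] (h : HasNilpHomology f M) :
    M.toCx.SupportedOn f := by
  obtain ⟨n, hn⟩ := h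
  exact M.toCx.supportedOn_of_pow f n hn

/-- The Koszul module attached to a projective object. -/
def toKoszul (M : Obj Q) [Module.Projective Q M] (h : IsKoszul f M) : KoszulModule Q f where
  toCurvedModule := M.toCx
  s := M.act (opS Q)
  s_mul_proj i := LinearMap.ext (M.isGraded.s_e i)
  d_mul_s_add := LinearMap.ext h.2
  s_mul_s := LinearMap.ext h.1

open Classical in
/-- The class of a Koszul module, as a function on all objects. -/
noncomputable def clsKoszul (f : Q) (M : Obj Q) : K0Koszul Q f :=
  if h : IsKoszul f M ∧ Module.Projective Q M then
    haveI := h.2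
    K0.cls (M.toKoszul h.1) else 0

theorem clsKoszul_eq {M : Obj Q} (h : IsKoszul f M) [h' : Module.Projective Q M] :
    clsKoszul f M = K0.cls (M.toKoszul h) := dif_pos ⟨h, h'⟩

open Classical in
/-- The class of a complex, as a function on all objects. -/
noncomputable def clsSupp (f : Q) (M : Obj Q) : K0Supp Q f :=
  if h : IsSupp f M ∧ Module.Projective Q M then
    haveI := h.2
    K0.cls ⟨M.toCx, supportedOn_toCx h.1.2⟩ else 0

theorem clsSupp_eq {M : Obj Q} (h : IsSupp f M) [h' : Module.Projective Q M] :
    clsSupp f M = K0.cls ⟨M.toCx, supportedOn_toCx h.2⟩ := dif_pos ⟨h, h'⟩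

theorem SES.toCx {M' M M'' : Obj Q} {i : M' →ₗ[Op Q] M} {q : M →ₗ[Op Q] M''} (_ : SES i q)
    [Module.Projective Q M'] [Module.Projective Q M] [Module.Projective Q M''] :
    CurvedModule.IsHom M'.toCx M.toCx (i.restrictScalars Q) ∧
    CurvedModule.IsHom M.toCx M''.toCx (q.restrictScalars Q) :=
  ⟨⟨fun _ => LinearMap.ext fun _ => map_smul i _ _, LinearMap.ext fun _ => map_smul i _ _⟩,
    ⟨fun _ => LinearMap.ext fun _ => map_smul q _ _, LinearMap.ext fun _ => map_smul q _ _⟩⟩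

theorem additiveOn_clsKoszul (f : Q) :
    AdditiveOn (fun M => IsKoszul f M ∧ Module.Projective Q M) (clsKoszul f) := by
  rintro M' M M'' ⟨h', p'⟩ ⟨h, p⟩ ⟨h'', p''⟩ i q hs
  rw [clsKoszul_eq h, clsKoszul_eq h', clsKoszul_eq h'']
  exact K0.cls_of_ses ⟨i.restrictScalars Q, q.restrictScalars Q,
    ⟨hs.toCx.1, LinearMap.ext fun _ => map_smul i _ _⟩,
    ⟨hs.toCx.2, LinearMap.ext fun _ => map_smul q _ _⟩, hs.inj, hs.exact, hs.surj⟩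

theorem additiveOn_clsSupp (f : Q) :
    AdditiveOn (fun M => IsSupp f M ∧ Module.Projective Q M) (clsSupp f) := by
  rintro M' M M'' ⟨h', p'⟩ ⟨h, p⟩ ⟨h'', p''⟩ i q hs
  rw [clsSupp_eq h, clsSupp_eq h', clsSupp_eq h'']
  exact K0Supp.cls_of_ses
    ⟨i.restrictScalars Q, q.restrictScalars Q, hs.toCx.1, hs.toCx.2, hs.inj, hs.exact, hs.surj⟩

theorem Contractible.htpyEquiv_toCx {M : Obj Q} (hM : M.Contractible) [Module.Projective Q M] :
    ∃ k : M →ₗ[Q] M, CurvedModule.IsHomotopy M.toCx M.toCx k 0 LinearMap.id ∧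
      ∀ x, k (opS Q • x) = -(opS Q • k x) := by
  obtain ⟨h, h1, h2, h3⟩ := hM
  -- A homotopy joining 0 to the identity must satisfy `d k + k d = -1`, hence the sign.
  refine ⟨-h, ⟨fun i => LinearMap.ext fun x => ?_, LinearMap.ext fun x => ?_⟩, fun x => ?_⟩
  · change -h (opE Q i • x) = opE Q (i + 1) • -h x
    rw [h1, smul_neg]
  · change opD Q • -h x + -h (opD Q • x) = 0 - x
    rw [smul_neg, ← neg_add, h2, zero_sub]
  · rw [LinearMap.neg_apply, LinearMap.neg_apply, h3, smul_neg]

theorem clsKoszul_of_contractible [IsNoetherianRing Q] (M : Obj Q) (h : IsKoszul f M)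
    (_ : Module.Projective Q M) (hM : M.Contractible) : clsKoszul f M = 0 := by
  have h0 := (resolving_isKoszul f).zero
  rw [← (additiveOn_clsKoszul f).map_subsingleton (zero Q) ⟨h0, inferInstance⟩, clsKoszul_eq h,
    clsKoszul_eq h0]
  obtain ⟨k, hk, hks⟩ := hM.htpyEquiv_toCx
  refine K0.cls_of_htpy ⟨0, 0, k, 0, ?_, ?_, ⟨?_, LinearMap.ext hks⟩, ?_⟩
  · exact ⟨⟨fun _ => LinearMap.ext fun _ => rfl, LinearMap.ext fun _ => rfl⟩,
      LinearMap.ext fun _ => rfl⟩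
  · exact ⟨⟨fun i => LinearMap.ext fun _ => (map_zero (M.act (opE Q i))).symm,
      LinearMap.ext fun _ => (map_zero (M.act (opD Q))).symm⟩,
      LinearMap.ext fun _ => (map_zero (M.act (opS Q))).symm⟩
  · rw [LinearMap.zero_comp]; exact hk
  · exact ⟨⟨fun _ => LinearMap.ext fun _ => rfl, LinearMap.ext fun _ => rfl⟩,
      LinearMap.ext fun _ => rfl⟩

theorem clsSupp_of_contractible [IsNoetherianRing Q] (M : Obj Q) (h : IsSupp f M)
    (_ : Module.Projective Q M) (hM : M.Contractible) : clsSupp f M = 0 := by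
  have h0 := (resolving_isSupp f).zero
  rw [← (additiveOn_clsSupp f).map_subsingleton (zero Q) ⟨h0, inferInstance⟩, clsSupp_eq h,
    clsSupp_eq h0]
  obtain ⟨k, hk, -⟩ := hM.htpyEquiv_toCx
  refine K0Supp.cls_of_htpy ⟨0, 0, k, 0, ?_, ?_, ?_, ?_⟩
  · exact ⟨fun _ => LinearMap.ext fun _ => rfl, LinearMap.ext fun _ => rfl⟩
  · exact ⟨fun i => LinearMap.ext fun _ => (map_zero (M.act (opE Q i))).symm,
      LinearMap.ext fun _ => (map_zero (M.act (opD Q))).symm⟩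
  · rw [LinearMap.zero_comp]; exact hk
  · exact ⟨fun _ => LinearMap.ext fun _ => rfl, LinearMap.ext fun _ => rfl⟩

theorem IsNilp.isSupp {N : Obj Q} (h : IsNilp f N) : IsSupp f N := by
  obtain ⟨n, h1, h2, h3⟩ := h
  exact ⟨h2, n, fun x _ => ⟨0, by rw [smul_zero, h3]⟩⟩

theorem HasNilpHomology.homology [IsNoetherianRing Q] {X : Obj Q} (h : HasNilpHomology f X) :
    IsNilp f X.homology := X.isHomology.isNilp h.choose_spec

/-- Objects with the same underlying complex have the same homology. -/
theorem nonempty_homology_equiv [IsNoetherianRing Q] {X Y : Obj Q} (φ : X ≃ₗ[Q] Y)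
    (he : ∀ i x, φ (opE Q i • x) = opE Q i • φ x) (hd : ∀ x, φ (opD Q • x) = opD Q • φ x) :
    Nonempty (X.homology ≃ₗ[Op Q] Y.homology) :=
  X.isHomology.nonempty_equiv Y.isHomology φ.toLinearMap he hd φ.symm.toLinearMap
    (fun i x => φ.injective (by simp [he])) (fun x => φ.injective (by simp [hd]))
    (fun _ => 0) (fun x _ => by simp) (fun _ => 0) (fun x _ => by simp)

/-- The functions on objects that compute the inverse of the forgetful map. -/
theorem exists_isDev [IsRegularRing Q] (f : Q) : ∃ b φ : Obj Q → K0Koszul Q f, IsDev f b φ ∧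
    ∀ M, IsKoszul f M → Module.Projective Q M → b M = clsKoszul f M := by
  obtain ⟨b, h1, h2, h3⟩ := (resolving_isKoszul f).exists_extension (additiveOn_clsKoszul f)
    ((additiveOn_clsKoszul f).eq_zero_of_acyclic (thick_isKoszul f) clsKoszul_of_contractible)
  obtain ⟨φ, h4, h5⟩ := (h1.mono fun _ h => h.isKoszul : AdditiveOn (IsTors f) b).exists_dev
  exact ⟨b, φ, ⟨h1, h3, h4, h5⟩, h2⟩

/-- Both sides are additive on Koszul modules and vanish on acyclic ones, so only the case `d = s =
0` matters. There the Koszul relation forces `f` to act as zero, the object is its own homology, and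
`φ` agrees with `b` by construction. -/
theorem IsDev.eq_homology [IsNoetherianRing Q] {A : Type*} [AddCommGroup A] {b φ : Obj Q → A}
    (h : IsDev f b φ) (M : Obj Q) (hM : IsKoszul f M) : b M = φ M.homology := by
  refine h.koszul.eq_of_homology (thick_isKoszul f)
    (h.additiveOn_homology.mono fun _ h => h.hasNilpHomology) h.acyclic
    (fun M _ => h.map_homology_of_acyclic) (fun M hM hd hs => ?_) M hM
  have ht : IsTors f M := ⟨hd, hs, fun x => by
    have := hM.2 x
    rw [hd, hs, zero_add] at this
    exact this.symm⟩
  rw [h.map_homology_of_isNilp (isTors_isNilp ht), h.eq _ ht]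

end Obj

/-! ### The forgetful map is an isomorphism. -/

open Obj

variable {Q : Type u} [CommRing Q] {f : Q}

theorem hasNilpHomology_ofCx [IsNoetherianRing Q] (X : SuppComplex Q f) :
    HasNilpHomology f (ofCx X.1) :=
  hasNilpHomology_of_equiv (ofCxEquiv X.1) (ofCxEquiv_spec X.1).2.1 X.2

theorem isSupp_ofCx [IsNoetherianRing Q] (X : SuppComplex Q f) : IsSupp f (ofCx X.1) :=
  ⟨fun x => (ofCxEquiv X.1).injective (by rw [(ofCxEquiv_spec X.1).2.2, map_zero]),
    hasNilpHomology_ofCx X⟩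

/-- A morphism of complexes, as a morphism of objects. -/
noncomputable def ofCxHom {P P' : BddComplex Q} {g : P.carrier →ₗ[Q] P'.carrier}
    (hg : CurvedModule.IsHom P P' g) : ofCx P →ₗ[Op Q] ofCx P' :=
  homOfCommute ((ofCxEquiv P').symm.toLinearMap ∘ₗ g ∘ₗ (ofCxEquiv P).toLinearMap)
    (fun i x => (ofCxEquiv P').injective (by
      have := LinearMap.congr_fun (hg.proj i) (ofCxEquiv P x)
      simp only [LinearMap.comp_apply] at this
      simp [(ofCxEquiv_spec P).1, (ofCxEquiv_spec P').1, this]))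
    (fun x => (ofCxEquiv P').injective (by
      have := LinearMap.congr_fun hg.d (ofCxEquiv P x)
      simp only [LinearMap.comp_apply] at this
      simp [(ofCxEquiv_spec P).2.1, (ofCxEquiv_spec P').2.1, this]))
    (fun x => (ofCxEquiv P').injective (by
      simp [(ofCxEquiv_spec P).2.2, (ofCxEquiv_spec P').2.2]))

theorem ofCxEquiv_hom {P P' : BddComplex Q} {g : P.carrier →ₗ[Q] P'.carrier}
    (hg : CurvedModule.IsHom P P' g) (x : ofCx P) :
    ofCxEquiv P' (ofCxHom hg x) = g (ofCxEquiv P x) := (ofCxEquiv P').apply_symm_apply _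

theorem ses_ofCx {P' P P'' : BddComplex Q} {i : P'.carrier →ₗ[Q] P.carrier}
    {q : P.carrier →ₗ[Q] P''.carrier} (hi : CurvedModule.IsHom P' P i)
    (hq : CurvedModule.IsHom P P'' q) (h1 : Function.Injective i) (h2 : Function.Exact i q)
    (h3 : Function.Surjective q) : SES (ofCxHom hi) (ofCxHom hq) := by
  refine ⟨fun x y hxy => ?_, fun x => ?_, fun y => ?_⟩
  · have := congrArg (ofCxEquiv P) hxy
    rw [ofCxEquiv_hom, ofCxEquiv_hom] at this
    exact (ofCxEquiv P').injective (h1 this)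
  · rw [← map_eq_zero_iff (ofCxEquiv P'') (ofCxEquiv P'').injective, ofCxEquiv_hom]
    refine (h2 _).trans ⟨?_, ?_⟩
    · rintro ⟨y, hy⟩
      refine ⟨(ofCxEquiv P').symm y, (ofCxEquiv P).injective ?_⟩
      rw [ofCxEquiv_hom, LinearEquiv.apply_symm_apply, hy]
    · rintro ⟨y, rfl⟩
      exact ⟨ofCxEquiv P' y, (ofCxEquiv_hom hi y).symm⟩
  · obtain ⟨x, hx⟩ := h3 (ofCxEquiv P'' y)
    refine ⟨(ofCxEquiv P).symm x, (ofCxEquiv P'').injective ?_⟩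
    rw [ofCxEquiv_hom, LinearEquiv.apply_symm_apply, hx]

theorem nonempty_homology_equiv_of_htpyEquiv [IsNoetherianRing Q] {P P' : BddComplex Q}
    (h : CurvedModule.HtpyEquiv P P') :
    Nonempty ((ofCx P).homology ≃ₗ[Op Q] (ofCx P').homology) := by
  obtain ⟨g, g', k, k', hg, hg', hk, hk'⟩ := h
  refine (ofCx P).isHomology.nonempty_equiv (ofCx P').isHomology ((ofCxHom hg).restrictScalars Q)
    (fun _ => map_smul (ofCxHom hg) _) (map_smul (ofCxHom hg) _)
    ((ofCxHom hg').restrictScalars Q) (fun _ => map_smul (ofCxHom hg') _)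
    (map_smul (ofCxHom hg') _) (fun x => (ofCxEquiv P).symm (k (ofCxEquiv P x))) (fun x hx => ?_)
    (fun x => (ofCxEquiv P').symm (k' (ofCxEquiv P' x))) (fun x hx => ?_)
  · apply (ofCxEquiv P).injective
    have h1 := congrArg (ofCxEquiv P) hx
    rw [(ofCxEquiv_spec P).2.1, map_zero] at h1
    have h2 := LinearMap.congr_fun hk.d (ofCxEquiv P x)
    simp only [LinearMap.add_apply, LinearMap.comp_apply, LinearMap.sub_apply, h1, map_zero,
      add_zero, LinearMap.id_apply] at h2
    rw [map_sub, (ofCxEquiv_spec P).2.1, LinearEquiv.apply_symm_apply, h2]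
    change ofCxEquiv P (ofCxHom hg' (ofCxHom hg x)) - _ = _
    rw [ofCxEquiv_hom, ofCxEquiv_hom]
  · apply (ofCxEquiv P').injective
    have h1 := congrArg (ofCxEquiv P') hx
    rw [(ofCxEquiv_spec P').2.1, map_zero] at h1
    have h2 := LinearMap.congr_fun hk'.d (ofCxEquiv P' x)
    simp only [LinearMap.add_apply, LinearMap.comp_apply, LinearMap.sub_apply, h1, map_zero,
      add_zero, LinearMap.id_apply] at h2
    rw [map_sub, (ofCxEquiv_spec P').2.1, LinearEquiv.apply_symm_apply, h2]
    change ofCxEquiv P' (ofCxHom hg (ofCxHom hg' x)) - _ = _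
    rw [ofCxEquiv_hom, ofCxEquiv_hom]

theorem cls_ofCx [IsNoetherianRing Q] (X : SuppComplex Q f) :
    (K0.cls X : K0Supp Q f) = clsSupp f (ofCx X.1) := by
  have : Module.Projective Q (ofCx X.1) := Module.Projective.of_equiv (ofCxEquiv X.1).symm
  rw [clsSupp_eq (isSupp_ofCx X), eq_comm]
  exact K0Supp.cls_of_htpy (CurvedModule.HtpyEquiv.of_equiv (ofCxEquiv X.1)
    ⟨fun i => LinearMap.ext ((ofCxEquiv_spec X.1).1 i), LinearMap.ext (ofCxEquiv_spec X.1).2.1⟩)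

theorem forgetMap_cls (P : KoszulModule Q f) : forgetMap Q f (K0.cls P) = K0.cls P.forget := rfl

/-- The inverse `L` sends `[X]` to `φ (H X)`; it respects homotopy equivalences because homology
does. It is a left inverse by `eq_homology`. For the other side let `b'` extend the universal class
of supported complexes. Then the image of `b` is `b'` on Koszul modules (`h2`, by uniqueness from
the projective ones), so the image of `φ` is `b'` on modules killed by a power of `f` (`h3`, by
dévissage), so `b'` is the image of `φ ∘ H` on all supported complexes (`h4`, by reduction to
homology). -/
theorem forgetMap_bijective [IsRegularRing Q] (f : Q) : Function.Bijective (forgetMap Q f) := by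
  obtain ⟨b, φ, h, hb⟩ := exists_isDev f
  let L : K0Supp Q f →+ K0Koszul Q f := K0.lift (fun X => φ (ofCx X.1).homology)
    (by
      rintro P' P P'' ⟨i, q, hi, hq, h1, h2, h3⟩
      exact h.additiveOn_homology (hasNilpHomology_ofCx P') (hasNilpHomology_ofCx P)
        (hasNilpHomology_ofCx P'') _ _ (ses_ofCx hi hq h1 h2 h3))
    (by
      intro P P' hP
      obtain ⟨ψ⟩ := nonempty_homology_equiv_of_htpyEquiv hP
      exact h.nilp.map_equiv ⟨0, isTors_zero _⟩ (hasNilpHomology_ofCx P).homology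
        (hasNilpHomology_ofCx P').homology ψ)
  have hL : ∀ X, L (K0.cls X) = φ (ofCx X.1).homology := K0.lift_cls _ _ _
  have h1 : ∀ x, L (forgetMap Q f x) = x := by
    refine DFunLike.congr_fun (?_ : L.comp (forgetMap Q f) = AddMonoidHom.id _)
    refine K0.hom_ext fun P => ?_
    obtain ⟨M, ψ, hE, hD, hS⟩ := exists_ofCx P.cx P.s P.s_mul_proj
    have hM : IsKoszul f M := by
      refine ⟨fun x => ψ.injective ?_, fun x => ψ.injective ?_⟩
      · rw [hS, hS, map_zero]
        exact LinearMap.congr_fun P.s_mul_s _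
      · rw [map_add, hD, hS, hS, hD, map_smul ψ]
        exact LinearMap.congr_fun P.d_mul_s_add _
    have hp : Module.Projective Q M := Module.Projective.of_equiv ψ.symm
    have e1 : (K0.cls P : K0Koszul Q f) = clsKoszul f M := by
      rw [clsKoszul_eq hM, eq_comm]
      exact K0.cls_of_htpy (KoszulModule.HtpyEquiv.of_equiv (P := M.toKoszul hM) ψ
        ⟨⟨fun i => LinearMap.ext (hE i), LinearMap.ext hD⟩, LinearMap.ext hS⟩)
    obtain ⟨τ⟩ := nonempty_homology_equiv (X := M) (Y := ofCx P.cx)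
      (ψ.trans (ofCxEquiv P.cx).symm)
      (fun i x => (ofCxEquiv P.cx).injective (by
        rw [(ofCxEquiv_spec P.cx).1]; simp [hE]))
      (fun x => (ofCxEquiv P.cx).injective (by
        rw [(ofCxEquiv_spec P.cx).2.1]; simp [hD]))
    rw [AddMonoidHom.comp_apply, forgetMap_cls, hL, AddMonoidHom.id_apply, e1, ← hb M hM hp, h.eq_homology M hM]
    exact (h.nilp.map_equiv ⟨0, isTors_zero _⟩ hM.hasNilpHomology.homology
      (hasNilpHomology_ofCx P.forget).homology τ).symm
  obtain ⟨b', hb1, hb2, hb3⟩ := (resolving_isSupp f).exists_extension (additiveOn_clsSupp f)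
    ((additiveOn_clsSupp f).eq_zero_of_acyclic (thick_isSupp f) clsSupp_of_contractible)
  have map_add' : ∀ {C : Obj Q → Prop} {c : Obj Q → K0Koszul Q f}, AdditiveOn C c →
      AdditiveOn C fun M => forgetMap Q f (c M) := by
    intro C c hc M' M M'' c' c₀ c'' i q hs
    simp only [hc c' c₀ c'' i q hs, map_add]
  have h2 : ∀ M, IsKoszul f M → forgetMap Q f (b M) = b' M.forgetS := by
    refine (resolving_isKoszul f).eq_of_projective (map_add' h.koszul) ?_ ?_
    · intro M' M M'' c' c₀ c'' i q hs
      exact hb1 (isSupp_forgetS c'.hasNilpHomology) (isSupp_forgetS c₀.hasNilpHomology)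
        (isSupp_forgetS c''.hasNilpHomology) _ _ hs.forgetS
    · intro M hM hp
      have hp' : Module.Projective Q M.forgetS := Module.Projective.of_equiv M.forgetSEquiv.symm
      have hS := isSupp_forgetS hM.hasNilpHomology
      rw [hb M hM hp, hb2 _ hS hp', clsKoszul_eq hM, clsSupp_eq hS, forgetMap_cls, eq_comm]
      exact K0Supp.cls_of_htpy (X := ⟨M.forgetS.toCx, _⟩) (X' := (M.toKoszul hM).forget)
        (CurvedModule.HtpyEquiv.of_equiv M.forgetSEquiv
          ⟨fun i => LinearMap.ext (M.forgetSEquiv_e i), LinearMap.ext M.forgetSEquiv_d⟩)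
  have h3 : ∀ N, IsNilp f N → forgetMap Q f (φ N) = b' N := by
    refine (map_add' h.nilp).eq_of_isTors (hb1.mono fun _ h => h.isSupp) fun N hN => ?_
    rw [h.eq N hN, h2 N hN.isKoszul]
    exact hb1.map_equiv (resolving_isSupp f).zero (isSupp_forgetS hN.isKoszul.hasNilpHomology)
      (isTors_isNilp hN).isSupp (LinearEquiv.ofBijective (homOfCommute N.forgetSEquiv.toLinearMap
        N.forgetSEquiv_e N.forgetSEquiv_d fun x => by
          rw [hN.2.1]; exact N.forgetSEquiv_s x) N.forgetSEquiv.bijective)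
  have h4 : ∀ M, IsSupp f M → b' M = forgetMap Q f (φ M.homology) := by
    refine hb1.eq_of_homology (thick_isSupp f)
      (map_add' (h.additiveOn_homology.mono fun _ h => h.hasNilpHomology)) hb3
      (fun M _ ha => by rw [h.map_homology_of_acyclic ha, map_zero]) fun M hM hd hs => ?_
    have hN : IsNilp f M := by
      obtain ⟨n, hn⟩ := hM.2
      refine ⟨n, hd, hs, fun x => ?_⟩
      obtain ⟨y, hy⟩ := hn x (hd x)
      rw [← hy, hd]
    rw [h.map_homology_of_isNilp hN, h3 M hN]
  have h5 : ∀ x, forgetMap Q f (L x) = x := by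
    refine DFunLike.congr_fun (?_ : (forgetMap Q f).comp L = AddMonoidHom.id _)
    refine K0.hom_ext fun X => ?_
    have hp : Module.Projective Q (ofCx X.1) := Module.Projective.of_equiv (ofCxEquiv X.1).symm
    rw [AddMonoidHom.comp_apply, hL, AddMonoidHom.id_apply, cls_ofCx, ← hb2 _ (isSupp_ofCx X) hp, h4 _ (isSupp_ofCx X)]
  exact ⟨Function.LeftInverse.injective h1, Function.RightInverse.surjective h5⟩

variable {Q : Type u} [CommRing Q] {f : Q}

/-! ## Folding is surjective -/

theorem foldMap_cls (P : KoszulModule Q f) : foldMap Q f (K0.cls P) = K0.cls P.fold := rfl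

theorem MatFac.sum_proj (P : MatFac Q f) : P.proj 0 + P.proj 1 = 1 := by
  apply P.ext_of_mem
  intro i x hx
  rw [LinearMap.add_apply, P.proj_apply_of_mem hx, P.proj_apply_of_mem hx]
  rcases zmod_two_eq i with rfl | rfl
  · simp
  · simp

theorem MatFac.proj_one_d (P : MatFac Q f) : P.proj 1 * P.d = P.d * P.proj 0 := by
  rw [P.d_mul_proj]; rfl

theorem MatFac.proj_zero_d (P : MatFac Q f) : P.proj 0 * P.d = P.d * P.proj 1 := by
  rw [P.d_mul_proj, sub_self]

/-- The projections of a matrix factorization, placed in the degrees `0` and `1`. -/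
noncomputable def MatFac.unfoldProj (P : MatFac Q f) (i : ℤ) : Module.End Q P.carrier :=
  if i = 0 then P.proj 0 else if i = 1 then P.proj 1 else 0

theorem MatFac.unfoldProj_zero (P : MatFac Q f) : P.unfoldProj 0 = P.proj 0 := if_pos rfl

theorem MatFac.unfoldProj_one (P : MatFac Q f) : P.unfoldProj 1 = P.proj 1 := by
  rw [unfoldProj, if_neg one_ne_zero, if_pos rfl]

theorem MatFac.unfoldProj_of_ne (P : MatFac Q f) {i : ℤ} (h0 : i ≠ 0) (h1 : i ≠ 1) :
    P.unfoldProj i = 0 := by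
  rw [unfoldProj, if_neg h0, if_neg h1]

/-- A matrix factorization, as a Koszul module in the degrees `0` and `1`. -/
noncomputable def MatFac.unfold (P : MatFac Q f) : KoszulModule Q f where
  carrier := P.carrier
  proj := P.unfoldProj
  proj_mul_self i := by
    unfold unfoldProj
    split_ifs
    exacts [P.proj_mul_self 0, P.proj_mul_self 1, zero_mul _]
  proj_mul_of_ne i j h := by
    have h10 : P.proj 1 * P.proj 0 = 0 := P.proj_mul_of_ne _ _ (by decide)
    have h01 : P.proj 0 * P.proj 1 = 0 := P.proj_mul_of_ne _ _ (by decide)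
    unfold unfoldProj
    split_ifs <;> first | omega | exact h10 | exact h01 | exact zero_mul _ | exact mul_zero _
  exists_sum_proj := by
    refine ⟨{0, 1}, fun i hi => ?_, ?_⟩
    · simp only [Finset.mem_insert, Finset.mem_singleton, not_or] at hi
      exact P.unfoldProj_of_ne hi.1 hi.2
    · rw [Finset.sum_pair (by decide), P.unfoldProj_zero, P.unfoldProj_one, P.sum_proj]
  -- `d` is `α`, from degree 1 to degree 0, and `s` is `β`, from degree 0 to degree 1. Both square
  -- to zero for reasons of degree, and `d s + s d = f` collects `α β = f` and `β α = f`.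
  d := P.d * P.proj 1
  d_mul_proj i := by
    by_cases h1 : i = 1
    · rw [h1, P.unfoldProj_one, sub_self, P.unfoldProj_zero, mul_assoc, P.proj_mul_self,
        ← mul_assoc, P.proj_zero_d, mul_assoc, P.proj_mul_self]
    by_cases h2 : i = 2
    · rw [P.unfoldProj_of_ne (by omega) (by omega), h2, mul_zero,
        show (2 : ℤ) - 1 = 1 by norm_num, P.unfoldProj_one, ← mul_assoc, P.proj_one_d, mul_assoc,
        P.proj_mul_of_ne 0 1 (by decide), mul_zero]
    · rw [P.unfoldProj_of_ne (i := i - 1) (by omega) (by omega), zero_mul]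
      by_cases h0 : i = 0
      · rw [h0, P.unfoldProj_zero, mul_assoc, P.proj_mul_of_ne 1 0 (by decide), mul_zero]
      · rw [P.unfoldProj_of_ne h0 h1, mul_zero]
  d_mul_d := by
    rw [zero_smul, mul_assoc, ← mul_assoc (P.proj 1), P.proj_one_d, mul_assoc,
      P.proj_mul_of_ne 0 1 (by decide), mul_zero, mul_zero]
  s := P.d * P.proj 0
  s_mul_proj i := by
    by_cases h0 : i = 0
    · rw [h0, P.unfoldProj_zero, zero_add, P.unfoldProj_one, mul_assoc, P.proj_mul_self,
        ← mul_assoc, P.proj_one_d, mul_assoc, P.proj_mul_self]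
    by_cases h2 : i = -1
    · rw [P.unfoldProj_of_ne (by omega) (by omega), h2, mul_zero,
        show (-1 : ℤ) + 1 = 0 by norm_num, P.unfoldProj_zero, ← mul_assoc, P.proj_zero_d,
        mul_assoc, P.proj_mul_of_ne 1 0 (by decide), mul_zero]
    · rw [P.unfoldProj_of_ne (i := i + 1) (by omega) (by omega), zero_mul]
      by_cases h1 : i = 1
      · rw [h1, P.unfoldProj_one, mul_assoc, P.proj_mul_of_ne 0 1 (by decide), mul_zero]
      · rw [P.unfoldProj_of_ne h0 h1, mul_zero]
  d_mul_s_add := by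
    have e1 : P.d * P.proj 1 * (P.d * P.proj 0) = f • P.proj 0 := by
      rw [mul_assoc, ← mul_assoc (P.proj 1), P.proj_one_d, mul_assoc, P.proj_mul_self, ← mul_assoc,
        P.d_mul_d, smul_mul_assoc, one_mul]
    have e2 : P.d * P.proj 0 * (P.d * P.proj 1) = f • P.proj 1 := by
      rw [mul_assoc, ← mul_assoc (P.proj 0), P.proj_zero_d, mul_assoc, P.proj_mul_self, ← mul_assoc,
        P.d_mul_d, smul_mul_assoc, one_mul]
    rw [e1, e2, ← smul_add, P.sum_proj]
  s_mul_s := by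
    rw [mul_assoc, ← mul_assoc (P.proj 0), P.proj_zero_d, mul_assoc,
      P.proj_mul_of_ne 1 0 (by decide), mul_zero, mul_zero]

theorem MatFac.cls_fold_unfold (P : MatFac Q f) :
    (K0.cls P.unfold.fold : K0MatFac Q f) = K0.cls P := by
  refine K0.cls_of_htpy (CurvedModule.HtpyEquiv.of_equiv (P := P.unfold.fold) (P' := P)
    (LinearEquiv.refl Q P.carrier) ⟨fun b => ?_, ?_⟩)
  · have h : P.unfold.cx.parityProj b = P.proj b := by
      rw [P.unfold.cx.parityProj_eq_sum b {0, 1} fun i hi => by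
        simp only [Finset.mem_insert, Finset.mem_singleton, not_or] at hi
        exact P.unfoldProj_of_ne hi.1 hi.2, Finset.sum_pair (by decide)]
      change (if SignedGrading.parity (0 : ℤ) = b then P.unfoldProj 0 else 0) +
        (if SignedGrading.parity (1 : ℤ) = b then P.unfoldProj 1 else 0) = _
      rw [P.unfoldProj_zero, P.unfoldProj_one, map_zero, map_one]
      rcases zmod_two_eq b with rfl | rfl
      · simp
      · simp
    exact h
  · change P.d * P.proj 1 + P.d * P.proj 0 = P.d
    rw [← mul_add, add_comm, P.sum_proj, mul_one]

theorem foldMap_surjective (f : Q) : Function.Surjective (foldMap Q f) := by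
  intro x
  rw [← AddMonoidHom.mem_range]
  induction x using K0.induction with
  | h P => exact ⟨K0.cls P.unfold, P.cls_fold_unfold⟩
  | h0 => exact zero_mem _
  | ha x y hx hy => exact add_mem hx hy
  | hn x hx => exact neg_mem hx

theorem rho_surjective (hF : Function.Bijective (forgetMap Q f)) : Function.Surjective (rho hF) :=
  (foldMap_surjective f).comp (AddEquiv.ofBijective (forgetMap Q f) hF).symm.surjective

theorem rho_forgetMap (hF : Function.Bijective (forgetMap Q f)) (x : K0Koszul Q f) :
    rho hF (forgetMap Q f x) = foldMap Q f x :=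
  congrArg (foldMap Q f) ((AddEquiv.ofBijective (forgetMap Q f) hF).symm_apply_apply x)

/-! ## Direct summands of curved modules -/

section eigProj

variable {Q : Type u} [CommRing Q] {M N : Type u} [AddCommGroup M] [Module Q M] [AddCommGroup N]
  [Module Q N] {p : ℕ}

/-- The projection onto the eigenspace of eigenvalue `z` of an operator `σ` with `σ ^ p = 1`. -/
noncomputable def eigProj (hp : IsUnit (p : Q)) (z : Q) (σ : Module.End Q M) : Module.End Q M :=
  -- The average of the `z⁻ᵏ σᵏ`, with `z ^ (p - 1)` in the role of the inverse of `z`.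
  ((hp.unit⁻¹ : Qˣ) : Q) • ∑ k ∈ Finset.range p, (z ^ (p - 1)) ^ k • σ ^ k

theorem eigProj_apply (hp : IsUnit (p : Q)) (z : Q) (σ : Module.End Q M) (x : M) :
    eigProj hp z σ x =
      ((hp.unit⁻¹ : Qˣ) : Q) • ∑ k ∈ Finset.range p, (z ^ (p - 1)) ^ k • (σ ^ k) x := by
  simp [eigProj]

theorem pow_apply_of_mem_eig {σ : Module.End Q M} {z : Q} {x : M} (hx : σ x = z • x) (k : ℕ) :
    (σ ^ k) x = z ^ k • x := by
  induction k with
  | zero => simp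
  | succ k ih => rw [pow_succ', Module.End.mul_apply, ih, map_smul, hx, smul_smul, pow_succ]

theorem pred_pow_mul (hp0 : p ≠ 0) {z : Q} (hz : z ^ p = 1) : z ^ (p - 1) * z = 1 := by
  rw [← pow_succ, Nat.sub_add_cancel (Nat.pos_of_ne_zero hp0), hz]

theorem eigProj_of_mem (hp : IsUnit (p : Q)) (hp0 : p ≠ 0) {z : Q} (hz : z ^ p = 1)
    {σ : Module.End Q M} {x : M} (hx : σ x = z • x) : eigProj hp z σ x = x := by
  rw [eigProj_apply]
  have : ∀ k ∈ Finset.range p, (z ^ (p - 1)) ^ k • (σ ^ k) x = x := fun k _ => by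
    rw [pow_apply_of_mem_eig hx, smul_smul, ← mul_pow, pred_pow_mul hp0 hz, one_pow, one_smul]
  rw [Finset.sum_congr rfl this, Finset.sum_const, Finset.card_range, ← Nat.cast_smul_eq_nsmul Q,
    smul_smul, IsUnit.val_inv_mul, one_smul]

/-- Applying `σ` shifts the index of summation; the last term returns as the term of index zero
because `σ ^ p = 1` and `z ^ p = 1`. -/
theorem apply_eigProj (hp : IsUnit (p : Q)) (hp0 : p ≠ 0) {z : Q} (hz : z ^ p = 1)
    {σ : Module.End Q M} (hσ : σ ^ p = 1) (x : M) :
    σ (eigProj hp z σ x) = z • eigProj hp z σ x := by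
  obtain ⟨n, rfl⟩ := Nat.exists_eq_succ_of_ne_zero hp0
  rw [eigProj_apply, map_smul, smul_comm z, map_sum]
  congr 1
  rw [Finset.smul_sum, Finset.sum_range_succ, Finset.sum_range_succ']
  have h1 : z * z ^ (n + 1 - 1) = 1 := by rw [mul_comm]; exact pred_pow_mul hp0 hz
  congr 1
  · refine Finset.sum_congr rfl fun k _ => ?_
    rw [map_smul, smul_smul, pow_succ (z ^ (n + 1 - 1)), mul_left_comm, h1, mul_one, pow_succ' σ]
    rfl
  · have h2 : (z ^ (n + 1 - 1)) ^ n = z := by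
      have : (z ^ (n + 1 - 1)) ^ (n + 1) = 1 := by rw [← pow_mul, mul_comm, pow_mul, hz, one_pow]
      calc (z ^ (n + 1 - 1)) ^ n = (z ^ (n + 1 - 1)) ^ n * (z * z ^ (n + 1 - 1)) := by
            rw [h1, mul_one]
        _ = z * (z ^ (n + 1 - 1)) ^ (n + 1) := by ring
        _ = z := by rw [this, mul_one]
    have h3 : σ ((σ ^ n) x) = x := by
      rw [← Module.End.mul_apply, ← pow_succ', hσ, Module.End.one_apply]
    rw [map_smul, h3, h2, pow_zero, pow_zero, one_smul, Module.End.one_apply]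

/-- This is the benefit of an explicit formula for the projector: it is natural for equivariant maps
between different modules, not only for endomorphisms commuting with `σ`. -/
theorem comp_eigProj (hp : IsUnit (p : Q)) (z : Q) {σ : Module.End Q M} {τ : Module.End Q N}
    {φ : M →ₗ[Q] N} (h : ∀ x, φ (σ x) = τ (φ x)) (x : M) :
    φ (eigProj hp z σ x) = eigProj hp z τ (φ x) := by
  have : ∀ k x, φ ((σ ^ k) x) = (τ ^ k) (φ x) := by
    intro k
    induction k with
    | zero => intro x; rfl
    | succ k ih => intro x; rw [pow_succ, pow_succ, Module.End.mul_apply, ih, h]; rfl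
  simp [eigProj_apply, this]

theorem eigProj_mul_self (hp : IsUnit (p : Q)) (hp0 : p ≠ 0) {z : Q} (hz : z ^ p = 1)
    {σ : Module.End Q M} (hσ : σ ^ p = 1) : eigProj hp z σ * eigProj hp z σ = eigProj hp z σ :=
  LinearMap.ext fun x => eigProj_of_mem hp hp0 hz (apply_eigProj hp hp0 hz hσ x)

theorem eigProj_comm (hp : IsUnit (p : Q)) (z : Q) {σ φ : Module.End Q M} (h : σ * φ = φ * σ) :
    eigProj hp z σ * φ = φ * eigProj hp z σ :=
  LinearMap.ext fun x => (comp_eigProj hp z (fun x => (LinearMap.congr_fun h x).symm) x).symm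

end eigProj

namespace CurvedModule

variable {Γ : Type} [CommRing Γ] {Q : Type u} [CommRing Q] {c : Q}

/-- The idempotent `ε` of the graded module `T` is such that the compression of the differential to
its range has curvature `c`. -/
structure IsSummand (T : CurvedModule Γ Q c) (ε : Module.End Q T.carrier) : Prop where
  idem : ∀ x, ε (ε x) = ε x
  proj : ∀ i x, ε (T.proj i x) = T.proj i (ε x)
  -- `ε` is not required to commute with `d`. Subquotients of a filtered object, which are summands
  -- only as graded modules, are thereby included.
  curv : ∀ x, ε (T.d (ε (T.d (ε x)))) = c • ε x

theorem IsSummand.of_comm {T : CurvedModule Γ Q c} {ε : Module.End Q T.carrier}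
    (h1 : ε * ε = ε) (h2 : ∀ i, ε * T.proj i = T.proj i * ε) (h3 : ε * T.d = T.d * ε) :
    IsSummand T ε where
  idem := LinearMap.congr_fun h1
  proj i := LinearMap.congr_fun (h2 i)
  curv x := by
    have h4 : ∀ y, ε (T.d y) = T.d (ε y) := LinearMap.congr_fun h3
    have h5 : ∀ y, ε (ε y) = ε y := LinearMap.congr_fun h1
    rw [h4, h5, h4, h5]
    exact LinearMap.congr_fun T.d_mul_d _

/-- The range of `ε`, with the compression of the differential. -/
noncomputable def summand (T : CurvedModule Γ Q c) {ε : Module.End Q T.carrier}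
    (h : IsSummand T ε) : CurvedModule Γ Q c where
  carrier := LinearMap.range ε
  projective := Module.Projective.of_split (LinearMap.range ε).subtype ε.rangeRestrict
    (LinearMap.ext (by rintro ⟨_, x, rfl⟩; exact Subtype.ext (h.idem x)))
  proj i := (T.proj i).restrict (by rintro _ ⟨x, rfl⟩; exact ⟨T.proj i x, h.proj i x⟩)
  proj_mul_self i := LinearMap.ext fun x => Subtype.ext (T.proj_apply_self i x)
  proj_mul_of_ne i j hij :=
    LinearMap.ext fun x => Subtype.ext (LinearMap.congr_fun (T.proj_mul_of_ne i j hij) x)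
  exists_sum_proj := by
    obtain ⟨S, h1, h2⟩ := T.exists_sum_proj
    refine ⟨S, fun i hi => LinearMap.ext fun x => Subtype.ext ?_,
      LinearMap.ext fun x => Subtype.ext ?_⟩
    · simp [h1 i hi]
    · have := LinearMap.congr_fun h2 (x : T.carrier)
      rw [LinearMap.sum_apply] at this
      simpa using this
  d := (ε * T.d).restrict fun _ _ => ⟨_, rfl⟩
  d_mul_proj i := LinearMap.ext fun x => Subtype.ext (by
    change ε (T.d (T.proj i x.1)) = T.proj (i - 1) (ε (T.d x.1))
    rw [← h.proj]
    exact congrArg ε (LinearMap.congr_fun (T.d_mul_proj i) x.1))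
  d_mul_d := LinearMap.ext (by
    rintro ⟨_, x, rfl⟩
    exact Subtype.ext (h.curv x))

theorem summand_val {T : CurvedModule Γ Q c} {ε : Module.End Q T.carrier} (h : IsSummand T ε)
    (x : (T.summand h).carrier) : ε x.1 = x.1 := by
  obtain ⟨_, x, rfl⟩ := x
  exact h.idem x

/-- An isomorphism of summands. -/
theorem summand_htpyEquiv {T T' : CurvedModule Γ Q c} {ε : Module.End Q T.carrier}
    {ε' : Module.End Q T'.carrier} (h : IsSummand T ε) (h' : IsSummand T' ε')
    (φ : T.carrier →ₗ[Q] T'.carrier) (φ' : T'.carrier →ₗ[Q] T.carrier)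
    (h1 : ∀ x, ε x = x → ε' (φ x) = φ x) (h2 : ∀ x, ε' x = x → ε (φ' x) = φ' x)
    (h3 : ∀ x, ε x = x → φ' (φ x) = x) (h4 : ∀ x, ε' x = x → φ (φ' x) = x)
    (h5 : ∀ i x, φ (T.proj i x) = T'.proj i (φ x))
    (h6 : ∀ x, ε x = x → φ (ε (T.d x)) = ε' (T'.d (φ x))) :
    HtpyEquiv (T.summand h) (T'.summand h') := by
  let a : (T.summand h).carrier →ₗ[Q] (T'.summand h').carrier :=
    φ.restrict fun x hx => ⟨φ x, h1 x (summand_val h ⟨x, hx⟩)⟩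
  let b : (T'.summand h').carrier →ₗ[Q] (T.summand h).carrier :=
    φ'.restrict fun x hx => ⟨φ' x, h2 x (summand_val h' ⟨x, hx⟩)⟩
  refine HtpyEquiv.of_equiv (LinearEquiv.ofLinearMap a b
    (LinearMap.ext fun x => Subtype.ext (h4 _ (summand_val h' x)))
    (LinearMap.ext fun x => Subtype.ext (h3 _ (summand_val h x))))
    ⟨fun i => LinearMap.ext fun x => Subtype.ext (h5 i _),
      LinearMap.ext fun x => Subtype.ext (h6 _ (summand_val h x))⟩

/-- A triangular decomposition of a summand yields a short exact sequence. -/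
theorem summand_shortExact {T : CurvedModule Γ Q c} {ε ε₁ ε₂ : Module.End Q T.carrier}
    (h : IsSummand T ε) (h₁ : IsSummand T ε₁) (h₂ : IsSummand T ε₂)
    (hs : ∀ x, ε x = ε₁ x + ε₂ x) (h12 : ∀ x, ε₁ (ε₂ x) = 0) (h21 : ∀ x, ε₂ (ε₁ x) = 0)
    (hd : ∀ x, ε₂ (T.d (ε₁ x)) = 0) :
    ShortExact (T.summand h₁) (T.summand h) (T.summand h₂) := by
  have e1 : ∀ x, ε (ε₁ x) = ε₁ x := fun x => by rw [hs, h₁.idem, h21, add_zero]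
  have e2 : ∀ x, ε (ε₂ x) = ε₂ x := fun x => by rw [hs, h12, h₂.idem, zero_add]
  have e3 : ∀ x, ε₂ (ε x) = ε₂ x := fun x => by rw [hs, map_add, h21, h₂.idem, zero_add]
  let i : (T.summand h₁).carrier →ₗ[Q] (T.summand h).carrier :=
    LinearMap.id.restrict (p := LinearMap.range ε₁) (q := LinearMap.range ε)
      (by rintro _ ⟨x, rfl⟩; exact ⟨ε₁ x, e1 x⟩)
  let q : (T.summand h).carrier →ₗ[Q] (T.summand h₂).carrier :=
    ε₂.restrict (p := LinearMap.range ε) (q := LinearMap.range ε₂) fun x _ => ⟨x, rfl⟩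
  have hi : ∀ x, (i x).1 = x.1 := fun _ => rfl
  have hq : ∀ x, (q x).1 = ε₂ x.1 := fun _ => rfl
  refine ⟨i, q, ⟨fun j => rfl, LinearMap.ext fun x => Subtype.ext ?_⟩,
    ⟨fun j => LinearMap.ext fun x => Subtype.ext (h₂.proj j _), LinearMap.ext fun x =>
      Subtype.ext ?_⟩, fun x y hxy => Subtype.ext (by
        rw [← hi x, ← hi y, hxy]), fun x => ?_,
      fun y => ?_⟩
  · change ε₁ (T.d x.1) = ε (T.d x.1)
    rw [hs, ← summand_val h₁ x, hd, add_zero]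
  · change ε₂ (ε (T.d x.1)) = ε₂ (T.d (ε₂ x.1))
    rw [e3]
    conv_lhs => rw [← summand_val h x, hs, map_add, map_add, hd, zero_add]
  · constructor
    · intro hx
      have hx0 : ε₂ x.1 = 0 := congrArg Subtype.val hx
      have hx1 : ε₁ x.1 = x.1 := by
        conv_rhs => rw [← summand_val h x, hs, hx0, add_zero]
      exact ⟨⟨x.1, x.1, hx1⟩, Subtype.ext rfl⟩
    · rintro ⟨y, rfl⟩
      apply Subtype.ext
      rw [hq, hi, ← summand_val h₁ y, h21]; rfl
  · refine ⟨⟨y.1, y.1, ?_⟩, Subtype.ext (summand_val h₂ y)⟩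
    rw [← summand_val h₂ y, e2]

theorem IsSummand.eigProj {T : CurvedModule Γ Q c} {p : ℕ} (hp : IsUnit (p : Q)) (hp0 : p ≠ 0)
    {z : Q} (hz : z ^ p = 1) {σ : Module.End Q T.carrier} (hσ : σ ^ p = 1)
    (h1 : ∀ i, σ * T.proj i = T.proj i * σ) (h2 : σ * T.d = T.d * σ) :
    IsSummand T (eigProj hp z σ) :=
  .of_comm (eigProj_mul_self hp hp0 hz hσ) (fun i => eigProj_comm hp z (h1 i))
    (eigProj_comm hp z h2)

/-- The eigenspace is a summand. -/
theorem eigenspace_htpyEquiv {T : CurvedModule Γ Q c} {p : ℕ} (hp : IsUnit (p : Q)) (hp0 : p ≠ 0)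
    {z : Q} (hz : z ^ p = 1) {σ : Module.End Q T.carrier} (hσ : σ ^ p = 1)
    (h1 : ∀ i, σ * T.proj i = T.proj i * σ) (h2 : σ * T.d = T.d * σ) :
    HtpyEquiv (T.eigenspace σ h1 h2 hp hσ z hz)
      (T.summand (.eigProj hp hp0 hz hσ h1 h2)) := by
  have e : eig σ z = LinearMap.range (CyclicAdams.eigProj hp z σ) := by
    ext x
    rw [mem_eig]
    constructor
    · exact fun hx => ⟨x, eigProj_of_mem hp hp0 hz hx⟩
    · rintro ⟨y, rfl⟩
      exact apply_eigProj hp hp0 hz hσ y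
  refine HtpyEquiv.of_equiv (LinearEquiv.ofEq _ _ e : eig σ z ≃ₗ[Q] _) ⟨fun i => rfl,
    LinearMap.ext fun x => Subtype.ext ?_⟩
  change T.d x.1 = CyclicAdams.eigProj hp z σ (T.d x.1)
  rw [← comp_eigProj hp z (fun y => (LinearMap.congr_fun h2 y).symm),
    eigProj_of_mem hp hp0 hz (mem_eig.mp x.2)]

end CurvedModule

namespace CurvedModule

theorem lcomp_sum {Q : Type u} [CommRing Q] {M N L : Type*} [AddCommGroup M] [Module Q M]
    [AddCommGroup N] [Module Q N] [AddCommGroup L] [Module Q L] {ι : Type*} (t : Finset ι)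
    (φ : N →ₗ[Q] L) (ψ : ι → M →ₗ[Q] N) : φ ∘ₗ (∑ s ∈ t, ψ s) = ∑ s ∈ t, φ ∘ₗ ψ s := by
  ext x; simp

theorem lsum_comp {Q : Type u} [CommRing Q] {M N L : Type*} [AddCommGroup M] [Module Q M]
    [AddCommGroup N] [Module Q N] [AddCommGroup L] [Module Q L] {ι : Type*} (t : Finset ι)
    (φ : M →ₗ[Q] N) (ψ : ι → N →ₗ[Q] L) : (∑ s ∈ t, ψ s) ∘ₗ φ = ∑ s ∈ t, ψ s ∘ₗ φ := by
  ext x; simp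

variable {Γ : Type} [CommRing Γ] {Q : Type u} [CommRing Q] {c : Q}

/-! ## Maps and homotopies of tensor powers -/

theorem IsHom.proj_mem {P P' : CurvedModule Γ Q c} {g : P.carrier →ₗ[Q] P'.carrier}
    (hg : ∀ i, g ∘ₗ P.proj i = P'.proj i ∘ₗ g) {i : Γ} {x : P.carrier} (hx : P.proj i x = x) :
    P'.proj i (g x) = g x := by
  have := LinearMap.congr_fun (hg i) x
  simp only [LinearMap.comp_apply, hx] at this
  exact this.symm

/-- The tensor power of a linear map. -/
noncomputable def tMap {P P' : CurvedModule Γ Q c} (n : ℕ) (g : P.carrier →ₗ[Q] P'.carrier) :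
    P.TPow n →ₗ[Q] P'.TPow n := PiTensorProduct.map fun _ => g

variable {n : ℕ} {P P' : CurvedModule Γ Q c} {g : P.carrier →ₗ[Q] P'.carrier}

theorem tMap_tprod (x : Fin n → P.carrier) :
    tMap n g (PiTensorProduct.tprod Q x) = PiTensorProduct.tprod Q fun s => g (x s) :=
  PiTensorProduct.map_tprod _ _

theorem tMap_tProj (hg : ∀ i, g ∘ₗ P.proj i = P'.proj i ∘ₗ g) (i : Γ) :
    tMap n g ∘ₗ P.tProj n i = P'.tProj n i ∘ₗ tMap n g := by
  classical
  refine P.tPow_ext fun a x hx => ?_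
  rw [LinearMap.comp_apply, LinearMap.comp_apply, P.tProj_apply hx, tMap_tprod,
    P'.tProj_apply (a := a) fun s => IsHom.proj_mem hg (hx s)]
  split_ifs
  · exact tMap_tprod x
  · exact map_zero _

variable [SignedGrading Γ]

theorem tMap_tPerm (hg : ∀ i, g ∘ₗ P.proj i = P'.proj i ∘ₗ g) (σ : Equiv.Perm (Fin n)) :
    tMap n g ∘ₗ P.tPerm n σ = P'.tPerm n σ ∘ₗ tMap n g := by
  refine P.tPow_ext fun a x hx => ?_
  rw [LinearMap.comp_apply, LinearMap.comp_apply, P.tPerm_apply σ hx, tMap_tprod,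
    P'.tPerm_apply σ (a := a) fun s => IsHom.proj_mem hg (hx s), map_smul, tMap_tprod]

theorem comp_signMap (hg : ∀ i, g ∘ₗ P.proj i = P'.proj i ∘ₗ g) :
    g ∘ₗ P.signMap = P'.signMap ∘ₗ g := by
  refine P.ext_of_mem fun i x hx => ?_
  rw [LinearMap.comp_apply, LinearMap.comp_apply, P.signMap_apply_of_mem hx, map_smul,
    P'.signMap_apply_of_mem (IsHom.proj_mem hg hx)]

theorem tMap_tDiff (hg : IsHom P P' g) : tMap n g ∘ₗ P.tDiff n = P'.tDiff n ∘ₗ tMap n g := by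
  unfold tDiff
  rw [lcomp_sum, lsum_comp]
  refine Finset.sum_congr rfl fun j _ => ?_
  unfold tMap tDiffAt
  rw [← PiTensorProduct.map_comp, ← PiTensorProduct.map_comp]
  congr 1
  funext k
  split_ifs
  exacts [comp_signMap hg.proj, hg.d, rfl]

theorem isHom_tMap (hg : IsHom P P' g) :
    IsHom (P.tensorPower n) (P'.tensorPower n) (tMap n g) :=
  ⟨tMap_tProj hg.proj, tMap_tDiff hg⟩

theorem homotopy_comp_signMap {h : P.carrier →ₗ[Q] P'.carrier}
    (hh : ∀ i, h ∘ₗ P.proj i = P'.proj (i + 1) ∘ₗ h) : h ∘ₗ P.signMap = -(P'.signMap ∘ₗ h) := by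
  refine P.ext_of_mem fun i x hx => ?_
  have hhx : P'.proj (i + 1) (h x) = h x := by
    have := LinearMap.congr_fun (hh i) x
    simp only [LinearMap.comp_apply, hx] at this
    exact this.symm
  rw [LinearMap.neg_apply, LinearMap.comp_apply, LinearMap.comp_apply, P.signMap_apply_of_mem hx,
    map_smul, P'.signMap_apply_of_mem hhx, map_add, map_one, sgn_add, sgn_one]
  simp

variable {g₁ g₂ h : P.carrier →ₗ[Q] P'.carrier}

/-- The `s`-th summand of the homotopy of the tensor powers of homotopic maps. -/
noncomputable def tHomotopyAt (n : ℕ) (h g₁ g₂ : P.carrier →ₗ[Q] P'.carrier) (s : Fin n) :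
    P.TPow n →ₗ[Q] P'.TPow n :=
  PiTensorProduct.map fun k => if k < s then g₁ ∘ₗ P.signMap else if k = s then h else g₂

theorem tHomotopyAt_tProj (hg₁ : IsHom P P' g₁) (hg₂ : IsHom P P' g₂)
    (hh : ∀ i, h ∘ₗ P.proj i = P'.proj (i + 1) ∘ₗ h) (s : Fin n) (i : Γ) :
    tHomotopyAt n h g₁ g₂ s ∘ₗ P.tProj n i = P'.tProj n (i + 1) ∘ₗ tHomotopyAt n h g₁ g₂ s := by
  classical
  refine P.tPow_ext fun a x hx => ?_
  have hm : ∀ k, P'.proj (Function.update a s (a s + 1) k)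
      ((if k < s then g₁ ∘ₗ P.signMap else if k = s then h else g₂) (x k)) =
      (if k < s then g₁ ∘ₗ P.signMap else if k = s then h else g₂) (x k) := by
    intro k
    rcases lt_trichotomy k s with hk | hk | hk
    · rw [if_pos hk, Function.update_of_ne hk.ne, LinearMap.comp_apply,
        P.signMap_apply_of_mem (hx k), map_smul, map_smul, IsHom.proj_mem hg₁.proj (hx k)]
    · subst hk
      rw [if_neg (lt_irrefl _), if_pos rfl, Function.update_self]
      have := LinearMap.congr_fun (hh (a k)) (x k)
      simp only [LinearMap.comp_apply, hx k] at this
      exact this.symm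
    · rw [if_neg hk.not_gt, if_neg hk.ne', Function.update_of_ne hk.ne']
      exact IsHom.proj_mem hg₂.proj (hx k)
  have hs : ∑ l, Function.update a s (a s + 1) l = ∑ l, a l + 1 := by
    rw [Finset.sum_update_of_mem (Finset.mem_univ s), ← Finset.add_sum_erase _ a
      (Finset.mem_univ s), Finset.sdiff_singleton_eq_erase]
    ring
  have e : tHomotopyAt n h g₁ g₂ s (PiTensorProduct.tprod Q x) = PiTensorProduct.tprod Q fun k =>
      (if k < s then g₁ ∘ₗ P.signMap else if k = s then h else g₂) (x k) :=
    PiTensorProduct.map_tprod _ _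
  rw [LinearMap.comp_apply, LinearMap.comp_apply, P.tProj_apply hx, e, P'.tProj_apply hm, hs]
  by_cases hi : ∑ l, a l = i
  · rw [if_pos hi, if_pos (by rw [hi]), e]
  · rw [if_neg hi, if_neg fun h' => hi (add_right_cancel h'), map_zero]

/-- The two composites agree in every factor except the one at the smaller of the two positions.
There an odd operator passes the sign map, which produces the factor `-1`. -/
theorem tDiffAt_comp_tHomotopyAt_of_ne (hg₁ : IsHom P P' g₁) (hg₂ : IsHom P P' g₂)
    (hh : ∀ i, h ∘ₗ P.proj i = P'.proj (i + 1) ∘ₗ h) {s t : Fin n} (hst : t ≠ s) :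
    P'.tDiffAt n t ∘ₗ tHomotopyAt n h g₁ g₂ s + tHomotopyAt n h g₁ g₂ s ∘ₗ P.tDiffAt n t = 0 := by
  classical
  unfold tDiffAt tHomotopyAt
  rw [← PiTensorProduct.map_comp, ← PiTensorProduct.map_comp]
  set G : Fin n → P.carrier →ₗ[Q] P'.carrier := fun k =>
    (if k < s then g₁ ∘ₗ P.signMap else if k = s then h else g₂) ∘ₗ
      (if k < t then P.signMap else if k = t then P.d else 1) with hG
  have hds : P.signMap ∘ₗ P.d = -(P.d ∘ₗ P.signMap) := P.signMap_mul_d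
  have e : (fun k => (if k < t then P'.signMap else if k = t then P'.d else 1) ∘ₗ
      (if k < s then g₁ ∘ₗ P.signMap else if k = s then h else g₂)) =
      Function.update G (min s t) ((-1 : Q) • G (min s t)) := by
    funext k
    rcases lt_or_gt_of_ne hst with hlt | hlt
    · rw [min_eq_right hlt.le]
      by_cases hk : k = t
      · subst hk
        simp only [hG, lt_irrefl, if_false, if_true, hlt, Function.update_self]
        rw [LinearMap.comp_assoc, hds, LinearMap.comp_neg, neg_smul, one_smul, neg_neg,
          ← LinearMap.comp_assoc, ← LinearMap.comp_assoc, hg₁.d]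
      · rw [Function.update_of_ne hk]
        simp only [hG, hk, if_false]
        rcases lt_or_gt_of_ne hk with hk' | hk'
        · simp only [hk', hk'.trans hlt, if_true]
          rw [← LinearMap.comp_assoc, comp_signMap hg₁.proj]
        · simp only [hk'.not_gt, if_false]; rfl
    · rw [min_eq_left hlt.le]
      by_cases hk : k = s
      · subst hk
        simp only [hG, lt_irrefl, if_false, if_true, hlt, Function.update_self]
        rw [homotopy_comp_signMap hh, neg_smul, one_smul, neg_neg]
      · rw [Function.update_of_ne hk]
        simp only [hG, hk, if_false]
        rcases lt_or_gt_of_ne hk with hk' | hk'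
        · simp only [hk', hk'.trans hlt, if_true]
          rw [← LinearMap.comp_assoc, comp_signMap hg₁.proj]
        · simp only [hk'.not_gt, if_false]
          split_ifs
          exacts [(comp_signMap hg₂.proj).symm, hg₂.d.symm, rfl]
  rw [e, PiTensorProduct.map_update_smul, Function.update_eq_self]
  calc (-1 : Q) • PiTensorProduct.map G + PiTensorProduct.map G
      = ((-1 : Q) + 1) • PiTensorProduct.map G := by rw [add_smul, one_smul]
    _ = 0 := by rw [neg_add_cancel, zero_smul]

/-- The signs to the left of position `s` square to one, and `d h + h d = g₁ - g₂` at `s` leaves the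
difference of two consecutive interpolations between the tensor powers of `g₂` and `g₁`. Summed over
`s` these telescope. -/
theorem tDiffAt_comp_tHomotopyAt_self (hg₁ : IsHom P P' g₁) (hh : IsHomotopy P P' h g₁ g₂)
    (s : Fin n) :
    P'.tDiffAt n s ∘ₗ tHomotopyAt n h g₁ g₂ s + tHomotopyAt n h g₁ g₂ s ∘ₗ P.tDiffAt n s =
      PiTensorProduct.map (fun k : Fin n => if (k : ℕ) < s + 1 then g₁ else g₂) -
        PiTensorProduct.map (fun k : Fin n => if (k : ℕ) < s then g₁ else g₂) := by
  classical
  unfold tDiffAt tHomotopyAt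
  rw [← PiTensorProduct.map_comp, ← PiTensorProduct.map_comp]
  set G : Fin n → P.carrier →ₗ[Q] P'.carrier := fun k => if k < s then g₁ else g₂ with hG
  have hss : P.signMap ∘ₗ P.signMap = LinearMap.id := P.signMap_mul_signMap
  have e1 : (fun k => (if k < s then P'.signMap else if k = s then P'.d else 1) ∘ₗ
      (if k < s then g₁ ∘ₗ P.signMap else if k = s then h else g₂)) =
      Function.update G s (P'.d ∘ₗ h) := by
    funext k
    by_cases hk : k = s
    · subst hk; simp
    · rw [Function.update_of_ne hk]
      simp only [hG, hk, if_false]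
      split_ifs
      · rw [← LinearMap.comp_assoc, ← comp_signMap hg₁.proj, LinearMap.comp_assoc, hss,
          LinearMap.comp_id]
      · rfl
  have e2 : (fun k => (if k < s then g₁ ∘ₗ P.signMap else if k = s then h else g₂) ∘ₗ
      (if k < s then P.signMap else if k = s then P.d else 1)) =
      Function.update G s (h ∘ₗ P.d) := by
    funext k
    by_cases hk : k = s
    · subst hk; simp
    · rw [Function.update_of_ne hk]
      simp only [hG, hk, if_false]
      split_ifs
      · rw [LinearMap.comp_assoc, hss, LinearMap.comp_id]
      · rfl
  have e3 : (fun k : Fin n => if (k : ℕ) < s + 1 then g₁ else g₂) = Function.update G s g₁ := by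
    funext k
    by_cases hk : k = s
    · subst hk; simp
    · rw [Function.update_of_ne hk]
      have : (k : ℕ) < s + 1 ↔ k < s := by
        rw [Nat.lt_succ_iff, ← Fin.le_def, le_iff_lt_or_eq, or_iff_left hk]
      simp only [hG, this]
  have e4 : (fun k : Fin n => if (k : ℕ) < s then g₁ else g₂) = Function.update G s g₂ := by
    funext k
    by_cases hk : k = s
    · subst hk; simp
    · rw [Function.update_of_ne hk]; rfl
  rw [e1, e2, e3, e4, ← PiTensorProduct.map_update_add, hh.d]
  have := PiTensorProduct.map_update_add G s (g₁ - g₂) g₂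
  rw [sub_add_cancel] at this
  exact eq_sub_of_add_eq this.symm

/-- The tensor powers of homotopic maps are homotopic. -/
theorem isHomotopy_tMap (hg₁ : IsHom P P' g₁) (hg₂ : IsHom P P' g₂)
    (hh : IsHomotopy P P' h g₁ g₂) :
    IsHomotopy (P.tensorPower n) (P'.tensorPower n) (∑ s, tHomotopyAt n h g₁ g₂ s)
      (tMap n g₁) (tMap n g₂) where
  proj i := by
    change (∑ s, tHomotopyAt n h g₁ g₂ s) ∘ₗ P.tProj n i =
      P'.tProj n (i + 1) ∘ₗ (∑ s, tHomotopyAt n h g₁ g₂ s)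
    rw [lsum_comp, lcomp_sum]
    exact Finset.sum_congr rfl fun s _ => tHomotopyAt_tProj hg₁ hg₂ hh.proj s i
  d := by
    change P'.tDiff n ∘ₗ (∑ s, tHomotopyAt n h g₁ g₂ s) +
      (∑ s, tHomotopyAt n h g₁ g₂ s) ∘ₗ P.tDiff n = _
    rw [lsum_comp, lcomp_sum, ← Finset.sum_add_distrib]
    have key : ∀ s, P'.tDiff n ∘ₗ tHomotopyAt n h g₁ g₂ s +
        tHomotopyAt n h g₁ g₂ s ∘ₗ P.tDiff n =
        PiTensorProduct.map (fun k : Fin n => if (k : ℕ) < (s : ℕ) + 1 then g₁ else g₂) -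
        PiTensorProduct.map (fun k : Fin n => if (k : ℕ) < s then g₁ else g₂) := by
      intro s
      unfold tDiff
      rw [lsum_comp, lcomp_sum, ← Finset.sum_add_distrib,
        Finset.sum_eq_single s]
      · exact tDiffAt_comp_tHomotopyAt_self hg₁ hh s
      · exact fun t _ hts => tDiffAt_comp_tHomotopyAt_of_ne hg₁ hg₂ hh.proj hts
      · exact fun hs => absurd (Finset.mem_univ s) hs
    rw [Finset.sum_congr rfl fun s _ => key s,
      Fin.sum_univ_eq_sum_range (fun s => PiTensorProduct.map
        (fun k : Fin n => if (k : ℕ) < s + 1 then g₁ else g₂) -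
        PiTensorProduct.map (fun k : Fin n => if (k : ℕ) < s then g₁ else g₂)),
      Finset.sum_range_sub (fun s => PiTensorProduct.map
        (fun k : Fin n => if (k : ℕ) < s then g₁ else g₂))]
    simp only [Fin.is_lt, if_true, Nat.not_lt_zero, if_false]
    rfl

theorem eigProj_tMap {p : ℕ} (hp : IsUnit (p : Q)) (z : Q)
    (hg : ∀ i, g ∘ₗ P.proj i = P'.proj i ∘ₗ g) (σ : Equiv.Perm (Fin n)) (x : P.TPow n) :
    tMap n g (eigProj hp z (P.tPerm n σ) x) = eigProj hp z (P'.tPerm n σ) (tMap n g x) :=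
  comp_eigProj hp z (LinearMap.congr_fun (tMap_tPerm hg σ)) x

/-- Homotopy equivalent objects have homotopy equivalent cyclic powers. -/
theorem HtpyEquiv.cyclicPower {p : ℕ} (hp : IsUnit (p : Q)) (hp0 : p ≠ 0) {z : Q}
    (hz : z ^ p = 1) (hP : HtpyEquiv P P') :
    HtpyEquiv (P.cyclicPower hp z hz) (P'.cyclicPower hp z hz) := by
  obtain ⟨g, g', k, k', hg, hg', hk, hk'⟩ := hP
  have hm : ∀ {P P' : CurvedModule Γ Q c} {g : P.carrier →ₗ[Q] P'.carrier} (hg : IsHom P P' g),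
      ∀ x ∈ eig (P.tPerm p (finRotate p)) z, tMap p g x ∈ eig (P'.tPerm p (finRotate p)) z := by
    intro P P' g hg x hx
    rw [mem_eig] at hx ⊢
    rw [← LinearMap.comp_apply, ← tMap_tPerm hg.proj, LinearMap.comp_apply, hx, map_smul]
  have hhom : ∀ {P P' : CurvedModule Γ Q c} {g : P.carrier →ₗ[Q] P'.carrier} (hg : IsHom P P' g),
      IsHom (P.cyclicPower hp z hz) (P'.cyclicPower hp z hz) ((tMap p g).restrict (hm hg)) := by
    intro P P' g hg
    exact ⟨fun i => LinearMap.ext fun x => Subtype.ext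
      (LinearMap.congr_fun ((isHom_tMap hg).proj i) x.1), LinearMap.ext fun x => Subtype.ext
      (LinearMap.congr_fun (isHom_tMap hg).d x.1)⟩
  have hidem : ∀ (P : CurvedModule Γ Q c) x, eigProj hp z (P.tPerm p (finRotate p)) x ∈
      eig (P.tPerm p (finRotate p)) z := fun P x =>
    mem_eig.mpr (apply_eigProj hp hp0 hz (P.tPerm_finRotate_pow p) x)
  have hhtpy : ∀ {P P' : CurvedModule Γ Q c} {g : P.carrier →ₗ[Q] P'.carrier}
      {g' : P'.carrier →ₗ[Q] P.carrier} {k : P.carrier →ₗ[Q] P.carrier} (hg : IsHom P P' g)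
      (hg' : IsHom P' P g') (_ : IsHomotopy P P k (g' ∘ₗ g) LinearMap.id),
      ∃ K, IsHomotopy (P.cyclicPower hp z hz) (P.cyclicPower hp z hz) K
        ((tMap p g').restrict (hm hg') ∘ₗ (tMap p g).restrict (hm hg)) LinearMap.id := by
    intro P P' g g' k hg hg' hk
    have hgg : IsHom P P (g' ∘ₗ g) := ⟨fun i => by
      rw [LinearMap.comp_assoc, hg.proj, ← LinearMap.comp_assoc, hg'.proj, LinearMap.comp_assoc],
      by rw [LinearMap.comp_assoc, hg.d, ← LinearMap.comp_assoc, hg'.d, LinearMap.comp_assoc]⟩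
    have hid : IsHom P P LinearMap.id := ⟨fun _ => rfl, rfl⟩
    have H := isHomotopy_tMap (n := p) hgg hid hk
    set K := ∑ s, tHomotopyAt p k (g' ∘ₗ g) LinearMap.id s
    set σ := P.tPerm p (finRotate p) with hσ
    have c1 : ∀ x, eigProj hp z σ (P.tDiff p x) = P.tDiff p (eigProj hp z σ x) :=
      LinearMap.congr_fun (eigProj_comm hp z (P.tPerm_mul_tDiff _))
    have c2 : ∀ i x, eigProj hp z σ (P.tProj p i x) = P.tProj p i (eigProj hp z σ x) := fun i =>
      LinearMap.congr_fun (eigProj_comm hp z (P.tPerm_mul_tProj _ i))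
    -- The homotopy `K` treats the factors asymmetrically and need not preserve the eigenspace.
    -- Composing with the projector repairs this, as the projector commutes with the differential
    -- and fixes the eigenspace.
    refine ⟨(eigProj hp z σ ∘ₗ K).restrict fun x _ => hidem P _, fun i => LinearMap.ext fun x =>
      Subtype.ext ?_, LinearMap.ext fun x => Subtype.ext ?_⟩
    · change eigProj hp z σ (K (P.tProj p i x.1)) = P.tProj p (i + 1) (eigProj hp z σ (K x.1))
      rw [← c2]
      exact congrArg _ (LinearMap.congr_fun (H.proj i) x.1)
    · have key : ∀ y : P.TPow p, P.tDiff p (K y) + K (P.tDiff p y) =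
          tMap p g' (tMap p g y) - y := by
        intro y
        have e1 : P.tDiff p (K y) + K (P.tDiff p y) =
          tMap p (g' ∘ₗ g) y - tMap p LinearMap.id y := LinearMap.congr_fun H.d y
        have e2 : tMap p (g' ∘ₗ g) y = tMap p g' (tMap p g y) :=
          LinearMap.congr_fun (PiTensorProduct.map_comp (fun _ => g') (fun _ => g)) y
        have e3 : tMap p LinearMap.id y = y := LinearMap.congr_fun PiTensorProduct.map_id y
        rw [e1, e2, e3]
      have key' : ∀ y : P.TPow p, y ∈ eig σ z →
          P.tDiff p (eigProj hp z σ (K y)) + eigProj hp z σ (K (P.tDiff p y)) =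
            tMap p g' (tMap p g y) - y := by
        intro y hy
        rw [← c1, ← map_add, key]
        refine eigProj_of_mem hp hp0 hz ?_
        rw [← mem_eig]
        exact Submodule.sub_mem _ (hm hg' _ (hm hg _ hy)) hy
      exact key' x.1 x.2
  obtain ⟨K, hK⟩ := hhtpy hg hg' hk
  obtain ⟨K', hK'⟩ := hhtpy hg' hg hk'
  exact ⟨_, _, K, K', hhom hg, hhom hg', hK, hK'⟩

end CurvedModule

namespace CurvedModule

/-! ## Graded splittings -/

section Splitting

variable {Γ : Type} [CommRing Γ] {Q : Type u} [CommRing Q] {c : Q}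

/-- A short exact sequence splits as a sequence of graded modules. -/
theorem ShortExact.exists_splitting {P' P P'' : CurvedModule Γ Q c} (h : ShortExact P' P P'') :
    ∃ (i : P'.carrier →ₗ[Q] P.carrier) (r : P.carrier →ₗ[Q] P'.carrier)
      (q : P.carrier →ₗ[Q] P''.carrier) (j : P''.carrier →ₗ[Q] P.carrier),
      IsHom P' P i ∧ IsHom P P'' q ∧ (∀ k, r ∘ₗ P.proj k = P'.proj k ∘ₗ r) ∧
      (∀ k, j ∘ₗ P''.proj k = P.proj k ∘ₗ j) ∧ (∀ x, r (i x) = x) ∧ (∀ x, q (j x) = x) ∧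
      (∀ x, q (i x) = 0) ∧ ∀ x, i (r x) + j (q x) = x := by
  classical
  obtain ⟨i, q, hi, hq, hinj, hex, hsurj⟩ := h
  obtain ⟨j₀, hj₀⟩ := Module.projective_lifting_property q LinearMap.id hsurj
  obtain ⟨S, hS0, hS1⟩ := P''.exists_sum_proj
  have hqp : ∀ k x, q (P.proj k x) = P''.proj k (q x) := fun k => LinearMap.congr_fun (hq.proj k)
  have hip : ∀ k x, i (P'.proj k x) = P.proj k (i x) := fun k => LinearMap.congr_fun (hi.proj k)
  -- A section given by projectivity need not respect degrees; its degree-preserving part is again a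
  -- section.
  set j : P''.carrier →ₗ[Q] P.carrier := ∑ k ∈ S, P.proj k ∘ₗ j₀ ∘ₗ P''.proj k with hj
  have hja : ∀ x, j x = ∑ k ∈ S, P.proj k (j₀ (P''.proj k x)) := fun x => by
    simp [hj, LinearMap.sum_apply]
  have hqj : ∀ x, q (j x) = x := by
    intro x
    rw [hja, map_sum]
    have : ∀ k ∈ S, q (P.proj k (j₀ (P''.proj k x))) = P''.proj k x := fun k _ => by
      rw [hqp]
      have : q (j₀ (P''.proj k x)) = P''.proj k x := LinearMap.congr_fun hj₀ _
      rw [this, P''.proj_apply_self]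
    rw [Finset.sum_congr rfl this, ← LinearMap.sum_apply, hS1]
    rfl
  have hjp : ∀ k, j ∘ₗ P''.proj k = P.proj k ∘ₗ j := by
    intro k
    refine P''.ext_of_mem fun l x hx => ?_
    have e : j x = P.proj l (j₀ x) := by
      rw [hja]
      by_cases hl : l ∈ S
      · rw [Finset.sum_eq_single_of_mem l hl, hx]
        intro b _ hb
        rw [P''.proj_apply_of_mem hx, if_neg hb.symm, map_zero, map_zero]
      · have hx0 : x = 0 := by rw [← hx, hS0 l hl]; rfl
        rw [hx0]; simp
    have ej : P.proj l (j x) = j x := by rw [e, P.proj_apply_self]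
    rw [LinearMap.comp_apply, LinearMap.comp_apply, P''.proj_apply_of_mem hx,
      P.proj_apply_of_mem ej]
    split_ifs
    · rfl
    · exact map_zero _
  set φ : Module.End Q P.carrier := LinearMap.id - j ∘ₗ q with hφ
  have hr : ∀ x, φ x ∈ LinearMap.range i := by
    intro x
    rw [LinearMap.mem_range, ← Set.mem_range, ← hex]
    simp [hφ, hqj]
  obtain ⟨r, hir⟩ : ∃ r : P.carrier →ₗ[Q] P'.carrier, ∀ x, i (r x) = x - j (q x) :=
    ⟨(LinearEquiv.ofInjective i hinj).symm.toLinearMap ∘ₗ φ.codRestrict _ hr, fun x =>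
      congrArg Subtype.val ((LinearEquiv.ofInjective i hinj).apply_symm_apply
        (φ.codRestrict _ hr x))⟩
  have hqi : ∀ x, q (i x) = 0 := fun x => (hex _).mpr ⟨x, rfl⟩
  refine ⟨i, r, q, j, hi, hq, fun k => LinearMap.ext fun x => hinj ?_, hjp,
    fun x => hinj ?_, hqj, hqi, fun x => by rw [hir, sub_add_cancel]⟩
  · have hjx : j (P''.proj k (q x)) = P.proj k (j (q x)) := LinearMap.congr_fun (hjp k) _
    rw [LinearMap.comp_apply, LinearMap.comp_apply, hir, hip, hir, map_sub, hqp, hjx]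
  · rw [hir, hqi, map_zero, sub_zero]

end Splitting

variable {Γ : Type} [CommRing Γ] {Q : Type u} [CommRing Q] {c : Q}

/-! ## Derivations of tensor powers -/

theorem map_tProj (P : CurvedModule Γ Q c) {n : ℕ} (g : Fin n → Module.End Q P.carrier)
    (hg : ∀ s i, g s * P.proj i = P.proj i * g s) (i : Γ) :
    PiTensorProduct.map g * P.tProj n i = P.tProj n i * PiTensorProduct.map g := by
  classical
  refine P.tPow_ext fun a x hx => ?_
  rw [Module.End.mul_apply, Module.End.mul_apply, P.tProj_apply hx, PiTensorProduct.map_tprod,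
    P.tProj_apply (a := a) fun s => IsHom.proj_mem (hg s) (hx s)]
  split_ifs
  · exact PiTensorProduct.map_tprod _ _
  · exact map_zero _

/-- An idempotent `e` of the graded module `P` whose range is stable under the differential. -/
structure IsWeight (P : CurvedModule Γ Q c) (e : Module.End Q P.carrier) : Prop where
  idem : e * e = e
  proj : ∀ i, e * P.proj i = P.proj i * e
  d : e * P.d * e = P.d * e

/-! ### The weight grading: counting the tensor factors that lie in a subobject. -/

namespace IsWeight

variable {P : CurvedModule Γ Q c} {e : Module.End Q P.carrier}

/-- The grading of `P` for which the range of `e` has degree one and the kernel of `e` has degree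
zero. -/
@[reducible]
noncomputable def grading (h : IsWeight P e) : CurvedModule ℤ Q 0 where
  carrier := P.carrier
  proj k := if k = 0 then 1 - e else if k = 1 then e else 0
  proj_mul_self k := by
    split_ifs
    · rw [sub_mul, mul_sub, mul_sub, h.idem]; simp
    · exact h.idem
    · exact mul_zero _
  proj_mul_of_ne k l hkl := by
    have h1 : (1 - e) * e = 0 := by rw [sub_mul, h.idem, one_mul, sub_self]
    have h2 : e * (1 - e) = 0 := by rw [mul_sub, h.idem, mul_one, sub_self]
    split_ifs <;> first | omega | exact h1 | exact h2 | exact zero_mul _ | exact mul_zero _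
  exists_sum_proj := ⟨{0, 1}, fun i hi => by
    simp only [Finset.mem_insert, Finset.mem_singleton, not_or] at hi
    rw [if_neg hi.1, if_neg hi.2], by rw [Finset.sum_pair (by decide)]; simp⟩
  -- With zero differential this is a bounded complex, so all results on `tProj` apply and give the
  -- grading of the tensor power by the total weight.
  d := 0
  d_mul_proj i := by rw [zero_mul, mul_zero]
  d_mul_d := by rw [zero_smul, zero_mul]

theorem grading_zero (h : IsWeight P e) : h.grading.proj 0 = 1 - e := by simp

theorem grading_one (h : IsWeight P e) : h.grading.proj 1 = e := by simp

theorem grading_of_ne (h : IsWeight P e) {k : ℤ} (h0 : k ≠ 0) (h1 : k ≠ 1) :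
    h.grading.proj k = 0 := by simp [h0, h1]

theorem grading_comm (h : IsWeight P e) {g : Module.End Q P.carrier} (hg : e * g = g * e) (k : ℤ) :
    g * h.grading.proj k = h.grading.proj k * g := by
  simp only
  split_ifs
  · rw [mul_sub, sub_mul, hg, one_mul, mul_one]
  · exact hg.symm
  · rw [mul_zero, zero_mul]

/-- The same graded module, with the differential that is induced on the range and on the cokernel
of `e`. -/
@[reducible]
noncomputable def diag (h : IsWeight P e) : CurvedModule Γ Q c where
  carrier := P.carrier
  proj := P.proj
  proj_mul_self := P.proj_mul_self
  proj_mul_of_ne := P.proj_mul_of_ne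
  exists_sum_proj := P.exists_sum_proj
  -- The component left out is `e d (1 - e)`, the one that glues the quotient to the subobject; what
  -- remains is the differential of the split extension.
  d := P.d * e + (1 - e) * P.d
  d_mul_proj i := by
    have h1 : (1 - e) * P.proj (i - 1) = P.proj (i - 1) * (1 - e) := by
      rw [sub_mul, mul_sub, h.proj, one_mul, mul_one]
    rw [add_mul, mul_add, mul_assoc, h.proj, ← mul_assoc, P.d_mul_proj, mul_assoc (1 - e),
      P.d_mul_proj, ← mul_assoc (1 - e), h1, mul_assoc, mul_assoc]
  d_mul_d := by
    have h1 : (1 - e) * e = 0 := by rw [sub_mul, h.idem, one_mul, sub_self]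
    have h2 : e * (1 - e) = 0 := by rw [mul_sub, h.idem, mul_one, sub_self]
    have h3 : (1 - e) * P.d * (1 - e) = (1 - e) * P.d := by
      rw [mul_sub, mul_one, sub_eq_self, sub_mul, sub_mul, one_mul, h.d, sub_self]
    calc (P.d * e + (1 - e) * P.d) * (P.d * e + (1 - e) * P.d)
        = P.d * (e * P.d * e) + P.d * (e * (1 - e)) * P.d + (1 - e) * (P.d * P.d) * e +
          ((1 - e) * P.d * (1 - e)) * P.d := by noncomm_ring
      _ = P.d * P.d * e + (1 - e) * (P.d * P.d) * e + (1 - e) * (P.d * P.d) := by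
          rw [h.d, h2, h3]; noncomm_ring
      _ = c • 1 := by
          rw [P.d_mul_d, smul_mul_assoc, mul_smul_comm, smul_mul_assoc, mul_one, h1, smul_zero,
            one_mul, add_zero, ← smul_add, add_sub_cancel]

theorem diag_comm (h : IsWeight P e) : e * h.diag.d = h.diag.d * e := by
  have h1 : (1 - e) * P.d * e = 0 := by rw [sub_mul, sub_mul, one_mul, h.d, sub_self]
  change e * (P.d * e + (1 - e) * P.d) = (P.d * e + (1 - e) * P.d) * e
  have h2 : e * (1 - e) = 0 := by rw [mul_sub, h.idem, mul_one, sub_self]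
  rw [mul_add, add_mul, h1, ← mul_assoc, ← mul_assoc, h.d, h2, mul_assoc P.d, h.idem, zero_mul]

/-- Linear maps on the tensor power agree if they agree on tensors of bihomogeneous elements. -/
theorem tPow_ext (h : IsWeight P e) {n : ℕ} {N : Type*} [AddCommGroup N] [Module Q N]
    {φ ψ : P.TPow n →ₗ[Q] N}
    (H : ∀ (a : Fin n → Γ) (b : Fin n → ℤ) (x : Fin n → P.carrier), (∀ s, P.proj (a s) (x s) = x s) →
      (∀ s, h.grading.proj (b s) (x s) = x s) →
      φ (PiTensorProduct.tprod Q x) = ψ (PiTensorProduct.tprod Q x)) : φ = ψ := by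
  classical
  refine P.tPow_ext fun a x hx => ?_
  obtain ⟨S, -, hS⟩ := h.grading.exists_sum_proj
  have hx' : x = fun s => ∑ i ∈ S, h.grading.proj i (x s) := by
    funext s
    conv_lhs => rw [← Module.End.one_apply (R := Q) (x s), ← hS, LinearMap.sum_apply]
  rw [hx', MultilinearMap.map_sum_finset, map_sum, map_sum]
  refine Finset.sum_congr rfl fun b _ => H a b _ (fun s => ?_)
    fun s => h.grading.proj_apply_self (b s) (x s)
  have := LinearMap.congr_fun (h.grading_comm (h.proj (a s)) (b s)) (x s)
  simp only [Module.End.mul_apply, hx s] at this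
  exact this

theorem tProj_comm_tProj (h : IsWeight P e) (n : ℕ) (k : ℤ) (i : Γ) :
    h.grading.tProj n k * P.tProj n i = P.tProj n i * h.grading.tProj n k := by
  classical
  refine h.tPow_ext fun a b x ha hb => ?_
  rw [Module.End.mul_apply, Module.End.mul_apply, P.tProj_apply ha, h.grading.tProj_apply hb]
  split_ifs with h1 h2 h2
  · rw [P.tProj_apply ha, if_pos h1]; exact (h.grading.tProj_apply hb k).trans (if_pos h2)
  · rw [map_zero]; exact (h.grading.tProj_apply hb k).trans (if_neg h2)
  · rw [map_zero]; exact ((P.tProj_apply ha i).trans (if_neg h1)).symm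
  · rw [map_zero, map_zero]

/-- A tensor of elements that are homogeneous for the weight vanishes, or its weights are zero or
one. -/
theorem tprod_eq_zero_or (h : IsWeight P e) {n : ℕ} {b : Fin n → ℤ} {x : Fin n → P.carrier}
    (hb : ∀ s, h.grading.proj (b s) (x s) = x s) :
    PiTensorProduct.tprod Q x = 0 ∨ ∀ s, b s = 0 ∨ b s = 1 := by
  by_contra hn
  push Not at hn
  obtain ⟨h0, s, h1, h2⟩ := hn
  refine h0 ((PiTensorProduct.tprod Q).map_coord_zero s ?_)
  rw [← hb s, h.grading_of_ne h1 h2]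
  rfl

theorem sum_tProj (h : IsWeight P e) (n : ℕ) :
    ∑ k ∈ Finset.range (n + 1), h.grading.tProj n ((n : ℤ) - k) = 1 := by
  classical
  refine h.grading.tPow_ext fun b x hb => ?_
  rw [LinearMap.sum_apply, Finset.sum_congr rfl fun k _ => h.grading.tProj_apply hb _]
  rcases h.tprod_eq_zero_or hb with h0 | h01
  · rw [h0]; simp
  · have h1 : 0 ≤ ∑ s, b s := Finset.sum_nonneg fun s _ => by rcases h01 s with h | h <;> omega
    have h2 : ∑ s, b s ≤ n := by
      refine (Finset.sum_le_sum (g := fun _ => (1 : ℤ)) fun s _ => ?_).trans (by simp)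
      rcases h01 s with h | h <;> omega
    rw [Finset.sum_eq_single (n - (∑ s, b s)).toNat]
    · rw [if_pos (by omega)]; rfl
    · intro k _ hk; exact if_neg (by omega)
    · intro hk; rw [Finset.mem_range] at hk; omega

theorem tProj_top (h : IsWeight P e) (n : ℕ) :
    h.grading.tProj n n = PiTensorProduct.map fun _ => e := by
  classical
  refine h.grading.tPow_ext fun b x hb => ?_
  rw [h.grading.tProj_apply hb, PiTensorProduct.map_tprod]
  rcases h.tprod_eq_zero_or hb with h0 | h01
  · have := PiTensorProduct.map_tprod (R := Q) (fun _ : Fin n => e) x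
    rw [h0, map_zero] at this
    rw [← this, h0, ite_self]
  · by_cases hs : ∀ s, b s = 1
    · rw [if_pos (by simp [hs])]
      congr 1
      funext s
      have := hb s
      rw [hs s, h.grading_one] at this
      exact this.symm
    · push Not at hs
      obtain ⟨s, hs⟩ := hs
      have hs0 : b s = 0 := (h01 s).resolve_right hs
      rw [if_neg, (PiTensorProduct.tprod Q).map_coord_zero s]
      · rw [← hb s, hs0, h.grading_zero, ← Module.End.mul_apply, mul_sub, h.idem, mul_one, sub_self]
        rfl
      · refine ne_of_lt ?_
        have : ∑ s, b s < ∑ _s : Fin n, (1 : ℤ) := by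
          refine Finset.sum_lt_sum (fun s _ => ?_) ⟨s, Finset.mem_univ s, by omega⟩
          rcases h01 s with h | h <;> omega
        simpa using this

theorem tProj_bot (h : IsWeight P e) (n : ℕ) :
    h.grading.tProj n 0 = PiTensorProduct.map fun _ => 1 - e := by
  classical
  refine h.grading.tPow_ext fun b x hb => ?_
  rw [h.grading.tProj_apply hb, PiTensorProduct.map_tprod]
  rcases h.tprod_eq_zero_or hb with h0 | h01
  · have := PiTensorProduct.map_tprod (R := Q) (fun _ : Fin n => 1 - e) x
    rw [h0, map_zero] at this
    rw [← this, h0, ite_self]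
  · by_cases hs : ∀ s, b s = 0
    · rw [if_pos (by simp [hs])]
      congr 1
      funext s
      have := hb s
      rw [hs s, h.grading_zero] at this
      exact this.symm
    · push Not at hs
      obtain ⟨s, hs⟩ := hs
      have hs0 : b s = 1 := (h01 s).resolve_left hs
      rw [if_neg, (PiTensorProduct.tprod Q).map_coord_zero s]
      · rw [← hb s, hs0, h.grading_one, ← Module.End.mul_apply, sub_mul, h.idem, one_mul, sub_self]
        rfl
      · refine ne_of_gt (Finset.sum_pos' (fun s _ => ?_) ⟨s, Finset.mem_univ s, by omega⟩)
        rcases h01 s with h | h <;> omega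

end IsWeight

section TDer

variable [SignedGrading Γ] (P : CurvedModule Γ Q c) (n : ℕ)

/-- The operator on the tensor power that is induced by an operator `δ` of odd degree. -/
noncomputable def tDerAt (δ : Module.End Q P.carrier) (j : Fin n) : Module.End Q (P.TPow n) :=
  PiTensorProduct.map fun k => if k < j then P.signMap else if k = j then δ else 1

/-- The derivation of the tensor power that is induced by an operator `δ` of odd degree. -/
noncomputable def tDer (δ : Module.End Q P.carrier) : Module.End Q (P.TPow n) :=
  ∑ j, P.tDerAt n δ j

theorem tDer_add (δ δ' : Module.End Q P.carrier) :
    P.tDer n (δ + δ') = P.tDer n δ + P.tDer n δ' := by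
  classical
  unfold tDer
  rw [← Finset.sum_add_distrib]
  refine Finset.sum_congr rfl fun j _ => ?_
  have : ∀ δ, P.tDerAt n δ j = PiTensorProduct.map (Function.update
      (fun k => if k < j then P.signMap else 1) j δ) := by
    intro δ
    unfold tDerAt
    congr 1
    funext k
    by_cases hk : k = j
    · subst hk; simp
    · simp [hk]
  rw [this, this, this, PiTensorProduct.map_update_add]

variable {n}

theorem map_mul_tDer (g : Fin n → Module.End Q P.carrier) (δ : Module.End Q P.carrier)
    (h1 : ∀ s, g s * P.signMap = P.signMap * g s) (h2 : ∀ s, g s * δ = δ * g s) :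
    PiTensorProduct.map g * P.tDer n δ = P.tDer n δ * PiTensorProduct.map g := by
  unfold tDer
  rw [Finset.mul_sum, Finset.sum_mul]
  refine Finset.sum_congr rfl fun j _ => ?_
  unfold tDerAt
  rw [← PiTensorProduct.map_mul, ← PiTensorProduct.map_mul]
  congr 1
  funext k
  split_ifs
  exacts [h1 k, h2 k, by rw [one_mul, mul_one]]

end TDer

namespace IsWeight

variable [SignedGrading Γ] {P : CurvedModule Γ Q c} {e : Module.End Q P.carrier}

theorem comm_signMap (h : IsWeight P e) : e * P.signMap = P.signMap * e :=
  comp_signMap (P := P) (P' := P) h.proj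

theorem tDer_mul_tProj (h : IsWeight P e) (n : ℕ) {δ : Module.End Q P.carrier} {l : ℤ}
    (hδ : ∀ k, δ * h.grading.proj k = h.grading.proj (k + l) * δ) (k : ℤ) :
    P.tDer n δ * h.grading.tProj n k = h.grading.tProj n (k + l) * P.tDer n δ := by
  classical
  unfold tDer
  rw [Finset.mul_sum, Finset.sum_mul]
  refine Finset.sum_congr rfl fun j _ => h.grading.tPow_ext fun a x hx => ?_
  have hm : ∀ s, h.grading.proj (Function.update a j (a j + l) s)
      ((if s < j then P.signMap else if s = j then δ else 1) (x s)) =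
      (if s < j then P.signMap else if s = j then δ else 1) (x s) := by
    intro s
    rcases lt_trichotomy s j with hs | hs | hs
    · rw [if_pos hs, Function.update_of_ne hs.ne]
      have := LinearMap.congr_fun (h.grading_comm h.comm_signMap (a s)) (x s)
      simp only [Module.End.mul_apply, hx s] at this
      exact this.symm
    · subst hs
      rw [if_neg (lt_irrefl _), if_pos rfl, Function.update_self]
      have := LinearMap.congr_fun (hδ (a s)) (x s)
      simp only [Module.End.mul_apply, hx s] at this
      exact this.symm
    · rw [if_neg hs.not_gt, if_neg hs.ne', Function.update_of_ne hs.ne']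
      exact hx s
  have hs : ∑ s, Function.update a j (a j + l) s = ∑ s, a s + l := by
    rw [Finset.sum_update_of_mem (Finset.mem_univ j), ← Finset.add_sum_erase _ a
      (Finset.mem_univ j), Finset.sdiff_singleton_eq_erase]
    ring
  have e1 : P.tDerAt n δ j (PiTensorProduct.tprod Q x) = PiTensorProduct.tprod Q fun s =>
      (if s < j then P.signMap else if s = j then δ else 1) (x s) :=
    PiTensorProduct.map_tprod _ _
  rw [Module.End.mul_apply, Module.End.mul_apply, h.grading.tProj_apply hx, e1,
    h.grading.tProj_apply hm, hs]
  by_cases hk : ∑ s, a s = k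
  · rw [if_pos hk, if_pos (by rw [hk]), e1]
  · rw [if_neg hk, if_neg fun h' => hk (add_right_cancel h'), map_zero]

theorem tProj_comm_tPerm (h : IsWeight P e) (n : ℕ) (k : ℤ) (σ : Equiv.Perm (Fin n)) :
    h.grading.tProj n k * P.tPerm n σ = P.tPerm n σ * h.grading.tProj n k := by
  classical
  refine h.tPow_ext fun a b x ha hb => ?_
  rw [Module.End.mul_apply, Module.End.mul_apply, P.tPerm_apply σ ha, map_smul,
    h.grading.tProj_apply hb, h.grading.tProj_apply (a := fun s => b (σ.symm s)) fun s => hb _,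
    Equiv.sum_comp σ.symm b]
  split_ifs with h1
  · exact (P.tPerm_apply σ ha).symm
  · rw [map_zero, smul_zero]

/-- The differential of the tensor power is the sum of a component of weight zero and a component
of weight one. -/
theorem exists_tDiff_eq (h : IsWeight P e) (n : ℕ) : ∃ N : Module.End Q (P.TPow n),
    P.tDiff n = h.diag.tDiff n + N ∧
    ∀ k, N * h.grading.tProj n k = h.grading.tProj n (k + 1) * N := by
  -- Since the range of `e` is stable under `d`, this commutator equals `e d (1 - e)`: the
  -- off-diagonal part of `d`, which takes weight zero to weight one.
  refine ⟨P.tDer n (e * P.d - P.d * e), ?_, h.tDer_mul_tProj n fun k => ?_⟩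
  · change P.tDer n P.d = P.tDer n (P.d * e + (1 - e) * P.d) + _
    rw [← tDer_add]
    congr 1
    noncomm_ring
  · have h1 : (e * P.d - P.d * e) * e = 0 := by rw [sub_mul, h.d, mul_assoc, h.idem, sub_self]
    have h2 : e * (e * P.d - P.d * e) = e * P.d - P.d * e := by
      rw [mul_sub, ← mul_assoc, ← mul_assoc, h.idem, h.d]
    by_cases h0 : k = 0
    · subst h0
      rw [h.grading_zero, zero_add, h.grading_one, mul_sub, h1, h2, mul_one, sub_zero]
    by_cases h3 : k = 1
    · subst h3
      rw [h.grading_one, h1, h.grading_of_ne (by decide) (by decide), zero_mul]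
    rw [h.grading_of_ne h0 h3, mul_zero]
    by_cases h4 : k = -1
    · subst h4
      rw [neg_add_cancel, h.grading_zero, sub_mul, h2, one_mul, sub_self]
    · rw [h.grading_of_ne (by omega) (by omega), zero_mul]

theorem diag_tDiff_comm (h : IsWeight P e) (n : ℕ) (k : ℤ) :
    h.diag.tDiff n * h.grading.tProj n k = h.grading.tProj n k * h.diag.tDiff n := by
  have := h.tDer_mul_tProj n (δ := h.diag.d) (l := 0)
    (fun k => by rw [add_zero]; exact h.grading_comm h.diag_comm k) k
  rw [add_zero] at this
  exact this

theorem tProj_tDiff_tProj_self (h : IsWeight P e) (n : ℕ) (k : ℤ) :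
    h.grading.tProj n k * P.tDiff n * h.grading.tProj n k =
      h.diag.tDiff n * h.grading.tProj n k := by
  obtain ⟨N, hN, hNk⟩ := h.exists_tDiff_eq n
  rw [mul_assoc, hN, add_mul, h.diag_tDiff_comm, hNk, mul_add, ← mul_assoc, ← mul_assoc,
    h.grading.tProj_mul_self, h.grading.tProj_mul_of_ne _ _ (by omega), zero_mul, add_zero]

theorem tProj_tDiff_tProj_of_lt (h : IsWeight P e) (n : ℕ) {k l : ℤ} (hkl : k < l) :
    h.grading.tProj n k * P.tDiff n * h.grading.tProj n l = 0 := by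
  obtain ⟨N, hN, hNk⟩ := h.exists_tDiff_eq n
  rw [mul_assoc, hN, add_mul, h.diag_tDiff_comm, hNk, mul_add, ← mul_assoc, ← mul_assoc,
    h.grading.tProj_mul_of_ne _ _ (by omega), h.grading.tProj_mul_of_ne _ _ (by omega), zero_mul,
    zero_mul, add_zero]

end IsWeight

end CurvedModule

namespace CurvedModule

variable {Γ : Type} [CommRing Γ] {Q : Type u} [CommRing Q] {c : Q}

/-! ## Additivity of cyclic powers -/

/-- A function on a class `C` of curved modules, closed under extensions and homotopy equivalences,
that is additive on short exact sequences and invariant under homotopy equivalences. -/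
structure IsClassFun {K : Type v} [AddCommGroup K] (C : CurvedModule Γ Q c → Prop)
    (κ : CurvedModule Γ Q c → K) : Prop where
  mem_of_ses : ∀ {X Y Z}, ShortExact X Y Z → C X → C Z → C Y
  mem_of_htpy : ∀ {X Y}, HtpyEquiv X Y → C X → C Y
  ses : ∀ {X Y Z}, ShortExact X Y Z → C X → C Z → κ Y = κ X + κ Z
  htpy : ∀ {X Y}, HtpyEquiv X Y → C X → κ X = κ Y

theorem HtpyEquiv.symm {P P' : CurvedModule Γ Q c} (h : HtpyEquiv P P') : HtpyEquiv P' P := by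
  obtain ⟨g, g', k, k', hg, hg', hk, hk'⟩ := h
  exact ⟨g', g, k', k, hg', hg, hk', hk⟩

namespace IsWeight

variable {P : CurvedModule Γ Q c} {e : Module.End Q P.carrier}

/-- The projection onto the part of weight at least `n - m` of the tensor power. -/
noncomputable def filtProj (h : IsWeight P e) (n m : ℕ) : Module.End Q (P.TPow n) :=
  ∑ k ∈ Finset.range (m + 1), h.grading.tProj n ((n : ℤ) - k)

theorem filtProj_zero (h : IsWeight P e) (n : ℕ) :
    h.filtProj n 0 = h.grading.tProj n n := by simp [filtProj]

theorem filtProj_self (h : IsWeight P e) (n : ℕ) : h.filtProj n n = 1 := h.sum_tProj n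

theorem filtProj_succ (h : IsWeight P e) (n m : ℕ) :
    h.filtProj n (m + 1) = h.filtProj n m + h.grading.tProj n ((n : ℤ) - (m + 1 : ℕ)) :=
  Finset.sum_range_succ _ _

theorem filtProj_mul_tProj (h : IsWeight P e) (n m : ℕ) :
    h.filtProj n m * h.grading.tProj n ((n : ℤ) - (m + 1 : ℕ)) = 0 := by
  unfold filtProj
  rw [Finset.sum_mul]
  refine Finset.sum_eq_zero fun k hk => h.grading.tProj_mul_of_ne _ _ ?_
  rw [Finset.mem_range] at hk
  omega

theorem tProj_mul_filtProj (h : IsWeight P e) (n m : ℕ) :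
    h.grading.tProj n ((n : ℤ) - (m + 1 : ℕ)) * h.filtProj n m = 0 := by
  unfold filtProj
  rw [Finset.mul_sum]
  refine Finset.sum_eq_zero fun k hk => h.grading.tProj_mul_of_ne _ _ ?_
  rw [Finset.mem_range] at hk
  omega

theorem filtProj_mul_self (h : IsWeight P e) (n m : ℕ) :
    h.filtProj n m * h.filtProj n m = h.filtProj n m := by
  induction m with
  | zero => rw [h.filtProj_zero, h.grading.tProj_mul_self]
  | succ m ih =>
    rw [h.filtProj_succ, mul_add, add_mul, add_mul, ih, h.tProj_mul_filtProj,
      h.filtProj_mul_tProj, h.grading.tProj_mul_self, add_zero, zero_add]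

end IsWeight

section Cyclic

variable [SignedGrading Γ] (P : CurvedModule Γ Q c) {p : ℕ} (hp : IsUnit (p : Q)) (z : Q)

variable {P} in
theorem IsSummand.tensorPower {n : ℕ} {ε : Module.End Q (P.TPow n)} (h1 : ε * ε = ε)
    (h2 : ∀ i, ε * P.tProj n i = P.tProj n i * ε)
    (h3 : ε * P.tDiff n * ε * P.tDiff n * ε = ((n : Q) * c) • ε) :
    IsSummand (P.tensorPower n) ε :=
  ⟨fun x => LinearMap.congr_fun h1 x, fun i x => LinearMap.congr_fun (h2 i) x,
    fun x => LinearMap.congr_fun h3 x⟩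

/-- The projection of the tensor power onto its cyclic power. -/
noncomputable def cycProj : Module.End Q (P.TPow p) := eigProj hp z (P.tPerm p (finRotate p))

variable {P hp z}

theorem apply_cycProj (hp0 : p ≠ 0) (hz : z ^ p = 1) (x : P.TPow p) :
    P.tPerm p (finRotate p) (P.cycProj hp z x) = z • P.cycProj hp z x :=
  apply_eigProj hp hp0 hz (P.tPerm_finRotate_pow p) x

theorem cycProj_of_mem (hp0 : p ≠ 0) (hz : z ^ p = 1) {x : P.TPow p}
    (hx : P.tPerm p (finRotate p) x = z • x) : P.cycProj hp z x = x :=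
  eigProj_of_mem hp hp0 hz hx

theorem cycProj_mul_self (hp0 : p ≠ 0) (hz : z ^ p = 1) :
    P.cycProj hp z * P.cycProj hp z = P.cycProj hp z :=
  eigProj_mul_self hp hp0 hz (P.tPerm_finRotate_pow p)

theorem cycProj_comm {φ : Module.End Q (P.TPow p)}
    (h : P.tPerm p (finRotate p) * φ = φ * P.tPerm p (finRotate p)) :
    P.cycProj hp z * φ = φ * P.cycProj hp z := eigProj_comm hp z h

theorem isSummand_cycProj (hp0 : p ≠ 0) (hz : z ^ p = 1) :
    IsSummand (P.tensorPower p) (P.cycProj hp z) :=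
  .eigProj hp hp0 hz (P.tPerm_finRotate_pow p) (P.tPerm_mul_tProj _) (P.tPerm_mul_tDiff _)

theorem cyclicPower_htpyEquiv (hp0 : p ≠ 0) (hz : z ^ p = 1) :
    HtpyEquiv (P.cyclicPower hp z hz) ((P.tensorPower p).summand (isSummand_cycProj (hp := hp) hp0 hz)) :=
  eigenspace_htpyEquiv hp hp0 hz (P.tPerm_finRotate_pow p) (P.tPerm_mul_tProj _)
    (P.tPerm_mul_tDiff _)

theorem tMap_cycProj {P P' : CurvedModule Γ Q c} {g : P.carrier →ₗ[Q] P'.carrier}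
    (hg : ∀ i, g ∘ₗ P.proj i = P'.proj i ∘ₗ g) (x : P.TPow p) :
    tMap p g (P.cycProj hp z x) = P'.cycProj hp z (tMap p g x) :=
  eigProj_tMap hp z hg _ x

namespace IsWeight

variable {e : Module.End Q P.carrier}

theorem cycProj_comm_weight (h : IsWeight P e) (k : ℤ) :
    P.cycProj hp z * h.grading.tProj p k = h.grading.tProj p k * P.cycProj hp z :=
  cycProj_comm (h.tProj_comm_tPerm p k _).symm

theorem cycProj_comm_diag (h : IsWeight P e) (x : P.TPow p) :
    P.cycProj hp z (h.diag.tDiff p x) = h.diag.tDiff p (P.cycProj hp z x) :=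
  LinearMap.congr_fun (cycProj_comm (h.diag.tPerm_mul_tDiff (finRotate p))) x

theorem weight_fixed_iff (h : IsWeight P e) (hp0 : p ≠ 0) (hz : z ^ p = 1) (k : ℤ)
    (x : P.TPow p) : (P.cycProj hp z * h.grading.tProj p k) x = x ↔
      h.grading.tProj p k x = x ∧ P.tPerm p (finRotate p) x = z • x := by
  constructor
  · intro hx
    refine ⟨?_, ?_⟩
    · rw [← hx, ← Module.End.mul_apply, h.cycProj_comm_weight, ← mul_assoc,
        h.grading.tProj_mul_self]
    · rw [← hx, Module.End.mul_apply]
      exact apply_cycProj hp0 hz _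
  · rintro ⟨h1, h2⟩
    rw [Module.End.mul_apply, h1]
    exact cycProj_of_mem hp0 hz h2

theorem weight_idem (h : IsWeight P e) (hp0 : p ≠ 0) (hz : z ^ p = 1) (k : ℤ) :
    (P.cycProj hp z * h.grading.tProj p k) * (P.cycProj hp z * h.grading.tProj p k) =
      P.cycProj hp z * h.grading.tProj p k := by
  rw [← mul_assoc, mul_assoc (P.cycProj hp z), ← h.cycProj_comm_weight, ← mul_assoc,
    cycProj_mul_self hp0 hz, mul_assoc, h.grading.tProj_mul_self]

/-- On the part of weight `k` the compressed differential is that of the split extension; the part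
of the differential that raises the weight is projected away. -/
theorem weight_tDiff (h : IsWeight P e) (hp0 : p ≠ 0) (hz : z ^ p = 1) {k : ℤ} {x : P.TPow p}
    (hx : (P.cycProj hp z * h.grading.tProj p k) x = x) :
    (P.cycProj hp z * h.grading.tProj p k) (P.tDiff p x) = h.diag.tDiff p x := by
  obtain ⟨h1, h2⟩ := (h.weight_fixed_iff hp0 hz k x).mp hx
  have h3 : h.grading.tProj p k (P.tDiff p x) = h.diag.tDiff p x := by
    have := LinearMap.congr_fun (h.tProj_tDiff_tProj_self p k) x
    simp only [Module.End.mul_apply, h1] at this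
    exact this
  rw [Module.End.mul_apply, h3, h.cycProj_comm_diag, cycProj_of_mem hp0 hz h2]

theorem diag_fixed (h : IsWeight P e) (hp0 : p ≠ 0) (hz : z ^ p = 1) {k : ℤ} {x : P.TPow p}
    (hx : (P.cycProj hp z * h.grading.tProj p k) x = x) :
    (P.cycProj hp z * h.grading.tProj p k) (h.diag.tDiff p x) = h.diag.tDiff p x := by
  obtain ⟨h1, h2⟩ := (h.weight_fixed_iff hp0 hz k x).mp hx
  have h3 := LinearMap.congr_fun (h.diag_tDiff_comm p k) x
  simp only [Module.End.mul_apply, h1] at h3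
  rw [Module.End.mul_apply, ← h3, h.cycProj_comm_diag, cycProj_of_mem hp0 hz h2]

/-- The part of weight `k` of the cyclic power. -/
theorem isSummand_weight (h : IsWeight P e) (hp0 : p ≠ 0) (hz : z ^ p = 1) (k : ℤ) :
    IsSummand (P.tensorPower p) (P.cycProj hp z * h.grading.tProj p k) := by
  refine .tensorPower (h.weight_idem hp0 hz k) (fun i => ?_) (LinearMap.ext fun x => ?_)
  · rw [mul_assoc, h.tProj_comm_tProj, ← mul_assoc, cycProj_comm (P.tPerm_mul_tProj _ i),
      mul_assoc]
  · set ε : Module.End Q (P.TPow p) := P.cycProj hp z * h.grading.tProj p k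
    have hx : ε (ε x) = ε x := LinearMap.congr_fun (h.weight_idem hp0 hz k) x
    have h1 : ε (P.tDiff p (ε x)) = h.diag.tDiff p (ε x) := h.weight_tDiff hp0 hz hx
    have h2 : ε (P.tDiff p (h.diag.tDiff p (ε x))) = h.diag.tDiff p (h.diag.tDiff p (ε x)) :=
      h.weight_tDiff hp0 hz (h.diag_fixed hp0 hz hx)
    change ε (P.tDiff p (ε (P.tDiff p (ε x)))) = _
    rw [h1, h2]
    exact LinearMap.congr_fun h.diag.tDiff_mul_tDiff _

theorem tProj_tDiff_filtProj (h : IsWeight P e) (n m : ℕ) :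
    h.grading.tProj n ((n : ℤ) - (m + 1 : ℕ)) * P.tDiff n * h.filtProj n m = 0 := by
  unfold filtProj
  rw [Finset.mul_sum]
  refine Finset.sum_eq_zero fun k hk => h.tProj_tDiff_tProj_of_lt n ?_
  rw [Finset.mem_range] at hk
  omega

/-- The differential never lowers the weight, so the elements of weight at least `n - m` form a
subobject. This is the filtration used for additivity. -/
theorem filtProj_tDiff_filtProj (h : IsWeight P e) {n m : ℕ} (hm : m ≤ n) :
    h.filtProj n m * P.tDiff n * h.filtProj n m = P.tDiff n * h.filtProj n m := by
  have h1 : h.filtProj n m + ∑ k ∈ Finset.Ico (m + 1) (n + 1), h.grading.tProj n ((n : ℤ) - k) =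
      1 := by
    rw [← h.filtProj_self n]
    unfold filtProj
    rw [Finset.sum_range_add_sum_Ico _ (by omega)]
  have h2 : (∑ k ∈ Finset.Ico (m + 1) (n + 1), h.grading.tProj n ((n : ℤ) - k)) * P.tDiff n *
      h.filtProj n m = 0 := by
    rw [Finset.sum_mul, Finset.sum_mul]
    refine Finset.sum_eq_zero fun k hk => ?_
    unfold filtProj
    rw [Finset.mul_sum]
    refine Finset.sum_eq_zero fun l hl => h.tProj_tDiff_tProj_of_lt n ?_
    rw [Finset.mem_range] at hl
    rw [Finset.mem_Ico] at hk
    omega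
  calc h.filtProj n m * P.tDiff n * h.filtProj n m = (h.filtProj n m +
        ∑ k ∈ Finset.Ico (m + 1) (n + 1), h.grading.tProj n ((n : ℤ) - k)) * P.tDiff n *
        h.filtProj n m := by rw [add_mul, add_mul, h2, add_zero]
    _ = _ := by rw [h1, one_mul]

theorem cycProj_comm_filtProj (h : IsWeight P e) (m : ℕ) :
    P.cycProj hp z * h.filtProj p m = h.filtProj p m * P.cycProj hp z := by
  unfold filtProj
  rw [Finset.mul_sum, Finset.sum_mul]
  exact Finset.sum_congr rfl fun k _ => h.cycProj_comm_weight _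

theorem isSummand_filt (h : IsWeight P e) (hp0 : p ≠ 0) (hz : z ^ p = 1) {m : ℕ} (hm : m ≤ p) :
    IsSummand (P.tensorPower p) (P.cycProj hp z * h.filtProj p m) := by
  set π := P.cycProj hp z with hπ
  set B := h.filtProj p m with hB
  have hππ : π * π = π := cycProj_mul_self hp0 hz
  have hBB : B * B = B := h.filtProj_mul_self p m
  have hπB : π * B = B * π := h.cycProj_comm_filtProj m
  have hπD : π * P.tDiff p = P.tDiff p * π := cycProj_comm (P.tPerm_mul_tDiff _)
  have hBDB : B * P.tDiff p * B = P.tDiff p * B := h.filtProj_tDiff_filtProj hm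
  have hid : π * B * (π * B) = π * B := by
    rw [mul_assoc, ← mul_assoc B, ← hπB, mul_assoc π B B, hBB, ← mul_assoc, hππ]
  have hD : π * B * P.tDiff p * (π * B) = P.tDiff p * (π * B) := by
    calc π * B * P.tDiff p * (π * B) = π * B * (P.tDiff p * π) * B := by
          simp only [mul_assoc]
      _ = π * (B * π) * (P.tDiff p * B) := by rw [← hπD]; simp only [mul_assoc]
      _ = π * π * (B * P.tDiff p * B) := by rw [← hπB]; simp only [mul_assoc]
      _ = P.tDiff p * (π * B) := by rw [hππ, hBDB, ← mul_assoc, hπD, mul_assoc]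
  refine .tensorPower hid (fun i => ?_) ?_
  · have h1 : B * P.tProj p i = P.tProj p i * B := by
      rw [hB, filtProj, Finset.sum_mul, Finset.mul_sum]
      exact Finset.sum_congr rfl fun k _ => h.tProj_comm_tProj p _ i
    rw [mul_assoc, h1, ← mul_assoc, cycProj_comm (P.tPerm_mul_tProj _ i), mul_assoc]
  · rw [hD, mul_assoc, mul_assoc, ← mul_assoc (π * B), hD, ← mul_assoc, P.tDiff_mul_tDiff,
      smul_mul_assoc, one_mul]

/-- The filtration of the cyclic power by the weight. -/
theorem filt_shortExact (h : IsWeight P e) (hp0 : p ≠ 0) (hz : z ^ p = 1) {m : ℕ}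
    (hm : m + 1 ≤ p) :
    ShortExact ((P.tensorPower p).summand
        (h.isSummand_filt (hp := hp) hp0 hz (Nat.le_of_succ_le hm)))
      ((P.tensorPower p).summand (h.isSummand_filt (hp := hp) hp0 hz hm))
      ((P.tensorPower p).summand
        (h.isSummand_weight (hp := hp) hp0 hz ((p : ℤ) - (m + 1 : ℕ)))) := by
  set π := P.cycProj hp z with hπ
  set B := h.filtProj p m with hB
  set E := h.grading.tProj p ((p : ℤ) - (m + 1 : ℕ)) with hE
  have hπB : π * B = B * π := h.cycProj_comm_filtProj m
  have hπE : π * E = E * π := h.cycProj_comm_weight _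
  have hπD : π * P.tDiff p = P.tDiff p * π := cycProj_comm (P.tPerm_mul_tDiff _)
  have h1 : π * h.filtProj p (m + 1) = π * B + π * E := by rw [h.filtProj_succ, mul_add]
  have h2 : (π * B) * (π * E) = 0 := by
    rw [hπE, mul_assoc, ← mul_assoc B, h.filtProj_mul_tProj, zero_mul, mul_zero]
  have h3 : (π * E) * (π * B) = 0 := by
    rw [hπB, mul_assoc, ← mul_assoc E, h.tProj_mul_filtProj, zero_mul, mul_zero]
  have h4 : (π * E) * P.tDiff p * (π * B) = 0 := by
    rw [hπB, ← mul_assoc, mul_assoc π, mul_assoc π, h.tProj_tDiff_filtProj, mul_zero, zero_mul]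
  exact summand_shortExact _ _ _ (fun x => LinearMap.congr_fun h1 x)
    (fun x => LinearMap.congr_fun h2 x) (fun x => LinearMap.congr_fun h3 x)
    (fun x => LinearMap.congr_fun h4 x)

end IsWeight

end Cyclic

end CurvedModule

/-! ### Comparison of the weight parts for different eigenvalues. -/

namespace CurvedModule

variable {Γ : Type} [CommRing Γ] {Q : Type u} [CommRing Q] {c : Q}

theorem summand_htpyEquiv_of_eq {T : CurvedModule Γ Q c} {ε ε' : Module.End Q T.carrier}
    (h : IsSummand T ε) (h' : IsSummand T ε') (e : ε = ε') :
    HtpyEquiv (T.summand h) (T.summand h') := by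
  subst e
  exact summand_htpyEquiv h h' LinearMap.id LinearMap.id (fun _ h => h) (fun _ h => h)
    (fun _ _ => rfl) (fun _ _ => rfl) (fun _ _ => rfl) (fun _ _ => rfl)

theorem tMap_comp {P₁ P₂ P₃ : CurvedModule Γ Q c} {n : ℕ} (g : P₂.carrier →ₗ[Q] P₃.carrier)
    (g' : P₁.carrier →ₗ[Q] P₂.carrier) (x : P₁.TPow n) :
    tMap n g (tMap n g' x) = tMap n (g ∘ₗ g') x :=
  (LinearMap.congr_fun (PiTensorProduct.map_comp (fun _ => g) (fun _ => g')) x).symm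

theorem tMap_id {P : CurvedModule Γ Q c} {n : ℕ} (x : P.TPow n) : tMap n LinearMap.id x = x :=
  LinearMap.congr_fun PiTensorProduct.map_id x

theorem isWeight_of_splitting {P' P : CurvedModule Γ Q c} {i : P'.carrier →ₗ[Q] P.carrier}
    {r : P.carrier →ₗ[Q] P'.carrier} (hi : IsHom P' P i) (hr : ∀ k, r ∘ₗ P.proj k = P'.proj k ∘ₗ r)
    (hri : ∀ x, r (i x) = x) : IsWeight P (i ∘ₗ r : Module.End Q P.carrier) where
  idem := LinearMap.ext fun x => congrArg i (hri _)
  proj k := LinearMap.ext fun x => by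
    have h1 : r (P.proj k x) = P'.proj k (r x) := LinearMap.congr_fun (hr k) x
    have h2 : i (P'.proj k (r x)) = P.proj k (i (r x)) := LinearMap.congr_fun (hi.proj k) _
    change i (r (P.proj k x)) = P.proj k (i (r x))
    rw [h1, h2]
  d := LinearMap.ext fun x => by
    have h2 : i (P'.d (r x)) = P.d (i (r x)) := LinearMap.congr_fun hi.d _
    change i (r (P.d (i (r x)))) = P.d (i (r x))
    rw [← h2, hri]

namespace IsWeight

section Twist

variable {P : CurvedModule Γ Q c} {e : Module.End Q P.carrier}

/-- The operator that multiplies the range of `e` in the `s`-th factor by `a s`. -/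
noncomputable def twist (P : CurvedModule Γ Q c) (e : Module.End Q P.carrier) {n : ℕ}
    (a : Fin n → Q) : Module.End Q (P.TPow n) :=
  PiTensorProduct.map fun s => 1 - e + a s • e

variable {n : ℕ} {a : Fin n → Q}

theorem twist_comm_aux (g : Module.End Q P.carrier) (hg : e * g = g * e) (b : Q) :
    (1 - e + b • e) * g = g * (1 - e + b • e) := by
  rw [add_mul, mul_add, sub_mul, mul_sub, smul_mul_assoc, mul_smul_comm, hg, one_mul, mul_one]

theorem twist_tProj (h : IsWeight P e) (i : Γ) :
    twist P e a * P.tProj n i = P.tProj n i * twist P e a :=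
  P.map_tProj _ (fun _ i => twist_comm_aux _ (h.proj i) _) i

theorem twist_weight (h : IsWeight P e) (k : ℤ) :
    twist P e a * h.grading.tProj n k = h.grading.tProj n k * twist P e a :=
  h.grading.map_tProj _ (fun _ i => twist_comm_aux _ (h.grading_comm rfl i) _) k

theorem twist_mul_twist (h : IsWeight P e) {a' : Fin n → Q} (ha : ∀ s, a s * a' s = 1) :
    twist P e a * twist P e a' = 1 := by
  unfold twist
  rw [← PiTensorProduct.map_mul]
  have : ∀ s, (1 - e + a s • e) * (1 - e + a' s • e) = 1 := by
    intro s
    have h1 : (1 - e) * e = 0 := by rw [sub_mul, h.idem, one_mul, sub_self]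
    have h2 : e * (1 - e) = 0 := by rw [mul_sub, h.idem, mul_one, sub_self]
    have h3 : (1 - e) * (1 - e) = 1 - e := by rw [mul_sub, mul_one, h1, sub_zero]
    rw [add_mul, mul_add, mul_add, smul_mul_assoc, mul_smul_comm, smul_mul_assoc, mul_smul_comm,
      h1, h2, h3, h.idem, smul_smul, ha, one_smul]
    simp
  simp only [this]
  exact PiTensorProduct.map_one

theorem twist_tprod (h : IsWeight P e) {b : Fin n → ℤ} {x : Fin n → P.carrier}
    (hb : ∀ s, h.grading.proj (b s) (x s) = x s) (hb' : ∀ s, b s = 0 ∨ b s = 1) :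
    twist P e a (PiTensorProduct.tprod Q x) =
      (∏ s, a s ^ (b s).toNat) • PiTensorProduct.tprod Q x := by
  classical
  unfold twist
  rw [PiTensorProduct.map_tprod, ← MultilinearMap.map_smul_univ]
  congr 1
  funext s
  have h1 := hb s
  rcases hb' s with h0 | h0
  · rw [h0, h.grading_zero, LinearMap.sub_apply, Module.End.one_apply, sub_eq_self] at h1
    rw [h0, LinearMap.add_apply, LinearMap.smul_apply, LinearMap.sub_apply, h1]
    simp
  · rw [h0, h.grading_one] at h1
    rw [h0, LinearMap.add_apply, LinearMap.smul_apply, LinearMap.sub_apply, h1]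
    simp

end Twist

variable [SignedGrading Γ]

variable {P : CurvedModule Γ Q c} {e : Module.End Q P.carrier} {p : ℕ} {hp : IsUnit (p : Q)} {z : Q}

section Class

variable {K : Type v} [AddCommGroup K] {C : CurvedModule Γ Q ((p : Q) * c) → Prop}
  {κ : CurvedModule Γ Q ((p : Q) * c) → K}

/-- The class of the cyclic power is the sum of the classes of its parts of given weight. -/
theorem class_cyclicPower (h : IsWeight P e) (hκ : IsClassFun C κ) (hp0 : p ≠ 0) (hz : z ^ p = 1)
    (hC : ∀ k, C ((P.tensorPower p).summand (h.isSummand_weight (hp := hp) hp0 hz k))) :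
    κ (P.cyclicPower hp z hz) = ∑ k ∈ Finset.range (p + 1),
      κ ((P.tensorPower p).summand (h.isSummand_weight (hp := hp) hp0 hz ((p : ℤ) - k))) := by
  have key : ∀ m (hm : m ≤ p),
      C ((P.tensorPower p).summand (h.isSummand_filt (hp := hp) hp0 hz hm)) ∧
      κ ((P.tensorPower p).summand (h.isSummand_filt (hp := hp) hp0 hz hm)) =
        ∑ k ∈ Finset.range (m + 1),
          κ ((P.tensorPower p).summand (h.isSummand_weight (hp := hp) hp0 hz ((p : ℤ) - k))) := by
    intro m
    induction m with
    | zero =>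
      intro hm
      have H := summand_htpyEquiv_of_eq
        (h.isSummand_weight (hp := hp) hp0 hz ((p : ℤ) - (0 : ℕ)))
        (h.isSummand_filt (hp := hp) hp0 hz hm) (by rw [h.filtProj_zero, Nat.cast_zero, sub_zero])
      refine ⟨hκ.mem_of_htpy H (hC _), ?_⟩
      rw [zero_add, Finset.sum_range_one, hκ.htpy H (hC _)]
    | succ m ih =>
      intro hm
      obtain ⟨i1, i2⟩ := ih (Nat.le_of_succ_le hm)
      have H := h.filt_shortExact (hp := hp) hp0 hz hm
      refine ⟨hκ.mem_of_ses H i1 (hC _), ?_⟩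
      rw [hκ.ses H i1 (hC _), i2, Finset.sum_range_succ _ (m + 1)]
  obtain ⟨k1, k2⟩ := key p le_rfl
  rw [← k2]
  have H1 := P.cyclicPower_htpyEquiv (hp := hp) hp0 hz
  have H2 := summand_htpyEquiv_of_eq (h.isSummand_filt (hp := hp) hp0 hz le_rfl)
    (P.isSummand_cycProj (hp := hp) hp0 hz) (by rw [h.filtProj_self, mul_one])
  rw [hκ.htpy H2 k1, hκ.htpy H1.symm (hκ.mem_of_htpy H2 k1)]

end Class

/-! ### The parts of intermediate weight -/

variable {n : ℕ} {a : Fin n → Q}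

/-- The twist respects the differential of the split extension, but in general not the component `e
d (1 - e)`. For this reason eigenspaces are compared weight by weight rather than on the whole
tensor power. -/
theorem twist_diag (h : IsWeight P e) :
    twist P e a * h.diag.tDiff n = h.diag.tDiff n * twist P e a :=
  P.map_mul_tDer _ _ (fun _ => twist_comm_aux _ h.comm_signMap _)
    (fun _ => twist_comm_aux _ h.diag_comm _)

/-- The cycle moves the factor at `s` to `s + 1`, where the twist carries one more `ζ`; each of the
`k` factors of weight one contributes such a factor. Going from the last position to the first is
harmless because `ζ ^ n = 1`. -/
theorem twist_tPerm (h : IsWeight P e) {ζ : Q} (hζ : ζ ^ n = 1) (k : ℕ) :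
    twist P e (fun s : Fin n => ζ ^ (s : ℕ)) * P.tPerm n (finRotate n) * h.grading.tProj n k =
      ζ ^ k • (P.tPerm n (finRotate n) * twist P e (fun s : Fin n => ζ ^ (s : ℕ)) *
        h.grading.tProj n k) := by
  classical
  refine h.tPow_ext fun d b x hd hb => ?_
  have hE : h.grading.tProj n k (PiTensorProduct.tprod Q x) =
    if ∑ j, b j = k then PiTensorProduct.tprod Q x else 0 := h.grading.tProj_apply hb k
  simp only [Module.End.mul_apply, LinearMap.smul_apply]
  erw [hE]
  by_cases hs : ∑ j, b j = k
  swap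
  · rw [if_neg hs]; simp
  rw [if_pos hs]
  rcases h.tprod_eq_zero_or hb with h0 | h01
  · rw [h0]; simp
  have hr : ∀ s : Fin n, ζ ^ (finRotate n s : ℕ) = ζ ^ ((s : ℕ) + 1) := by
    intro s
    obtain ⟨m, rfl⟩ : ∃ m, n = m + 1 := ⟨n - 1, by have := s.pos; omega⟩
    by_cases hl : s = Fin.last m
    · rw [hl, finRotate_last]; simp [hζ]
    · rw [coe_finRotate_of_ne_last hl]
  rw [h.twist_tprod hb h01, map_smul, P.tPerm_apply _ hd, map_smul,
    h.twist_tprod (b := fun s => b ((finRotate n).symm s)) (fun _ => hb _) (fun s => h01 _),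
    smul_smul, smul_smul, smul_smul]
  have hprod : ∏ s : Fin n, (ζ ^ (s : ℕ)) ^ (b ((finRotate n).symm s)).toNat =
      ζ ^ k * ∏ s : Fin n, (ζ ^ (s : ℕ)) ^ (b s).toNat := by
    rw [← Equiv.prod_comp (finRotate n)]
    simp only [Equiv.symm_apply_apply, hr, pow_succ, mul_pow, Finset.prod_mul_distrib]
    rw [mul_comm, Finset.prod_pow_eq_pow_sum]
    congr 2
    have : ((∑ s, (b s).toNat : ℕ) : ℤ) = k := by
      rw [← hs, Nat.cast_sum]
      exact Finset.sum_congr rfl fun s _ => by rcases h01 s with h | h <;> simp [h]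
    exact_mod_cast this
  congr 1
  rw [hprod]
  ring

/-- The parts of intermediate weight of the cyclic powers do not depend on the root of unity. -/
theorem weight_htpyEquiv (h : IsWeight P e) (hp' : p.Prime) (hz : z ^ p = 1) {k : ℕ}
    (hk0 : 0 < k) (hkp : k < p) :
    HtpyEquiv
      ((P.tensorPower p).summand
        (h.isSummand_weight (hp := hp) (z := 1) hp'.ne_zero (one_pow p) k))
      ((P.tensorPower p).summand (h.isSummand_weight (hp := hp) (z := z) hp'.ne_zero hz k)) := by
  have hp0 := hp'.ne_zero
  -- As `p` is prime and `0 < k < p`, `k` is invertible modulo `p`, and `l` represents `-1 / k`.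
  -- Then `ζ = z ^ l` satisfies `ζ ^ k * z = 1`, so the twist by `ζ` carries eigenvalue 1 to
  -- eigenvalue `z` in weight `k`.
  obtain ⟨l, hl⟩ : ∃ l : ℕ, z ^ (l * k) * z = 1 := by
    have := Fact.mk hp'
    have hk : (k : ZMod p) ≠ 0 := by
      rw [Ne, ZMod.natCast_eq_zero_iff]
      exact Nat.not_dvd_of_pos_of_lt hk0 hkp
    refine ⟨(-(k : ZMod p)⁻¹).val, ?_⟩
    rw [← pow_succ]
    have : p ∣ (-(k : ZMod p)⁻¹).val * k + 1 := by
      rw [← ZMod.natCast_eq_zero_iff]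
      push_cast
      rw [ZMod.natCast_zmod_val, neg_mul, inv_mul_cancel₀ hk, neg_add_cancel]
    obtain ⟨m, hm⟩ := this
    rw [hm, pow_mul, hz, one_pow]
  set ζ := z ^ l with hζ
  have hζp : ζ ^ p = 1 := by rw [hζ, ← pow_mul, mul_comm, pow_mul, hz, one_pow]
  have hζk : ζ ^ k * z = 1 := by rw [hζ, ← pow_mul, hl]
  set U := twist P e (fun s : Fin p => ζ ^ (s : ℕ)) with hU
  set U' := twist P e (fun s : Fin p => (ζ ^ (p - 1)) ^ (s : ℕ)) with hU'
  have hUU' : ∀ x, U (U' x) = x := LinearMap.congr_fun (h.twist_mul_twist fun s => by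
    rw [← mul_pow, mul_comm, pred_pow_mul hp0 hζp, one_pow])
  have hU'U : ∀ x, U' (U x) = x := LinearMap.congr_fun (h.twist_mul_twist fun s => by
    rw [← mul_pow, pred_pow_mul hp0 hζp, one_pow])
  have hσ : ∀ x, h.grading.tProj p k x = x → U (P.tPerm p (finRotate p) x) =
      ζ ^ k • P.tPerm p (finRotate p) (U x) := by
    intro x hx
    have := LinearMap.congr_fun (h.twist_tPerm hζp k) x
    simp only [Module.End.mul_apply, LinearMap.smul_apply] at this
    erw [hx] at this
    exact this
  have hUE : ∀ x, h.grading.tProj p k x = x → h.grading.tProj p k (U x) = U x := by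
    intro x hx
    have := LinearMap.congr_fun (h.twist_weight (a := fun s : Fin p => ζ ^ (s : ℕ)) k) x
    simp only [Module.End.mul_apply] at this
    erw [hx] at this
    exact this.symm
  have hU'E : ∀ x, h.grading.tProj p k x = x → h.grading.tProj p k (U' x) = U' x := by
    intro x hx
    have := LinearMap.congr_fun
      (h.twist_weight (a := fun s : Fin p => (ζ ^ (p - 1)) ^ (s : ℕ)) k) x
    simp only [Module.End.mul_apply] at this
    erw [hx] at this
    exact this.symm
  have h1 : ∀ x : P.TPow p, (P.cycProj hp 1 * h.grading.tProj p k) x = x →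
      (P.cycProj hp z * h.grading.tProj p k) (U x) = U x := by
    intro x hx
    obtain ⟨e1, e2⟩ := (h.weight_fixed_iff hp0 (one_pow p) k x).mp hx
    rw [one_smul] at e2
    refine (h.weight_fixed_iff hp0 hz k (U x)).mpr ⟨hUE x e1, ?_⟩
    have := hσ x e1
    rw [e2] at this
    conv_rhs => rw [this, smul_smul, mul_comm, hζk, one_smul]
  have h2 : ∀ x : P.TPow p, (P.cycProj hp z * h.grading.tProj p k) x = x →
      (P.cycProj hp 1 * h.grading.tProj p k) (U' x) = U' x := by
    intro x hx
    obtain ⟨e1, e2⟩ := (h.weight_fixed_iff hp0 hz k x).mp hx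
    refine (h.weight_fixed_iff hp0 (one_pow p) k (U' x)).mpr ⟨hU'E x e1, ?_⟩
    have := hσ (U' x) (hU'E x e1)
    rw [hUU', e2, smul_smul, hζk, one_smul] at this
    rw [one_smul, ← hU'U (P.tPerm p (finRotate p) (U' x)), this]
  have h5 : ∀ i x, U (P.tProj p i x) = P.tProj p i (U x) := fun i =>
    LinearMap.congr_fun (h.twist_tProj i)
  have h6 : ∀ x : P.TPow p, (P.cycProj hp 1 * h.grading.tProj p k) x = x →
      U ((P.cycProj hp 1 * h.grading.tProj p k) (P.tDiff p x)) =
      (P.cycProj hp z * h.grading.tProj p k) (P.tDiff p (U x)) := by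
    intro x hx
    rw [h.weight_tDiff hp0 (one_pow p) hx, h.weight_tDiff hp0 hz (h1 x hx)]
    exact LinearMap.congr_fun h.twist_diag x
  exact summand_htpyEquiv _ _ U U' h1 h2 (fun x _ => hU'U x) (fun x _ => hUU' x) h5 h6

end IsWeight

/-! ### The parts of extremal weight -/

section Extremal

variable [SignedGrading Γ] {P' P P'' : CurvedModule Γ Q c} {i : P'.carrier →ₗ[Q] P.carrier}
  {r : P.carrier →ₗ[Q] P'.carrier} {q : P.carrier →ₗ[Q] P''.carrier}
  {j : P''.carrier →ₗ[Q] P.carrier}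

variable {p : ℕ} {hp : IsUnit (p : Q)} {z : Q}

/-- In weight `p` every factor lies in the image of `i`, so tensor powers of `i` and `r` identify
this part with the cyclic power of the subobject. At the other extreme, in weight zero, `q` and `j`
do the same for the quotient. -/
theorem weight_top_htpyEquiv (hi : IsHom P' P i) (hr : ∀ k, r ∘ₗ P.proj k = P'.proj k ∘ₗ r)
    (hri : ∀ x, r (i x) = x) (h : IsWeight P (i ∘ₗ r : Module.End Q P.carrier)) (hp0 : p ≠ 0)
    (hz : z ^ p = 1) : HtpyEquiv ((P'.tensorPower p).summand (P'.isSummand_cycProj (hp := hp) hp0 hz))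
      ((P.tensorPower p).summand (h.isSummand_weight (hp := hp) hp0 hz p)) := by
  have hE : ∀ x, h.grading.tProj p p x = tMap p i (tMap p r x) := fun x => by
    rw [h.tProj_top, tMap_comp]; rfl
  have hri' : ∀ x, tMap p r (tMap p i x) = x := fun x => by
    rw [tMap_comp, show r ∘ₗ i = LinearMap.id from LinearMap.ext hri, tMap_id]
  have hE' : ∀ x, h.grading.tProj p p (tMap p i x) = tMap p i x := fun x => by rw [hE, hri']
  have hε : ∀ x, (P.cycProj hp z * h.grading.tProj p p) (tMap p i x) =
      tMap p i (P'.cycProj hp z x) := fun x => by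
    rw [Module.End.mul_apply, hE', tMap_cycProj hi.proj]
  have h2 : ∀ x : P.TPow p, (P.cycProj hp z * h.grading.tProj p p) x = x →
      P'.cycProj hp z (tMap p r x) = tMap p r x := by
    intro x hx
    rw [← tMap_cycProj hr, cycProj_of_mem hp0 hz ((h.weight_fixed_iff hp0 hz p x).mp hx).2]
  have h6 : ∀ x : P'.TPow p, P'.cycProj hp z x = x →
      tMap p i (P'.cycProj hp z (P'.tDiff p x)) =
      (P.cycProj hp z * h.grading.tProj p p) (P.tDiff p (tMap p i x)) := by
    intro x hx
    have : P.tDiff p (tMap p i x) = tMap p i (P'.tDiff p x) :=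
      (LinearMap.congr_fun (tMap_tDiff hi) x).symm
    rw [this, hε]
  have h1 : ∀ x : P'.TPow p, P'.cycProj hp z x = x →
      (P.cycProj hp z * h.grading.tProj p p) (tMap p i x) = tMap p i x := fun x hx => by
    rw [hε, hx]
  have h4 : ∀ x : P.TPow p, (P.cycProj hp z * h.grading.tProj p p) x = x →
      tMap p i (tMap p r x) = x := fun x hx => by
    rw [← hE, ((h.weight_fixed_iff hp0 hz p x).mp hx).1]
  exact summand_htpyEquiv _ _ (tMap p i) (tMap p r) h1 h2 (fun x _ => hri' x) h4
    (fun k => LinearMap.congr_fun (tMap_tProj hi.proj k)) h6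

theorem weight_bot_htpyEquiv (hq : IsHom P P'' q) (hj : ∀ k, j ∘ₗ P''.proj k = P.proj k ∘ₗ j)
    (hqj : ∀ x, q (j x) = x) (hij : ∀ x, i (r x) + j (q x) = x)
    (h : IsWeight P (i ∘ₗ r : Module.End Q P.carrier)) (hp0 : p ≠ 0)
    (hz : z ^ p = 1) : HtpyEquiv
      ((P.tensorPower p).summand (h.isSummand_weight (hp := hp) hp0 hz 0))
      ((P''.tensorPower p).summand (P''.isSummand_cycProj (hp := hp) hp0 hz)) := by
  have he : (1 - i ∘ₗ r : Module.End Q P.carrier) = j ∘ₗ q := LinearMap.ext fun x => by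
    rw [LinearMap.sub_apply, Module.End.one_apply, sub_eq_iff_eq_add']
    exact (hij x).symm
  have hE : ∀ x, h.grading.tProj p 0 x = tMap p j (tMap p q x) := fun x => by
    rw [h.tProj_bot, he, tMap_comp]; rfl
  have hqj' : ∀ x, tMap p q (tMap p j x) = x := fun x => by
    rw [tMap_comp, show q ∘ₗ j = LinearMap.id from LinearMap.ext hqj, tMap_id]
  have hqE : ∀ x, tMap p q ((P.cycProj hp z * h.grading.tProj p 0) x) =
      P''.cycProj hp z (tMap p q x) := fun x => by
    rw [Module.End.mul_apply, tMap_cycProj hq.proj, hE, hqj']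
  have h1 : ∀ x : P.TPow p, (P.cycProj hp z * h.grading.tProj p 0) x = x →
      P''.cycProj hp z (tMap p q x) = tMap p q x := fun x hx => by
    rw [← hqE, hx]
  have h2 : ∀ x : P''.TPow p, P''.cycProj hp z x = x →
      (P.cycProj hp z * h.grading.tProj p 0) (tMap p j x) = tMap p j x := fun x hx => by
    rw [Module.End.mul_apply, hE, hqj', ← tMap_cycProj hj, hx]
  have h3 : ∀ x : P.TPow p, (P.cycProj hp z * h.grading.tProj p 0) x = x →
      tMap p j (tMap p q x) = x := fun x hx => by
    rw [← hE, ((h.weight_fixed_iff hp0 hz 0 x).mp hx).1]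
  have h6 : ∀ x : P.TPow p, (P.cycProj hp z * h.grading.tProj p 0) x = x →
      tMap p q ((P.cycProj hp z * h.grading.tProj p 0) (P.tDiff p x)) =
        P''.cycProj hp z (P''.tDiff p (tMap p q x)) := fun x _ => by
    have : P''.tDiff p (tMap p q x) = tMap p q (P.tDiff p x) :=
      (LinearMap.congr_fun (tMap_tDiff hq) x).symm
    rw [hqE, this]
  exact summand_htpyEquiv _ _ (tMap p q) (tMap p j) h1 h2 h3 (fun x _ => hqj' x)
    (fun k => LinearMap.congr_fun (tMap_tProj hq.proj k)) h6

end Extremal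

/-- The difference of the classes of two cyclic powers is additive on short exact sequences. -/
theorem ShortExact.class_cyclicPower [SignedGrading Γ] {K : Type v} [AddCommGroup K] {p : ℕ} (hp' : p.Prime)
    {C : CurvedModule Γ Q ((p : Q) * c) → Prop} {κ : CurvedModule Γ Q ((p : Q) * c) → K}
    (hκ : IsClassFun C κ) (hp : IsUnit (p : Q)) {z : Q} (hz : z ^ p = 1)
    {P' P P'' : CurvedModule Γ Q c} (hP : ShortExact P' P P'')
    (hC : ∀ (i : P'.carrier →ₗ[Q] P.carrier) (r : P.carrier →ₗ[Q] P'.carrier)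
      (q : P.carrier →ₗ[Q] P''.carrier) (j : P''.carrier →ₗ[Q] P.carrier), IsHom P' P i →
      IsHom P P'' q → (∀ k, r ∘ₗ P.proj k = P'.proj k ∘ₗ r) →
      (∀ k, j ∘ₗ P''.proj k = P.proj k ∘ₗ j) → (∀ x, r (i x) = x) → (∀ x, q (j x) = x) →
      (∀ x, q (i x) = 0) → (∀ x, i (r x) + j (q x) = x) →
      ∀ (h : IsWeight P (i ∘ₗ r : Module.End Q P.carrier)) (z : Q) (hz : z ^ p = 1) (k : ℤ), C ((P.tensorPower p).summand (h.isSummand_weight (hp := hp) hp'.ne_zero hz k))) :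
    κ (P.cyclicPower hp 1 (one_pow p)) - κ (P.cyclicPower hp z hz) =
      (κ (P'.cyclicPower hp 1 (one_pow p)) - κ (P'.cyclicPower hp z hz)) +
      (κ (P''.cyclicPower hp 1 (one_pow p)) - κ (P''.cyclicPower hp z hz)) := by
  have hp0 := hp'.ne_zero
  obtain ⟨i, r, q, j, hi, hq, hr, hj, hri, hqj, hqi, hij⟩ := hP.exists_splitting
  have h := isWeight_of_splitting hi hr hri
  have h1 := hC i r q j hi hq hr hj hri hqj hqi hij h
  set f : ℤ → K := fun k =>
    κ ((P.tensorPower p).summand (h.isSummand_weight (hp := hp) hp0 (one_pow p) k)) -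
      κ ((P.tensorPower p).summand (h.isSummand_weight (hp := hp) hp0 hz k)) with hf
  have hP' : ∀ (z : Q) (hz : z ^ p = 1), κ (P'.cyclicPower hp z hz) =
      κ ((P.tensorPower p).summand (h.isSummand_weight (hp := hp) hp0 hz p)) := by
    intro z hz
    have H1 := P'.cyclicPower_htpyEquiv (hp := hp) hp0 hz
    have H2 := weight_top_htpyEquiv (hp := hp) hi hr hri h hp0 hz
    have m2 := hκ.mem_of_htpy H2.symm (h1 z hz p)
    rw [← hκ.htpy H2 m2, ← hκ.htpy H1.symm m2]
  have hP'' : ∀ (z : Q) (hz : z ^ p = 1), κ (P''.cyclicPower hp z hz) =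
      κ ((P.tensorPower p).summand (h.isSummand_weight (hp := hp) hp0 hz 0)) := by
    intro z hz
    have H1 := P''.cyclicPower_htpyEquiv (hp := hp) hp0 hz
    have H2 := weight_bot_htpyEquiv (hp := hp) hq hj hqj hij h hp0 hz
    have m2 := hκ.mem_of_htpy H2 (h1 z hz 0)
    rw [hκ.htpy H2 (h1 z hz 0), ← hκ.htpy H1.symm m2]
  -- For intermediate weights the parts for the eigenvalues 1 and `z` are isomorphic and cancel in
  -- the difference; only the weights `p` and 0, belonging to `P'` and `P''`, survive.
  have hmid : ∀ k ∈ Finset.range (p - 1), f ((p : ℤ) - (k + 1 : ℕ)) = 0 := by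
    intro k hk
    rw [Finset.mem_range] at hk
    have e : (p : ℤ) - (k + 1 : ℕ) = ((p - (k + 1) : ℕ) : ℤ) := by omega
    rw [e, hf]
    exact sub_eq_zero.mpr (hκ.htpy (h.weight_htpyEquiv (hp := hp) hp' hz (by omega) (by omega))
      (h1 1 (one_pow p) _))
  have hsum : κ (P.cyclicPower hp 1 (one_pow p)) - κ (P.cyclicPower hp z hz) = f p + f 0 := by
    rw [h.class_cyclicPower hκ hp0 (one_pow p) (h1 1 (one_pow p)),
      h.class_cyclicPower hκ hp0 hz (h1 z hz), ← Finset.sum_sub_distrib]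
    change ∑ k ∈ Finset.range (p + 1), f ((p : ℤ) - k) = _
    rw [Finset.sum_range_succ, sub_self, ← Nat.sub_add_cancel hp'.one_le, Finset.sum_range_succ',
      Nat.sub_add_cancel hp'.one_le, Finset.sum_eq_zero hmid, zero_add, Nat.cast_zero, sub_zero]
  rw [hsum, hP' 1 (one_pow p), hP' z hz, hP'' 1 (one_pow p), hP'' z hz]

end CurvedModule

/-! ## Cyclic powers for the nontrivial roots of unity -/

namespace CurvedModule

section

variable {Γ : Type} [CommRing Γ] [SignedGrading Γ] {Q : Type u} [CommRing Q] {c : Q}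

/-- Multiplication by the unit `m` conjugates translation by 1 to translation by `m`. The statement
is about `ZMod n` for its ring structure; `ZMod (n + 1)` is `Fin (n + 1)`. -/
theorem exists_perm_mul_eq {n m k : ℕ} (hmk : m * k ≡ 1 [MOD n]) (ρ : Equiv.Perm (ZMod n))
    (hρ : ∀ s, ρ s = s + 1) : ∃ τ : Equiv.Perm (ZMod n), τ * ρ = ρ ^ m * τ := by
  have h : (m : ZMod n) * k = 1 := by exact_mod_cast (ZMod.natCast_eq_natCast_iff _ _ _).mpr hmk
  have hpow : ∀ (l : ℕ) (s : ZMod n), (ρ ^ l) s = s + l := by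
    intro l
    induction l with
    | zero => intro s; rw [pow_zero, Nat.cast_zero, add_zero]; rfl
    | succ l ih => intro s; rw [pow_succ', Equiv.Perm.mul_apply, ih, hρ, Nat.cast_succ, add_assoc]
  refine ⟨⟨fun s => m * s, fun s => k * s, fun s => ?_, fun s => ?_⟩, Equiv.ext fun s => ?_⟩
  · change (k : ZMod n) * (m * s) = s
    rw [← mul_assoc, mul_comm (k : ZMod n), h, one_mul]
  · change (m : ZMod n) * (k * s) = s
    rw [← mul_assoc, h, one_mul]
  · rw [Equiv.Perm.mul_apply, Equiv.Perm.mul_apply, hpow, hρ]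
    exact mul_add_one (m : ZMod n) s

/-- The multiplication by `m` modulo `p` conjugates the `p`-cycle to its `m`-th power. -/
theorem exists_perm_finRotate {p m k : ℕ} (hp : p ≠ 0) (hmk : m * k ≡ 1 [MOD p]) :
    ∃ τ : Equiv.Perm (Fin p), τ * finRotate p = finRotate p ^ m * τ := by
  obtain ⟨n, rfl⟩ := Nat.exists_eq_succ_of_ne_zero hp
  exact exists_perm_mul_eq hmk (finRotate (n + 1)) finRotate_apply

/-- The cyclic powers for the nontrivial powers of a root of unity are isomorphic. -/
theorem cyclicPower_pow_htpyEquiv (P : CurvedModule Γ Q c) {p : ℕ} (hp' : p.Prime)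
    (hp : IsUnit (p : Q)) {z : Q} (hz : z ^ p = 1) {k : ℕ} (hk0 : 0 < k) (hkp : k < p)
    (hzk : (z ^ k) ^ p = 1) :
    HtpyEquiv (P.cyclicPower hp z hz) (P.cyclicPower hp (z ^ k) hzk) := by
  obtain ⟨m, hm⟩ : ∃ m : ℕ, m * k ≡ 1 [MOD p] := by
    have := Fact.mk hp'
    have hk : (k : ZMod p) ≠ 0 := by
      rw [Ne, ZMod.natCast_eq_zero_iff]
      exact Nat.not_dvd_of_pos_of_lt hk0 hkp
    refine ⟨((k : ZMod p)⁻¹).val, (ZMod.natCast_eq_natCast_iff _ _ _).mp ?_⟩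
    push_cast
    rw [ZMod.natCast_zmod_val, inv_mul_cancel₀ hk]
  -- `τ` turns the cycle into its `m`-th power, so it carries the `z`-eigenspace of `σ` to that of
  -- `σ ^ m`. Since `m k` is 1 modulo `p`, taking `k`-th powers shows that this is the `z ^
  -- k`-eigenspace of `σ`.
  obtain ⟨τ, hτ⟩ := exists_perm_finRotate hp'.ne_zero hm
  set σ := P.tPerm p (finRotate p) with hσ
  have hσp : ∀ x, (σ ^ p) x = x := LinearMap.congr_fun (P.tPerm_finRotate_pow p)
  set t := P.tPerm p τ with ht
  set t' := P.tPerm p τ⁻¹ with ht'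
  have htt' : ∀ x, t (t' x) = x := LinearMap.congr_fun (by
    rw [ht, ht', ← tPerm_mul, mul_inv_cancel, P.tPerm_one]; rfl : t * t' = LinearMap.id)
  have ht't : ∀ x, t' (t x) = x := LinearMap.congr_fun (by
    rw [ht, ht', ← tPerm_mul, inv_mul_cancel, P.tPerm_one]; rfl : t' * t = LinearMap.id)
  have htσ : ∀ x, t (σ x) = (σ ^ m) (t x) := LinearMap.congr_fun (by
    rw [ht, hσ, ← tPerm_mul, hτ, tPerm_mul, tPerm_pow] : t * σ = σ ^ m * t)
  have hmod : ∀ {G : Type u} [Monoid G] (w : G), w ^ p = 1 → w ^ (m * k) = w := by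
    intro G _ w hw
    have h1 : m * k % p = 1 := Eq.trans hm (Nat.mod_eq_of_lt hp'.one_lt)
    rw [← Nat.div_add_mod (m * k) p, h1, pow_succ, pow_mul, hw, one_pow, one_mul]
  have h1 : ∀ x ∈ eig σ z, t x ∈ eig σ (z ^ k) := by
    intro x hx
    rw [mem_eig] at hx ⊢
    have e1 : (σ ^ m) (t x) = z • t x := by rw [← htσ, hx, map_smul]
    have e2 := pow_apply_of_mem_eig e1 k
    rw [← pow_mul] at e2
    have hσ1 : σ ^ (m * k) = σ := hmod σ (P.tPerm_finRotate_pow p)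
    rw [hσ1] at e2
    exact e2
  have h2 : ∀ x ∈ eig σ (z ^ k), t' x ∈ eig σ z := by
    intro x hx
    rw [mem_eig] at hx ⊢
    have e1 := pow_apply_of_mem_eig hx m
    rw [← pow_mul, mul_comm k, hmod z hz] at e1
    have e2 := htσ (t' x)
    rw [htt', e1] at e2
    rw [← ht't (σ (t' x)), e2, map_smul]
  let a : (P.cyclicPower hp z hz).carrier →ₗ[Q] (P.cyclicPower hp (z ^ k) hzk).carrier :=
    t.restrict h1
  let b : (P.cyclicPower hp (z ^ k) hzk).carrier →ₗ[Q] (P.cyclicPower hp z hz).carrier :=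
    t'.restrict h2
  exact HtpyEquiv.of_equiv (LinearEquiv.ofLinearMap a b
    (LinearMap.ext fun x => Subtype.ext (htt' x.1)) (LinearMap.ext fun x => Subtype.ext (ht't x.1)))
    ⟨fun i => LinearMap.ext fun x => Subtype.ext
      (LinearMap.congr_fun (P.tPerm_mul_tProj τ i) x.1),
      LinearMap.ext fun x => Subtype.ext (LinearMap.congr_fun (P.tPerm_mul_tDiff τ) x.1)⟩

end

/-! ## Class functions -/

section Copy

variable {Γ : Type} [CommRing Γ] {Q : Type u} [CommRing Q] {c c' : Q}

theorem HtpyEquiv.copy (h : c = c') {X Y : CurvedModule Γ Q c} (H : HtpyEquiv X Y) :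
    HtpyEquiv (X.copy h) (Y.copy h) := by
  subst h; exact H

theorem ShortExact.copy (h : c = c') {X Y Z : CurvedModule Γ Q c} (H : ShortExact X Y Z) :
    ShortExact (X.copy h) (Y.copy h) (Z.copy h) := by
  subst h; exact H

end Copy

end CurvedModule

namespace MatFac

variable {Q : Type u} [CommRing Q] {f : Q}

theorem isHom_mult (u : Qˣ) {P P' : MatFac Q f} {g : P.carrier →ₗ[Q] P'.carrier}
    (hg : CurvedModule.IsHom P P' g) : CurvedModule.IsHom (mult u P) (mult u P') g where
  proj := hg.proj
  d := LinearMap.ext fun (x : P.carrier) => by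
    have h1 : ∀ i x, g (P.proj i x) = P'.proj i (g x) := fun i => LinearMap.congr_fun (hg.proj i)
    have h2 : ∀ x, g (P.d x) = P'.d (g x) := LinearMap.congr_fun hg.d
    change g (P.d (P.proj 1 x + (u : Q) • P.proj 0 x)) =
      P'.d (P'.proj 1 (g x) + (u : Q) • P'.proj 0 (g x))
    rw [h2, map_add, map_smul, h1, h1]

/-- The new differential is multiplied by `u` on the even part only, so the homotopy must be divided
by `u` on the odd part. -/
theorem isHomotopy_mult (u : Qˣ) {P P' : MatFac Q f} {h g₁ g₂ : P.carrier →ₗ[Q] P'.carrier}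
    (hh : CurvedModule.IsHomotopy P P' h g₁ g₂) :
    CurvedModule.IsHomotopy (mult u P) (mult u P')
      (h ∘ₗ (P.proj 0 + ((u⁻¹ : Qˣ) : Q) • P.proj 1)) g₁ g₂ := by
  have h1 : ∀ i x, h (P.proj i x) = P'.proj (i + 1) (h x) :=
    fun i => LinearMap.congr_fun (hh.proj i)
  have hd : ∀ x, P'.d (h x) + h (P.d x) = g₁ x - g₂ x := LinearMap.congr_fun hh.d
  have h01 : ∀ x, P.proj 0 (P.proj 1 x) = 0 :=
    LinearMap.congr_fun (P.proj_mul_of_ne 0 1 (by decide))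
  have h10 : ∀ x, P.proj 1 (P.proj 0 x) = 0 :=
    LinearMap.congr_fun (P.proj_mul_of_ne 1 0 (by decide))
  refine ⟨fun i => LinearMap.ext fun (x : P.carrier) => ?_, P.ext_of_mem fun i x hx => ?_⟩
  · change h (P.proj 0 (P.proj i x) + ((u⁻¹ : Qˣ) : Q) • P.proj 1 (P.proj i x)) =
      P'.proj (i + 1) (h (P.proj 0 x + ((u⁻¹ : Qˣ) : Q) • P.proj 1 x))
    rw [← h1]
    congr 1
    rw [map_add, map_smul]
    rcases zmod_two_eq i with rfl | rfl
    · rw [h01, h10]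
    · rw [h01, h10]
  · have hdx := P.proj_d_of_mem hx
    have hhx : P'.proj (i + 1) (h x) = h x := by rw [← h1, hx]
    change P'.d (P'.proj 1 (h (P.proj 0 x + ((u⁻¹ : Qˣ) : Q) • P.proj 1 x)) +
        (u : Q) • P'.proj 0 (h (P.proj 0 x + ((u⁻¹ : Qˣ) : Q) • P.proj 1 x))) +
      h (P.proj 0 (P.d (P.proj 1 x + (u : Q) • P.proj 0 x)) +
        ((u⁻¹ : Qˣ) : Q) • P.proj 1 (P.d (P.proj 1 x + (u : Q) • P.proj 0 x))) = g₁ x - g₂ x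
    rw [← hd]
    rcases zmod_two_eq i with rfl | rfl
    · have a0 : P'.proj 1 (h x) = h x := hhx
      have a1 : P'.proj 0 (h x) = 0 := by rw [P'.proj_apply_of_mem a0]; rfl
      have b0 : P.proj 1 (P.d x) = P.d x := hdx
      have b1 : P.proj 0 (P.d x) = 0 := by rw [P.proj_apply_of_mem b0]; rfl
      have b2 : P.proj 1 x = 0 := by rw [P.proj_apply_of_mem hx]; rfl
      simp only [hx, a0, a1, b0, b1, b2, smul_zero, zero_add, add_zero, map_smul]
      rw [smul_smul, Units.inv_mul, one_smul]
    · have a0 : P'.proj 0 (h x) = h x := hhx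
      have a1 : P'.proj 1 (h x) = 0 := by rw [P'.proj_apply_of_mem a0]; rfl
      have b0 : P.proj 0 (P.d x) = P.d x := hdx
      have b1 : P.proj 1 (P.d x) = 0 := by rw [P.proj_apply_of_mem b0]; rfl
      have b2 : P.proj 0 x = 0 := by rw [P.proj_apply_of_mem hx]; rfl
      simp only [hx, a0, a1, b0, b1, b2, smul_zero, zero_add, add_zero, map_smul]
      rw [smul_smul, Units.mul_inv, one_smul]

theorem HtpyEquiv.mult (u : Qˣ) {P P' : MatFac Q f} (H : CurvedModule.HtpyEquiv P P') :
    CurvedModule.HtpyEquiv (mult u P) (mult u P') := by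
  obtain ⟨g, g', k, k', hg, hg', hk, hk'⟩ := H
  exact ⟨g, g', _, _, isHom_mult u hg, isHom_mult u hg', isHomotopy_mult u hk,
    isHomotopy_mult u hk'⟩

theorem ShortExact.mult (u : Qˣ) {X Y Z : MatFac Q f} (H : CurvedModule.ShortExact X Y Z) :
    CurvedModule.ShortExact (mult u X) (mult u Y) (mult u Z) := by
  obtain ⟨i, q, hi, hq, h⟩ := H
  exact ⟨i, q, isHom_mult u hi, isHom_mult u hq, h⟩

theorem inv_unit_mul_mul {p : ℕ} (hp : IsUnit (p : Q)) (f : Q) :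
    ((hp.unit⁻¹ : Qˣ) : Q) * ((p : Q) * f) = f := by
  rw [← mul_assoc, IsUnit.val_inv_mul, one_mul]

/-- The class of a matrix factorization of `p f`, divided by `p`. -/
noncomputable def classDiv {p : ℕ} (hp : IsUnit (p : Q)) (T : MatFac Q ((p : Q) * f)) :
    K0MatFac Q f :=
  K0.cls ((MatFac.mult hp.unit⁻¹ T).copy (inv_unit_mul_mul hp f))

theorem isClassFun_classDiv {p : ℕ} (hp : IsUnit (p : Q)) :
    CurvedModule.IsClassFun (fun _ => True) (classDiv (f := f) hp) where
  mem_of_ses _ _ _ := trivial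
  mem_of_htpy _ _ := trivial
  ses H _ _ := K0.cls_of_ses ((ShortExact.mult _ H).copy _)
  htpy H _ := K0.cls_of_htpy ((HtpyEquiv.mult _ H).copy _)

end MatFac

namespace BddComplex

variable {Q : Type u} [CommRing Q] [IsNoetherianRing Q] {f : Q}

/-- A power of `f` kills the homology of each end, and the product of the two powers kills that of
the middle term. -/
theorem SupportedOn.of_shortExact {X Y Z : BddComplex Q} (H : CurvedModule.ShortExact X Y Z)
    (hX : X.SupportedOn f) (hZ : Z.SupportedOn f) : Y.SupportedOn f := by
  obtain ⟨i, q, hi, hq, hinj, hex, hsurj⟩ := H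
  have hid : ∀ x, i (X.d x) = Y.d (i x) := LinearMap.congr_fun hi.d
  have hqd : ∀ x, q (Y.d x) = Z.d (q x) := LinearMap.congr_fun hq.d
  obtain ⟨a, ha⟩ := X.pow_of_supportedOn f hX
  obtain ⟨b, hb⟩ := Z.pow_of_supportedOn f hZ
  refine Y.supportedOn_of_pow f (a + b) fun x hx => ?_
  obtain ⟨z, hz⟩ := hb (q x) (by rw [← hqd, hx, map_zero])
  obtain ⟨y, rfl⟩ := hsurj z
  obtain ⟨x', hx'⟩ := (hex (f ^ b • x - Y.d y)).mp (by rw [map_sub, map_smul, hqd, hz, sub_self])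
  have hdd : Y.d (Y.d y) = 0 := by
    have := LinearMap.congr_fun Y.d_mul_d y
    rwa [zero_smul] at this
  obtain ⟨y', hy'⟩ := ha x' (hinj (by
    rw [hid, hx', map_sub, map_smul, hx, hdd, smul_zero, sub_zero, map_zero]))
  refine ⟨i y' + f ^ a • y, ?_⟩
  rw [map_add, ← hid, hy', map_smul, map_smul, hx', smul_sub, smul_smul, pow_add]
  abel

theorem SupportedOn.of_htpyEquiv {X Y : BddComplex Q} (H : CurvedModule.HtpyEquiv X Y)
    (hX : X.SupportedOn f) : Y.SupportedOn f := by
  obtain ⟨g, g', k, k', hg, hg', -, hk'⟩ := H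
  have hgd : ∀ x, g (X.d x) = Y.d (g x) := LinearMap.congr_fun hg.d
  have hgd' : ∀ x, g' (Y.d x) = X.d (g' x) := LinearMap.congr_fun hg'.d
  obtain ⟨a, ha⟩ := X.pow_of_supportedOn f hX
  refine Y.supportedOn_of_pow f a fun x hx => ?_
  obtain ⟨y, hy⟩ := ha (g' x) (by rw [← hgd', hx, map_zero])
  have hk : Y.d (k' x) + k' (Y.d x) = g (g' x) - x := LinearMap.congr_fun hk'.d x
  rw [hx, map_zero, add_zero] at hk
  refine ⟨g y - f ^ a • k' x, ?_⟩
  rw [map_sub, ← hgd, hy, map_smul, map_smul, hk, smul_sub, sub_sub_cancel]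

open Classical in
/-- The class of a complex of curvature `p * 0` if it is supported on `V(f)`, and zero otherwise. -/
noncomputable def classSupp (f : Q) (p : ℕ) (T : CurvedModule ℤ Q ((p : Q) * 0)) : K0Supp Q f :=
  if h : SupportedOn (T.copy (mul_zero _)) f then K0.cls ⟨T.copy (mul_zero _), h⟩ else 0

theorem isClassFun_classSupp (p : ℕ) :
    CurvedModule.IsClassFun (fun T => SupportedOn (T.copy (mul_zero (p : Q))) f)
      (classSupp f p) where
  mem_of_ses H := SupportedOn.of_shortExact (H.copy _)
  mem_of_htpy H := SupportedOn.of_htpyEquiv (H.copy _)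
  ses {X Y Z} H hX hZ := by
    have H' := H.copy (mul_zero (p : Q))
    rw [classSupp, classSupp, classSupp, dif_pos hX, dif_pos hZ,
      dif_pos (SupportedOn.of_shortExact H' hX hZ)]
    exact K0Supp.cls_of_ses H'
  htpy {X Y} H hX := by
    have H' := H.copy (mul_zero (p : Q))
    rw [classSupp, classSupp, dif_pos hX, dif_pos (SupportedOn.of_htpyEquiv H' hX)]
    exact K0Supp.cls_of_htpy H'

open CurvedModule in
/-- The parts of given weight of a cyclic power are supported on `V(f)`. -/
theorem supportedOn_weight {P' P P'' : BddComplex Q} (hP' : P'.SupportedOn f)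
    (hP'' : P''.SupportedOn f) {i : P'.carrier →ₗ[Q] P.carrier} {r : P.carrier →ₗ[Q] P'.carrier}
    {q : P.carrier →ₗ[Q] P''.carrier} {j : P''.carrier →ₗ[Q] P.carrier} (hi : IsHom P' P i)
    (hq : IsHom P P'' q) (hr : ∀ k, r ∘ₗ P.proj k = P'.proj k ∘ₗ r)
    (hj : ∀ k, j ∘ₗ P''.proj k = P.proj k ∘ₗ j) (hri : ∀ x, r (i x) = x)
    (hqj : ∀ x, q (j x) = x) (hqi : ∀ x, q (i x) = 0) (hij : ∀ x, i (r x) + j (q x) = x)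
    (h : IsWeight P (i ∘ₗ r : Module.End Q P.carrier)) {p : ℕ} (hp0 : p ≠ 0)
    (hp : IsUnit (p : Q)) (z : Q) (hz : z ^ p = 1) (k : ℤ) :
    SupportedOn (((P.tensorPower p).summand
      (h.isSummand_weight (hp := hp) hp0 hz k)).copy (mul_zero _)) f := by
  obtain ⟨a₁, ha₁⟩ := P'.pow_of_supportedOn f hP'
  obtain ⟨a₂, t', ht', hta⟩ := P'.exists_nullHomotopy _ ha₁
  obtain ⟨b₁, hb₁⟩ := P''.pow_of_supportedOn f hP''
  obtain ⟨b₂, t'', ht'', htb⟩ := P''.exists_nullHomotopy _ hb₁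
  rw [← pow_mul] at hta htb
  set a := a₁ * a₂
  set b := b₁ * b₂
  have hrj : ∀ y, r (j y) = 0 := fun y => by
    have := hij (j y)
    rw [hqj, add_eq_right] at this
    rw [← hri (r (j y)), this, map_zero]
  have e1 : ∀ i' x, i (P'.proj i' x) = P.proj i' (i x) := fun k => LinearMap.congr_fun (hi.proj k)
  have e2 : ∀ i' x, j (P''.proj i' x) = P.proj i' (j x) := fun k => LinearMap.congr_fun (hj k)
  have e3 : ∀ i' x, r (P.proj i' x) = P'.proj i' (r x) := fun k => LinearMap.congr_fun (hr k)
  have e4 : ∀ i' x, q (P.proj i' x) = P''.proj i' (q x) := fun k =>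
    LinearMap.congr_fun (hq.proj k)
  have e5 : ∀ i' x, t' (P'.proj i' x) = P'.proj (i' + 1) (t' x) := fun k =>
    LinearMap.congr_fun (ht' k)
  have e6 : ∀ i' x, t'' (P''.proj i' x) = P''.proj (i' + 1) (t'' x) := fun k =>
    LinearMap.congr_fun (ht'' k)
  have e7 : ∀ x, P'.d (t' x) + t' (P'.d x) = f ^ a • x := LinearMap.congr_fun hta
  have e8 : ∀ x, P''.d (t'' x) + t'' (P''.d x) = f ^ b • x := LinearMap.congr_fun htb
  have e9 : ∀ x, h.diag.d x = i (P'.d (r x)) + j (P''.d (q x)) := fun x => by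
    have h1 : i (P'.d (r x)) = P.d (i (r x)) := LinearMap.congr_fun hi.d _
    have h2 : q (P.d x) = P''.d (q x) := LinearMap.congr_fun hq.d _
    have h3 := hij (P.d x)
    change P.d (i (r x)) + (P.d x - i (r (P.d x))) = _
    rw [h1, ← h2, ← eq_sub_iff_add_eq'.mpr h3]
  -- The powers `f ^ a` and `f ^ b` are null-homotopic on `P'` and `P''`. Weighted by the
  -- complementary powers, the two homotopies combine to one for `f ^ (a + b)` on the split
  -- extension, whose differential is the one that the weight parts inherit.
  set t : Module.End Q P.carrier := f ^ b • (i ∘ₗ t' ∘ₗ r) + f ^ a • (j ∘ₗ t'' ∘ₗ q) with htdef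
  have ht : ∀ x, t x = f ^ b • i (t' (r x)) + f ^ a • j (t'' (q x)) := fun x => rfl
  obtain ⟨n, rfl⟩ := Nat.exists_eq_succ_of_ne_zero hp0
  obtain ⟨H, hH⟩ := BddComplex.exists_tensorPower_nullHomotopy h.diag t (fun l =>
      LinearMap.ext fun x => by
        change t (P.proj l x) = P.proj (l + 1) (t x)
        rw [ht, ht, e3, e4, e5, e6, e1, e2, map_add, map_smul, map_smul])
    (f ^ (a + b)) (LinearMap.ext fun x => by
        change h.diag.d (t x) + t (h.diag.d x) = f ^ (a + b) • x
        rw [e9, e9, ht, ht]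
        simp only [map_add, map_smul, hri, hqj, hqi, hrj, add_zero, zero_add, smul_zero]
        calc _ = f ^ b • i (P'.d (t' (r x)) + t' (P'.d (r x))) +
            f ^ a • j (P''.d (t'' (q x)) + t'' (P''.d (q x))) := by
              simp only [map_add, smul_add]; abel
          _ = f ^ (a + b) • (i (r x) + j (q x)) := by
              rw [e7, e8, map_smul, map_smul, smul_smul, smul_smul, smul_add, pow_add,
                mul_comm (f ^ b)]
          _ = _ := by rw [hij]) n
  have hH' : ∀ x, h.diag.tDiff (n + 1) (H x) + H (h.diag.tDiff (n + 1) x) = f ^ (a + b) • x :=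
    LinearMap.congr_fun hH
  set ε : Module.End Q (P.TPow (n + 1)) := P.cycProj hp z * h.grading.tProj (n + 1) k with hε
  have hidem : ∀ x, ε (ε x) = ε x := LinearMap.congr_fun (h.weight_idem hp0 hz k)
  have hcomm : ∀ x, ε (h.diag.tDiff (n + 1) x) = h.diag.tDiff (n + 1) (ε x) := fun x => by
    have h1 := LinearMap.congr_fun (h.diag_tDiff_comm (n + 1) k) x
    simp only [Module.End.mul_apply] at h1
    rw [hε, Module.End.mul_apply, ← h1, h.cycProj_comm_diag, Module.End.mul_apply]
  refine supportedOn_of_pow _ f (a + b) fun x hx => ?_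
  have hxε : ε x.1 = x.1 := summand_val (h.isSummand_weight (hp := hp) hp0 hz k) x
  have hx0 : h.diag.tDiff (n + 1) x.1 = 0 := by
    have h1 : ε (P.tDiff (n + 1) x.1) = 0 := congrArg Subtype.val hx
    rwa [h.weight_tDiff hp0 hz hxε] at h1
  -- The homotopy `H` need not preserve the weight part; it is compressed by `ε`, which commutes
  -- with the differential of the split extension.
  have key : ∀ y : P.TPow (n + 1), ε y = y → h.diag.tDiff (n + 1) y = 0 →
      ε (P.tDiff (n + 1) (ε (H y))) = f ^ (a + b) • y := by
    intro y hy hy0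
    have h2 := hH' y
    rw [hy0, map_zero, add_zero] at h2
    have h3 : ε (f ^ (a + b) • y) = f ^ (a + b) • ε y := map_smul _ _ _
    rw [h.weight_tDiff hp0 hz (hidem _), ← hcomm, h2, h3, hy]
  exact ⟨⟨ε (H x.1), H x.1, rfl⟩, Subtype.ext (key x.1 hxε hx0)⟩

end BddComplex

/-! ## The cyclic Adams operations -/

section Cyc

variable {p : ℕ}

theorem isPrimitiveRoot_zetaC (hp : p.Prime) : IsPrimitiveRoot (zetaC p) p :=
  Complex.isPrimitiveRoot_exp p hp.ne_zero

theorem sum_zetaInt_pow (hp : p.Prime) : ∑ k ∈ Finset.range p, zetaInt p ^ k = 0 := by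
  apply Subtype.ext
  rw [AddSubmonoidClass.coe_finsetSum, ZeroMemClass.coe_zero,
    ← (isPrimitiveRoot_zetaC hp).geom_sum_eq_zero hp.one_lt]
  rfl

theorem isIntegral_zetaC (hp : p.Prime) : IsIntegral ℤ (zetaC p) :=
  (isPrimitiveRoot_zetaC hp).isIntegral hp.pos

/-- The inclusion of `ℤ` in `ℤ[e^{2 π i / p}]` has a retraction. -/
theorem exists_retraction_cycInt (hp : p.Prime) : ∃ r : CycInt p →ₗ[ℤ] ℤ, r 1 = 1 := by
  -- As `ζ` is integral over the integrally closed ring `ℤ`, its powers form a basis of `ℤ[ζ]`, and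
  -- the coefficient of 1 is a retraction.
  let B := Algebra.adjoin.powerBasis' (isIntegral_zetaC hp)
  have hd : 0 < B.dim := B.dim_pos
  refine ⟨B.basis.coord ⟨0, hd⟩, ?_⟩
  have h1 : B.basis ⟨0, hd⟩ = 1 := by rw [B.basis_eq_pow, pow_zero]
  rw [← h1, Module.Basis.coord_apply, Module.Basis.repr_self, Finsupp.single_eq_same]

/-- A retraction survives tensoring with any abelian group, torsion included. Hence an equation
after tensoring with `ℤ[ζ]` determines the operation on `K` itself. -/
theorem one_tmul_injective (hp : p.Prime) {K : Type w} [AddCommGroup K] :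
    Function.Injective fun x : K => (1 : CycInt p) ⊗ₜ[ℤ] x := by
  obtain ⟨r, hr⟩ := exists_retraction_cycInt hp
  refine Function.LeftInverse.injective
    (g := fun y => TensorProduct.lid ℤ K (LinearMap.rTensor K r y)) fun x => ?_
  simp [hr]

variable {O : Type v} {ses : O → O → O → Prop} {htpy : O → O → Prop} {t : ℕ → O → O}

theorem IsCyclicAdams.unique (hp : p.Prime) {ψ ψ' : K0 O ses htpy →+ K0 O ses htpy}
    (h : IsCyclicAdams p t ψ) (h' : IsCyclicAdams p t ψ') : ψ = ψ' :=
  K0.hom_ext fun P => one_tmul_injective hp ((h P).trans (h' P).symm)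

/-- The operation is `[t 0] - [t 1]`. -/
theorem isCyclicAdams_of (hp : p.Prime) {ψ : K0 O ses htpy →+ K0 O ses htpy}
    (h1 : ∀ k P, 0 < k → k < p → (K0.cls (t k P) : K0 O ses htpy) = K0.cls (t 1 P))
    (h : ∀ P, ψ (K0.cls P) = K0.cls (t 0 P) - K0.cls (t 1 P)) : IsCyclicAdams p t ψ := by
  intro P
  have hs := sum_zetaInt_pow hp
  obtain ⟨n, rfl⟩ := Nat.exists_eq_succ_of_ne_zero hp.ne_zero
  -- The nontrivial roots of unity all come with the same class `[t 1]`, and their sum is `-1`.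
  rw [Finset.sum_range_succ', pow_zero, add_eq_zero_iff_eq_neg] at hs
  rw [h, Finset.sum_range_succ', pow_zero]
  have h2 : ∀ k ∈ Finset.range n, (zetaInt (n + 1) ^ (k + 1)) ⊗ₜ[ℤ]
      (K0.cls (t (k + 1) P) : K0 O ses htpy) =
      (zetaInt (n + 1) ^ (k + 1)) ⊗ₜ[ℤ] (K0.cls (t 1 P) : K0 O ses htpy) := by
    intro k hk
    rw [Finset.mem_range] at hk
    rw [h1 (k + 1) P (Nat.succ_pos k) (by omega)]
  rw [Finset.sum_congr rfl h2, ← TensorProduct.sum_tmul, hs, TensorProduct.neg_tmul,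
    TensorProduct.tmul_sub, sub_eq_neg_add]

end Cyc

theorem CurvedModule.cyclicPower_congr {Γ : Type} [CommRing Γ] [SignedGrading Γ] {Q : Type u}
    [CommRing Q] {p : ℕ} {c : Q}
    (P : CurvedModule Γ Q c) (hpu : IsUnit (p : Q)) {z z' : Q} (h : z = z') (hz : z ^ p = 1)
    (hz' : z' ^ p = 1) : P.cyclicPower hpu z hz = P.cyclicPower hpu z' hz' := by
  subst h; rfl

section Operations

variable {p : ℕ} (hp : p.Prime) {Q : Type u} [CommRing Q] [Algebra (Ap p) Q] {f : Q}

theorem cls_tMatFac (k : ℕ) (P : MatFac Q f) :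
    (K0.cls (tMatFac hp k P) : K0MatFac Q f) = MatFac.classDiv (isUnit_natCast hp)
      (P.cyclicPower (isUnit_natCast hp) (zetaQ p Q ^ k) (zetaQ_pow_pow hp k)) := rfl

theorem cls_tMatFac_zero (P : MatFac Q f) :
    (K0.cls (tMatFac hp 0 P) : K0MatFac Q f) = MatFac.classDiv (isUnit_natCast hp)
      (P.cyclicPower (isUnit_natCast hp) 1 (one_pow p)) := by
  rw [cls_tMatFac, P.cyclicPower_congr _ (pow_zero _)]

theorem cls_tMatFac_eq {k : ℕ} (P : MatFac Q f) (hk0 : 0 < k) (hkp : k < p) :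
    (K0.cls (tMatFac hp k P) : K0MatFac Q f) = K0.cls (tMatFac hp 1 P) := by
  have H := P.cyclicPower_pow_htpyEquiv hp (isUnit_natCast hp) (zetaQ_pow_pow (Q := Q) hp 1) hk0 hkp
    (by rw [pow_one]; exact zetaQ_pow_pow hp k)
  rw [cls_tMatFac, cls_tMatFac, (MatFac.isClassFun_classDiv _).htpy H trivial]
  rw [P.cyclicPower_congr _ (z := zetaQ p Q ^ k) (z' := (zetaQ p Q ^ 1) ^ k) (by rw [pow_one])]

/-- The cyclic Adams operation on matrix factorizations. -/
noncomputable def adamsMatFac (f : Q) : K0MatFac Q f →+ K0MatFac Q f :=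
  K0.lift (fun P => K0.cls (tMatFac hp 0 P) - K0.cls (tMatFac hp 1 P))
    (fun P' P P'' h => by
      rw [cls_tMatFac_zero, cls_tMatFac_zero, cls_tMatFac_zero]
      exact h.class_cyclicPower hp (MatFac.isClassFun_classDiv (isUnit_natCast hp))
        (isUnit_natCast hp) (zetaQ_pow_pow hp 1)
        fun _ _ _ _ _ _ _ _ _ _ _ _ _ _ _ _ => trivial)
    (fun P P' h => by
      rw [cls_tMatFac, cls_tMatFac, cls_tMatFac, cls_tMatFac]
      have hκ := MatFac.isClassFun_classDiv (f := f) (isUnit_natCast (Q := Q) hp)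
      rw [hκ.htpy (h.cyclicPower (isUnit_natCast hp) hp.ne_zero (zetaQ_pow_pow hp 0)) trivial,
        hκ.htpy (h.cyclicPower (isUnit_natCast hp) hp.ne_zero (zetaQ_pow_pow hp 1)) trivial])

theorem adamsMatFac_cls (P : MatFac Q f) : adamsMatFac hp f (K0.cls P) =
    K0.cls (tMatFac hp 0 P) - K0.cls (tMatFac hp 1 P) := K0.lift_cls _ _ _ P

theorem isCyclicAdams_adamsMatFac (f : Q) :
    IsCyclicAdams p (tMatFac (f := f) hp) (adamsMatFac hp f) :=
  isCyclicAdams_of hp (fun _ P hk0 hkp => cls_tMatFac_eq hp P hk0 hkp) (adamsMatFac_cls hp)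

variable [IsNoetherianRing Q]

theorem supportedOn_cyclicPower (P : SuppComplex Q f) {z : Q} (hz : z ^ p = 1) :
    BddComplex.SupportedOn ((CurvedModule.cyclicPower P.1 (isUnit_natCast hp) z hz).copy
      (mul_zero _)) f := P.1.cyclicPower_supportedOn f P.2 hp.ne_zero _ _ _

theorem cls_tSupp (k : ℕ) (P : SuppComplex Q f) :
    (K0.cls (tSupp hp k P) : K0Supp Q f) = BddComplex.classSupp f p
      (CurvedModule.cyclicPower P.1 (isUnit_natCast hp) (zetaQ p Q ^ k) (zetaQ_pow_pow hp k)) := by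
  rw [BddComplex.classSupp, dif_pos (supportedOn_cyclicPower hp P _)]
  rfl

theorem cls_tSupp_zero (P : SuppComplex Q f) :
    (K0.cls (tSupp hp 0 P) : K0Supp Q f) = BddComplex.classSupp f p
      (CurvedModule.cyclicPower P.1 (isUnit_natCast hp) 1 (one_pow p)) := by
  rw [cls_tSupp, CurvedModule.cyclicPower_congr _ _ (pow_zero _)]

theorem cls_tSupp_eq {k : ℕ} (P : SuppComplex Q f) (hk0 : 0 < k) (hkp : k < p) :
    (K0.cls (tSupp hp k P) : K0Supp Q f) = K0.cls (tSupp hp 1 P) := by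
  have H := P.1.cyclicPower_pow_htpyEquiv hp (isUnit_natCast hp) (zetaQ_pow_pow (Q := Q) hp 1) hk0
    hkp (by rw [pow_one]; exact zetaQ_pow_pow hp k)
  rw [cls_tSupp, cls_tSupp, (BddComplex.isClassFun_classSupp _).htpy H
    (supportedOn_cyclicPower hp P _), CurvedModule.cyclicPower_congr P.1 _
      (z := zetaQ p Q ^ k) (z' := (zetaQ p Q ^ 1) ^ k) (by rw [pow_one])]

/-- The cyclic Adams operation on complexes supported on `V(f)`. -/
noncomputable def adamsSupp (f : Q) : K0Supp Q f →+ K0Supp Q f :=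
  K0.lift (fun P => K0.cls (tSupp hp 0 P) - K0.cls (tSupp hp 1 P))
    (fun P' P P'' h => by
      rw [cls_tSupp_zero, cls_tSupp_zero, cls_tSupp_zero, cls_tSupp, cls_tSupp, cls_tSupp]
      exact h.class_cyclicPower hp (BddComplex.isClassFun_classSupp p)
        (isUnit_natCast hp) (zetaQ_pow_pow hp 1)
        fun i r q j hi hq hr hj hri hqj hqi hij hw z hz k =>
          BddComplex.supportedOn_weight P'.2 P''.2 hi hq hr hj hri hqj hqi hij hw hp.ne_zero
            (isUnit_natCast hp) z hz k)
    (fun P P' h => by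
      rw [cls_tSupp, cls_tSupp, cls_tSupp, cls_tSupp]
      have hκ := BddComplex.isClassFun_classSupp (f := f) p
      rw [hκ.htpy (h.cyclicPower (isUnit_natCast hp) hp.ne_zero (zetaQ_pow_pow hp 0))
          (supportedOn_cyclicPower hp P _),
        hκ.htpy (h.cyclicPower (isUnit_natCast hp) hp.ne_zero (zetaQ_pow_pow hp 1))
          (supportedOn_cyclicPower hp P _)])

theorem adamsSupp_cls (P : SuppComplex Q f) : adamsSupp hp f (K0.cls P) =
    K0.cls (tSupp hp 0 P) - K0.cls (tSupp hp 1 P) := K0.lift_cls _ _ _ P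

theorem isCyclicAdams_adamsSupp (f : Q) :
    IsCyclicAdams p (tSupp (f := f) hp) (adamsSupp hp f) :=
  isCyclicAdams_of hp (fun _ P hk0 hkp => cls_tSupp_eq hp P hk0 hkp) (adamsSupp_cls hp)

end Operations

namespace KoszulModule

variable {Q : Type u} [CommRing Q] {f : Q}

/-! ## Cyclic powers of Koszul modules -/

/-- The underlying module with the opposite grading and the differential `s`. -/
@[reducible]
def op (P : KoszulModule Q f) : BddComplex Q where
  carrier := P.carrier
  proj i := P.proj (-i)
  proj_mul_self i := P.proj_mul_self (-i)
  proj_mul_of_ne i j h := P.proj_mul_of_ne _ _ fun h' => h (neg_injective h')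
  exists_sum_proj := by
    obtain ⟨S, h1, h2⟩ := P.exists_sum_proj
    refine ⟨S.map (Equiv.neg ℤ).toEmbedding, fun i hi => h1 _ fun hi' => hi ?_, ?_⟩
    · exact Finset.mem_map.mpr ⟨-i, hi', neg_neg i⟩
    · rw [Finset.sum_map]
      simpa using h2
  -- Reversing the degrees makes `s` a differential of degree `-1`, so the results on differentials
  -- of tensor powers also cover the derivation induced by `s`.
  d := P.s
  d_mul_proj i := by rw [P.s_mul_proj, show -(i - 1) = -i + 1 by ring]
  d_mul_d := by rw [P.s_mul_s, zero_smul]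

theorem op_mem (P : KoszulModule Q f) {i : ℤ} {x : P.carrier} (hx : P.proj i x = x) :
    P.op.proj (-i) x = x := by
  change P.proj (- -i) x = x
  rw [neg_neg, hx]

/-- A degree and its negative have the same parity. Thus `op` involves the same Koszul signs, and
its tensor powers carry the same action of permutations. -/
theorem op_parityProj (P : KoszulModule Q f) (b : ZMod 2) :
    P.op.parityProj b = P.cx.parityProj b := by
  refine P.cx.ext_of_mem fun i x hx => ?_
  rw [P.cx.parityProj_apply_of_mem hx]
  refine (P.op.parityProj_apply_of_mem (P.op_mem hx) b).trans ?_
  rw [map_neg, ZMod.neg_eq_self_mod_two]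

theorem fold_mem (P : KoszulModule Q f) {i : ℤ} {x : P.carrier} (hx : P.proj i x = x) :
    P.fold.proj (SignedGrading.parity i) x = x := by
  change P.cx.parityProj _ x = x
  rw [P.cx.parityProj_apply_of_mem hx, if_pos rfl]

theorem fold_parityProj (P : KoszulModule Q f) (b : ZMod 2) :
    P.fold.parityProj b = P.cx.parityProj b := by
  refine P.cx.ext_of_mem fun i x hx => ?_
  exact (P.fold.parityProj_apply_of_mem (P.fold_mem hx) b).trans
    (P.cx.parityProj_apply_of_mem hx b).symm

variable (P : KoszulModule Q f) (n : ℕ)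

theorem op_signMap : P.op.signMap = P.cx.signMap := by
  unfold CurvedModule.signMap
  rw [op_parityProj, op_parityProj]

theorem fold_signMap : P.fold.signMap = P.cx.signMap := by
  unfold CurvedModule.signMap
  rw [fold_parityProj, fold_parityProj]
  rfl

/-- The action of `ε` on the tensor power. -/
noncomputable def tS : Module.End Q (P.cx.TPow n) := P.cx.tDer n P.s

theorem op_tDiff : P.op.tDiff n = P.tS n := by
  change P.op.tDer n P.s = P.cx.tDer n P.s
  unfold CurvedModule.tDer CurvedModule.tDerAt
  rw [op_signMap]

theorem fold_tDiff : P.fold.tDiff n = P.cx.tDiff n + P.tS n := by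
  have h : P.cx.tDer n (P.d + P.s) = P.cx.tDiff n + P.tS n := P.cx.tDer_add n _ _
  rw [← h]
  change P.fold.tDer n (P.d + P.s) = P.cx.tDer n (P.d + P.s)
  unfold CurvedModule.tDer CurvedModule.tDerAt
  rw [fold_signMap]
  rfl

variable {n}

theorem op_tPerm (σ : Equiv.Perm (Fin n)) : P.op.tPerm n σ = P.cx.tPerm n σ := by
  unfold CurvedModule.tPerm
  simp only [op_parityProj]

theorem fold_tPerm (σ : Equiv.Perm (Fin n)) : P.fold.tPerm n σ = P.cx.tPerm n σ := by
  unfold CurvedModule.tPerm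
  simp only [fold_parityProj]
  rfl

theorem op_tProj (k : ℤ) : P.op.tProj n k = P.cx.tProj n (-k) := by
  refine P.cx.tPow_ext fun a x hx => ?_
  rw [P.cx.tProj_apply hx]
  refine (P.op.tProj_apply (a := fun s => -a s) (fun s => P.op_mem (hx s)) k).trans ?_
  rw [Finset.sum_neg_distrib]
  simp only [neg_eq_iff_eq_neg]

theorem fold_tProj (b : ZMod 2) : P.fold.tProj n b = (P.cx.tensorPower n).parityProj b := by
  classical
  refine P.cx.tPow_ext fun a x hx => ?_
  have h1 : (P.cx.tensorPower n).proj (∑ s, a s) (PiTensorProduct.tprod Q x) =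
    PiTensorProduct.tprod Q x := (P.cx.tProj_apply hx _).trans (if_pos rfl)
  refine (P.fold.tProj_apply (a := fun s => SignedGrading.parity (a s))
    (fun s => P.fold_mem (hx s)) b).trans ?_
  refine Eq.trans ?_ ((P.cx.tensorPower n).parityProj_apply_of_mem h1 b).symm
  rw [map_sum]
  rfl

theorem tPerm_mul_tS (σ : Equiv.Perm (Fin n)) :
    P.cx.tPerm n σ * P.tS n = P.tS n * P.cx.tPerm n σ := by
  rw [← op_tPerm, ← op_tDiff]
  exact P.op.tPerm_mul_tDiff σ

theorem tS_mul_tProj (k : ℤ) : P.tS n * P.cx.tProj n k = P.cx.tProj n (k + 1) * P.tS n := by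
  have := P.op.tDiff_mul_tProj (n := n) (-k)
  rw [op_tProj, op_tProj, op_tDiff, neg_neg, neg_sub, sub_neg_eq_add, add_comm 1 k] at this
  exact this

theorem tS_mul_tS : P.tS n * P.tS n = 0 := by
  have := P.op.tDiff_mul_tDiff (n := n)
  rw [mul_zero, zero_smul, op_tDiff] at this
  exact this

/-- The folded differential on the tensor power is the sum of the two derivations and has square `n
f`, while each of the two squares to zero; the mixed terms are what is left. -/
theorem tDiff_mul_tS_add :
    P.cx.tDiff n * P.tS n + P.tS n * P.cx.tDiff n = ((n : Q) * f) • (1 : Module.End Q (P.cx.TPow n)) := by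
  have h1 := P.fold.tDiff_mul_tDiff (n := n)
  have h2 := P.cx.tDiff_mul_tDiff (n := n)
  rw [mul_zero, zero_smul] at h2
  rw [fold_tDiff] at h1
  have h3 : (P.cx.tDiff n + P.tS n) * (P.cx.tDiff n + P.tS n) =
      P.cx.tDiff n * P.tS n + P.tS n * P.cx.tDiff n := by
    rw [add_mul, mul_add, mul_add, h2, P.tS_mul_tS, zero_add, add_zero]
  rw [← h3]
  exact h1

/-- The action of `ε` on an eigenspace of the cyclic permutation. -/
noncomputable def eigS (p : ℕ) (z : Q) : Module.End Q (eig (P.cx.tPerm p (finRotate p)) z) :=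
  LinearMap.restrict (P.tS p) (map_eig (P.tPerm_mul_tS (finRotate p)))

/-- The cyclic power of a Koszul module. -/
noncomputable def cyclicPower {p : ℕ} (hp : IsUnit (p : Q)) (z : Q) (hz : z ^ p = 1) :
    KoszulModule Q ((p : Q) * f) where
  toCurvedModule := P.cx.cyclicPower hp z hz
  s := P.eigS p z
  s_mul_proj i := LinearMap.ext fun x => Subtype.ext
    (LinearMap.congr_fun (P.tS_mul_tProj i) (x : eig (P.cx.tPerm p (finRotate p)) z).1)
  d_mul_s_add := LinearMap.ext fun x => Subtype.ext
    (LinearMap.congr_fun P.tDiff_mul_tS_add (x : eig (P.cx.tPerm p (finRotate p)) z).1)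
  s_mul_s := LinearMap.ext fun x => Subtype.ext
    (LinearMap.congr_fun P.tS_mul_tS (x : eig (P.cx.tPerm p (finRotate p)) z).1)

theorem fold_htpyEquiv_of_equiv {c : Q} (X : KoszulModule Q c) (Y : MatFac Q c)
    (φ : X.carrier ≃ₗ[Q] Y.carrier)
    (h1 : ∀ i x, X.proj i x = x → Y.proj (SignedGrading.parity i) (φ x) = φ x)
    (h2 : ∀ x, φ (X.d x) + φ (X.s x) = Y.d (φ x)) : CurvedModule.HtpyEquiv X.fold Y := by
  refine CurvedModule.HtpyEquiv.of_equiv (P := X.fold) (P' := Y) φ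
    ⟨fun b => X.cx.ext_of_mem fun i x hx => ?_, LinearMap.ext fun x => ?_⟩
  · change φ (X.cx.parityProj b x) = Y.proj b (φ x)
    rw [X.cx.parityProj_apply_of_mem hx, Y.proj_apply_of_mem (h1 i x hx)]
    split_ifs
    · rfl
    · exact map_zero φ
  · exact (map_add φ (X.d x) (X.s x)).trans (h2 x)

variable (n) in
/-- The tensor powers of a Koszul module and of its folding have the same underlying module. -/
noncomputable def foldTPow : P.cx.TPow n ≃ₗ[Q] P.fold.TPow n := LinearEquiv.refl Q (P.cx.TPow n)

theorem foldTPow_tDiff (x : P.cx.TPow n) :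
    P.foldTPow n (P.cx.tDiff n x) + P.foldTPow n (P.tS n x) =
      P.fold.tDiff n (P.foldTPow n x) :=
  (LinearMap.congr_fun (P.fold_tDiff n) x).symm

theorem foldTPow_tPerm (σ : Equiv.Perm (Fin n)) (x : P.cx.TPow n) :
    P.foldTPow n (P.cx.tPerm n σ x) = P.fold.tPerm n σ (P.foldTPow n x) :=
  (LinearMap.congr_fun (P.fold_tPerm σ) x).symm

theorem foldTPow_tProj {i : ℤ} {x : P.cx.TPow n} (hx : P.cx.tProj n i x = x) :
    P.fold.tProj n (SignedGrading.parity i) (P.foldTPow n x) = P.foldTPow n x := by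
  refine (LinearMap.congr_fun (P.fold_tProj (SignedGrading.parity i)) x).trans ?_
  exact ((P.cx.tensorPower n).parityProj_apply_of_mem hx _).trans (if_pos rfl)

/-- The equivalence between eigenspaces that is induced by an equivariant equivalence. -/
noncomputable def eigEquiv {M N : Type u} [AddCommGroup M] [Module Q M] [AddCommGroup N]
    [Module Q N] (φ : M ≃ₗ[Q] N) {σ : Module.End Q M} {τ : Module.End Q N}
    (h : ∀ x, φ (σ x) = τ (φ x)) (z : Q) : eig σ z ≃ₗ[Q] eig τ z :=
  φ.ofSubmodules _ _ <| by
    ext y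
    obtain ⟨x, rfl⟩ := φ.surjective y
    rw [Submodule.mem_map_equiv, φ.symm_apply_apply, mem_eig, mem_eig, ← h, ← map_smul,
      φ.injective.eq_iff]

/-- Folding commutes with cyclic powers. -/
theorem fold_cyclicPower_htpyEquiv {p : ℕ} (hp : IsUnit (p : Q)) (z : Q) (hz : z ^ p = 1) :
    CurvedModule.HtpyEquiv (P.cyclicPower hp z hz).fold (P.fold.cyclicPower hp z hz) := by
  refine (P.cyclicPower hp z hz).fold_htpyEquiv_of_equiv (P.fold.cyclicPower hp z hz)
    (eigEquiv (P.foldTPow p) (P.foldTPow_tPerm (finRotate p)) z)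
    (fun i x hx => Subtype.ext ?_) fun x => Subtype.ext ?_
  · exact P.foldTPow_tProj (congrArg Subtype.val hx)
  · exact P.foldTPow_tDiff (x : eig (P.cx.tPerm p (finRotate p)) z).1

/-! ## Rescaling -/

section Rescale

variable {f : Q} (u : Qˣ)

/-- A Koszul module over the Koszul algebra of `u f`, as one over the Koszul algebra of `f`. -/
def rescale (X : KoszulModule Q ((u : Q) * f)) : KoszulModule Q f where
  toCurvedModule := X.toCurvedModule
  s := ((u⁻¹ : Qˣ) : Q) • X.s
  s_mul_proj i := by rw [smul_mul_assoc, mul_smul_comm, X.s_mul_proj]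
  d_mul_s_add := by
    rw [smul_mul_assoc, mul_smul_comm, ← smul_add, X.d_mul_s_add, smul_smul, Units.inv_mul_cancel_left]
  s_mul_s := by rw [smul_mul_assoc, mul_smul_comm, X.s_mul_s, smul_zero, smul_zero]

/-- The multiplication by `u ^ ⌊i / 2⌋` in degree `i`. -/
noncomputable def scale (X : BddComplex Q) : Module.End Q X.carrier :=
  ∑ i ∈ X.exists_sum_proj.choose, ((u ^ (i / 2) : Qˣ) : Q) • X.proj i

theorem scale_apply (X : BddComplex Q) {i : ℤ} {x : X.carrier} (hx : X.proj i x = x) :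
    scale u X x = ((u ^ (i / 2) : Qˣ) : Q) • x := by
  unfold scale
  have h := X.exists_sum_proj.choose_spec.1
  set S := X.exists_sum_proj.choose
  rw [LinearMap.sum_apply]
  have h1 : ∀ j ∈ S, (((u ^ (j / 2) : Qˣ) : Q) • X.proj j) x =
      if i = j then ((u ^ (i / 2) : Qˣ) : Q) • x else 0 := by
    intro j _
    rw [LinearMap.smul_apply, X.proj_apply_of_mem hx]
    split_ifs with hij
    · rw [hij]
    · exact smul_zero _
  rw [Finset.sum_congr rfl h1, Finset.sum_ite_eq]
  split_ifs with hi
  · rfl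
  · rw [← hx, h i hi, LinearMap.zero_apply, smul_zero]

theorem scale_scale (X : BddComplex Q) (x : X.carrier) : scale u⁻¹ X (scale u X x) = x := by
  have : scale u⁻¹ X ∘ₗ scale u X = LinearMap.id := X.ext_of_mem fun i x hx => by
    rw [LinearMap.comp_apply, scale_apply u X hx, map_smul, scale_apply u⁻¹ X hx, smul_smul,
      ← Units.val_mul, ← mul_zpow, mul_inv_cancel, one_zpow, Units.val_one, one_smul]
    rfl
  exact LinearMap.congr_fun this x

/-- Rescaling the action of `ε` yields, after folding, the rescaling of one of the two maps of a
matrix factorization. -/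
theorem fold_rescale_htpyEquiv (X : KoszulModule Q ((u : Q) * f))
    (h : ((u⁻¹ : Qˣ) : Q) * ((u : Q) * f) = f) :
    CurvedModule.HtpyEquiv (X.rescale u).fold ((MatFac.mult u⁻¹ X.fold).copy h) := by
  refine CurvedModule.HtpyEquiv.of_equiv (P := (X.rescale u).fold)
    (P' := (MatFac.mult u⁻¹ X.fold).copy h) (LinearEquiv.ofLinearMap (scale u X.cx)
      (scale u⁻¹ X.cx) (LinearMap.ext fun x => by
        have := scale_scale u⁻¹ X.cx x
        rwa [inv_inv] at this) (LinearMap.ext fun x => scale_scale u X.cx x))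
    ⟨fun b => X.cx.ext_of_mem fun i x hx => ?_, X.cx.ext_of_mem fun i x hx => ?_⟩
  · change scale u X.cx (X.cx.parityProj b x) = X.cx.parityProj b (scale u X.cx x)
    rw [scale_apply u X.cx hx, map_smul, X.cx.parityProj_apply_of_mem hx]
    split_ifs
    · exact scale_apply u X.cx hx
    · rw [map_zero, smul_zero]
  · change scale u X.cx (X.d x + ((u⁻¹ : Qˣ) : Q) • X.s x) = (X.d + X.s)
      (X.cx.parityProj 1 (scale u X.cx x) +
        ((u⁻¹ : Qˣ) : Q) • X.cx.parityProj 0 (scale u X.cx x))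
    rw [scale_apply u X.cx hx, map_add, map_smul, scale_apply u X.cx (X.cx.proj_d_of_mem hx),
      scale_apply u X.cx (X.proj_s_of_mem hx), map_smul, map_smul,
      X.cx.parityProj_apply_of_mem hx, X.cx.parityProj_apply_of_mem hx, smul_smul, smul_smul,
      ← Units.val_mul, ← Units.val_mul, ← zpow_neg_one, ← zpow_add, ← zpow_add]
    -- The exponent `⌊i / 2⌋` drops under `d` exactly from even degrees and rises under `s` exactly
    -- from odd ones. In degree `2 m` both sides are `u ^ (m - 1)` times `d + s`, in degree `2 m +
    -- 1` both are `u ^ m` times `d + s`.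
    rcases Int.even_or_odd' i with ⟨m, rfl | rfl⟩
    · have h2 : (SignedGrading.parity (2 * m) : ZMod 2) = 0 := by
        rw [map_mul, map_ofNat]; exact (by decide : ∀ b : ZMod 2, 2 * b = 0) _
      rw [h2, if_pos rfl, if_neg (by decide), smul_zero, zero_add, map_smul, LinearMap.add_apply,
        smul_add]
      congr 4 <;> omega
    · have h2 : (SignedGrading.parity (2 * m + 1) : ZMod 2) = 1 := by
        rw [map_add, map_mul, map_ofNat, map_one]
        exact (by decide : ∀ b : ZMod 2, 2 * b + 1 = 1) _
      rw [h2, if_pos rfl, if_neg (by decide), smul_zero, add_zero, map_smul, LinearMap.add_apply,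
        smul_add]
      congr 4 <;> omega

end Rescale

end KoszulModule

/-! ## Compatibility of the cyclic Adams operations -/

section Compat

variable {p : ℕ} (hp : p.Prime) {Q : Type u} [CommRing Q] [Algebra (Ap p) Q] {f : Q}

/-- The cyclic power of a Koszul module, as a module over the same Koszul algebra. -/
noncomputable def tKoszul (k : ℕ) (P : KoszulModule Q f) : KoszulModule Q f :=
  (P.cyclicPower (isUnit_natCast hp) (zetaQ p Q ^ k) (zetaQ_pow_pow hp k)).rescale
    (isUnit_natCast hp).unit

/-- Folding commutes with cyclic powers, and dividing `s` by `p` becomes, after rescaling the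
degrees by powers of `p`, the division of `β` by `p`. -/
theorem cls_tKoszul_fold (k : ℕ) (P : KoszulModule Q f) :
    (K0.cls (tKoszul hp k P).fold : K0MatFac Q f) = K0.cls (tMatFac hp k P.fold) := by
  have h1 := KoszulModule.fold_rescale_htpyEquiv (isUnit_natCast hp).unit
    (P.cyclicPower (isUnit_natCast hp) (zetaQ p Q ^ k) (zetaQ_pow_pow hp k))
    (MatFac.inv_unit_mul_mul _ f)
  have h2 := (MatFac.HtpyEquiv.mult (isUnit_natCast hp).unit⁻¹
    (P.fold_cyclicPower_htpyEquiv (isUnit_natCast hp) (zetaQ p Q ^ k)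
      (zetaQ_pow_pow hp k))).copy (MatFac.inv_unit_mul_mul _ f)
  exact (K0.cls_of_htpy h1).trans (K0.cls_of_htpy h2)

variable [IsNoetherianRing Q]

/-- Rescaling changes only `s`, so on underlying complexes the agreement is strict. -/
theorem tKoszul_forget (k : ℕ) (P : KoszulModule Q f) :
    (tKoszul hp k P).forget = tSupp hp k P.forget := rfl

/-- Since the forgetful map is surjective, it is enough to evaluate on classes of Koszul modules.
There `tKoszul` lifts the cyclic powers on both sides. Only classes of individual objects are
compared, so no Adams operation on `K0Koszul` is needed. -/
theorem rho_adams (hF : Function.Bijective (forgetMap Q f)) (x : K0Supp Q f) :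
    rho hF (adamsSupp hp f x) = adamsMatFac hp f (rho hF x) := by
  obtain ⟨y, rfl⟩ := hF.2 x
  have : ((rho hF).comp (adamsSupp hp f)).comp (forgetMap Q f) =
      (adamsMatFac hp f).comp (foldMap Q f) := by
    refine K0.hom_ext fun P => ?_
    rw [AddMonoidHom.comp_apply, AddMonoidHom.comp_apply, AddMonoidHom.comp_apply, forgetMap_cls,
      foldMap_cls, adamsSupp_cls, adamsMatFac_cls, ← tKoszul_forget, ← tKoszul_forget,
      ← forgetMap_cls, ← forgetMap_cls, map_sub, rho_forgetMap, rho_forgetMap, foldMap_cls,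
      foldMap_cls, cls_tKoszul_fold, cls_tKoszul_fold]
  rw [rho_forgetMap]
  exact DFunLike.congr_fun this y

end Compat

end CyclicAdams

theorem proposition2p6 (p : ℕ) (hp : p.Prime) (Q : Type*) [CommRing Q] [IsRegularRing Q]
    [Algebra (CyclicAdams.Ap p) Q] (f : Q) (hf : f ∈ nonZeroDivisors Q) :
    ∃ hF : Function.Bijective (CyclicAdams.forgetMap Q f),
      Function.Surjective (CyclicAdams.rho hF) ∧
      (∃! ψ : CyclicAdams.K0Supp Q f →+ CyclicAdams.K0Supp Q f,
        CyclicAdams.IsCyclicAdams p (CyclicAdams.tSupp hp) ψ) ∧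
      (∃! ψ' : CyclicAdams.K0MatFac Q f →+ CyclicAdams.K0MatFac Q f,
        CyclicAdams.IsCyclicAdams p (CyclicAdams.tMatFac hp) ψ') ∧
      ∀ (ψ : CyclicAdams.K0Supp Q f →+ CyclicAdams.K0Supp Q f)
        (ψ' : CyclicAdams.K0MatFac Q f →+ CyclicAdams.K0MatFac Q f),
        CyclicAdams.IsCyclicAdams p (CyclicAdams.tSupp hp) ψ →
        CyclicAdams.IsCyclicAdams p (CyclicAdams.tMatFac hp) ψ' →
        ∀ x : CyclicAdams.K0Supp Q f, CyclicAdams.rho hF (ψ x) = ψ' (CyclicAdams.rho hF x) := by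
  have hF := CyclicAdams.forgetMap_bijective (Q := Q) f
  have h₁ := CyclicAdams.isCyclicAdams_adamsSupp hp f
  have h₂ := CyclicAdams.isCyclicAdams_adamsMatFac hp f
  refine ⟨hF, CyclicAdams.rho_surjective hF, ⟨_, h₁, fun ψ hψ => hψ.unique hp h₁⟩,
    ⟨_, h₂, fun ψ hψ => hψ.unique hp h₂⟩, fun ψ ψ' hψ hψ' x => ?_⟩
  rw [hψ.unique hp h₁, hψ'.unique hp h₂]
  exact CyclicAdams.rho_adams hp hF x
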